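/- **Setting.** $EA_0$ is the quantifier-free theory of finite sets whose terms are built from variables by $\varnothing$, $\{s,t\}$, power set $\mathrm P(s)$, $\bigcup s$, the epsilon fan $\epsilon(s)$, comprehension $\{x\in s:A\}$ ($A$ an $EA_0$ formula) and replacement $\{t:x\in s\}$, and whose formulas are the propositional combinations of $s\in t$, $s=t$, $s\subseteq t$; local quantifiers are abbreviations, $(\forall x\in s)A$ being $s\subseteq\{x\in s:A\}$. $EA_1$ is the classical first-order theory with equality obtained by adding quantifiers to the formulas (not to the comprehension terms), with axioms: the defining axioms of the above operations and of $\subseteq$, extensionality, Dedekind finiteness ($a\subsetneq b\supset a<_{\mathrm c}b$) and foundation ($a\in\mathrm{TC}(b)\supset b\notin \mathrm{TC}(a)$). Here $\epsilon(b)$ is the set of non-empty linear orderings whose first term lies in $b$ and each of whose later terms is a member of its immediate predecessor, $\mathrm{TC}(b)$ is the union of the fields of the members of $\epsilon(b)$, and $\simeq_{\mathrm c},\le_{\mathrm c},<_{\mathrm c}$ compare cardinalities by local functions. A linear ordering is identified with the set of fields of its non-empty initial segments. $S^x$ is the set of local functions from $x$ to $S$, $\mathbf k$ is the term $\mathrm{Succ}^{\mathbf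 k}(\varnothing)$ with $\mathrm{Succ}(a)=a\cup\{a\}$, and $\log_S(a)$ is the least $x\in\mathrm{Card}(a)$ with $a\le_{\mathrm c}S^x$ (and $\varnothing$ for $a=\varnothing$), where $\mathrm{Card}(a)$ is the local cardinal of $a$, a definable set with $\mathrm{Card}(a)\simeq_{\mathrm c}a$ containing exactly one member of each cardinality smaller than that of $a$. A *unary global function* is an $EA_0$ term in one free variable (no parameters); its iterates are $\varphi^0(x)=x$, $\varphi^{k+1}(x)=\varphi(\varphi^k(x))$. It is *arithmetical* if $EA_1\vdash\forall x\forall y\,(x\simeq_{\mathrm c}y\supset\varphi(x)\simeq_{\mathrm c}\varphi(y))$, and *increasing* if the same holds with $\le_{\mathrm c}$ in place of $\simeq_{\mathrm c}$. **Natural number systems.** Given a closed term $0_{\mathcal N}$ and a unary global function $\sigma_{\mathcal N}$, a linear ordering $L$ is *in* $\mathcal N$ if $L=[\,]$ or its first term is $0_{\mathcal N}$ and the next term after each non-last term $x$ is $\sigma_{\mathcal N}(x)$. $\mathcal N$ is a *natural number system* if $EA_1\vdash \forall L\,(L\text{ in }\mathcal N\supset\sigma_{\mathcal N}(\mathrm{Last}(L))\notin\mathrm{Field}(L))$.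 It is *closed under* an arithmetical $\varphi$ if there is a unary global function $\eta$ with $EA_1\vdash\forall x\,(x\text{ in }\mathcal N\supset\eta(x)\text{ in }\mathcal N\ \&\ \varphi(x)\simeq_{\mathrm c}\eta(x))$. An increasing unary arithmetical global function $\varphi$ is *maximally powerful in* the natural number system $\mathcal N$ if $\mathcal N$ is closed under $\varphi$, and for every unary arithmetical global function $\psi$ under which $\mathcal N$ is closed there are classical natural numbers $n,M$ with $EA_1\vdash\forall x\,(x\text{ in }\mathcal N\ \&\ \mathbf M\le_{\mathrm c}x\supset\psi(x)<_{\mathrm c}\varphi^n(x))$. The systems $\mathcal{VN},\mathcal Z,\mathcal{CH}$ all have $0=\varnothing$, with $\sigma(x)=x\cup\{x\}$, $\{x\}$, $\mathrm P(x)$ respectively. **Numeral extensions.** A closed term $S$ is a *numeration base* if $EA_1$ proves that $\mathbf 2\le_{\mathrm c}S$ and that $S$ has exactly one member of each cardinality smaller than its own; write $0_S=\varnothing$. An $S$-ary numeral of length $K=[0,\dots,k]$ (a non-empty linear ordering) is $(S,\langle s_0,\dots,s_k\rangle_K)$ with all $s_i\in S$; it codes the cardinality $\sum_{i}s_i\cdot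 S^{[0,\dots,i-1]}$, and it is proper if $s_k\ne 0_S$ or it has just one digit. $\mathrm{Num}_S(L)$ is the linear ordering, by the cardinality coded, of all proper $S$-ary numerals with length an initial segment of $L$. $\mathcal N[S]$ has initial term $(S,\langle 0_S\rangle_{[0_{\mathcal N}]})$, and its successor function sends a numeral $x$ whose length $[0,\dots,k]$ is in $\mathcal N$ to the numeral next after $x$ in $\mathrm{Num}_S([0,\dots,k,\sigma_{\mathcal N}(k)])$. Put $\mathcal N^{0}[S]=\mathcal N$, $\mathcal N^{k+1}[S]=(\mathcal N^{k}[S])[S]$, and $\varphi^S_0(a)=\varphi(a)$, $\varphi^S_{k+1}(a)=S^{\varphi^S_k(\log_S a)}$. **Theorem.** Let $\mathcal N$ be a natural number system, $S$ a numeration base and $\varphi$ a unary arithmetical global function that is maximally powerful in $\mathcal N$. Then for every classical natural number $n$, $\mathcal N^n[S]$ is a natural number system and $\varphi^S_n$ is maximally powerful in it. Moreover, if $\mathcal N$ is $\mathcal{CH}$, $\mathcal{VN}$ or $\mathcal Z$ and $S$ is any numeration base, then $\lambda x\,\mathbf 2x$ is maximally powerful in $\mathcal N[S]$, $\lambda x\,x^{\mathbf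 2}$ is maximally powerful in $\mathcal N^2[S]$, and $\omega_1=\lambda x\,x^{\log_{\mathbf 2}(x)}$ is maximally powerful in $\mathcal N^3[S]$. -/

import Mathlib

/-!
The theory of finite sets `EA₁` as a formal system: terms and formulas, derivability,
the set-theoretical vocabulary as explicit terms and formulas, natural number systems,
numeral extensions, and the notion of a maximally powerful arithmetical function.
-/

namespace EA

/-- The syntactic categories: terms, and formulas; `fm false` are the formulas of `EA₀` (no global
quantifiers), `fm true` the formulas of the first-order theory `EA₁`. -/
inductive Kind : Type
  | tm : Kind
  | fm : Bool → Kind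

/-- Terms and formulas whose free variables are among `n` given ones (well-scoped de Bruijn
indices; a binder binds the variable `0`). The matrix of a comprehension term is an `EA₀` formula. -/
inductive Expr : Kind → ℕ → Type
  | var {n : ℕ} : Fin n → Expr .tm n
  | empty {n : ℕ} : Expr .tm n
  | pair {n : ℕ} : Expr .tm n → Expr .tm n → Expr .tm n
  | pow {n : ℕ} : Expr .tm n → Expr .tm n
  | union {n : ℕ} : Expr .tm n → Expr .tm n
  | fan {n : ℕ} : Expr .tm n → Expr .tm n
  | sep {n : ℕ} : Expr .tm n → Expr (.fm false) (n + 1) → Expr .tm n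
  | repl {n : ℕ} : Expr .tm (n + 1) → Expr .tm n → Expr .tm n
  | mem {n : ℕ} {q : Bool} : Expr .tm n → Expr .tm n → Expr (.fm q) n
  | eq {n : ℕ} {q : Bool} : Expr .tm n → Expr .tm n → Expr (.fm q) n
  | sub {n : ℕ} {q : Bool} : Expr .tm n → Expr .tm n → Expr (.fm q) n
  | neg {n : ℕ} {q : Bool} : Expr (.fm q) n → Expr (.fm q) n
  | and {n : ℕ} {q : Bool} : Expr (.fm q) n → Expr (.fm q) n → Expr (.fm q) n
  | or {n : ℕ} {q : Bool} : Expr (.fm q) n → Expr (.fm q) n → Expr (.fm q) n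
  | imp {n : ℕ} {q : Bool} : Expr (.fm q) n → Expr (.fm q) n → Expr (.fm q) n
  | all {n : ℕ} : Expr (.fm true) (n + 1) → Expr (.fm true) n

/-- `EA₀` terms (these are also the terms of `EA₁`). A closed term is a `Tm 0`; a unary global
function is given by a term in one free variable, a `Tm 1`. -/
abbrev Tm (n : ℕ) : Type := Expr .tm n

/-- `EA₀` formulas. -/
abbrev Fm0 (n : ℕ) : Type := Expr (.fm false) n

/-- `EA₁` formulas. -/
abbrev Fm (n : ℕ) : Type := Expr (.fm true) n

infix:60 " ∈ₑ " => Expr.mem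
infix:60 " =ₑ " => Expr.eq
infix:60 " ⊆ₑ " => Expr.sub
prefix:max "∼ₑ" => Expr.neg
infixr:45 " ∧ₑ " => Expr.and
infixr:40 " ∨ₑ " => Expr.or
infixr:35 " ⊃ₑ " => Expr.imp

namespace Expr

/-- Extend a renaming under a binder. -/
def upRen {m n : ℕ} (ρ : Fin m → Fin n) : Fin (m + 1) → Fin (n + 1) :=
  Fin.cases 0 (fun i => (ρ i).succ)

/-- Renaming of free variables. -/
def rename : {k : Kind} → {m n : ℕ} → (Fin m → Fin n) → Expr k m → Expr k n
  | _, _, _, ρ, .var i => .var (ρ i)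
  | _, _, _, _, .empty => .empty
  | _, _, _, ρ, .pair s t => .pair (rename ρ s) (rename ρ t)
  | _, _, _, ρ, .pow s => .pow (rename ρ s)
  | _, _, _, ρ, .union s => .union (rename ρ s)
  | _, _, _, ρ, .fan s => .fan (rename ρ s)
  | _, _, _, ρ, .sep s A => .sep (rename ρ s) (rename (upRen ρ) A)
  | _, _, _, ρ, .repl t s => .repl (rename (upRen ρ) t) (rename ρ s)
  | _, _, _, ρ, .mem s t => .mem (rename ρ s) (rename ρ t)
  | _, _, _, ρ, .eq s t => .eq (rename ρ s) (rename ρ t)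
  | _, _, _, ρ, .sub s t => .sub (rename ρ s) (rename ρ t)
  | _, _, _, ρ, .neg A => .neg (rename ρ A)
  | _, _, _, ρ, .and A B => .and (rename ρ A) (rename ρ B)
  | _, _, _, ρ, .or A B => .or (rename ρ A) (rename ρ B)
  | _, _, _, ρ, .imp A B => .imp (rename ρ A) (rename ρ B)
  | _, _, _, ρ, .all A => .all (rename (upRen ρ) A)

/-- Weakening: regard an expression as one with an additional (unused) newest variable. -/
def wk {k : Kind} {n : ℕ} (e : Expr k n) : Expr k (n + 1) := rename Fin.succ e

/-- Extend a substitution under a binder. -/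
def upSub {m n : ℕ} (σ : Fin m → Tm n) : Fin (m + 1) → Tm (n + 1) :=
  Fin.cases (.var 0) (fun i => (σ i).wk)

/-- Simultaneous capture-free substitution of terms for the free variables. -/
def subst : {k : Kind} → {m n : ℕ} → (Fin m → Tm n) → Expr k m → Expr k n
  | _, _, _, σ, .var i => σ i
  | _, _, _, _, .empty => .empty
  | _, _, _, σ, .pair s t => .pair (subst σ s) (subst σ t)
  | _, _, _, σ, .pow s => .pow (subst σ s)
  | _, _, _, σ, .union s => .union (subst σ s)
  | _, _, _, σ, .fan s => .fan (subst σ s)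
  | _, _, _, σ, .sep s A => .sep (subst σ s) (subst (upSub σ) A)
  | _, _, _, σ, .repl t s => .repl (subst (upSub σ) t) (subst σ s)
  | _, _, _, σ, .mem s t => .mem (subst σ s) (subst σ t)
  | _, _, _, σ, .eq s t => .eq (subst σ s) (subst σ t)
  | _, _, _, σ, .sub s t => .sub (subst σ s) (subst σ t)
  | _, _, _, σ, .neg A => .neg (subst σ A)
  | _, _, _, σ, .and A B => .and (subst σ A) (subst σ B)
  | _, _, _, σ, .or A B => .or (subst σ A) (subst σ B)
  | _, _, _, σ, .imp A B => .imp (subst σ A) (subst σ B)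
  | _, _, _, σ, .all A => .all (subst (upSub σ) A)

/-- `A[t/x]` for the newest variable `x`. -/
def inst {k : Kind} {n : ℕ} (A : Expr k (n + 1)) (t : Tm n) : Expr k n :=
  subst (Fin.cases t .var) A

/-- An `EA₀` formula regarded as an `EA₁` formula. -/
def toFm : {n : ℕ} → Fm0 n → Fm n
  | _, .mem s t => .mem s t
  | _, .eq s t => .eq s t
  | _, .sub s t => .sub s t
  | _, .neg A => .neg (toFm A)
  | _, .and A B => .and (toFm A) (toFm B)
  | _, .or A B => .or (toFm A) (toFm B)
  | _, .imp A B => .imp (toFm A) (toFm B)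

end Expr

/-- A closed term in any context. -/
def const {n : ℕ} (t : Tm 0) : Tm n := t.subst Fin.elim0

/-- The value `φ(t)` of the unary global function `φ` at the term `t`. -/
def ap {n : ℕ} (φ : Tm 1) (t : Tm n) : Tm n := φ.subst (fun _ => t)

/-! ### Binders, applied to functions of the bound variable -/

/-- `{x ∈ s : A x}` -/
def comp {n : ℕ} (s : Tm n) (A : Tm (n + 1) → Fm0 (n + 1)) : Tm n := .sep s (A (.var 0))

/-- `{t x : x ∈ s}` -/
def image {n : ℕ} (s : Tm n) (t : Tm (n + 1) → Tm (n + 1)) : Tm n := .repl (t (.var 0)) s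

/-- The local quantifier `(∀ x ∈ s) A x`, that is, `s ⊆ {x ∈ s : A x}`. -/
def ball {n : ℕ} {q : Bool} (s : Tm n) (A : Tm (n + 1) → Fm0 (n + 1)) : Expr (.fm q) n :=
  s ⊆ₑ comp s A

/-- The local quantifier `(∃ x ∈ s) A x`. -/
def bex {n : ℕ} {q : Bool} (s : Tm n) (A : Tm (n + 1) → Fm0 (n + 1)) : Expr (.fm q) n :=
  ∼ₑ(ball s fun x => ∼ₑ(A x))

/-- The global quantifier `∀ x, A x`. -/
def forallE {n : ℕ} (A : Tm (n + 1) → Fm (n + 1)) : Fm n := .all (A (.var 0))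

/-- The biconditional. -/
def iffE {n : ℕ} {q : Bool} (A B : Expr (.fm q) n) : Expr (.fm q) n := (A ⊃ₑ B) ∧ₑ (B ⊃ₑ A)

/-- The `x ∈ s` such that `A x`: this is `⋃ {x ∈ s : A x}`, which is that `x` if there is exactly
one. -/
def the {n : ℕ} (s : Tm n) (A : Tm (n + 1) → Fm0 (n + 1)) : Tm n := .union (comp s A)

/-! ### Elementary set operations -/

/-- `{s}` -/
def sing {n : ℕ} (s : Tm n) : Tm n := .pair s s

/-- `s ∪ t` -/
def cup {n : ℕ} (s t : Tm n) : Tm n := .union (.pair s t)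

/-- The ordered pair `(s, t) = {{s}, {s, t}}`. -/
def opair {n : ℕ} (s t : Tm n) : Tm n := .pair (sing s) (.pair s t)

/-- First component of an ordered pair. -/
def fst {n : ℕ} (p : Tm n) : Tm n :=
  the (.union p) fun x => bex (Expr.union p).wk fun y => p.wk.wk =ₑ opair x.wk y

/-- Second component of an ordered pair. -/
def snd {n : ℕ} (p : Tm n) : Tm n :=
  the (.union p) fun y => bex (Expr.union p).wk fun x => p.wk.wk =ₑ opair x y.wk

/-- `a × b` -/
def prod {n : ℕ} (a b : Tm n) : Tm n :=
  .union (image a fun x => image b.wk fun y => opair x.wk y)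

/-- `f` is a local function from `a` to `b`. -/
def isFun {n : ℕ} {q : Bool} (f a b : Tm n) : Expr (.fm q) n :=
  (f ⊆ₑ prod a b) ∧ₑ
  ball a fun x => bex b.wk fun y =>
    (opair x.wk y ∈ₑ f.wk.wk) ∧ₑ
    ball b.wk.wk fun z => (opair x.wk.wk z ∈ₑ f.wk.wk.wk) ⊃ₑ (z =ₑ y.wk)

/-- `f` is an injective local function from `a` to `b`. -/
def isInj {n : ℕ} {q : Bool} (f a b : Tm n) : Expr (.fm q) n :=
  isFun f a b ∧ₑ
  ball a fun x => ball a.wk fun x' => ball b.wk.wk fun y =>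
    ((opair x.wk.wk y ∈ₑ f.wk.wk.wk) ∧ₑ (opair x'.wk y ∈ₑ f.wk.wk.wk)) ⊃ₑ (x.wk.wk =ₑ x'.wk)

/-- `f` is a bijective local function from `a` to `b`. -/
def isBij {n : ℕ} {q : Bool} (f a b : Tm n) : Expr (.fm q) n :=
  isInj f a b ∧ₑ ball b fun y => bex a.wk fun x => opair x y.wk ∈ₑ f.wk.wk

/-- The value of the local function `f` at the argument `x`. -/
def val {n : ℕ} (f x : Tm n) : Tm n :=
  the (.union (.union f)) fun y => opair x.wk y ∈ₑ f.wk

/-! ### Cardinality -/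

/-- `a ≃ b`: cardinal equivalence -/
def cardEq {n : ℕ} {q : Bool} (a b : Tm n) : Expr (.fm q) n :=
  bex (.pow (prod a b)) fun f => isBij f a.wk b.wk

/-- `a ≤ b`: cardinal inequality -/
def cardLe {n : ℕ} {q : Bool} (a b : Tm n) : Expr (.fm q) n :=
  bex (.pow (prod a b)) fun f => isInj f a.wk b.wk

/-- `a < b`: strict cardinal inequality -/
def cardLt {n : ℕ} {q : Bool} (a b : Tm n) : Expr (.fm q) n :=
  cardLe a b ∧ₑ ∼ₑ(cardEq a b)

infix:60 " ≃c " => cardEq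
infix:60 " ≤c " => cardLe
infix:60 " <c " => cardLt

/-- `a ∪ {a}` -/
def succSet {n : ℕ} (a : Tm n) : Tm n := cup a (sing a)

/-- The constant term denoting the classical natural number `k`. -/
def numeral {n : ℕ} : ℕ → Tm n
  | 0 => .empty
  | k + 1 => succSet (numeral k)

/-- Cardinal exponentiation `a ^ b`: the set of local functions from `b` to `a`. -/
def exp {n : ℕ} (a b : Tm n) : Tm n := comp (.pow (prod b a)) fun f => isFun f b.wk a.wk

/-! ### Linear orderings

A linear ordering is the set of the fields of its non-empty initial segments. -/

/-- `L` is a linear ordering. -/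
def isOrd {n : ℕ} {q : Bool} (L : Tm n) : Expr (.fm q) n :=
  ∼ₑ(.empty ∈ₑ L) ∧ₑ
  (∼ₑ(L =ₑ .empty) ⊃ₑ bex L fun x => bex x fun y => x.wk =ₑ sing y) ∧ₑ
  (ball L fun x => (x =ₑ .union L.wk) ∨ₑ
    bex (.union L.wk) fun y => ∼ₑ(y ∈ₑ x.wk) ∧ₑ (cup x.wk (sing y) ∈ₑ L.wk.wk)) ∧ₑ
  ball L fun x => ball L.wk fun y => (x.wk ⊆ₑ y) ∨ₑ (y ⊆ₑ x.wk)

/-- The set of terms of `L`. -/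
def field {n : ℕ} (L : Tm n) : Tm n := .union L

/-- `a <_L b` -/
def ordLt {n : ℕ} {q : Bool} (L a b : Tm n) : Expr (.fm q) n :=
  bex L fun x => (a.wk ∈ₑ x) ∧ₑ ∼ₑ(b.wk ∈ₑ x)

/-- The first term of `L`. -/
def first {n : ℕ} (L : Tm n) : Tm n :=
  the (field L) fun a => ball (field L).wk fun b => ∼ₑ(ordLt L.wk.wk b a.wk)

/-- The last term of `L`. -/
def last {n : ℕ} (L : Tm n) : Tm n :=
  the (field L) fun a => ball (field L).wk fun b => ∼ₑ(ordLt L.wk.wk a.wk b)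

/-- The term of `L` next after `x`; the last term is its own `next`. -/
def next {n : ℕ} (L x : Tm n) : Tm n :=
  the (field L) fun y =>
    ((x.wk =ₑ last L.wk) ∧ₑ (y =ₑ x.wk)) ∨ₑ
    (ordLt L.wk x.wk y ∧ₑ
      ball (field L).wk fun z => ordLt L.wk.wk x.wk.wk z ⊃ₑ ∼ₑ(ordLt L.wk.wk z y.wk))

/-- The set of proper initial segments of the linear ordering `L`. (For linear orderings, being an
initial segment is the same as being a subset.) -/
def inSeg {n : ℕ} (L : Tm n) : Tm n :=
  comp (.pow L) fun K => isOrd K ∧ₑ ∼ₑ(K =ₑ L.wk)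

/-- The linear ordering of the set `D` by the total ordering `le` on `D`: the set of all
`{y ∈ D : le y x}` with `x ∈ D`. -/
def ordOf {n : ℕ} (D : Tm n) (le : Tm (n + 2) → Tm (n + 2) → Fm0 (n + 2)) : Tm n :=
  image D fun x => comp D.wk fun y => le y x.wk

/-- `L * [a]`: the linear ordering `L` extended by `a` as new last term. -/
def snoc {n : ℕ} (L a : Tm n) : Tm n := cup L (sing (cup (field L) (sing a)))

/-- `a` is an `ε`-chain for `b`. -/
def isChain {n : ℕ} {q : Bool} (a b : Tm n) : Expr (.fm q) n :=
  isOrd a ∧ₑ ∼ₑ(a =ₑ .empty) ∧ₑ (first a ∈ₑ b) ∧ₑ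
  ball (field a) fun x => ∼ₑ(x =ₑ last a.wk) ⊃ₑ (next a.wk x ∈ₑ x)

/-- Transitive closure. -/
def tc {n : ℕ} (s : Tm n) : Tm n := .union (image (.fan s) fun x => field x)

/-! ### The theory `EA₁` -/

/-- The set-theoretical axioms of `EA₁`. -/
inductive Postulate : {n : ℕ} → Fm n → Prop
  | empty {n : ℕ} (a : Tm n) : Postulate (∼ₑ(a ∈ₑ .empty))
  | pair {n : ℕ} (a s t : Tm n) : Postulate (iffE (a ∈ₑ .pair s t) ((a =ₑ s) ∨ₑ (a =ₑ t)))
  | pow {n : ℕ} (a s : Tm n) : Postulate (iffE (a ∈ₑ .pow s) (a ⊆ₑ s))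
  | union {n : ℕ} (a s : Tm n) : Postulate (iffE (a ∈ₑ .union s) (bex s fun x => a.wk ∈ₑ x))
  | selection {n : ℕ} (a s : Tm n) (A : Fm0 (n + 1)) :
      Postulate (iffE (a ∈ₑ .sep s A) ((a ∈ₑ s) ∧ₑ (A.inst a).toFm))
  | replacement {n : ℕ} (a s : Tm n) (t : Tm (n + 1)) :
      Postulate (iffE (a ∈ₑ .repl t s) (bex s fun _ => a.wk =ₑ t))
  | subIntro {n : ℕ} (s t : Tm n) :
      Postulate ((forallE fun a => (a ∈ₑ s.wk) ⊃ₑ (a ∈ₑ t.wk)) ⊃ₑ (s ⊆ₑ t))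
  | subElim {n : ℕ} (a s t : Tm n) : Postulate (((s ⊆ₑ t) ∧ₑ (a ∈ₑ s)) ⊃ₑ (a ∈ₑ t))
  | ext {n : ℕ} (a b : Tm n) : Postulate (((a ⊆ₑ b) ∧ₑ (b ⊆ₑ a)) ⊃ₑ (a =ₑ b))
  | finiteness {n : ℕ} (a b : Tm n) : Postulate (((a ⊆ₑ b) ∧ₑ ∼ₑ(a =ₑ b)) ⊃ₑ (a <c b))
  | epsilonFan {n : ℕ} (a b : Tm n) : Postulate (iffE (a ∈ₑ .fan b) (isChain a b))
  | foundation {n : ℕ} (a b : Tm n) : Postulate ((a ∈ₑ tc b) ⊃ₑ ∼ₑ(b ∈ₑ tc a))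

/-- `EA₁ ⊢ A`: derivability from the set-theoretical axioms in classical first-order logic with
equality (a Hilbert calculus). -/
inductive Proves : {n : ℕ} → Fm n → Prop
  | postulate {n : ℕ} {A : Fm n} : Postulate A → Proves A
  | impK {n : ℕ} (A B : Fm n) : Proves (A ⊃ₑ B ⊃ₑ A)
  | impS {n : ℕ} (A B C : Fm n) : Proves ((A ⊃ₑ B ⊃ₑ C) ⊃ₑ (A ⊃ₑ B) ⊃ₑ A ⊃ₑ C)
  | andL {n : ℕ} (A B : Fm n) : Proves ((A ∧ₑ B) ⊃ₑ A)
  | andR {n : ℕ} (A B : Fm n) : Proves ((A ∧ₑ B) ⊃ₑ B)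
  | andI {n : ℕ} (A B : Fm n) : Proves (A ⊃ₑ B ⊃ₑ (A ∧ₑ B))
  | orL {n : ℕ} (A B : Fm n) : Proves (A ⊃ₑ (A ∨ₑ B))
  | orR {n : ℕ} (A B : Fm n) : Proves (B ⊃ₑ (A ∨ₑ B))
  | orE {n : ℕ} (A B C : Fm n) : Proves ((A ⊃ₑ C) ⊃ₑ (B ⊃ₑ C) ⊃ₑ (A ∨ₑ B) ⊃ₑ C)
  | negI {n : ℕ} (A B : Fm n) : Proves ((A ⊃ₑ B) ⊃ₑ (A ⊃ₑ ∼ₑB) ⊃ₑ ∼ₑA)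
  | negE {n : ℕ} (A : Fm n) : Proves (∼ₑ(∼ₑA) ⊃ₑ A)
  | mp {n : ℕ} {A B : Fm n} : Proves (A ⊃ₑ B) → Proves A → Proves B
  | gen {n : ℕ} {A : Fm (n + 1)} : Proves A → Proves (.all A)
  | allInst {n : ℕ} (A : Fm (n + 1)) (t : Tm n) : Proves (.all A ⊃ₑ A.inst t)
  | allImp {n : ℕ} (A : Fm n) (B : Fm (n + 1)) :
      Proves (.all (A.wk ⊃ₑ B) ⊃ₑ A ⊃ₑ .all B)
  | eqRefl {n : ℕ} (t : Tm n) : Proves (t =ₑ t)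
  | eqSubst {n : ℕ} (s t : Tm n) (A : Fm (n + 1)) :
      Proves ((s =ₑ t) ⊃ₑ A.inst s ⊃ₑ A.inst t)

/-! ### Local cardinals and logarithms -/

/-- The set of equivalence classes of proper subsets of `s` under cardinal equivalence. -/
def cardClasses {n : ℕ} (s : Tm n) : Tm n :=
  let D : Tm n := comp (.pow s) fun x => ∼ₑ(x =ₑ s.wk)
  image D fun x => comp D.wk fun y => y ≃c x.wk

/-- The local cardinal of `s`: the set of proper initial segments of the linear ordering of
`cardClasses s` by the sizes of the members of these classes. -/
def card {n : ℕ} (s : Tm n) : Tm n :=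
  inSeg (ordOf (cardClasses s) fun p q => bex p fun u => bex q.wk fun v => u.wk ≤c v)

/-- The member of least cardinality of a set that has exactly one such member; `∅` for `∅`. -/
def minCard {n : ℕ} (s : Tm n) : Tm n := the s fun x => ball s.wk fun y => x.wk ≤c y

/-- The base `S` logarithm of `a`. -/
def log {n : ℕ} (S a : Tm n) : Tm n := minCard (comp (card a) fun x => a.wk ≤c exp S.wk x)

/-! ### Natural number systems -/

/-- An iteration system: an initial term and a successor function. -/
structure IterSystem : Type where
  zero : Tm 0
  succ : Tm 1

/-- `L` in `N`: the linear ordering `L` is generated from the initial term by the successor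
function. -/
def IterSystem.isNumber {n : ℕ} {q : Bool} (N : IterSystem) (L : Tm n) : Expr (.fm q) n :=
  isOrd L ∧ₑ
  ((L =ₑ .empty) ∨ₑ
    (∼ₑ(L =ₑ .empty) ∧ₑ (first L =ₑ const N.zero) ∧ₑ
      ball (field L) fun x => ∼ₑ(x =ₑ last L.wk) ⊃ₑ (next L.wk x =ₑ ap N.succ x)))

/-- `N` is (provably) a natural number system. -/
def IterSystem.IsNatSystem (N : IterSystem) : Prop :=
  Proves (n := 0) (forallE fun L => N.isNumber L ⊃ₑ ∼ₑ(ap N.succ (last L) ∈ₑ field L))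

/-- The cumulative hierarchy system. -/
def CH : IterSystem := ⟨.empty, .pow (.var 0)⟩

/-- The von Neumann system. -/
def VN : IterSystem := ⟨.empty, succSet (.var 0)⟩

/-- The Zermelo system. -/
def Zer : IterSystem := ⟨.empty, sing (.var 0)⟩

/-! ### Closure properties -/

/-- `φ` is arithmetical. -/
def Arithmetical (φ : Tm 1) : Prop :=
  Proves (n := 0) (forallE fun x => forallE fun y =>
    (x.wk ≃c y) ⊃ₑ (ap φ x.wk ≃c ap φ y))

/-- `φ` is increasing in its argument. -/
def Increasing (φ : Tm 1) : Prop :=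
  Proves (n := 0) (forallE fun x => forallE fun y =>
    (x.wk ≤c y) ⊃ₑ (ap φ x.wk ≤c ap φ y))

/-- `η` represents `φ` as a map from `M` to `N`. -/
def Represents (η φ : Tm 1) (M N : IterSystem) : Prop :=
  Proves (n := 0) (forallE fun x =>
    M.isNumber x ⊃ₑ (N.isNumber (ap η x) ∧ₑ (ap φ x ≃c ap η x)))

/-- `N` is closed under `φ`. -/
def ClosedUnder (N : IterSystem) (φ : Tm 1) : Prop := ∃ η : Tm 1, Represents η φ N N

/-- `φ` eventually dominates `ψ` on `N`. -/
def DominatedOn (N : IterSystem) (ψ φ : Tm 1) : Prop :=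
  ∃ M : ℕ, Proves (n := 0) (forallE fun x =>
    (N.isNumber x ∧ₑ (numeral M ≤c x)) ⊃ₑ (ap ψ x <c ap φ x))

/-- The `k`-th iterate of a unary global function. -/
def iterate (φ : Tm 1) : ℕ → Tm 1
  | 0 => .var 0
  | k + 1 => ap φ (iterate φ k)

/-- The increasing unary arithmetical global function `φ` is maximally powerful in the natural
number system `N`. -/
structure MaximallyPowerful (φ : Tm 1) (N : IterSystem) : Prop where
  isNatSystem : N.IsNatSystem
  arithmetical : Arithmetical φ
  increasing : Increasing φ
  closed : ClosedUnder N φ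
  dominates : ∀ ψ : Tm 1, Arithmetical ψ → ClosedUnder N ψ →
    ∃ k : ℕ, DominatedOn N ψ (iterate φ k)

/-! ### Numeral extensions -/

/-- The closed term `S` (provably) denotes a numeration base: it has at least two members, and
exactly one member of each cardinality strictly smaller than its own. -/
def IsNumerationBase (S : Tm 0) : Prop :=
  Proves (n := 0) ((numeral 2 ≤c S) ∧ₑ
    forallE fun x => (x <c S.wk) ⊃ₑ
      bex S.wk fun y => (y ≃c x.wk) ∧ₑ
        ball S.wk.wk fun z => (z ≃c x.wk.wk) ⊃ₑ (z =ₑ y.wk))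

/-- The numeral with base `S`, length `K` and digits `f`, where `f` is a local function from
`field K` to `S`. -/
def mkNumeral {n : ℕ} (S K f : Tm n) : Tm n := opair S (opair K f)

/-- The length of a numeral. -/
def lengthOf {n : ℕ} (x : Tm n) : Tm n := fst (snd x)

/-- The digit function of a numeral. -/
def digitsOf {n : ℕ} (x : Tm n) : Tm n := snd (snd x)

/-- A set of the cardinality coded by the numeral `x` to the base `S`: the disjoint union over the
terms `i` of the length `K` of `x` of the sets `sᵢ × S ^ {j : j <_K i}`, `sᵢ` being the digit
at `i`. -/
def coded {n : ℕ} (S x : Tm n) : Tm n :=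
  .union (image (field (lengthOf x)) fun i =>
    prod (sing i) (prod (val (digitsOf x.wk) i)
      (exp S.wk (comp (field (lengthOf x.wk)) fun j => ordLt (lengthOf x.wk.wk) j i.wk))))

/-- The set of proper `S`-ary numerals with length a non-empty initial segment of `L`. A numeral is
proper if its last digit is not the digit `∅`, or if it has only one digit (so that zero has
exactly one proper numeral of length contained in `L`). -/
def properNumerals {n : ℕ} (S L : Tm n) : Tm n :=
  .union (image (comp (.pow L) fun K => isOrd K ∧ₑ ∼ₑ(K =ₑ .empty)) fun K =>
    image
      (comp (exp S.wk (field K)) fun f =>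
        ∼ₑ(val f (last K.wk) =ₑ .empty) ∨ₑ (first K.wk =ₑ last K.wk))
      fun f => mkNumeral S.wk.wk K.wk f)

/-- `Num_S(L)`: the linear ordering of the proper `S`-ary numerals with length an initial segment
of `L` by the cardinalities they code. -/
def numOrd {n : ℕ} (S L : Tm n) : Tm n :=
  ordOf (properNumerals S L) fun x y => coded S.wk.wk x ≤c coded S.wk.wk y

/-- The `S`-ary numeral extension `N[S]`. The initial term is the one-digit numeral zero of length
`[0_N]`; the successor of an `S`-ary numeral `x` with length `K = [0, …, k]` in `N` is the numeral
next after `x` in `Num_S([0, …, k, σ_N(k)])`. -/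
def numeralExt (S : Tm 0) (N : IterSystem) : IterSystem where
  zero := mkNumeral S (sing (sing N.zero)) (sing (opair N.zero .empty))
  succ := next
    (numOrd (const S) (snoc (lengthOf (.var 0)) (ap N.succ (last (lengthOf (.var 0))))))
    (.var 0)

/-- The `k`-fold `S`-ary numeral extension `N^k[S]`. -/
def iterExt (S : Tm 0) (N : IterSystem) : ℕ → IterSystem
  | 0 => N
  | k + 1 => numeralExt S (iterExt S N k)

/-- The hierarchy `φ^S_0(a) = φ(a)`, `φ^S_{k+1}(a) = S ^ (φ^S_k(log_S a))`. -/
def hier (S : Tm 0) (φ : Tm 1) : ℕ → Tm 1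
  | 0 => φ
  | k + 1 => exp (const S) (ap (hier S φ k) (log (const S) (.var 0)))

/-- `λ x, 2 x` -/
def double : Tm 1 := prod (numeral 2) (.var 0)

/-- `λ x, x ^ 2` -/
def square : Tm 1 := exp (.var 0) (numeral 2)

/-- `ω₁ = λ x, x ^ (log₂ x)` -/
def omega1 : Tm 1 := exp (.var 0) (log (numeral 2) (.var 0))

end EA

/-!
The definitions speak of derivability in `EA₁`. By the completeness theorem (`proves_iff`) this is
validity in all models, and the models may be taken on sets of natural numbers, so that everything
is proved about the sets, the cardinal numbers and the linear orderings of an arbitrary model `M`;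
what is uniform in `M`, such as the bound on the size of the value of a closed term, is read off
from terms. A model is finite from its own point of view only: induction is available for
properties that are given by an `EA₀` formula with parameters. The classes `DF`, `DP` and `DC`
record that a function, a property, or a function with cardinal values is of this kind, and
instance search finds the formula.

Dedekind finiteness gives this induction (`set_ind`, `Cd.ind`): if the induction steps did not lead
to `a`, then the addition of an element would be an injection, which is not onto, of the set of
classes of those subsets of `a` that have the property. Hence the cardinal numbers `Cd M` of a model
form an ordered semiring with exponentiation, with logarithms `Cd.lg s` such that
`lg s c ≤ d ↔ c ≤ s ^ d`; a linear ordering is determined up to isomorphism by its length, and has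
a term of each rank below its length.

For a numeration base with `s` members the numerals of length `K` code each number below `s ^ |K|`
exactly once, so the ordering of the proper numerals with length an initial segment of `K` has
length `s ^ |K|`, and rank in it is the number coded (`numOrdM_spec`, `len_numOrdM`). So a number of
`N` of length `c` gives a number of `N[S]` of length `s ^ c` (the term `back`), and a number of
`N[S]` of length `c`, the last term of which is a numeral, gives a number of `N` of length `lg s c`,
the length of that numeral (the term `cut`). If `η` represents `φ` in `N`, then `back ∘ η ∘ cut`
represents `s ^ φ (lg s c)` in `N[S]`. Conversely, if `N[S]` is closed under `ψ`, then `N` is closed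
under `logBound S ψ`, the maximum of the logarithms of `ψ d` for `d ≤ s ^ c`; a maximum is needed
because `ψ` is not assumed to be increasing. If `φ` is maximally powerful in `N`, then
`logBound S ψ` is dominated by an iterate of `φ`, and so `ψ` by the same iterate of
`s ^ φ (lg s c)`. This is `MaximallyPowerful.step`, and `maximallyPowerful_hier` is its iteration.
The threshold beyond which the domination holds changes from `m` to `s ^ m`, which is bounded by a
standard number, because a closed term has a standard number of members (`exists_cd_closed_le`).

In `CH`, `VN` and `Zer` the successor function raises the set-theoretical rank by one, so the length
of a number is its rank up to a constant; each term raises ranks by a standard number at most, and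
so `c + 1` is maximally powerful in these systems (`IsRanked.maximallyPowerful_succFn`). The first
part then gives the functions `s ^ (lg s c + 1)`, `s ^ s ^ (lg s (lg s c) + 1)` and
`s ^ s ^ s ^ (lg s (lg s (lg s c)) + 1)` in the first three numeral extensions. They lie above
`2 * c`, `c ^ 2` and `c ^ lg 2 c`, and eventually below iterates of these, and maximal power is
inherited by functions so related (`MaximallyPowerful.of_le_of_le_iterate`).
-/


namespace EA

/-! ### Renaming and substitution -/

namespace Expr

@[simp] theorem upRen_zero {m n : ℕ} (ρ : Fin m → Fin n) : upRen ρ 0 = 0 := rfl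

@[simp] theorem upRen_succ {m n : ℕ} (ρ : Fin m → Fin n) (i : Fin m) :
    upRen ρ i.succ = (ρ i).succ := rfl

@[simp] theorem upSub_zero {m n : ℕ} (σ : Fin m → Tm n) : upSub σ 0 = .var 0 := rfl

@[simp] theorem upSub_succ {m n : ℕ} (σ : Fin m → Tm n) (i : Fin m) :
    upSub σ i.succ = (σ i).wk := rfl

theorem upRen_comp {l m n : ℕ} (ρ : Fin l → Fin m) (ρ' : Fin m → Fin n) :
    upRen (ρ' ∘ ρ) = upRen ρ' ∘ upRen ρ := by
  funext i; cases i using Fin.cases <;> rfl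

theorem upRen_id {n : ℕ} : upRen (id : Fin n → Fin n) = id := by
  funext i; cases i using Fin.cases <;> rfl

theorem rename_rename {k : Kind} {l : ℕ} (e : Expr k l) :
    ∀ {m n : ℕ} (ρ : Fin l → Fin m) (ρ' : Fin m → Fin n),
      rename ρ' (rename ρ e) = rename (ρ' ∘ ρ) e := by
  induction e <;> intros <;> simp only [rename, upRen_comp, Function.comp_apply, *]

theorem rename_id {k : Kind} {n : ℕ} (e : Expr k n) : rename id e = e := by
  induction e <;> simp only [rename, upRen_id, id, *]

theorem subst_rename {k : Kind} {l : ℕ} (e : Expr k l) :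
    ∀ {m n : ℕ} (ρ : Fin l → Fin m) (σ : Fin m → Tm n),
      subst σ (rename ρ e) = subst (σ ∘ ρ) e := by
  have key : ∀ {l m n : ℕ} (ρ : Fin l → Fin m) (σ : Fin m → Tm n),
      upSub σ ∘ upRen ρ = upSub (σ ∘ ρ) := by
    intros; funext i; cases i using Fin.cases <;> rfl
  induction e <;> intros <;> simp only [rename, subst, Function.comp_apply, *]

theorem wk_rename {k : Kind} {m n : ℕ} (ρ : Fin m → Fin n) (e : Expr k m) :
    (rename ρ e).wk = rename (upRen ρ) e.wk := by
  simp only [wk, rename_rename]; congr 1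

theorem rename_subst {k : Kind} {l : ℕ} (e : Expr k l) :
    ∀ {m n : ℕ} (σ : Fin l → Tm m) (ρ : Fin m → Fin n),
      rename ρ (subst σ e) = subst (fun i => rename ρ (σ i)) e := by
  have key : ∀ {l m n : ℕ} (σ : Fin l → Tm m) (ρ : Fin m → Fin n),
      (fun i => rename (upRen ρ) (upSub σ i)) = upSub (fun i => rename ρ (σ i)) := by
    intros; funext i; cases i using Fin.cases
    · rfl
    · simp [wk_rename]
  induction e <;> intros <;> simp only [rename, subst, *]

theorem subst_var {k : Kind} {m : ℕ} (e : Expr k m) :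
    ∀ {n : ℕ} (ρ : Fin m → Fin n), subst (fun i => .var (ρ i)) e = rename ρ e := by
  have key : ∀ {m n : ℕ} (ρ : Fin m → Fin n),
      (upSub fun i => (.var (ρ i) : Tm n)) = fun i => .var (upRen ρ i) := by
    intros; funext i; cases i using Fin.cases <;> rfl
  induction e <;> intros <;> simp only [rename, subst, *]

theorem rename_inst {k : Kind} {m n : ℕ} (ρ : Fin m → Fin n) (A : Expr k (m + 1)) (t : Tm m) :
    rename ρ (A.inst t) = (rename (upRen ρ) A).inst (rename ρ t) := by
  simp only [inst, rename_subst, subst_rename]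
  congr 1; funext i; cases i using Fin.cases <;> rfl

theorem rename_toFm : {m n : ℕ} → (ρ : Fin m → Fin n) → (A : Fm0 m) →
    rename ρ A.toFm = (rename ρ A).toFm
  | _, _, _, .mem _ _ => by simp only [toFm, rename]
  | _, _, _, .eq _ _ => by simp only [toFm, rename]
  | _, _, _, .sub _ _ => by simp only [toFm, rename]
  | _, _, ρ, .neg A => by simp only [toFm, rename, rename_toFm ρ A]
  | _, _, ρ, .and A B => by simp only [toFm, rename, rename_toFm ρ A, rename_toFm ρ B]
  | _, _, ρ, .or A B => by simp only [toFm, rename, rename_toFm ρ A, rename_toFm ρ B]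
  | _, _, ρ, .imp A B => by simp only [toFm, rename, rename_toFm ρ A, rename_toFm ρ B]

@[simp] theorem wk_inst {k : Kind} {n : ℕ} (A : Expr k n) (t : Tm n) : A.wk.inst t = A := by
  simp only [inst, wk, subst_rename]
  exact (subst_var A id).trans (rename_id A)

/-- Instantiating the newest variable, with the older ones kept, by a variable. -/
theorem inst_var {k : Kind} {n : ℕ} (A : Expr k (n + 1)) (i : Fin n) :
    A.inst (.var i) = rename (Fin.cases i id) A := by
  rw [← subst_var]; simp only [inst]; congr 1; funext j; cases j using Fin.cases <;> rfl

/-- The newest variable, substituted for a copy of itself. -/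
theorem rename_up_succ_inst_zero {k : Kind} {n : ℕ} (A : Expr k (n + 1)) :
    (rename (upRen Fin.succ) A).inst (.var 0) = A := by
  rw [inst_var, rename_rename]
  convert rename_id A using 2
  funext i; cases i using Fin.cases <;> rfl

end Expr

open EA.Expr

section RenameVocabulary

variable {m n : ℕ} (ρ : Fin m → Fin n)

@[simp] theorem rename_wk {k : Kind} (e : Expr k m) :
    rename (upRen ρ) e.wk = (rename ρ e).wk := (wk_rename ρ e).symm

@[simp] theorem rename_opair (a b : Tm m) :
    rename ρ (opair a b) = opair (rename ρ a) (rename ρ b) := rfl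

@[simp] theorem rename_prod (a b : Tm m) :
    rename ρ (prod a b) = prod (rename ρ a) (rename ρ b) := by
  simp [prod, image, rename]

@[simp] theorem rename_isFun {q : Bool} (f a b : Tm m) :
    rename ρ (isFun (q := q) f a b) = isFun (rename ρ f) (rename ρ a) (rename ρ b) := by
  simp [isFun, ball, bex, comp, rename]

@[simp] theorem rename_isInj {q : Bool} (f a b : Tm m) :
    rename ρ (isInj (q := q) f a b) = isInj (rename ρ f) (rename ρ a) (rename ρ b) := by
  simp [isInj, ball, comp, rename]

@[simp] theorem rename_isBij {q : Bool} (f a b : Tm m) :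
    rename ρ (isBij (q := q) f a b) = isBij (rename ρ f) (rename ρ a) (rename ρ b) := by
  simp [isBij, ball, bex, comp, rename]

@[simp] theorem rename_cardEq {q : Bool} (a b : Tm m) :
    rename ρ (cardEq (q := q) a b) = cardEq (rename ρ a) (rename ρ b) := by
  simp [cardEq, ball, bex, comp, rename]

@[simp] theorem rename_cardLe {q : Bool} (a b : Tm m) :
    rename ρ (cardLe (q := q) a b) = cardLe (rename ρ a) (rename ρ b) := by
  simp [cardLe, ball, bex, comp, rename]

@[simp] theorem rename_cardLt {q : Bool} (a b : Tm m) :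
    rename ρ (cardLt (q := q) a b) = cardLt (rename ρ a) (rename ρ b) := by
  simp [cardLt, rename]

@[simp] theorem rename_isOrd {q : Bool} (L : Tm m) :
    rename ρ (isOrd (q := q) L) = isOrd (rename ρ L) := by
  simp [isOrd, ball, bex, comp, rename, cup, sing]

@[simp] theorem rename_ordLt {q : Bool} (L a b : Tm m) :
    rename ρ (ordLt (q := q) L a b) = ordLt (rename ρ L) (rename ρ a) (rename ρ b) := by
  simp [ordLt, ball, bex, comp, rename]

@[simp] theorem rename_field (L : Tm m) : rename ρ (field L) = field (rename ρ L) := rfl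

@[simp] theorem wk_field (L : Tm m) : (field L).wk = field L.wk := rfl

@[simp] theorem rename_first (L : Tm m) : rename ρ (first L) = first (rename ρ L) := by
  simp [first, ball, the, comp, rename]

@[simp] theorem rename_last (L : Tm m) : rename ρ (last L) = last (rename ρ L) := by
  simp [last, ball, the, comp, rename]

@[simp] theorem rename_next (L x : Tm m) :
    rename ρ (next L x) = next (rename ρ L) (rename ρ x) := by
  simp [next, ball, the, comp, rename]

@[simp] theorem rename_isChain {q : Bool} (a b : Tm m) :
    rename ρ (isChain (q := q) a b) = isChain (rename ρ a) (rename ρ b) := by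
  simp [isChain, ball, comp, rename]

@[simp] theorem rename_tc (s : Tm m) : rename ρ (tc s) = tc (rename ρ s) := by
  simp [tc, image, rename]

@[simp] theorem rename_iffE {q : Bool} (A B : Expr (.fm q) m) :
    rename ρ (iffE A B) = iffE (rename ρ A) (rename ρ B) := rfl

end RenameVocabulary

theorem Postulate.rename {m n : ℕ} (ρ : Fin m → Fin n) {A : Fm m} (h : Postulate A) :
    Postulate (Expr.rename ρ A) := by
  cases h with
  | empty a => exact .empty _
  | pair a s t => exact .pair _ _ _
  | pow a s => exact .pow _ _
  | union a s =>
    have := Postulate.union (Expr.rename ρ a) (Expr.rename ρ s)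
    simpa [Expr.rename, bex, ball, comp] using this
  | selection a s A =>
    have := Postulate.selection (Expr.rename ρ a) (Expr.rename ρ s) (Expr.rename (upRen ρ) A)
    rw [← rename_inst, ← rename_toFm] at this
    exact this
  | replacement a s t =>
    have := Postulate.replacement (Expr.rename ρ a) (Expr.rename ρ s) (Expr.rename (upRen ρ) t)
    simpa [Expr.rename, bex, ball, comp] using this
  | subIntro s t =>
    have := Postulate.subIntro (Expr.rename ρ s) (Expr.rename ρ t)
    simpa [Expr.rename, forallE] using this
  | subElim a s t => exact .subElim _ _ _
  | ext a b => exact .ext _ _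
  | finiteness a b =>
    have := Postulate.finiteness (Expr.rename ρ a) (Expr.rename ρ b)
    simpa [Expr.rename] using this
  | epsilonFan a b =>
    have := Postulate.epsilonFan (Expr.rename ρ a) (Expr.rename ρ b)
    simpa [Expr.rename] using this
  | foundation a b =>
    have := Postulate.foundation (Expr.rename ρ a) (Expr.rename ρ b)
    simpa [Expr.rename] using this

/-- Derivability is preserved by renaming the free variables; in particular by weakening. -/
theorem Proves.rename {m : ℕ} {A : Fm m} (h : Proves A) :
    ∀ {n : ℕ} (ρ : Fin m → Fin n), Proves (Expr.rename ρ A) := by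
  induction h with
  | postulate h => exact fun ρ => .postulate (h.rename ρ)
  | impK A B => exact fun ρ => .impK _ _
  | impS A B C => exact fun ρ => .impS _ _ _
  | andL A B => exact fun ρ => .andL _ _
  | andR A B => exact fun ρ => .andR _ _
  | andI A B => exact fun ρ => .andI _ _
  | orL A B => exact fun ρ => .orL _ _
  | orR A B => exact fun ρ => .orR _ _
  | orE A B C => exact fun ρ => .orE _ _ _
  | negI A B => exact fun ρ => .negI _ _
  | negE A => exact fun ρ => .negE _
  | mp _ _ ih1 ih2 => exact fun ρ => .mp (ih1 ρ) (ih2 ρ)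
  | gen _ ih => exact fun ρ => .gen (ih _)
  | allInst A t =>
    intro n ρ
    simp only [Expr.rename, rename_inst]
    exact .allInst _ _
  | allImp A B =>
    intro n ρ
    simp only [Expr.rename, rename_wk]
    exact .allImp _ _
  | eqRefl t => exact fun ρ => .eqRefl _
  | eqSubst s t A =>
    intro n ρ
    simp only [Expr.rename, rename_inst]
    exact .eqSubst _ _ _

/-! ### Derived rules of the calculus -/

namespace Proves

variable {n : ℕ} {A B C χ : Fm n}

theorem weaken (h : Proves A) : Proves (χ ⊃ₑ A) := .mp (.impK _ _) h

theorem imp_mp (h : Proves (χ ⊃ₑ A ⊃ₑ B)) (h' : Proves (χ ⊃ₑ A)) : Proves (χ ⊃ₑ B) :=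
  .mp (.mp (.impS _ _ _) h) h'

theorem imp_self (A : Fm n) : Proves (A ⊃ₑ A) := imp_mp (B := A) (.impK A (A ⊃ₑ A)) (.impK A A)

theorem imp_trans (h : Proves (A ⊃ₑ B)) (h' : Proves (B ⊃ₑ C)) : Proves (A ⊃ₑ C) :=
  imp_mp (weaken h') h

theorem curry (h : Proves ((χ ∧ₑ A) ⊃ₑ B)) : Proves (χ ⊃ₑ A ⊃ₑ B) :=
  imp_trans (.andI χ A) (.mp (.impS _ _ _) (weaken h))

theorem imp_not_intro (h : Proves ((χ ∧ₑ A) ⊃ₑ B)) (h' : Proves ((χ ∧ₑ A) ⊃ₑ ∼ₑB)) :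
    Proves (χ ⊃ₑ ∼ₑA) :=
  imp_mp (imp_mp (weaken (.negI _ _)) (curry h)) (curry h')

theorem imp_by_contra (h : Proves ((χ ∧ₑ ∼ₑA) ⊃ₑ B)) (h' : Proves ((χ ∧ₑ ∼ₑA) ⊃ₑ ∼ₑB)) :
    Proves (χ ⊃ₑ A) :=
  imp_trans (imp_not_intro h h') (.negE _)

theorem imp_exfalso (h : Proves (χ ⊃ₑ B)) (h' : Proves (χ ⊃ₑ ∼ₑB)) : Proves (χ ⊃ₑ A) :=
  imp_by_contra (imp_trans (.andL _ _) h) (imp_trans (.andL _ _) h')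

theorem not_of_imp (h : Proves (χ ⊃ₑ B)) (h' : Proves (χ ⊃ₑ ∼ₑB)) : Proves (∼ₑχ) :=
  .mp (.mp (.negI _ _) h) h'

theorem imp_of_not_and_not (h : Proves (∼ₑ(χ ∧ₑ ∼ₑA))) : Proves (χ ⊃ₑ A) :=
  imp_by_contra (imp_self _) (weaken h)

theorem imp_not_of_not_and (h : Proves (∼ₑ(χ ∧ₑ A))) : Proves (χ ⊃ₑ ∼ₑA) :=
  imp_not_intro (imp_self _) (weaken h)

theorem wk (h : Proves A) : Proves A.wk := h.rename _

/-- The substitution of `t` for the newest variable, as an implication in the context that still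
contains this variable. -/
theorem eq_imp_inst (A : Fm (n + 1)) (t : Tm n) :
    Proves ((.var 0 =ₑ t.wk) ⊃ₑ A ⊃ₑ (A.inst t).wk) := by
  have h := eqSubst (.var 0) t.wk (Expr.rename (upRen Fin.succ) A)
  rwa [rename_up_succ_inst_zero, Expr.wk, ← rename_inst] at h

end Proves

/-! ### Models -/

/-- `a` consed to the valuation `v`: the valuation for the context with one more variable. -/
abbrev cons {M : Type} {n : ℕ} (a : M) (v : Fin n → M) : Fin (n + 1) → M := Fin.cons a v

/-- A model of `EA₁`: a set with an interpretation of all terms and formulas that obeys Tarski's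
clauses for the logical symbols, is compatible with renaming and instantiation of variables, and
satisfies the set-theoretical axioms. -/
class EAModel (M : Type) where
  ev : {n : ℕ} → Tm n → (Fin n → M) → M
  sat : {q : Bool} → {n : ℕ} → Expr (.fm q) n → (Fin n → M) → Prop
  ev_var {n : ℕ} (i : Fin n) (v : Fin n → M) : ev (.var i) v = v i
  sat_eq {q : Bool} {n : ℕ} (s t : Tm n) (v : Fin n → M) :
    sat (q := q) (s =ₑ t) v ↔ ev s v = ev t v
  sat_neg {q : Bool} {n : ℕ} (A : Expr (.fm q) n) (v : Fin n → M) : sat (∼ₑA) v ↔ ¬ sat A v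
  sat_and {q : Bool} {n : ℕ} (A B : Expr (.fm q) n) (v : Fin n → M) :
    sat (A ∧ₑ B) v ↔ sat A v ∧ sat B v
  sat_or {q : Bool} {n : ℕ} (A B : Expr (.fm q) n) (v : Fin n → M) :
    sat (A ∨ₑ B) v ↔ sat A v ∨ sat B v
  sat_imp {q : Bool} {n : ℕ} (A B : Expr (.fm q) n) (v : Fin n → M) :
    sat (A ⊃ₑ B) v ↔ (sat A v → sat B v)
  sat_all {n : ℕ} (A : Fm (n + 1)) (v : Fin n → M) : sat (.all A) v ↔ ∀ a, sat A (cons a v)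
  sat_toFm {n : ℕ} (A : Fm0 n) (v : Fin n → M) : sat A.toFm v ↔ sat A v
  sat_mem_toFm {q : Bool} {n : ℕ} (s t : Tm n) (v : Fin n → M) :
    sat (q := q) (s ∈ₑ t) v ↔ sat (q := true) (s ∈ₑ t) v
  sat_sub_toFm {q : Bool} {n : ℕ} (s t : Tm n) (v : Fin n → M) :
    sat (q := q) (s ⊆ₑ t) v ↔ sat (q := true) (s ⊆ₑ t) v
  sat_rename {m n : ℕ} (ρ : Fin m → Fin n) (A : Fm m) (v : Fin n → M) :
    sat (A.rename ρ) v ↔ sat A (v ∘ ρ)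
  ev_rename {m n : ℕ} (ρ : Fin m → Fin n) (t : Tm m) (v : Fin n → M) :
    ev (t.rename ρ) v = ev t (v ∘ ρ)
  sat_inst {n : ℕ} (A : Fm (n + 1)) (t : Tm n) (v : Fin n → M) :
    sat (A.inst t) v ↔ sat A (cons (ev t v) v)
  sat_postulate {n : ℕ} {A : Fm n} (h : Postulate A) (v : Fin n → M) : sat A v

/-- Every derivable formula holds in every model. -/
theorem Proves.sound {M : Type} [EAModel M] {n : ℕ} {A : Fm n} (h : Proves A) :
    ∀ v : Fin n → M, EAModel.sat A v := by
  induction h with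
  | postulate h => exact EAModel.sat_postulate h
  | mp _ _ ih1 ih2 => exact fun v => (EAModel.sat_imp _ _ v).1 (ih1 v) (ih2 v)
  | gen _ ih => exact fun v => (EAModel.sat_all _ v).2 fun a => ih _
  | allInst A t =>
    intro v
    simp only [EAModel.sat_imp, EAModel.sat_inst, EAModel.sat_all]
    exact fun h => h _
  | allImp A B =>
    intro v
    simp only [EAModel.sat_imp, EAModel.sat_all, Expr.wk, EAModel.sat_rename]
    exact fun h hA a => h a hA
  | eqRefl t => exact fun v => (EAModel.sat_eq _ _ v).2 rfl
  | eqSubst s t A =>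
    intro v
    simp only [EAModel.sat_imp, EAModel.sat_inst, EAModel.sat_eq]
    exact fun h hA => h ▸ hA
  | _ =>
    intro v
    simp only [EAModel.sat_imp, EAModel.sat_and, EAModel.sat_or, EAModel.sat_neg]
    tauto

/-! ### The completeness theorem -/

/-- A code of an expression, in Polish notation. -/
def Expr.code : {k : Kind} → {n : ℕ} → Expr k n → List ℕ
  | _, _, .var i => [0, i]
  | _, _, .empty => [1]
  | _, _, .pair s t => 2 :: (s.code ++ t.code)
  | _, _, .pow s => 3 :: s.code
  | _, _, .union s => 4 :: s.code
  | _, _, .fan s => 5 :: s.code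
  | _, _, .sep s A => 6 :: (s.code ++ A.code)
  | _, _, .repl t s => 7 :: (t.code ++ s.code)
  | _, _, .mem s t => 8 :: (s.code ++ t.code)
  | _, _, .eq s t => 9 :: (s.code ++ t.code)
  | _, _, .sub s t => 10 :: (s.code ++ t.code)
  | _, _, .neg A => 11 :: A.code
  | _, _, .and A B => 12 :: (A.code ++ B.code)
  | _, _, .or A B => 13 :: (A.code ++ B.code)
  | _, _, .imp A B => 14 :: (A.code ++ B.code)
  | _, _, .all A => 15 :: A.code

theorem Expr.code_append_inj {k : Kind} {n : ℕ} (e : Expr k n) :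
    ∀ (e' : Expr k n) (l l' : List ℕ), e.code ++ l = e'.code ++ l' → e = e' ∧ l = l' := by
  induction e with
  | var i =>
    intro e' l l' h
    cases e' <;> simp [code, Fin.ext_iff] at h ⊢
    exact h
  | empty => intro e' l l' h; cases e' <;> simp [code] at h ⊢; exact h
  | pow s ih | union s ih | fan s ih | neg s ih | all s ih =>
    intro e' l l' h
    cases e' <;> simp [code] at h ⊢
    exact ih _ _ _ h
  | pair s t ih1 ih2 | sep s t ih1 ih2 | repl s t ih1 ih2 | mem s t ih1 ih2 | eq s t ih1 ih2
  | sub s t ih1 ih2 | and s t ih1 ih2 | or s t ih1 ih2 | imp s t ih1 ih2 =>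
    intro e' l l' h
    cases e' <;> simp [code] at h ⊢
    obtain ⟨rfl, h'⟩ := ih1 _ _ _ h
    obtain ⟨rfl, h''⟩ := ih2 _ _ _ h'
    simp [h'']

instance {k : Kind} {n : ℕ} : Countable (Expr k n) :=
  Function.Injective.countable (f := Expr.code) fun e e' h =>
    (e.code_append_inj e' [] [] (by simpa using h)).1

namespace Henkin

/-- Consistency of a formula. -/
def Con {n : ℕ} (χ : Fm n) : Prop := ¬ Proves (∼ₑχ)

theorem Con.wk {n : ℕ} {χ : Fm n} (h : Con χ) : Con χ.wk := by
  intro h'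
  have := Proves.mp (Proves.allInst _ .empty) (Proves.gen h')
  exact h ((wk_inst (∼ₑχ) .empty) ▸ this)

/-- The formula `B` can be decided over `χ` with one more variable, which serves as a
counterexample if a universal formula is refuted. -/
theorem exists_step {k : ℕ} {χ : Fm k} (hχ : Con χ) (B : Fm k) :
    ∃ χ' : Fm (k + 1), Con χ' ∧ Proves (χ' ⊃ₑ χ.wk) ∧
      (Proves (χ' ⊃ₑ B.wk) ∨
        (Proves (χ' ⊃ₑ ∼ₑB.wk) ∧ ∀ C, B = .all C → Proves (χ' ⊃ₑ ∼ₑC))) := by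
  by_cases h : Con (χ ∧ₑ B)
  · exact ⟨(χ ∧ₑ B).wk, h.wk, .andL _ _, .inl (.andR _ _)⟩
  have h2 : Con (χ ∧ₑ ∼ₑB) := fun h' =>
    hχ (Proves.not_of_imp (Proves.imp_of_not_and_not h')
      (Proves.imp_not_of_not_and (not_not.1 h)))
  by_cases hB : ∃ C, B = .all C
  · obtain ⟨C, rfl⟩ := hB
    refine ⟨(χ ∧ₑ ∼ₑ(.all C)).wk ∧ₑ ∼ₑC, ?_, ?_, .inr ⟨?_, ?_⟩⟩
    · intro h'
      have h3 := Proves.mp (Proves.allImp _ _) (Proves.gen (Proves.imp_of_not_and_not h'))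
      exact h2 (Proves.not_of_imp h3 (.andR _ _))
    · exact Proves.imp_trans (.andL _ _) (.andL _ _)
    · exact Proves.imp_trans (.andL _ _) (.andR _ _)
    · rintro C' h
      cases h
      exact .andR _ _
  · exact ⟨(χ ∧ₑ ∼ₑB).wk, h2.wk, .andL _ _, .inr ⟨.andR _ _, fun C hC => (hB ⟨C, hC⟩).elim⟩⟩

/-- The variable that carries the name `l` in the context with `k + 1` variables: the variable that
was newest when there were `l + 1` variables. -/
def nm (k l : ℕ) : Fin (k + 1) := ⟨k - l, by omega⟩

/-- The formula `A` with its variables named by `ρ`, in the context with `k + 1` variables. -/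
def named (k : ℕ) {K : Kind} {n : ℕ} (ρ : Fin n → ℕ) (A : Expr K n) : Expr K (k + 1) :=
  rename (fun i => nm k (ρ i)) A

theorem wk_named {k : ℕ} {K : Kind} {n : ℕ} {ρ : Fin n → ℕ} (h : ∀ i, ρ i ≤ k) (A : Expr K n) :
    (named k ρ A).wk = named (k + 1) ρ A := by
  simp only [named, wk, rename_rename]
  congr 1
  funext i
  ext
  simp only [nm, Function.comp_apply, Fin.val_succ]
  have := h i
  omega

theorem up_named {k n : ℕ} {ρ : Fin n → ℕ} (h : ∀ i, ρ i ≤ k) :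
    upRen (fun i => nm k (ρ i)) = fun i => nm (k + 1) ((cons (k + 1) ρ : Fin (n + 1) → ℕ) i) := by
  funext i
  cases i using Fin.cases with
  | zero => ext; simp [nm]
  | succ i =>
    ext
    change k - ρ i + 1 = k + 1 - ρ i
    have := h i
    omega

/-- A formula of some context, with names for its variables. -/
abbrev Task : Type := Σ n : ℕ, Fm n × (Fin n → ℕ)

/-- An enumeration of all tasks in which each task occurs infinitely often. -/
theorem exists_tasks : ∃ f : ℕ → Task, ∀ t k, ∃ k' ≥ k, f k' = t := by
  have : Nonempty Task := ⟨⟨0, .eq .empty .empty, fun _ => 0⟩⟩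
  obtain ⟨g, hg⟩ := exists_surjective_nat Task
  refine ⟨fun k => g k.unpair.1, fun t k => ?_⟩
  obtain ⟨c, rfl⟩ := hg t
  exact ⟨Nat.pair c k, Nat.right_le_pair c k, by simp⟩

/-- A chain of consistent formulas with one more variable at each step. -/
structure Chain where
  X : (k : ℕ) → Fm (k + 1)
  con : ∀ k, Con (X k)
  step : ∀ k, Proves (X (k + 1) ⊃ₑ (X k).wk)
  decide : ∀ {n : ℕ} (A : Fm n) (ρ : Fin n → ℕ), ∃ k, (∀ i, ρ i ≤ k) ∧
    (Proves (X (k + 1) ⊃ₑ named (k + 1) ρ A) ∨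
      (Proves (X (k + 1) ⊃ₑ ∼ₑ(named (k + 1) ρ A)) ∧ ∀ C, A = .all C →
        Proves (X (k + 1) ⊃ₑ ∼ₑ(named (k + 1) (cons (k + 1) ρ : Fin (n + 1) → ℕ) C))))

theorem exists_chain {χ : Fm 1} (hχ : Con χ) : ∃ H : Chain, H.X 0 = χ := by
  obtain ⟨f, hf⟩ := exists_tasks
  choose! next h1 h2 h3 using fun (k : ℕ) (χ : Fm (k + 1)) (hχ : Con χ) (B : Fm (k + 1)) =>
    exists_step hχ B
  let X : (k : ℕ) → {χ : Fm (k + 1) // Con χ} := fun k =>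
    Nat.rec ⟨χ, hχ⟩
      (fun k x => ⟨next k x.1 x.2 (named k (f k).2.2 (f k).2.1), h1 _ _ _ _⟩) k
  refine ⟨⟨fun k => (X k).1, fun k => (X k).2, fun k => h2 k (X k).1 (X k).2 _, ?_⟩, rfl⟩
  intro n A ρ
  obtain ⟨k, hk, hfk⟩ := hf ⟨n, A, ρ⟩ (∑ i, ρ i)
  have hρ : ∀ i, ρ i ≤ k := fun i =>
    (Finset.single_le_sum (f := ρ) (fun _ _ => Nat.zero_le _) (Finset.mem_univ i)).trans hk
  refine ⟨k, hρ, ?_⟩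
  have := h3 k (X k).1 (X k).2 (named k (f k).2.2 (f k).2.1)
  change Proves ((X (k + 1)).1 ⊃ₑ _) ∨ Proves ((X (k + 1)).1 ⊃ₑ _) ∧
    ∀ C, _ → Proves ((X (k + 1)).1 ⊃ₑ _) at this
  rw [hfk] at this
  simp only [wk_named hρ] at this
  refine this.imp id (And.imp id ?_)
  rintro h C rfl
  have := h (rename (upRen fun i => nm k (ρ i)) C) rfl
  rwa [up_named hρ] at this

namespace Chain

variable (H : Chain)

/-- Truth of the formula `A`, with its variables named by `ρ`, along the chain. -/
def T {n : ℕ} (A : Fm n) (ρ : Fin n → ℕ) : Prop :=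
  ∃ k, (∀ i, ρ i ≤ k) ∧ Proves (H.X k ⊃ₑ named k ρ A)

variable {H} {n : ℕ} {A B : Fm n} {ρ : Fin n → ℕ}

theorem T.mono {k k' : ℕ} (hk : k ≤ k') (hρ : ∀ i, ρ i ≤ k)
    (h : Proves (H.X k ⊃ₑ named k ρ A)) : Proves (H.X k' ⊃ₑ named k' ρ A) := by
  induction k', hk using Nat.le_induction with
  | base => exact h
  | succ k' hk ih =>
    rw [← wk_named fun i => (hρ i).trans hk]
    exact (H.step k').imp_trans ih.wk

theorem T.of_proves (h : Proves A) : H.T A ρ :=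
  ⟨∑ i, ρ i, fun i => Finset.single_le_sum (f := ρ) (fun _ _ => Nat.zero_le _) (Finset.mem_univ i),
    (h.rename _).weaken⟩

theorem T.mp (h : H.T (A ⊃ₑ B) ρ) (h' : H.T A ρ) : H.T B ρ := by
  obtain ⟨k, hk, h⟩ := h
  obtain ⟨k', hk', h'⟩ := h'
  exact ⟨max k k', fun i => (hk i).trans (le_max_left _ _),
    Proves.imp_mp (T.mono (A := A ⊃ₑ B) (le_max_left _ _) hk h) (T.mono (le_max_right _ _) hk' h')⟩

theorem T.of_imp (h : Proves (A ⊃ₑ B)) (h' : H.T A ρ) : H.T B ρ := (T.of_proves h).mp h'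

theorem T_neg : H.T (∼ₑA) ρ ↔ ¬ H.T A ρ := by
  constructor
  · rintro ⟨k, hk, h⟩ ⟨k', hk', h'⟩
    exact H.con _ (Proves.not_of_imp (T.mono (le_max_right k k') hk' h')
      (T.mono (A := ∼ₑA) (le_max_left k k') hk h))
  · intro h
    obtain ⟨k, hk, h1 | h1⟩ := H.decide A ρ
    · exact (h ⟨k + 1, fun i => (hk i).trans k.le_succ, h1⟩).elim
    · exact ⟨k + 1, fun i => (hk i).trans k.le_succ, h1.1⟩

theorem T_imp : H.T (A ⊃ₑ B) ρ ↔ (H.T A ρ → H.T B ρ) := by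
  refine ⟨fun h h' => h.mp h', fun h => ?_⟩
  by_cases hA : H.T A ρ
  · exact T.of_imp (.impK _ _) (h hA)
  · exact T.of_imp (Proves.curry (Proves.imp_exfalso (.andR _ _) (.andL _ _))) (T_neg.2 hA)

theorem T_and : H.T (A ∧ₑ B) ρ ↔ H.T A ρ ∧ H.T B ρ :=
  ⟨fun h => ⟨h.of_imp (.andL _ _), h.of_imp (.andR _ _)⟩,
    fun h => (h.1.of_imp (.andI _ _)).mp h.2⟩

theorem T_or : H.T (A ∨ₑ B) ρ ↔ H.T A ρ ∨ H.T B ρ := by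
  refine ⟨fun h => ?_, fun h => h.elim (T.of_imp (.orL _ _)) (T.of_imp (.orR _ _))⟩
  by_contra! hn
  have h1 : H.T (A ⊃ₑ ∼ₑ(A ∨ₑ B)) ρ := T_imp.2 fun hA => (hn.1 hA).elim
  have h2 : H.T (B ⊃ₑ ∼ₑ(A ∨ₑ B)) ρ := T_imp.2 fun hB => (hn.2 hB).elim
  exact T_neg.1 ((((T.of_proves (.orE _ _ _)).mp h1).mp h2).mp h) h

theorem T_rename {m : ℕ} (f : Fin m → Fin n) (A : Fm m) (ρ : Fin n → ℕ) :
    H.T (rename f A) ρ ↔ H.T A (ρ ∘ f) := by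
  have hn : ∀ k, named k ρ (rename f A) = named k (ρ ∘ f) A := fun k => by
    simp only [named, rename_rename]; rfl
  constructor
  · rintro ⟨k, hk, h⟩
    exact ⟨k, fun i => hk _, hn k ▸ h⟩
  · rintro ⟨k, hk, h⟩
    refine ⟨k + ∑ i, ρ i, fun i => ?_, hn _ ▸ T.mono (Nat.le_add_right _ _) hk h⟩
    exact (Finset.single_le_sum (f := ρ) (fun _ _ => Nat.zero_le _) (Finset.mem_univ i)).trans
      (Nat.le_add_left _ _)

theorem T_wk (A : Fm n) (l : ℕ) (ρ : Fin n → ℕ) :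
    H.T A.wk (cons l ρ : Fin (n + 1) → ℕ) ↔ H.T A ρ := T_rename _ _ _

theorem T.witness {A : Fm (n + 1)} (h : ¬ H.T (.all A) ρ) :
    ∃ l, ¬ H.T A (cons l ρ : Fin (n + 1) → ℕ) := by
  obtain ⟨k, hk, h1 | h1⟩ := H.decide (.all A) ρ
  · exact (h ⟨k + 1, fun i => (hk i).trans k.le_succ, h1⟩).elim
  · refine ⟨k + 1, T_neg.1 ⟨k + 1, fun i => ?_, h1.2 A rfl⟩⟩
    cases i using Fin.cases
    · exact le_rfl
    · exact (hk _).trans k.le_succ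

theorem T_inst {A : Fm (n + 1)} {t : Tm n} {l : ℕ}
    (h : H.T (.var 0 =ₑ t.wk) (cons l ρ : Fin (n + 1) → ℕ)) :
    H.T (A.inst t) ρ ↔ H.T A (cons l ρ : Fin (n + 1) → ℕ) := by
  have key : ∀ B : Fm (n + 1), H.T B (cons l ρ : Fin (n + 1) → ℕ) → H.T (B.inst t) ρ :=
    fun B hB => (T_wk _ l _).1 ((T.of_imp (Proves.eq_imp_inst B t) h).mp hB)
  refine ⟨fun hA => ?_, key A⟩
  by_contra hn
  exact T_neg.1 (key _ (T_neg.2 hn)) hA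

/-- Two names of the same element. -/
def Same (H : Chain) (l l' : ℕ) : Prop := H.T (n := 2) (.var 0 =ₑ .var 1) ![l, l']

theorem T_var_eq (i j : Fin n) : H.T (.var i =ₑ .var j) ρ ↔ H.Same (ρ i) (ρ j) := by
  have := T_rename (H := H) ![i, j] (.var 0 =ₑ .var 1) ρ
  have e : ρ ∘ ![i, j] = ![ρ i, ρ j] := by
    funext x; fin_cases x <;> rfl
  rw [e] at this
  exact this

theorem same_refl (l : ℕ) : H.Same l l :=
  (T_var_eq (ρ := fun _ : Fin 1 => l) 0 0).1 (T.of_proves (.eqRefl _))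

theorem exists_same {t : Tm n} (ρ : Fin n → ℕ) :
    ∃ l, H.T (.var 0 =ₑ t.wk) (cons l ρ : Fin (n + 1) → ℕ) := by
  have : ¬ H.T (.all (∼ₑ(.var 0 =ₑ t.wk))) ρ := by
    intro h
    have h2 := h.of_imp (.allInst _ t)
    have h3 : (∼ₑ(.var 0 =ₑ t.wk) : Fm (n + 1)).inst t = ∼ₑ(t =ₑ t) :=
      congrArg (fun x => ∼ₑ(t =ₑ x)) (wk_inst t t)
    rw [h3] at h2
    exact T_neg.1 h2 (T.of_proves (.eqRefl _))
  obtain ⟨l, hl⟩ := T.witness this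
  rw [T_neg, not_not] at hl
  exact ⟨l, hl⟩

/-- Truth is invariant under the replacement of the name of the newest variable. -/
theorem T_congr {A : Fm (n + 1)} {l l' : ℕ} (h : H.Same l l') :
    H.T A (cons l ρ : Fin (n + 1) → ℕ) ↔ H.T A (cons l' ρ : Fin (n + 1) → ℕ) := by
  have h1 := T_inst (H := H) (A := rename (upRen Fin.succ) A) (t := .var 0) (l := l)
    (ρ := (cons l' ρ : Fin (n + 1) → ℕ)) ((T_var_eq _ _).2 h)
  rw [rename_up_succ_inst_zero, T_rename] at h1
  rw [h1]
  convert Iff.rfl using 2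
  funext i; cases i using Fin.cases <;> rfl

theorem Same.trans {a b c : ℕ} (h : H.Same a b) (h' : H.Same b c) : H.Same a c :=
  (T_congr (n := 1) (ρ := ![c]) h).2 h'

theorem Same.symm {a b : ℕ} (h : H.Same a b) : H.Same b a := by
  exact (T_var_eq (ρ := (cons b ![a] : Fin 2 → ℕ)) 0 1).1
    ((T_congr (ρ := ![a]) h).1 ((T_var_eq (ρ := (cons a ![a] : Fin 2 → ℕ)) 0 1).2 (same_refl a)))

end Chain

end Henkin

namespace Henkin

/-- A formula of either category as a formula of `EA₁`. -/
def asFm : {q : Bool} → {n : ℕ} → Expr (.fm q) n → Fm n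
  | true, _, A => A
  | false, _, A => A.toFm

/-- The elements of the Henkin model: the names that are least among the names of the same
element. -/
def Carrier (H : Chain) : Type := {l : ℕ // ∀ l' < l, ¬ H.Same l' l}

namespace Chain

variable {H : Chain} {n : ℕ}

theorem exists_carrier (l : ℕ) : ∃ c : Carrier H, H.Same c.1 l := by
  classical
  have h : ∃ c, H.Same c l := ⟨l, same_refl l⟩
  exact ⟨⟨Nat.find h, fun l' hl' hs => Nat.find_min h hl' (hs.trans (Nat.find_spec h))⟩,
    Nat.find_spec h⟩

theorem carrier_eq {c c' : Carrier H} (h : H.Same c.1 c'.1) : c = c' := by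
  rcases lt_trichotomy c.1 c'.1 with hlt | heq | hgt
  · exact (c'.2 _ hlt h).elim
  · exact Subtype.ext heq
  · exact (c.2 _ hgt h.symm).elim

/-- The names of the values of a valuation. -/
def names (v : Fin n → Carrier H) : Fin n → ℕ := fun i => (v i).1

theorem names_cons (c : Carrier H) (v : Fin n → Carrier H) :
    names (cons c v : Fin (n + 1) → Carrier H) = (cons c.1 (names v) : Fin (n + 1) → ℕ) := by
  funext i; cases i using Fin.cases <;> rfl

theorem exists_value (t : Tm n) (v : Fin n → Carrier H) :
    ∃ c : Carrier H, H.T (.var 0 =ₑ t.wk) (names (cons c v : Fin (n + 1) → Carrier H)) := by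
  obtain ⟨l, hl⟩ := exists_same (H := H) (t := t) (names v)
  obtain ⟨c, hc⟩ := exists_carrier (H := H) l
  exact ⟨c, names_cons c v ▸ (T_congr hc).2 hl⟩

/-- The value of a term in the Henkin model. -/
noncomputable def value (t : Tm n) (v : Fin n → Carrier H) : Carrier H :=
  (exists_value t v).choose

theorem value_spec (t : Tm n) (v : Fin n → Carrier H) :
    H.T (.var 0 =ₑ t.wk) (cons (value t v).1 (names v) : Fin (n + 1) → ℕ) :=
  names_cons (value t v) v ▸ (exists_value t v).choose_spec

theorem T_inst_value (A : Fm (n + 1)) (t : Tm n) (v : Fin n → Carrier H) :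
    H.T (A.inst t) (names v) ↔ H.T A (names (cons (value t v) v : Fin (n + 1) → Carrier H)) := by
  rw [names_cons]
  exact T_inst (value_spec t v)

theorem T_eq_symm {s t : Tm n} {ρ : Fin n → ℕ} (h : H.T (s =ₑ t) ρ) : H.T (t =ₑ s) ρ := by
  have h1 : Proves ((s =ₑ t) ⊃ₑ (s =ₑ s) ⊃ₑ (t =ₑ s)) := by
    have h2 : ∀ x : Tm n, (.var 0 =ₑ s.wk : Fm (n + 1)).inst x = (x =ₑ s) := fun x =>
      congrArg (fun y => x =ₑ y) (wk_inst s x)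
    simpa only [h2] using Proves.eqSubst s t (.var 0 =ₑ s.wk)
  exact (h.of_imp h1).mp (T.of_proves (.eqRefl s))

theorem T_eq_trans {s t u : Tm n} {ρ : Fin n → ℕ} (h : H.T (s =ₑ t) ρ) (h' : H.T (t =ₑ u) ρ) :
    H.T (s =ₑ u) ρ := by
  have h1 : Proves ((t =ₑ u) ⊃ₑ (s =ₑ t) ⊃ₑ (s =ₑ u)) := by
    have h2 : ∀ x : Tm n, (s.wk =ₑ .var 0 : Fm (n + 1)).inst x = (s =ₑ x) := fun x =>
      congrArg (fun y => y =ₑ x) (wk_inst s x)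
    simpa only [h2] using Proves.eqSubst t u (s.wk =ₑ .var 0)
  exact (h'.of_imp h1).mp h

theorem same_of_T_eq {t : Tm n} {ρ : Fin n → ℕ} {l l' : ℕ}
    (h : H.T (.var 0 =ₑ t.wk) (cons l ρ : Fin (n + 1) → ℕ))
    (h' : H.T (.var 0 =ₑ t.wk) (cons l' ρ : Fin (n + 1) → ℕ)) : H.Same l l' := by
  let ρ' : Fin (n + 2) → ℕ := cons l (cons l' ρ : Fin (n + 1) → ℕ)
  have h1 : H.T (.var 0 =ₑ t.wk.wk) ρ' := by
    have := (T_rename (H := H) (upRen Fin.succ) (.var 0 =ₑ t.wk) ρ').2 (by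
      convert h using 1
      funext i; cases i using Fin.cases <;> rfl)
    simp only [rename, rename_wk] at this
    exact this
  have h2 : H.T (.var 1 =ₑ t.wk.wk) ρ' := (T_wk (.var 0 =ₑ t.wk) l _).2 h'
  exact (T_var_eq _ _).1 (T_eq_trans h1 (T_eq_symm h2))

theorem value_eq_iff (t : Tm n) (v : Fin n → Carrier H) (c : Carrier H) :
    c = value t v ↔ H.T (.var 0 =ₑ t.wk) (names (cons c v : Fin (n + 1) → Carrier H)) := by
  constructor
  · rintro rfl
    exact names_cons (value t v) v ▸ value_spec t v
  · intro h
    exact carrier_eq (same_of_T_eq (names_cons c v ▸ h) (value_spec t v))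

theorem T_eq_iff (s t : Tm n) (v : Fin n → Carrier H) :
    H.T (s =ₑ t) (names v) ↔ value s v = value t v := by
  rw [value_eq_iff]
  have h := T_inst_value (.var 0 =ₑ t.wk) s v
  rw [← h]
  exact Iff.of_eq (congrArg (fun x => H.T (s =ₑ x) (names v)) (wk_inst t s).symm)

theorem T_all_iff (A : Fm (n + 1)) (v : Fin n → Carrier H) :
    H.T (.all A) (names v) ↔ ∀ c : Carrier H, H.T A (names (cons c v : Fin (n + 1) → _)) := by
  constructor
  · intro h c
    have h1 := (T_wk _ c.1 _).2 h
    have h2 := h1.of_imp (.allInst _ (.var 0))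
    rw [names_cons]
    exact rename_up_succ_inst_zero A ▸ h2
  · intro h
    by_contra hn
    obtain ⟨l, hl⟩ := T.witness hn
    obtain ⟨c, hc⟩ := exists_carrier (H := H) l
    exact hl ((T_congr hc).1 (names_cons c v ▸ h c))

/-- The Henkin model of a chain. -/
noncomputable instance : EAModel (Carrier H) where
  ev t v := value t v
  sat A v := H.T (asFm A) (names v)
  ev_var i v := ((value_eq_iff _ _ _).2
    ((T_var_eq (ρ := names (cons (v i) v : Fin _ → Carrier H)) 0 i.succ).2 (same_refl _))).symm
  sat_eq {q n} s t v := by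
    have : asFm (q := q) (s =ₑ t) = (s =ₑ t) := by cases q <;> simp only [asFm, toFm]
    rw [this, T_eq_iff]
  sat_neg {q n} A v := by
    have : asFm (∼ₑA) = ∼ₑ(asFm A) := by cases q <;> simp only [asFm, toFm]
    rw [this, T_neg]
  sat_and {q n} A B v := by
    have : asFm (A ∧ₑ B) = (asFm A ∧ₑ asFm B) := by cases q <;> simp only [asFm, toFm]
    rw [this, T_and]
  sat_or {q n} A B v := by
    have : asFm (A ∨ₑ B) = (asFm A ∨ₑ asFm B) := by cases q <;> simp only [asFm, toFm]
    rw [this, T_or]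
  sat_imp {q n} A B v := by
    have : asFm (A ⊃ₑ B) = (asFm A ⊃ₑ asFm B) := by cases q <;> simp only [asFm, toFm]
    rw [this, T_imp]
  sat_all A v := T_all_iff A v
  sat_toFm A v := Iff.rfl
  sat_mem_toFm {q n} s t v := by cases q <;> simp only [asFm, toFm]
  sat_sub_toFm {q n} s t v := by cases q <;> simp only [asFm, toFm]
  sat_rename ρ A v := T_rename ρ A (names v)
  ev_rename {m n} ρ t v := by
    refine ((value_eq_iff _ _ _).2 ?_).symm
    have h := (T_rename (H := H) (upRen ρ) (.var 0 =ₑ t.wk)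
      (names (cons (value t (v ∘ ρ)) v : Fin (n + 1) → Carrier H))).2 (by
        convert (value_eq_iff t (v ∘ ρ) _).1 rfl using 1
        funext i; cases i using Fin.cases <;> rfl)
    simp only [rename, rename_wk] at h
    exact h
  sat_inst A t v := T_inst_value A t v
  sat_postulate h v := T.of_proves (.postulate h)

end Chain

end Henkin

/-- Completeness: a sentence that holds in every model is derivable. -/
theorem proves_of_forall_model {A : Fm 0}
    (h : ∀ (M : Type) [EAModel M], EAModel.sat A (Fin.elim0 : Fin 0 → M)) : Proves A := by
  by_contra hA
  have hc : Henkin.Con (∼ₑA) := fun h' => hA (.mp (.negE _) h')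
  obtain ⟨H, hH⟩ := Henkin.exists_chain hc.wk
  have h1 : H.T A (Henkin.Chain.names (Fin.elim0 : Fin 0 → Henkin.Carrier H)) :=
    (congrArg (H.T A) (funext fun i => i.elim0)).mp (h (Henkin.Carrier H))
  refine Henkin.Chain.T_neg.1 ⟨0, fun i => i.elim0, ?_⟩ h1
  rw [hH]
  convert Proves.imp_self _ using 2
  simp only [Henkin.named, wk]
  congr 1
  funext i; exact i.elim0

theorem proves_iff {A : Fm 0} :
    Proves A ↔ ∀ (M : Type) [EAModel M], EAModel.sat A (Fin.elim0 : Fin 0 → M) :=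
  ⟨fun h _ _ => h.sound _, proves_of_forall_model⟩

open EAModel

/-! ### Membership in a model, and the set-theoretical operations -/

section Basic

variable {M : Type} [EAModel M]

@[simp] theorem cons_zero {M : Type} {n : ℕ} (a : M) (v : Fin n → M) :
    (cons a v : Fin (n + 1) → M) 0 = a := rfl

instance : Membership M M := ⟨fun b a => sat (q := true) (.var 0 ∈ₑ .var 1) ![a, b]⟩

instance : HasSubset M := ⟨fun a b => ∀ x, x ∈ a → x ∈ b⟩

theorem sub_def {a b : M} : a ⊆ b ↔ ∀ x, x ∈ a → x ∈ b := Iff.rfl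

@[simp] theorem ev_wk {n : ℕ} (t : Tm n) (a : M) (v : Fin n → M) :
    ev t.wk (cons a v) = ev t v := ev_rename _ _ _

theorem sat_rename' {q : Bool} {m n : ℕ} (ρ : Fin m → Fin n) (A : Expr (.fm q) m)
    (v : Fin n → M) : sat (A.rename ρ) v ↔ sat A (v ∘ ρ) := by
  cases q with
  | true => exact sat_rename _ _ _
  | false => rw [← sat_toFm, ← rename_toFm, sat_rename, sat_toFm]

@[simp] theorem sat_mem {q : Bool} {n : ℕ} (s t : Tm n) (v : Fin n → M) :
    sat (q := q) (s ∈ₑ t) v ↔ ev s v ∈ ev t v := by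
  rw [sat_mem_toFm]
  have h1 : (.var 0 ∈ₑ t.wk : Fm (n + 1)).inst s = (s ∈ₑ t) :=
    congrArg (fun x => s ∈ₑ x) (wk_inst t s)
  have h2 := sat_inst (M := M) (.var 1 ∈ₑ .var 0) t.wk (cons (ev s v) v)
  have h3 : (.var 1 ∈ₑ .var 0 : Fm (n + 2)) = rename ![1, 0] (.var 0 ∈ₑ .var 1 : Fm 2) := rfl
  have h4 : (.var 1 ∈ₑ .var 0 : Fm (n + 2)).inst t.wk = (.var 0 ∈ₑ t.wk : Fm (n + 1)) := rfl
  rw [h4, h3, sat_rename] at h2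
  rw [← h1, sat_inst, h2, ev_wk]
  refine Iff.of_eq (congrArg _ ?_)
  funext i; fin_cases i <;> rfl

@[simp] theorem sat_sub {q : Bool} {n : ℕ} (s t : Tm n) (v : Fin n → M) :
    sat (q := q) (s ⊆ₑ t) v ↔ ev s v ⊆ ev t v := by
  rw [sat_sub_toFm]
  constructor
  · intro h x hx
    have := sat_postulate (.subElim (.var 0) s.wk t.wk) (cons x v)
    simp only [sat_imp, sat_and, sat_mem, ev_wk, ev_var] at this
    refine this ⟨?_, hx⟩
    exact (sat_rename Fin.succ (s ⊆ₑ t) (cons x v)).2 h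
  · intro h
    have := sat_postulate (.subIntro s t) v
    simp only [forallE, sat_imp, sat_all, sat_mem, ev_wk, ev_var] at this
    exact this h

theorem ext {a b : M} (h : ∀ x, x ∈ a ↔ x ∈ b) : a = b := by
  have := sat_postulate (.ext (.var 0) (.var 1)) ![a, b]
  simp only [sat_imp, sat_and, sat_sub, sat_eq, ev_var] at this
  exact this ⟨fun x => (h x).1, fun x => (h x).2⟩

theorem sub_antisymm {a b : M} (h : a ⊆ b) (h' : b ⊆ a) : a = b := ext fun x => ⟨h x, h' x⟩

@[simp] theorem mem_ev_empty {n : ℕ} (v : Fin n → M) (a : M) : a ∈ ev .empty v ↔ False := by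
  have := sat_postulate (.empty (.var 0)) (cons a v)
  simp only [sat_neg, sat_mem, ev_var, cons_zero] at this
  rw [show ev .empty (cons a v) = _ from ev_wk .empty a v] at this
  exact ⟨this, False.elim⟩

theorem sat_iffE {q : Bool} {n : ℕ} (A B : Expr (.fm q) n) (v : Fin n → M) :
    sat (iffE A B) v ↔ (sat A v ↔ sat B v) := by
  simp only [iffE, sat_and, sat_imp]; tauto

@[simp] theorem mem_ev_pair {n : ℕ} (s t : Tm n) (v : Fin n → M) (a : M) :
    a ∈ ev (.pair s t) v ↔ a = ev s v ∨ a = ev t v := by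
  have := sat_postulate (.pair (.var 0) s.wk t.wk) (cons a v)
  simp only [sat_iffE, sat_or, sat_eq, sat_mem, ev_var, cons_zero, ev_wk] at this
  rwa [show ev (.pair s.wk t.wk) (cons a v) = _ from ev_wk (.pair s t) a v] at this

@[simp] theorem mem_ev_pow {n : ℕ} (s : Tm n) (v : Fin n → M) (a : M) :
    a ∈ ev (.pow s) v ↔ a ⊆ ev s v := by
  have := sat_postulate (.pow (.var 0) s.wk) (cons a v)
  simp only [sat_iffE, sat_sub, sat_mem, ev_var, cons_zero, ev_wk] at this
  rwa [show ev (.pow s.wk) (cons a v) = _ from ev_wk (.pow s) a v] at this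

@[simp] theorem mem_ev_sep {n : ℕ} (s : Tm n) (A : Fm0 (n + 1)) (v : Fin n → M) (a : M) :
    a ∈ ev (.sep s A) v ↔ a ∈ ev s v ∧ sat A (cons a v) := by
  have := sat_postulate (.selection (.var 0) s.wk (rename (upRen Fin.succ) A)) (cons a v)
  rw [rename_up_succ_inst_zero] at this
  simp only [sat_iffE, sat_and, sat_mem, ev_var, cons_zero, ev_wk, sat_toFm] at this
  rwa [show ev (.sep s.wk (rename (upRen Fin.succ) A)) (cons a v) = _ from
    ev_wk (.sep s A) a v] at this

@[simp] theorem sat_ball {q : Bool} {n : ℕ} (s : Tm n) (A : Tm (n + 1) → Fm0 (n + 1))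
    (v : Fin n → M) : sat (q := q) (ball s A) v ↔ ∀ x ∈ ev s v, sat (A (.var 0)) (cons x v) := by
  simp only [ball, comp, sat_sub, sub_def, mem_ev_sep]
  exact ⟨fun h x hx => (h x hx).2, fun h x hx => ⟨hx, h x hx⟩⟩

@[simp] theorem sat_bex {q : Bool} {n : ℕ} (s : Tm n) (A : Tm (n + 1) → Fm0 (n + 1))
    (v : Fin n → M) : sat (q := q) (bex s A) v ↔ ∃ x ∈ ev s v, sat (A (.var 0)) (cons x v) := by
  simp only [bex, sat_neg, sat_ball]
  push Not
  rfl

@[simp] theorem mem_ev_union {n : ℕ} (s : Tm n) (v : Fin n → M) (a : M) :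
    a ∈ ev (.union s) v ↔ ∃ x ∈ ev s v, a ∈ x := by
  have := sat_postulate (.union (.var 0) s.wk) (cons a v)
  simp only [sat_iffE, sat_mem, ev_var, cons_zero, ev_wk, sat_bex] at this
  rwa [show ev (.union s.wk) (cons a v) = _ from ev_wk (.union s) a v] at this

@[simp] theorem mem_ev_repl {n : ℕ} (t : Tm (n + 1)) (s : Tm n) (v : Fin n → M) (a : M) :
    a ∈ ev (.repl t s) v ↔ ∃ x ∈ ev s v, a = ev t (cons x v) := by
  have := sat_postulate (.replacement (.var 0) s.wk (rename (upRen Fin.succ) t)) (cons a v)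
  simp only [sat_iffE, sat_mem, ev_var, cons_zero, ev_wk, sat_bex, sat_eq, ev_rename] at this
  rw [show ev (.repl (rename (upRen Fin.succ) t) s.wk) (cons a v) = _ from
    ev_wk (.repl t s) a v] at this
  refine Iff.trans this (exists_congr fun x => and_congr_right fun _ => ?_)
  refine Eq.congr_right (congrArg _ ?_)
  funext i; cases i using Fin.cases <;> rfl

theorem mem_ev_fan {n : ℕ} (s : Tm n) (v : Fin n → M) (a : M) :
    a ∈ ev (.fan s) v ↔ sat (q := true) (isChain (.var 0) s.wk) (cons a v) := by
  have := sat_postulate (.epsilonFan (.var 0) s.wk) (cons a v)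
  simp only [sat_iffE, sat_mem, ev_var, cons_zero] at this
  rw [← this]
  exact Iff.of_eq (congrArg (a ∈ ·) (ev_wk (.fan s) a v).symm)

/-- The value of the expression `e` under a substitution is its value at the values of the
substituted terms. -/
def SubstSound (M : Type) [EAModel M] : {k : Kind} → {m : ℕ} → Expr k m → Prop
  | .tm, m, e => ∀ {n : ℕ} (σ : Fin m → Tm n) (v : Fin n → M),
      ev (subst σ e) v = ev e fun i => ev (σ i) v
  | .fm _, m, e => ∀ {n : ℕ} (σ : Fin m → Tm n) (v : Fin n → M),
      sat (subst σ e) v ↔ sat e fun i => ev (σ i) v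

theorem substSound {k : Kind} {m : ℕ} (e : Expr k m) : SubstSound M e := by
  have key : ∀ {m n : ℕ} (σ : Fin m → Tm n) (v : Fin n → M) (a : M),
      (fun i => ev (upSub σ i) (cons a v)) = cons a fun i => ev (σ i) v := by
    intros; funext i
    cases i using Fin.cases
    · exact ev_var _ _
    · exact ev_wk _ _ _
  induction e with
  | var i => intro n σ v; exact (ev_var (M := M) i fun i => ev (σ i) v).symm
  | empty => intro n σ v; exact ext fun x => by simp only [subst, mem_ev_empty]
  | pair s t ih1 ih2 =>
    intro n σ v
    exact ext fun x => by simp only [subst, mem_ev_pair, ih1 σ v, ih2 σ v]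
  | pow s ih => intro n σ v; exact ext fun x => by simp only [subst, mem_ev_pow, ih σ v]
  | union s ih => intro n σ v; exact ext fun x => by simp only [subst, mem_ev_union, ih σ v]
  | fan s ih =>
    intro n σ v
    refine ext fun x => ?_
    simp only [subst, mem_ev_fan]
    -- Both sides say that `x` is a chain for the value of `s`.
    have h2 : ∀ {k : ℕ} (t : Tm k) (w : Fin k → M),
        sat (q := true) (isChain (.var 0) t.wk) (cons x w) ↔
          sat (q := true) (isChain (.var 0) (.var 1)) ![x, ev t w] := by
      intro k t w
      have h3 := sat_inst (M := M) (isChain (.var 1) (.var 0) : Fm (k + 2)) t.wk (cons x w)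
      have h4 : (isChain (.var 1) (.var 0) : Fm (k + 2)).inst t.wk =
          isChain (.var 0) t.wk := by
        simp only [isChain, isOrd, first, last, next, the, field, ordLt, ball, bex, comp, cup,
          sing, inst, subst, wk, rename]
        rfl
      have h5 : (isChain (.var 1) (.var 0) : Fm (k + 2)) =
          rename ![1, 0] (isChain (.var 0) (.var 1) : Fm 2) := by
        rw [rename_isChain]; rfl
      rw [h4, h5, sat_rename, ev_wk] at h3
      rw [h3]
      refine Iff.of_eq (congrArg _ ?_)
      funext i; fin_cases i <;> rfl
    rw [h2, h2, ih σ v]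
  | sep s A ih1 ih2 =>
    intro n σ v
    exact ext fun x => by
      simp only [subst, mem_ev_sep, ih1 σ v, ih2 (upSub σ) (cons x v), key]
  | repl t s ih1 ih2 =>
    intro n σ v
    exact ext fun x => by
      simp only [subst, mem_ev_repl, ih2 σ v, fun y => ih1 (upSub σ) (cons y v), key]
  | mem s t ih1 ih2 | eq s t ih1 ih2 | sub s t ih1 ih2 =>
    intro n σ v
    simp only [subst, sat_mem, sat_eq, sat_sub, ih1 σ v, ih2 σ v]
  | neg A ih => intro n σ v; simp only [subst, sat_neg, ih σ v]
  | and A B ih1 ih2 | or A B ih1 ih2 | imp A B ih1 ih2 =>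
    intro n σ v
    simp only [subst, sat_and, sat_or, sat_imp, ih1 σ v, ih2 σ v]
  | all A ih =>
    intro n σ v
    simp only [subst, sat_all, fun y => ih (upSub σ) (cons y v), key]

theorem ev_subst {m n : ℕ} (t : Tm m) (σ : Fin m → Tm n) (v : Fin n → M) :
    ev (t.subst σ) v = ev t fun i => ev (σ i) v := substSound t σ v

theorem sat_subst {q : Bool} {m n : ℕ} (A : Expr (.fm q) m) (σ : Fin m → Tm n)
    (v : Fin n → M) : sat (A.subst σ) v ↔ sat A fun i => ev (σ i) v :=
  substSound A σ v

@[simp] theorem ev_const {n : ℕ} (t : Tm 0) (v : Fin n → M) :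
    ev (const t) v = ev t (Fin.elim0 : Fin 0 → M) := by
  rw [const, ev_subst]; congr 1; funext i; exact i.elim0

@[simp] theorem ev_ap {n : ℕ} (φ : Tm 1) (t : Tm n) (v : Fin n → M) :
    ev (ap φ t) v = ev φ fun _ => ev t v := by
  rw [ap, ev_subst]

end Basic

/-! ### Definability -/

section Definability

/-- The arguments of a term with parameters: coordinates of the valuation, or parameters. -/
def args {M : Type} {m n : ℕ} (g : Fin m → Fin n ⊕ M) (v : Fin n → M) : Fin m → M :=
  fun j => Sum.elim v id (g j)

theorem args_append_castAdd {M : Type} {n m m' : ℕ} (g : Fin m → Fin n ⊕ M)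
    (g' : Fin m' → Fin n ⊕ M) (v : Fin n → M) :
    args (Fin.append g g') v ∘ Fin.castAdd m' = args g v := by
  funext i; simp [args]

theorem args_append_natAdd {M : Type} {n m m' : ℕ} (g : Fin m → Fin n ⊕ M)
    (g' : Fin m' → Fin n ⊕ M) (v : Fin n → M) :
    args (Fin.append g g') v ∘ Fin.natAdd m = args g' v := by
  funext i; simp [args]

variable {M : Type} [EAModel M]

/-- The function `f` on valuations is given by a term with parameters. -/
class DF {n : ℕ} (f : (Fin n → M) → M) : Prop where
  out : ∃ (m : ℕ) (t : Tm m) (g : Fin m → Fin n ⊕ M), ∀ v, f v = ev t (args g v)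

/-- The property `P` of valuations is given by an `EA₀` formula with parameters. -/
class DP {n : ℕ} (P : (Fin n → M) → Prop) : Prop where
  out : ∃ (m : ℕ) (A : Fm0 m) (g : Fin m → Fin n ⊕ M), ∀ v, P v ↔ sat A (args g v)

/-- The property `P` of sets is given by an `EA₀` formula with parameters. -/
abbrev DP1 (P : M → Prop) : Prop := DP fun v : Fin 1 → M => P (v 0)

/-- The relation `R` between sets is given by an `EA₀` formula with parameters. -/
abbrev DP2 (R : M → M → Prop) : Prop := DP fun v : Fin 2 → M => R (v 0) (v 1)

/-- The function `F` on sets is given by a term with parameters. -/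
abbrev DF1 (F : M → M) : Prop := DF fun v : Fin 1 → M => F (v 0)

variable {n : ℕ}

theorem DF.common (f f' : (Fin n → M) → M) [h : DF f] [h' : DF f'] :
    ∃ (m : ℕ) (t t' : Tm m) (g : Fin m → Fin n ⊕ M),
      (∀ v, f v = ev t (args g v)) ∧ ∀ v, f' v = ev t' (args g v) := by
  obtain ⟨m, t, g, ht⟩ := h.out
  obtain ⟨m', t', g', ht'⟩ := h'.out
  exact ⟨m + m', t.rename (Fin.castAdd m'), t'.rename (Fin.natAdd m), Fin.append g g',
    fun v => by rw [ev_rename, args_append_castAdd, ht],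
    fun v => by rw [ev_rename, args_append_natAdd, ht']⟩

theorem DP.common (P Q : (Fin n → M) → Prop) [h : DP P] [h' : DP Q] :
    ∃ (m : ℕ) (A B : Fm0 m) (g : Fin m → Fin n ⊕ M),
      (∀ v, P v ↔ sat A (args g v)) ∧ ∀ v, Q v ↔ sat B (args g v) := by
  obtain ⟨m, t, g, ht⟩ := h.out
  obtain ⟨m', t', g', ht'⟩ := h'.out
  exact ⟨m + m', t.rename (Fin.castAdd m'), t'.rename (Fin.natAdd m), Fin.append g g',
    fun v => by rw [sat_rename', args_append_castAdd, ht],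
    fun v => by rw [sat_rename', args_append_natAdd, ht']⟩

/-- Bind the newest coordinate by the newest variable. -/
def bindRen {m : ℕ} (g : Fin m → Fin (n + 1) ⊕ M) : Fin m → Fin (m + 1) :=
  fun j => Sum.elim (Fin.cases 0 fun _ => j.succ) (fun _ => j.succ) (g j)

/-- The arguments other than the newest coordinate. -/
def bindArgs {m : ℕ} (g : Fin m → Fin (n + 1) ⊕ M) : Fin m → Fin n ⊕ M :=
  fun j => Sum.elim (Fin.cases (.inr (ev .empty (Fin.elim0 : Fin 0 → M))) fun i => .inl i)
    (fun c => .inr c) (g j)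

theorem args_bind {m : ℕ} (g : Fin m → Fin (n + 1) ⊕ M) (a : M) (v : Fin n → M) :
    (cons a (args (bindArgs g) v) : Fin (m + 1) → M) ∘ bindRen g = args g (cons a v) := by
  funext j
  simp only [Function.comp_apply, bindRen, args]
  rcases hg : g j with i | c
  · cases i using Fin.cases
    · simp
    · simp [bindArgs, args, hg]
  · simp [bindArgs, args, hg]

theorem DP.bind (P : (Fin (n + 1) → M) → Prop) [h : DP P] :
    ∃ (m : ℕ) (A : Fm0 (m + 1)) (g : Fin m → Fin n ⊕ M),
      ∀ v a, P (cons a v) ↔ sat A (cons a (args g v)) := by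
  obtain ⟨m, A, g, hA⟩ := h.out
  exact ⟨m, A.rename (bindRen g), bindArgs g, fun v a => by rw [sat_rename', args_bind, hA]⟩

theorem DF.bind (f : (Fin (n + 1) → M) → M) [h : DF f] :
    ∃ (m : ℕ) (t : Tm (m + 1)) (g : Fin m → Fin n ⊕ M),
      ∀ v a, f (cons a v) = ev t (cons a (args g v)) := by
  obtain ⟨m, A, g, hA⟩ := h.out
  exact ⟨m, A.rename (bindRen g), bindArgs g, fun v a => by rw [ev_rename, args_bind, hA]⟩

instance DF.const (c : M) : DF fun _ : Fin n → M => c :=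
  ⟨1, .var 0, fun _ => .inr c, fun v => by rw [ev_var]; rfl⟩

instance DF.var (i : Fin n) : DF fun v : Fin n → M => v i :=
  ⟨1, .var 0, fun _ => .inl i, fun v => by rw [ev_var]; rfl⟩

/-- A definable function of some of the coordinates; this applies to a function of the older
coordinates below a binder. -/
instance (priority := low) DF.rename {m : ℕ} (f : (Fin m → M) → M) [h : DF f] (ρ : Fin m → Fin n) :
    DF fun v : Fin n → M => f fun i => v (ρ i) := by
  obtain ⟨k, t, g, ht⟩ := h.out
  refine ⟨k, t, fun j => Sum.map ρ id (g j), fun v => (ht _).trans (congrArg _ ?_)⟩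
  funext j
  simp only [args]
  rcases g j with i | c <;> simp

instance (priority := low) DP.rename {m : ℕ} (P : (Fin m → M) → Prop) [h : DP P]
    (ρ : Fin m → Fin n) : DP fun v : Fin n → M => P fun i => v (ρ i) := by
  obtain ⟨k, t, g, ht⟩ := h.out
  refine ⟨k, t, fun j => Sum.map ρ id (g j), fun v => (ht _).trans (Iff.of_eq (congrArg _ ?_))⟩
  funext j
  simp only [args]
  rcases g j with i | c <;> simp

/-- The composition of a term with definable functions. -/
theorem DF.comp2 (t : Tm 2) (f f' : (Fin n → M) → M) [DF f] [DF f'] :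
    DF fun v => ev t ![f v, f' v] := by
  obtain ⟨m, s, s', g, h, h'⟩ := DF.common f f'
  refine ⟨m, t.subst ![s, s'], g, fun v => ?_⟩
  rw [ev_subst]; congr 1; funext i; fin_cases i
  · exact h v
  · exact h' v

theorem DF.comp1 (t : Tm 1) (f : (Fin n → M) → M) [h : DF f] : DF fun v => ev t fun _ => f v := by
  obtain ⟨m, s, g, h⟩ := h.out
  refine ⟨m, t.subst fun _ => s, g, fun v => ?_⟩
  rw [ev_subst]; simp only [h]

instance DF.ev1 (t : Tm 1) (f : (Fin n → M) → M) [DF f] : DF fun v => ev t fun _ => f v :=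
  DF.comp1 t f

instance DP.eq (f f' : (Fin n → M) → M) [DF f] [DF f'] : DP fun v => f v = f' v := by
  obtain ⟨m, s, s', g, h, h'⟩ := DF.common f f'
  exact ⟨m, s =ₑ s', g, fun v => by rw [sat_eq, h, h']⟩

instance DP.mem (f f' : (Fin n → M) → M) [DF f] [DF f'] : DP fun v => f v ∈ f' v := by
  obtain ⟨m, s, s', g, h, h'⟩ := DF.common f f'
  exact ⟨m, s ∈ₑ s', g, fun v => by rw [sat_mem, h, h']⟩

instance DP.not (P : (Fin n → M) → Prop) [h : DP P] : DP fun v => ¬ P v := by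
  obtain ⟨m, A, g, hA⟩ := h.out
  exact ⟨m, ∼ₑA, g, fun v => by rw [sat_neg, hA]⟩

instance DP.and (P Q : (Fin n → M) → Prop) [DP P] [DP Q] : DP fun v => P v ∧ Q v := by
  obtain ⟨m, A, B, g, hA, hB⟩ := DP.common P Q
  exact ⟨m, A ∧ₑ B, g, fun v => by rw [sat_and, hA, hB]⟩

instance DP.or (P Q : (Fin n → M) → Prop) [DP P] [DP Q] : DP fun v => P v ∨ Q v := by
  obtain ⟨m, A, B, g, hA, hB⟩ := DP.common P Q
  exact ⟨m, A ∨ₑ B, g, fun v => by rw [sat_or, hA, hB]⟩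

instance DP.imp (P Q : (Fin n → M) → Prop) [DP P] [DP Q] : DP fun v => P v → Q v := by
  obtain ⟨m, A, B, g, hA, hB⟩ := DP.common P Q
  exact ⟨m, A ⊃ₑ B, g, fun v => by rw [sat_imp, hA, hB]⟩

instance DP.ball (s : (Fin n → M) → M) (P : (Fin n → M) → M → Prop) [hs : DF s]
    [hP : DP fun w : Fin (n + 1) → M => P (fun i => w i.succ) (w 0)] :
    DP fun v => ∀ y, y ∈ s v → P v y := by
  obtain ⟨m, t, g, ht⟩ := hs.out
  obtain ⟨m', A, g', hA⟩ := DP.bind _ (h := hP)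
  refine ⟨m + m', EA.ball (t.rename (Fin.castAdd m'))
    fun _ => A.rename (upRen (Fin.natAdd m)), Fin.append g g', fun v => ?_⟩
  rw [sat_ball, ev_rename, args_append_castAdd, ht]
  refine forall_congr' fun y => imp_congr_right fun _ => (hA v y).trans ?_
  rw [sat_rename', ← args_append_natAdd g g']
  refine Iff.of_eq (congrArg _ ?_)
  funext i; cases i using Fin.cases <;> rfl

instance DP.bex (s : (Fin n → M) → M) (P : (Fin n → M) → M → Prop) [DF s]
    [DP fun w : Fin (n + 1) → M => P (fun i => w i.succ) (w 0)] :
    DP fun v => ∃ y, y ∈ s v ∧ P v y := by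
  have : DP fun v => ¬ ∀ y, y ∈ s v → ¬ P v y := inferInstance
  simpa only [not_forall, not_not, exists_prop] using this

open Classical in
/-- `{x ∈ s : P x}`, for a definable property `P`. -/
noncomputable def sepM (s : M) (P : M → Prop) : M :=
  if h : ∃ z, ∀ a, a ∈ z ↔ a ∈ s ∧ P a then h.choose else s

theorem sepM_spec {s z : M} {P : M → Prop} (h : ∀ a, a ∈ z ↔ a ∈ s ∧ P a) : sepM s P = z := by
  have h' : ∃ z, ∀ a, a ∈ z ↔ a ∈ s ∧ P a := ⟨z, h⟩
  rw [sepM, dif_pos h']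
  exact ext fun a => (h'.choose_spec a).trans (h a).symm

@[simp] theorem mem_sepM {s : M} {P : M → Prop} [hP : DP1 P] {a : M} :
    a ∈ sepM s P ↔ a ∈ s ∧ P a := by
  obtain ⟨m, A, g, hA⟩ := DP.bind (n := 0) _ (h := hP)
  have : ∀ a, a ∈ ev (.sep (.var 0) (A.rename (upRen Fin.succ)))
      (cons s (args g (Fin.elim0 : Fin 0 → M))) ↔ a ∈ s ∧ P a := by
    intro a
    rw [mem_ev_sep, ev_var, sat_rename']
    refine and_congr_right fun _ => (Iff.of_eq (congrArg _ ?_)).trans (hA Fin.elim0 a).symm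
    funext i; cases i using Fin.cases <;> rfl
  rw [sepM_spec this, this]

open Classical in
/-- `{F x : x ∈ s}`, for a definable function `F`. -/
noncomputable def imgM (s : M) (F : M → M) : M :=
  if h : ∃ z, ∀ a, a ∈ z ↔ ∃ x ∈ s, a = F x then h.choose else s

theorem imgM_spec {s z : M} {F : M → M} (h : ∀ a, a ∈ z ↔ ∃ x ∈ s, a = F x) : imgM s F = z := by
  have h' : ∃ z, ∀ a, a ∈ z ↔ ∃ x ∈ s, a = F x := ⟨z, h⟩
  rw [imgM, dif_pos h']
  exact ext fun a => (h'.choose_spec a).trans (h a).symm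

@[simp] theorem mem_imgM {s : M} {F : M → M} [hF : DF1 F] {a : M} :
    a ∈ imgM s F ↔ ∃ x ∈ s, a = F x := by
  obtain ⟨m, A, g, hA⟩ := DF.bind (n := 0) _ (h := hF)
  have : ∀ a, a ∈ ev (.repl (A.rename (upRen Fin.succ)) (.var 0))
      (cons s (args g (Fin.elim0 : Fin 0 → M))) ↔ ∃ x ∈ s, a = F x := by
    intro a
    rw [mem_ev_repl, ev_var]
    refine exists_congr fun x => and_congr_right fun _ => Eq.congr_right ?_
    refine Eq.trans ?_ (hA Fin.elim0 x).symm
    rw [ev_rename]; congr 1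
    funext i; cases i using Fin.cases <;> rfl
  rw [imgM_spec this, this]

instance DF.sep (s : (Fin n → M) → M) (P : (Fin n → M) → M → Prop) [hs : DF s]
    [hP : DP fun w : Fin (n + 1) → M => P (fun i => w i.succ) (w 0)] :
    DF fun v => sepM (s v) (P v) := by
  obtain ⟨m, t, g, ht⟩ := hs.out
  obtain ⟨m', A, g', hA⟩ := DP.bind _ (h := hP)
  refine ⟨m + m', .sep (t.rename (Fin.castAdd m')) (A.rename (upRen (Fin.natAdd m))),
    Fin.append g g', fun v => sepM_spec fun y => ?_⟩
  rw [mem_ev_sep, ev_rename, args_append_castAdd, ht]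
  refine and_congr_right fun _ => Iff.trans ?_ (hA v y).symm
  rw [sat_rename', ← args_append_natAdd g g']
  refine Iff.of_eq (congrArg _ ?_)
  funext i; cases i using Fin.cases <;> rfl

instance DF.img (s : (Fin n → M) → M) (F : (Fin n → M) → M → M) [hs : DF s]
    [hF : DF fun w : Fin (n + 1) → M => F (fun i => w i.succ) (w 0)] :
    DF fun v => imgM (s v) (F v) := by
  obtain ⟨m, t, g, ht⟩ := hs.out
  obtain ⟨m', A, g', hA⟩ := DF.bind _ (h := hF)
  refine ⟨m + m', .repl (A.rename (upRen (Fin.natAdd m))) (t.rename (Fin.castAdd m')),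
    Fin.append g g', fun v => imgM_spec fun y => ?_⟩
  rw [mem_ev_repl, ev_rename, args_append_castAdd, ht]
  refine exists_congr fun x => and_congr_right fun _ => Eq.congr_right ?_
  refine Eq.trans ?_ (hA v x).symm
  rw [ev_rename, ← args_append_natAdd g g']; congr 1
  funext i; cases i using Fin.cases <;> rfl

/-- A definable function of one argument, applied to a definable function. For a variable `F`
instance search cannot find the pattern `F (f v)`, so the proofs add this fact about their functions
to the local context. -/
theorem DF.app (F : M → M) [hF : DF1 F] (f : (Fin n → M) → M) [hf : DF f] :
    DF fun v => F (f v) := by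
  obtain ⟨m, t, g, ht⟩ := DF.bind (n := 0) _ (h := hF)
  obtain ⟨m', s, g', hs⟩ := hf.out
  refine ⟨m + m', (t.rename (upRen (Fin.castAdd m'))).inst (s.rename (Fin.natAdd m)),
    Fin.append (fun j => .inr (args g (Fin.elim0 : Fin 0 → M) j)) g', fun v => ?_⟩
  rw [inst, ev_subst, ev_rename, hs]
  refine (ht Fin.elim0 _).trans (congrArg _ ?_)
  funext i
  cases i using Fin.cases with
  | zero =>
    change _ = ev (Expr.rename (Fin.natAdd m) s) _
    rw [ev_rename, args_append_natAdd]; rfl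
  | succ i =>
    change _ = ev (.var (Fin.castAdd m' i)) _
    rw [ev_var]; simp [args]

theorem DP.app (P : M → Prop) [hP : DP1 P] (f : (Fin n → M) → M) [hf : DF f] :
    DP fun v => P (f v) := by
  obtain ⟨m, t, g, ht⟩ := DP.bind (n := 0) _ (h := hP)
  obtain ⟨m', s, g', hs⟩ := hf.out
  refine ⟨m + m', (t.rename (upRen (Fin.castAdd m'))).inst (s.rename (Fin.natAdd m)),
    Fin.append (fun j => .inr (args g (Fin.elim0 : Fin 0 → M) j)) g', fun v => ?_⟩
  rw [inst, sat_subst, sat_rename', hs]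
  refine (ht Fin.elim0 _).trans (Iff.of_eq (congrArg _ ?_))
  funext i
  cases i using Fin.cases with
  | zero =>
    change _ = ev (Expr.rename (Fin.natAdd m) s) _
    rw [ev_rename, args_append_natAdd]; rfl
  | succ i =>
    change _ = ev (.var (Fin.castAdd m' i)) _
    rw [ev_var]; simp [args]

theorem DP.app2 (R : M → M → Prop) [hR : DP2 R] (f f' : (Fin n → M) → M) [DF f] [DF f'] :
    DP fun v => R (f v) (f' v) := by
  obtain ⟨m, A, g, hA⟩ := hR.out
  obtain ⟨m', s, s', g', hs, hs'⟩ := DF.common f f'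
  refine ⟨m + m', A.subst fun j =>
      Sum.elim (fun i => (![s, s'] i).rename (Fin.natAdd m)) (fun _ => .var (Fin.castAdd m' j))
        (g j),
    Fin.append (fun j => .inr (Sum.elim (fun _ => ev .empty (Fin.elim0 : Fin 0 → M)) id (g j))) g',
    fun v => ?_⟩
  rw [sat_subst]
  refine (hA ![f v, f' v]).trans (Iff.of_eq (congrArg _ ?_))
  funext j
  rcases hg : g j with i | c
  · simp only [args, hg, Sum.elim_inl]
    rw [ev_rename, args_append_natAdd]
    fin_cases i
    · exact hs v
    · exact hs' v
  · simp [args, hg, ev_var]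

end Definability



/-! ### The vocabulary of the theory, interpreted in a model -/

attribute [simp] ev_var sat_eq sat_neg sat_and sat_or sat_imp sat_all sat_iffE

section Vocabulary

variable {M : Type} [EAModel M] {n : ℕ}

instance : EmptyCollection M := ⟨ev .empty (Fin.elim0 : Fin 0 → M)⟩

@[simp] theorem not_mem_empty (a : M) : a ∉ (∅ : M) := (mem_ev_empty _ a).1

@[simp] theorem ev_empty (v : Fin n → M) : ev .empty v = ∅ := ext fun x => by simp

/-- `{a, b}` -/
def pairM (a b : M) : M := ev (.pair (.var 0) (.var 1)) ![a, b]

@[simp] theorem mem_pairM {a b x : M} : x ∈ pairM a b ↔ x = a ∨ x = b := by simp [pairM]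

@[simp] theorem ev_pair (s t : Tm n) (v : Fin n → M) :
    ev (.pair s t) v = pairM (ev s v) (ev t v) := ext fun x => by simp

instance (f g : (Fin n → M) → M) [DF f] [DF g] : DF fun v => pairM (f v) (g v) :=
  DF.comp2 _ _ _

/-- The power set of `a`. -/
def powM (a : M) : M := ev (n := 1) (.pow (.var 0)) fun _ => a

@[simp] theorem mem_powM {a x : M} : x ∈ powM a ↔ x ⊆ a := by simp [powM]

@[simp] theorem ev_pow (s : Tm n) (v : Fin n → M) : ev (.pow s) v = powM (ev s v) :=
  ext fun x => by simp

instance (f : (Fin n → M) → M) [DF f] : DF fun v => powM (f v) := DF.comp1 _ _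

/-- The union of the members of `a`. -/
def unionM (a : M) : M := ev (n := 1) (.union (.var 0)) fun _ => a

@[simp] theorem mem_unionM {a x : M} : x ∈ unionM a ↔ ∃ y ∈ a, x ∈ y := by simp [unionM]

@[simp] theorem ev_union (s : Tm n) (v : Fin n → M) : ev (.union s) v = unionM (ev s v) :=
  ext fun x => by simp

instance (f : (Fin n → M) → M) [DF f] : DF fun v => unionM (f v) := DF.comp1 _ _

/-- The epsilon fan of `a`. -/
def fanM (a : M) : M := ev (n := 1) (.fan (.var 0)) fun _ => a

@[simp] theorem ev_fan (s : Tm n) (v : Fin n → M) : ev (.fan s) v = fanM (ev s v) := by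
  have := ev_subst (M := M) (m := 1) (.fan (.var 0)) (fun _ => s) v
  simpa [subst, fanM] using this

instance (f : (Fin n → M) → M) [DF f] : DF fun v => fanM (f v) := DF.comp1 _ _

@[simp] theorem ev_sep (s : Tm n) (A : Fm0 (n + 1)) (v : Fin n → M) :
    ev (.sep s A) v = sepM (ev s v) fun a => sat A (cons a v) :=
  (sepM_spec fun a => by simp).symm

@[simp] theorem ev_repl (t : Tm (n + 1)) (s : Tm n) (v : Fin n → M) :
    ev (.repl t s) v = imgM (ev s v) fun a => ev t (cons a v) :=
  (imgM_spec fun a => by simp).symm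

@[simp] theorem ev_comp (s : Tm n) (A : Tm (n + 1) → Fm0 (n + 1)) (v : Fin n → M) :
    ev (comp s A) v = sepM (ev s v) fun a => sat (A (.var 0)) (cons a v) := ev_sep _ _ _

@[simp] theorem ev_image (s : Tm n) (t : Tm (n + 1) → Tm (n + 1)) (v : Fin n → M) :
    ev (image s t) v = imgM (ev s v) fun a => ev (t (.var 0)) (cons a v) := ev_repl _ _ _

/-- The `x ∈ s` such that `P x`, if there is exactly one. -/
noncomputable def theM (s : M) (P : M → Prop) : M := unionM (sepM s P)

theorem theM_eq {s a : M} {P : M → Prop} [DP1 P] (ha : a ∈ s) (hP : P a)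
    (h : ∀ b ∈ s, P b → b = a) : theM s P = a :=
  ext fun x => by
    simp only [theM, mem_unionM, mem_sepM]
    constructor
    · rintro ⟨y, ⟨hy, hPy⟩, hx⟩
      exact h y hy hPy ▸ hx
    · exact fun hx => ⟨a, ⟨ha, hP⟩, hx⟩

@[simp] theorem ev_the (s : Tm n) (A : Tm (n + 1) → Fm0 (n + 1)) (v : Fin n → M) :
    ev (the s A) v = theM (ev s v) fun a => sat (A (.var 0)) (cons a v) := by
  simp [the, theM]

instance (s : (Fin n → M) → M) (P : (Fin n → M) → M → Prop) [DF s]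
    [DP fun w : Fin (n + 1) → M => P (fun i => w i.succ) (w 0)] :
    DF fun v => theM (s v) (P v) := by
  unfold theM; infer_instance

/-- `{a}` -/
def singM (a : M) : M := pairM a a

@[simp] theorem mem_singM {a x : M} : x ∈ singM a ↔ x = a := by simp [singM]

@[simp] theorem ev_sing (s : Tm n) (v : Fin n → M) : ev (sing s) v = singM (ev s v) := by
  simp [sing, singM]

instance (f : (Fin n → M) → M) [DF f] : DF fun v => singM (f v) := by
  unfold singM; infer_instance

/-- `a ∪ b` -/
def cupM (a b : M) : M := unionM (pairM a b)

@[simp] theorem mem_cupM {a b x : M} : x ∈ cupM a b ↔ x ∈ a ∨ x ∈ b := by simp [cupM]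

@[simp] theorem ev_cup (s t : Tm n) (v : Fin n → M) : ev (cup s t) v = cupM (ev s v) (ev t v) := by
  simp [cup, cupM]

instance (f g : (Fin n → M) → M) [DF f] [DF g] : DF fun v => cupM (f v) (g v) := by
  unfold cupM; infer_instance

/-- `a ∪ {b}` -/
def insM (a b : M) : M := cupM a (singM b)

@[simp] theorem mem_insM {a b x : M} : x ∈ insM a b ↔ x ∈ a ∨ x = b := by simp [insM]

instance (f g : (Fin n → M) → M) [DF f] [DF g] : DF fun v => insM (f v) (g v) := by
  unfold insM; infer_instance

@[simp] theorem ev_succSet (s : Tm n) (v : Fin n → M) :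
    ev (succSet s) v = insM (ev s v) (ev s v) := by simp [succSet, insM]

/-- The ordered pair `(a, b)`. -/
def opairM (a b : M) : M := pairM (singM a) (pairM a b)

@[simp] theorem ev_opair (s t : Tm n) (v : Fin n → M) :
    ev (opair s t) v = opairM (ev s v) (ev t v) := by simp [opair, opairM]

instance (f g : (Fin n → M) → M) [DF f] [DF g] : DF fun v => opairM (f v) (g v) := by
  unfold opairM; infer_instance

theorem mem_union_opairM {a b x : M} : x ∈ unionM (opairM a b) ↔ x = a ∨ x = b := by
  simp only [opairM, mem_unionM, mem_pairM]
  constructor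
  · rintro ⟨y, rfl | rfl, h⟩
    · exact .inl (mem_singM.1 h)
    · exact mem_pairM.1 h
  · rintro (rfl | rfl)
    · exact ⟨_, .inl rfl, mem_singM.2 rfl⟩
    · exact ⟨_, .inr rfl, mem_pairM.2 (.inr rfl)⟩

@[simp] theorem opairM_inj {a b c d : M} : opairM a b = opairM c d ↔ a = c ∧ b = d := by
  refine ⟨fun h => ?_, fun h => by rw [h.1, h.2]⟩
  have hac : a = c := by
    have h1 : singM c ∈ opairM a b := h ▸ mem_pairM.2 (.inl rfl)
    rcases mem_pairM.1 h1 with h2 | h2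
    · exact (mem_singM.1 (h2 ▸ mem_singM.2 rfl : c ∈ singM a)).symm
    · exact mem_singM.1 (h2 ▸ mem_pairM.2 (.inl rfl) : a ∈ singM c)
  subst hac
  refine ⟨rfl, ?_⟩
  have h1 : pairM a d ∈ opairM a b := h ▸ mem_pairM.2 (.inr rfl)
  have h2 : pairM a b ∈ opairM a d := h ▸ mem_pairM.2 (.inr rfl)
  have h3 : d = a ∨ d = b := by
    rcases mem_pairM.1 h1 with h2 | h2
    · exact .inl (mem_singM.1 (h2 ▸ mem_pairM.2 (.inr rfl)))
    · exact mem_pairM.1 (h2 ▸ mem_pairM.2 (.inr rfl))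
  have h4 : b = a ∨ b = d := by
    rcases mem_pairM.1 h2 with h2 | h2
    · exact .inl (mem_singM.1 (h2 ▸ mem_pairM.2 (.inr rfl)))
    · exact mem_pairM.1 (h2 ▸ mem_pairM.2 (.inr rfl))
  rcases h3 with rfl | rfl
  · rcases h4 with rfl | rfl <;> rfl
  · rfl

/-- The first component of an ordered pair. -/
noncomputable def fstM (p : M) : M := theM (unionM p) fun x => ∃ y ∈ unionM p, p = opairM x y

/-- The second component of an ordered pair. -/
noncomputable def sndM (p : M) : M := theM (unionM p) fun y => ∃ x ∈ unionM p, p = opairM x y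

@[simp] theorem fstM_opairM (a b : M) : fstM (opairM a b) = a :=
  theM_eq (mem_union_opairM.2 (.inl rfl)) ⟨b, mem_union_opairM.2 (.inr rfl), rfl⟩
    fun _ _ ⟨_, _, h⟩ => (opairM_inj.1 h).1.symm

@[simp] theorem sndM_opairM (a b : M) : sndM (opairM a b) = b :=
  theM_eq (mem_union_opairM.2 (.inr rfl)) ⟨a, mem_union_opairM.2 (.inl rfl), rfl⟩
    fun _ _ ⟨_, _, h⟩ => (opairM_inj.1 h).2.symm

@[simp] theorem ev_fst (s : Tm n) (v : Fin n → M) : ev (fst s) v = fstM (ev s v) := by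
  simp [fst, fstM]

@[simp] theorem ev_snd (s : Tm n) (v : Fin n → M) : ev (snd s) v = sndM (ev s v) := by
  simp [snd, sndM]

instance (f : (Fin n → M) → M) [DF f] : DF fun v => fstM (f v) := by
  unfold fstM; infer_instance

instance (f : (Fin n → M) → M) [DF f] : DF fun v => sndM (f v) := by
  unfold sndM; infer_instance

/-- `a × b` -/
noncomputable def prodM (a b : M) : M := unionM (imgM a fun x => imgM b fun y => opairM x y)

@[simp] theorem mem_prodM {a b p : M} : p ∈ prodM a b ↔ ∃ x ∈ a, ∃ y ∈ b, p = opairM x y := by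
  simp only [prodM, mem_unionM, mem_imgM]
  constructor
  · rintro ⟨z, ⟨x, hx, rfl⟩, hp⟩
    exact ⟨x, hx, mem_imgM.1 hp⟩
  · rintro ⟨x, hx, y, hy, rfl⟩
    exact ⟨_, ⟨x, hx, rfl⟩, mem_imgM.2 ⟨y, hy, rfl⟩⟩

theorem opairM_mem_prodM {a b x y : M} : opairM x y ∈ prodM a b ↔ x ∈ a ∧ y ∈ b := by
  simp only [mem_prodM, opairM_inj]
  constructor
  · rintro ⟨x', hx, y', hy, rfl, rfl⟩
    exact ⟨hx, hy⟩
  · exact fun h => ⟨x, h.1, y, h.2, rfl, rfl⟩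

@[simp] theorem ev_prod (s t : Tm n) (v : Fin n → M) :
    ev (prod s t) v = prodM (ev s v) (ev t v) := by simp [prod, prodM]

instance (f g : (Fin n → M) → M) [DF f] [DF g] : DF fun v => prodM (f v) (g v) := by
  unfold prodM; infer_instance

/-- `f` is a local function from `a` to `b`. -/
def IsFun (f a b : M) : Prop :=
  f ⊆ prodM a b ∧ ∀ x ∈ a, ∃ y ∈ b, opairM x y ∈ f ∧ ∀ z ∈ b, opairM x z ∈ f → z = y

@[simp] theorem sat_isFun {q : Bool} (f a b : Tm n) (v : Fin n → M) :
    sat (q := q) (isFun f a b) v ↔ IsFun (ev f v) (ev a v) (ev b v) := by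
  simp [isFun, IsFun]

instance (f g h : (Fin n → M) → M) [DF f] [DF g] [DF h] :
    DP fun v => IsFun (f v) (g v) (h v) := by
  unfold IsFun; infer_instance

/-- `f` is an injective local function from `a` to `b`. -/
def IsInj (f a b : M) : Prop :=
  IsFun f a b ∧ ∀ x ∈ a, ∀ x' ∈ a, ∀ y ∈ b, opairM x y ∈ f ∧ opairM x' y ∈ f → x = x'

@[simp] theorem sat_isInj {q : Bool} (f a b : Tm n) (v : Fin n → M) :
    sat (q := q) (isInj f a b) v ↔ IsInj (ev f v) (ev a v) (ev b v) := by
  simp [isInj, IsInj]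

instance (f g h : (Fin n → M) → M) [DF f] [DF g] [DF h] :
    DP fun v => IsInj (f v) (g v) (h v) := by
  unfold IsInj; infer_instance

/-- `f` is a bijective local function from `a` to `b`. -/
def IsBij (f a b : M) : Prop := IsInj f a b ∧ ∀ y ∈ b, ∃ x ∈ a, opairM x y ∈ f

@[simp] theorem sat_isBij {q : Bool} (f a b : Tm n) (v : Fin n → M) :
    sat (q := q) (isBij f a b) v ↔ IsBij (ev f v) (ev a v) (ev b v) := by
  simp [isBij, IsBij]

instance (f g h : (Fin n → M) → M) [DF f] [DF g] [DF h] :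
    DP fun v => IsBij (f v) (g v) (h v) := by
  unfold IsBij; infer_instance

/-- The value of the local function `f` at `x`. -/
noncomputable def valM (f x : M) : M := theM (unionM (unionM f)) fun y => opairM x y ∈ f

@[simp] theorem ev_val (s t : Tm n) (v : Fin n → M) : ev (val s t) v = valM (ev s v) (ev t v) := by
  simp [val, valM]

instance (f g : (Fin n → M) → M) [DF f] [DF g] : DF fun v => valM (f v) (g v) := by
  unfold valM; infer_instance

/-- Cardinal equivalence. -/
def CEq (a b : M) : Prop := ∃ f ∈ powM (prodM a b), IsBij f a b

/-- Cardinal inequality. -/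
def CLe (a b : M) : Prop := ∃ f ∈ powM (prodM a b), IsInj f a b

@[simp] theorem sat_cardEq {q : Bool} (a b : Tm n) (v : Fin n → M) :
    sat (q := q) (cardEq a b) v ↔ CEq (ev a v) (ev b v) := by
  simp [cardEq, CEq]

@[simp] theorem sat_cardLe {q : Bool} (a b : Tm n) (v : Fin n → M) :
    sat (q := q) (cardLe a b) v ↔ CLe (ev a v) (ev b v) := by
  simp [cardLe, CLe]

instance (f g : (Fin n → M) → M) [DF f] [DF g] : DP fun v => CEq (f v) (g v) := by
  unfold CEq; infer_instance

instance (f g : (Fin n → M) → M) [DF f] [DF g] : DP fun v => CLe (f v) (g v) := by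
  unfold CLe; infer_instance

@[simp] theorem sat_cardLt {q : Bool} (a b : Tm n) (v : Fin n → M) :
    sat (q := q) (cardLt a b) v ↔ CLe (ev a v) (ev b v) ∧ ¬ CEq (ev a v) (ev b v) := by
  simp [cardLt]

/-- The set denoted by the numeral `k`. -/
def numM : ℕ → M
  | 0 => ∅
  | k + 1 => insM (numM k) (numM k)

@[simp] theorem ev_numeral (k : ℕ) (v : Fin n → M) : ev (numeral k) v = numM k := by
  induction k with
  | zero => simp [numeral, numM]
  | succ k ih => simp [numeral, numM, ih]

/-- The set of local functions from `b` to `a`. -/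
noncomputable def expM (a b : M) : M := sepM (powM (prodM b a)) fun f => IsFun f b a

theorem mem_expM {a b f : M} : f ∈ expM a b ↔ IsFun f b a := by
  simp only [expM, mem_sepM, mem_powM, and_iff_right_iff_imp]
  exact fun h => h.1

@[simp] theorem ev_exp (s t : Tm n) (v : Fin n → M) : ev (exp s t) v = expM (ev s v) (ev t v) := by
  simp [exp, expM]

instance (f g : (Fin n → M) → M) [DF f] [DF g] : DF fun v => expM (f v) (g v) := by
  unfold expM; infer_instance

/-- `L` is a linear ordering. -/
def IsOrd (L : M) : Prop :=
  ∅ ∉ L ∧ (L ≠ ∅ → ∃ x ∈ L, ∃ y ∈ x, x = singM y) ∧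
  (∀ x ∈ L, x = unionM L ∨ ∃ y ∈ unionM L, y ∉ x ∧ insM x y ∈ L) ∧
  ∀ x ∈ L, ∀ y ∈ L, x ⊆ y ∨ y ⊆ x

@[simp] theorem sat_isOrd {q : Bool} (L : Tm n) (v : Fin n → M) :
    sat (q := q) (isOrd L) v ↔ IsOrd (ev L v) := by
  simp [isOrd, IsOrd, insM]

instance (f : (Fin n → M) → M) [DF f] : DP fun v => IsOrd (f v) := by
  unfold IsOrd; infer_instance

/-- `a` precedes `b` in `L`. -/
def OrdLt (L a b : M) : Prop := ∃ x ∈ L, a ∈ x ∧ b ∉ x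

@[simp] theorem sat_ordLt {q : Bool} (L a b : Tm n) (v : Fin n → M) :
    sat (q := q) (ordLt L a b) v ↔ OrdLt (ev L v) (ev a v) (ev b v) := by
  simp [ordLt, OrdLt]

instance (f g h : (Fin n → M) → M) [DF f] [DF g] [DF h] :
    DP fun v => OrdLt (f v) (g v) (h v) := by
  unfold OrdLt; infer_instance

@[simp] theorem ev_field (s : Tm n) (v : Fin n → M) : ev (field s) v = unionM (ev s v) := by
  simp [field]

/-- The first term of `L`. -/
noncomputable def firstM (L : M) : M := theM (unionM L) fun a => ∀ b ∈ unionM L, ¬ OrdLt L b a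

/-- The last term of `L`. -/
noncomputable def lastM (L : M) : M := theM (unionM L) fun a => ∀ b ∈ unionM L, ¬ OrdLt L a b

/-- The term of `L` next after `x`. -/
noncomputable def nextM (L x : M) : M :=
  theM (unionM L) fun y => (x = lastM L ∧ y = x) ∨
    (OrdLt L x y ∧ ∀ z ∈ unionM L, OrdLt L x z → ¬ OrdLt L z y)

@[simp] theorem ev_first (s : Tm n) (v : Fin n → M) : ev (first s) v = firstM (ev s v) := by
  simp [first, firstM]

@[simp] theorem ev_last (s : Tm n) (v : Fin n → M) : ev (last s) v = lastM (ev s v) := by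
  simp [last, lastM]

instance (f : (Fin n → M) → M) [DF f] : DF fun v => firstM (f v) := by
  unfold firstM; infer_instance

instance (f : (Fin n → M) → M) [DF f] : DF fun v => lastM (f v) := by
  unfold lastM; infer_instance

@[simp] theorem ev_next (s t : Tm n) (v : Fin n → M) :
    ev (next s t) v = nextM (ev s v) (ev t v) := by
  simp [next, nextM]

instance (f g : (Fin n → M) → M) [DF f] [DF g] : DF fun v => nextM (f v) (g v) := by
  unfold nextM; infer_instance

/-- The set of proper initial segments of `L`. -/
noncomputable def inSegM (L : M) : M := sepM (powM L) fun K => IsOrd K ∧ K ≠ L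

@[simp] theorem ev_inSeg (s : Tm n) (v : Fin n → M) : ev (inSeg s) v = inSegM (ev s v) := by
  simp [inSeg, inSegM]

instance (f : (Fin n → M) → M) [DF f] : DF fun v => inSegM (f v) := by
  unfold inSegM; infer_instance

/-- The linear ordering of the set `D` by `le`. -/
noncomputable def ordOfM (D : M) (le : M → M → Prop) : M := imgM D fun x => sepM D fun y => le y x

@[simp] theorem ev_ordOf (D : Tm n) (le : Tm (n + 2) → Tm (n + 2) → Fm0 (n + 2))
    (v : Fin n → M) : ev (ordOf D le) v =
      ordOfM (ev D v) fun b a =>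
        sat (le (.var 0) (.var 0 : Tm (n + 1)).wk) (cons b (cons a v)) := by
  simp [ordOf, ordOfM]

instance (s : (Fin n → M) → M) (R : (Fin n → M) → M → M → Prop) [DF s]
    [DP fun w : Fin (n + 2) → M => R (fun i => w i.succ.succ) (w 0) (w (Fin.succ 0))] :
    DF fun v => ordOfM (s v) (R v) := by
  unfold ordOfM; infer_instance

/-- The linear ordering `L` extended by `a` as new last term. -/
def snocM (L a : M) : M := insM L (insM (unionM L) a)

@[simp] theorem ev_snoc (s t : Tm n) (v : Fin n → M) :
    ev (snoc s t) v = snocM (ev s v) (ev t v) := by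
  simp [snoc, snocM, insM]

/-- `a` is an epsilon chain for `b`. -/
def IsChain (a b : M) : Prop :=
  IsOrd a ∧ a ≠ ∅ ∧ firstM a ∈ b ∧ ∀ x ∈ unionM a, x ≠ lastM a → nextM a x ∈ x

@[simp] theorem sat_isChain {q : Bool} (a b : Tm n) (v : Fin n → M) :
    sat (q := q) (isChain a b) v ↔ IsChain (ev a v) (ev b v) := by
  simp [isChain, IsChain]

@[simp] theorem mem_fanM {a x : M} : x ∈ fanM a ↔ IsChain x a := by
  rw [fanM, mem_ev_fan]; simp

/-- The transitive closure. -/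
noncomputable def tcM (s : M) : M := unionM (imgM (fanM s) fun x => unionM x)

@[simp] theorem mem_tcM {s x : M} : x ∈ tcM s ↔ ∃ c, IsChain c s ∧ x ∈ unionM c := by
  simp only [tcM, mem_unionM (a := imgM _ _), mem_imgM, mem_fanM]
  constructor
  · rintro ⟨y, ⟨c, hc, rfl⟩, hx⟩
    exact ⟨c, hc, hx⟩
  · rintro ⟨c, hc, hx⟩
    exact ⟨_, ⟨c, hc, rfl⟩, hx⟩

@[simp] theorem ev_tc (s : Tm n) (v : Fin n → M) : ev (tc s) v = tcM (ev s v) := by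
  simp [tc, tcM]

theorem finiteness {a b : M} (h : a ⊆ b) (hne : a ≠ b) : CLe a b ∧ ¬ CEq a b := by
  have := sat_postulate (.finiteness (.var 0) (.var 1)) ![a, b]
  simp only [sat_imp, sat_and, sat_sub, sat_neg, sat_eq, ev_var, sat_cardLt] at this
  exact this ⟨h, hne⟩

theorem foundation {a b : M} (h : a ∈ tcM b) : b ∉ tcM a := by
  have := sat_postulate (.foundation (.var 0) (.var 1)) ![a, b]
  simp only [sat_imp, sat_mem, sat_neg, ev_var, ev_tc] at this
  exact this h

/-- The equivalence classes of the proper subsets of `s` under cardinal equivalence. -/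
noncomputable def cardClassesM (s : M) : M :=
  imgM (sepM (powM s) fun x => x ≠ s) fun x => sepM (sepM (powM s) fun x => x ≠ s) fun y => CEq y x

@[simp] theorem ev_cardClasses (s : Tm n) (v : Fin n → M) :
    ev (cardClasses s) v = cardClassesM (ev s v) := by
  simp [cardClasses, cardClassesM]

instance (f : (Fin n → M) → M) [DF f] : DF fun v => cardClassesM (f v) := by
  unfold cardClassesM; infer_instance

/-- The local cardinal of `s`. -/
noncomputable def cardM (s : M) : M :=
  inSegM (ordOfM (cardClassesM s) fun p q => ∃ u ∈ p, ∃ w ∈ q, CLe u w)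

@[simp] theorem ev_card (s : Tm n) (v : Fin n → M) : ev (card s) v = cardM (ev s v) := by
  simp [card, cardM]

instance (f : (Fin n → M) → M) [DF f] : DF fun v => cardM (f v) := by
  unfold cardM; infer_instance

/-- The member of least cardinality. -/
noncomputable def minCardM (s : M) : M := theM s fun x => ∀ y ∈ s, CLe x y

@[simp] theorem ev_minCard (s : Tm n) (v : Fin n → M) :
    ev (minCard s) v = minCardM (ev s v) := by
  simp [minCard, minCardM]

instance (f : (Fin n → M) → M) [DF f] : DF fun v => minCardM (f v) := by
  unfold minCardM; infer_instance

/-- The logarithm of `a` to the base `S`. -/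
noncomputable def logM (S a : M) : M := minCardM (sepM (cardM a) fun x => CLe a (expM S x))

@[simp] theorem ev_log (s t : Tm n) (v : Fin n → M) : ev (log s t) v = logM (ev s v) (ev t v) := by
  simp [log, logM]

instance (f g : (Fin n → M) → M) [DF f] [DF g] : DF fun v => logM (f v) (g v) := by
  unfold logM; infer_instance

/-- `L` is generated from the initial term `z` by the successor function `σ`. -/
def IsNum (z : M) (σ : M → M) (L : M) : Prop :=
  IsOrd L ∧ (L = ∅ ∨ (L ≠ ∅ ∧ firstM L = z ∧ ∀ x ∈ unionM L, x ≠ lastM L → nextM L x = σ x))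

instance (z : M) (σ : M → M) [DF1 σ] (f : (Fin n → M) → M) [DF f] :
    DP fun v => IsNum z σ (f v) := by
  have := fun n => DF.app (n := n) σ
  unfold IsNum; infer_instance

/-- The initial term of an iteration system. -/
def IterSystem.z (N : IterSystem) (M : Type) [EAModel M] : M := ev N.zero (Fin.elim0 : Fin 0 → M)

/-- The successor function of an iteration system. -/
def IterSystem.σ (N : IterSystem) (x : M) : M := ev N.succ fun _ => x

instance (N : IterSystem) (f : (Fin n → M) → M) [DF f] : DF fun v => N.σ (f v) := DF.comp1 _ _

@[simp] theorem sat_isNumber {q : Bool} (N : IterSystem) (L : Tm n) (v : Fin n → M) :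
    sat (q := q) (N.isNumber L) v ↔ IsNum (N.z M) N.σ (ev L v) := by
  simp [IterSystem.isNumber, IsNum, IterSystem.z, IterSystem.σ]

/-- The numeral with base `S`, length `K` and digits `f`. -/
def mkNumM (S K f : M) : M := opairM S (opairM K f)

@[simp] theorem ev_mkNumeral (S K f : Tm n) (v : Fin n → M) :
    ev (mkNumeral S K f) v = mkNumM (ev S v) (ev K v) (ev f v) := by
  simp [mkNumeral, mkNumM]

instance (f g h : (Fin n → M) → M) [DF f] [DF g] [DF h] :
    DF fun v => mkNumM (f v) (g v) (h v) := by
  unfold mkNumM; infer_instance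

/-- The length of a numeral. -/
noncomputable def lenM (x : M) : M := fstM (sndM x)

/-- The digit function of a numeral. -/
noncomputable def digM (x : M) : M := sndM (sndM x)

@[simp] theorem lenM_mkNumM (S K f : M) : lenM (mkNumM S K f) = K := by simp [lenM, mkNumM]

@[simp] theorem digM_mkNumM (S K f : M) : digM (mkNumM S K f) = f := by simp [digM, mkNumM]

@[simp] theorem ev_lengthOf (s : Tm n) (v : Fin n → M) : ev (lengthOf s) v = lenM (ev s v) := by
  simp [lengthOf, lenM]

@[simp] theorem ev_digitsOf (s : Tm n) (v : Fin n → M) : ev (digitsOf s) v = digM (ev s v) := by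
  simp [digitsOf, digM]

instance (f : (Fin n → M) → M) [DF f] : DF fun v => lenM (f v) := by
  unfold lenM; infer_instance

instance (f : (Fin n → M) → M) [DF f] : DF fun v => digM (f v) := by
  unfold digM; infer_instance

/-- The terms of `L` before `x`. -/
noncomputable def belowM (L x : M) : M := sepM (unionM L) fun j => OrdLt L j x

instance (f g : (Fin n → M) → M) [DF f] [DF g] : DF fun v => belowM (f v) (g v) := by
  unfold belowM; infer_instance

/-- The disjoint union over `i ∈ I` of the sets `f i × S ^ {j : j <_K i}`. -/
noncomputable def codeM (S K f I : M) : M :=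
  unionM (imgM I fun i => prodM (singM i) (prodM (valM f i) (expM S (belowM K i))))

instance (f g h k : (Fin n → M) → M) [DF f] [DF g] [DF h] [DF k] :
    DF fun v => codeM (f v) (g v) (h v) (k v) := by
  unfold codeM; infer_instance

/-- A set of the cardinality coded by the numeral `x` to the base `S`. -/
noncomputable def codedM (S x : M) : M := codeM S (lenM x) (digM x) (unionM (lenM x))

@[simp] theorem ev_coded (S x : Tm n) (v : Fin n → M) :
    ev (coded S x) v = codedM (ev S v) (ev x v) := by
  simp [coded, codedM, codeM, belowM]

instance (f g : (Fin n → M) → M) [DF f] [DF g] : DF fun v => codedM (f v) (g v) := by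
  unfold codedM; infer_instance

/-- The proper `S`-ary numerals with length a non-empty initial segment of `L`. -/
noncomputable def properM (S L : M) : M :=
  unionM (imgM (sepM (powM L) fun K => IsOrd K ∧ K ≠ ∅) fun K =>
    imgM (sepM (expM S (unionM K)) fun f => valM f (lastM K) ≠ ∅ ∨ firstM K = lastM K)
      fun f => mkNumM S K f)

@[simp] theorem ev_properNumerals (S L : Tm n) (v : Fin n → M) :
    ev (properNumerals S L) v = properM (ev S v) (ev L v) := by
  simp [properNumerals, properM]

instance (f g : (Fin n → M) → M) [DF f] [DF g] : DF fun v => properM (f v) (g v) := by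
  unfold properM; infer_instance

/-- The linear ordering of the proper `S`-ary numerals with length an initial segment of `L`. -/
noncomputable def numOrdM (S L : M) : M :=
  ordOfM (properM S L) fun x y => CLe (codedM S x) (codedM S y)

@[simp] theorem ev_numOrd (S L : Tm n) (v : Fin n → M) :
    ev (numOrd S L) v = numOrdM (ev S v) (ev L v) := by
  simp [numOrd, numOrdM]

theorem z_numeralExt (S : Tm 0) (N : IterSystem) : (numeralExt S N).z M =
    mkNumM (ev S (Fin.elim0 : Fin 0 → M)) (singM (singM (N.z M))) (singM (opairM (N.z M) ∅)) := by
  simp [numeralExt, IterSystem.z]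

theorem σ_numeralExt (S : Tm 0) (N : IterSystem) (x : M) : (numeralExt S N).σ x =
    nextM (numOrdM (ev S (Fin.elim0 : Fin 0 → M))
      (snocM (lenM x) (N.σ (lastM (lenM x))))) x := by
  simp [numeralExt, IterSystem.σ]

end Vocabulary

/-! ### Local functions and cardinal comparison -/

section Functions

variable {M : Type} [EAModel M] {n : ℕ}

instance DP.constProp (p : Prop) : DP fun _ : Fin n → M => p := by
  by_cases hp : p
  · have : DP fun _ : Fin n → M => (∅ : M) = ∅ := inferInstance
    simpa [hp] using this
  · have : DP fun _ : Fin n → M => (∅ : M) ∈ (∅ : M) := inferInstance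
    simpa [hp] using this

/-- Definition by cases: `a` if `P`, and `b` otherwise. -/
noncomputable def iteM (P : Prop) (a b : M) : M :=
  cupM (sepM a fun _ => P) (sepM b fun _ => ¬ P)

theorem iteM_pos {P : Prop} (h : P) (a b : M) : iteM P a b = a := ext fun x => by simp [iteM, h]

theorem iteM_neg {P : Prop} (h : ¬ P) (a b : M) : iteM P a b = b := ext fun x => by simp [iteM, h]

instance (P : (Fin n → M) → Prop) (f g : (Fin n → M) → M) [DP P] [DF f] [DF g] :
    DF fun v => iteM (P v) (f v) (g v) := by
  unfold iteM; infer_instance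

theorem IsFun.val_eq {f a b x y : M} (h : IsFun f a b) (hxy : opairM x y ∈ f) : valM f x = y := by
  have hm := opairM_mem_prodM.1 (h.1 _ hxy)
  refine theM_eq ?_ hxy fun z hz hxz => ?_
  · exact mem_unionM.2 ⟨_, mem_unionM.2 ⟨_, hxy, mem_pairM.2 (.inr rfl)⟩, mem_pairM.2 (.inr rfl)⟩
  · obtain ⟨w, _, _, hw⟩ := h.2 x hm.1
    rw [hw y hm.2 hxy, hw z (opairM_mem_prodM.1 (h.1 _ hxz)).2 hxz]

theorem IsFun.val_spec {f a b x : M} (h : IsFun f a b) (hx : x ∈ a) :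
    valM f x ∈ b ∧ opairM x (valM f x) ∈ f := by
  obtain ⟨y, hy, hxy, _⟩ := h.2 x hx
  rw [h.val_eq hxy]
  exact ⟨hy, hxy⟩

theorem IsFun.mem_iff {f a b p : M} (h : IsFun f a b) :
    p ∈ f ↔ ∃ x ∈ a, p = opairM x (valM f x) := by
  constructor
  · intro hp
    obtain ⟨x, hx, y, hy, rfl⟩ := mem_prodM.1 (h.1 _ hp)
    exact ⟨x, hx, by rw [h.val_eq hp]⟩
  · rintro ⟨x, hx, rfl⟩
    exact (h.val_spec hx).2

theorem IsFun.ext {f g a b b' : M} (h : IsFun f a b) (h' : IsFun g a b')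
    (hv : ∀ x ∈ a, valM f x = valM g x) : f = g :=
  EA.ext fun p => by
    rw [h.mem_iff, h'.mem_iff]
    exact exists_congr fun x => and_congr_right fun hx => by rw [hv x hx]

theorem CLe.of_rel {a b : M} (R : M → M → Prop) [DP2 R] (htot : ∀ x ∈ a, ∃ y ∈ b, R x y)
    (hfun : ∀ x ∈ a, ∀ y ∈ b, ∀ y' ∈ b, R x y → R x y' → y = y')
    (hinj : ∀ x ∈ a, ∀ x' ∈ a, ∀ y ∈ b, R x y → R x' y → x = x') : CLe a b := by
  have := fun n => DP.app2 (n := n) R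
  have hmem : ∀ x y, opairM x y ∈ sepM (prodM a b) (fun p => R (fstM p) (sndM p)) ↔
      (x ∈ a ∧ y ∈ b) ∧ R x y := fun x y => by
    rw [mem_sepM, opairM_mem_prodM, fstM_opairM, sndM_opairM]
  refine ⟨sepM (prodM a b) fun p => R (fstM p) (sndM p), ?_, ⟨?_, ?_⟩, ?_⟩
  · exact mem_powM.2 fun p hp => (mem_sepM.1 hp).1
  · exact fun p hp => (mem_sepM.1 hp).1
  · intro x hx
    obtain ⟨y, hy, hxy⟩ := htot x hx
    exact ⟨y, hy, (hmem x y).2 ⟨⟨hx, hy⟩, hxy⟩, fun z hz hxz =>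
      hfun x hx z hz y hy ((hmem x z).1 hxz).2 hxy⟩
  · rintro x hx x' hx' y hy ⟨h1, h2⟩
    exact hinj x hx x' hx' y hy ((hmem x y).1 h1).2 ((hmem x' y).1 h2).2

theorem CEq.of_rel {a b : M} (R : M → M → Prop) [DP2 R] (htot : ∀ x ∈ a, ∃ y ∈ b, R x y)
    (hfun : ∀ x ∈ a, ∀ y ∈ b, ∀ y' ∈ b, R x y → R x y' → y = y')
    (hinj : ∀ x ∈ a, ∀ x' ∈ a, ∀ y ∈ b, R x y → R x' y → x = x')
    (hsurj : ∀ y ∈ b, ∃ x ∈ a, R x y) : CEq a b := by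
  have := fun n => DP.app2 (n := n) R
  have hmem : ∀ x y, opairM x y ∈ sepM (prodM a b) (fun p => R (fstM p) (sndM p)) ↔
      (x ∈ a ∧ y ∈ b) ∧ R x y := fun x y => by
    rw [mem_sepM, opairM_mem_prodM, fstM_opairM, sndM_opairM]
  refine ⟨sepM (prodM a b) fun p => R (fstM p) (sndM p), ?_, ⟨⟨?_, ?_⟩, ?_⟩, ?_⟩
  · exact mem_powM.2 fun p hp => (mem_sepM.1 hp).1
  · exact fun p hp => (mem_sepM.1 hp).1
  · intro x hx
    obtain ⟨y, hy, hxy⟩ := htot x hx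
    exact ⟨y, hy, (hmem x y).2 ⟨⟨hx, hy⟩, hxy⟩, fun z hz hxz =>
      hfun x hx z hz y hy ((hmem x z).1 hxz).2 hxy⟩
  · rintro x hx x' hx' y hy ⟨h1, h2⟩
    exact hinj x hx x' hx' y hy ((hmem x y).1 h1).2 ((hmem x' y).1 h2).2
  · intro y hy
    obtain ⟨x, hx, hxy⟩ := hsurj y hy
    exact ⟨x, hx, (hmem x y).2 ⟨⟨hx, hy⟩, hxy⟩⟩

theorem CLe.of_fun {a b : M} (F : M → M) [DF1 F] (hmap : ∀ x ∈ a, F x ∈ b)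
    (hinj : ∀ x ∈ a, ∀ x' ∈ a, F x = F x' → x = x') : CLe a b := by
  have := fun n => DF.app (n := n) F
  exact .of_rel (fun x y => F x = y) (fun x hx => ⟨F x, hmap x hx, rfl⟩)
    (fun x _ y _ y' _ h h' => h ▸ h')
    (fun x hx x' hx' y _ h h' => hinj x hx x' hx' (h.trans h'.symm))

theorem CEq.of_fun {a b : M} (F : M → M) [DF1 F] (hmap : ∀ x ∈ a, F x ∈ b)
    (hinj : ∀ x ∈ a, ∀ x' ∈ a, F x = F x' → x = x') (hsurj : ∀ y ∈ b, ∃ x ∈ a, F x = y) :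
    CEq a b := by
  have := fun n => DF.app (n := n) F
  exact .of_rel (fun x y => F x = y) (fun x hx => ⟨F x, hmap x hx, rfl⟩)
    (fun x _ y _ y' _ h h' => h ▸ h')
    (fun x hx x' hx' y _ h h' => hinj x hx x' hx' (h.trans h'.symm))
    hsurj

theorem CLe.exists_fun {a b : M} (h : CLe a b) : ∃ F : M → M, DF1 F ∧ (∀ x ∈ a, F x ∈ b) ∧
    ∀ x ∈ a, ∀ x' ∈ a, F x = F x' → x = x' := by
  obtain ⟨f, _, hf⟩ := h
  refine ⟨fun x => valM f x, inferInstance, fun x hx => (hf.1.val_spec hx).1,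
    fun x hx x' hx' hxx => ?_⟩
  exact hf.2 x hx x' hx' (valM f x) (hf.1.val_spec hx).1
    ⟨(hf.1.val_spec hx).2, (show valM f x = valM f x' from hxx) ▸ (hf.1.val_spec hx').2⟩

theorem CEq.exists_fun {a b : M} (h : CEq a b) : ∃ F : M → M, DF1 F ∧ (∀ x ∈ a, F x ∈ b) ∧
    (∀ x ∈ a, ∀ x' ∈ a, F x = F x' → x = x') ∧ ∀ y ∈ b, ∃ x ∈ a, F x = y := by
  obtain ⟨f, hf, hb⟩ := h
  refine ⟨fun x => valM f x, inferInstance, fun x hx => (hb.1.1.val_spec hx).1,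
    fun x hx x' hx' hxx => ?_, fun y hy => ?_⟩
  · exact hb.1.2 x hx x' hx' (valM f x) (hb.1.1.val_spec hx).1
      ⟨(hb.1.1.val_spec hx).2, (show valM f x = valM f x' from hxx) ▸ (hb.1.1.val_spec hx').2⟩
  · obtain ⟨x, hx, hxy⟩ := hb.2 y hy
    exact ⟨x, hx, hb.1.1.val_eq hxy⟩

theorem CEq.cLe {a b : M} (h : CEq a b) : CLe a b := by
  obtain ⟨F, hF, h1, h2, _⟩ := h.exists_fun
  exact .of_fun F h1 h2

theorem CEq.refl (a : M) : CEq a a :=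
  .of_fun (fun x => x) (fun _ h => h) (fun _ _ _ _ h => h) fun y hy => ⟨y, hy, rfl⟩

theorem CLe.of_subset {a b : M} (h : a ⊆ b) : CLe a b :=
  .of_fun (fun x => x) h fun _ _ _ _ h => h

theorem CEq.symm {a b : M} (h : CEq a b) : CEq b a := by
  obtain ⟨F, hF, h1, h2, h3⟩ := h.exists_fun
  have := fun n => DF.app (n := n) F
  exact .of_rel (fun y x => F x = y) h3
    (fun y _ x hx x' hx' e e' => h2 x hx x' hx' (e.trans e'.symm))
    (fun y _ y' _ x _ e e' => e ▸ e') fun x hx => ⟨F x, h1 x hx, rfl⟩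

theorem CEq.trans {a b c : M} (h : CEq a b) (h' : CEq b c) : CEq a c := by
  obtain ⟨F, hF, h1, h2, h3⟩ := h.exists_fun
  obtain ⟨G, hG, k1, k2, k3⟩ := h'.exists_fun
  have := fun n => DF.app (n := n) F
  have := fun n => DF.app (n := n) G
  refine .of_fun (fun x => G (F x)) (fun x hx => k1 _ (h1 x hx))
    (fun x hx x' hx' e => h2 x hx x' hx' (k2 _ (h1 x hx) _ (h1 x' hx') e)) fun z hz => ?_
  obtain ⟨y, hy, rfl⟩ := k3 z hz
  obtain ⟨x, hx, rfl⟩ := h3 y hy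
  exact ⟨x, hx, rfl⟩

theorem CLe.trans {a b c : M} (h : CLe a b) (h' : CLe b c) : CLe a c := by
  obtain ⟨F, hF, h1, h2⟩ := h.exists_fun
  obtain ⟨G, hG, k1, k2⟩ := h'.exists_fun
  have := fun n => DF.app (n := n) F
  have := fun n => DF.app (n := n) G
  exact .of_fun (fun x => G (F x)) (fun x hx => k1 _ (h1 x hx))
    (fun x hx x' hx' e => h2 x hx x' hx' (k2 _ (h1 x hx) _ (h1 x' hx') e))

/-- Dedekind finiteness: an injective definable relation from a set to itself is onto. -/
theorem surj_of_rel {a : M} (R : M → M → Prop) [DP2 R] (htot : ∀ x ∈ a, ∃ y ∈ a, R x y)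
    (hfun : ∀ x ∈ a, ∀ y ∈ a, ∀ y' ∈ a, R x y → R x y' → y = y')
    (hinj : ∀ x ∈ a, ∀ x' ∈ a, ∀ y ∈ a, R x y → R x' y → x = x') :
    ∀ y ∈ a, ∃ x ∈ a, R x y := by
  have := fun n => DP.app2 (n := n) R
  intro y hy
  by_contra hn
  refine (finiteness (a := sepM a fun y => ∃ x, x ∈ a ∧ R x y) (b := a)
    (fun x hx => (mem_sepM.1 hx).1) ?_).2 ?_
  · intro h
    exact hn (mem_sepM.1 (h.symm ▸ hy : y ∈ sepM a _)).2
  · refine CEq.symm (.of_rel R ?_ ?_ ?_ ?_)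
    · intro x hx
      obtain ⟨z, hz, hxz⟩ := htot x hx
      exact ⟨z, mem_sepM.2 ⟨hz, x, hx, hxz⟩, hxz⟩
    · exact fun x hx y hy y' hy' => hfun x hx y (mem_sepM.1 hy).1 y' (mem_sepM.1 hy').1
    · exact fun x hx x' hx' y hy => hinj x hx x' hx' y (mem_sepM.1 hy).1
    · exact fun y hy => (mem_sepM.1 hy).2

theorem CEq.of_subset {a b : M} (h : a ⊆ b) (h' : CEq a b) : a = b := by
  by_contra hn
  exact (finiteness h hn).2 h'

theorem CLe.antisymm {a b : M} (h : CLe a b) (h' : CLe b a) : CEq a b := by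
  obtain ⟨F, hF, h1, h2⟩ := h.exists_fun
  obtain ⟨G, hG, k1, k2⟩ := h'.exists_fun
  have := fun n => DF.app (n := n) F
  have := fun n => DF.app (n := n) G
  refine .of_fun F h1 h2 fun y hy => ?_
  -- The composite injection of `b` into itself is onto.
  obtain ⟨z, hz, e⟩ := surj_of_rel (a := b) (fun u w => F (G u) = w)
    (fun x hx => ⟨_, h1 _ (k1 x hx), rfl⟩) (fun x _ y _ y' _ e e' => e ▸ e')
    (fun x hx x' hx' y _ e e' => k2 x hx x' hx' (h2 _ (k1 x hx) _ (k1 x' hx') (e.trans e'.symm)))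
    y hy
  exact ⟨_, k1 z hz, e⟩

theorem CLe.insM {x x' y y' : M} (hy : y ∉ x) (hy' : y' ∉ x') (h : CLe x x') :
    CLe (insM x y) (insM x' y') := by
  obtain ⟨F, hF, h1, h2⟩ := h.exists_fun
  have := fun n => DF.app (n := n) F
  have e1 : ∀ u ∈ x, iteM (u = y) y' (F u) = F u := fun u hu =>
    iteM_neg (fun e : u = y => hy (e ▸ hu)) _ _
  refine .of_fun (fun u => iteM (u = y) y' (F u)) ?_ ?_
  · rintro u hu
    rcases mem_insM.1 hu with hu | rfl
    · rw [e1 u hu]; exact mem_insM.2 (.inl (h1 u hu))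
    · rw [iteM_pos rfl]; exact mem_insM.2 (.inr rfl)
  · intro u hu w hw e
    rcases mem_insM.1 hu with hu' | eu <;> rcases mem_insM.1 hw with hw' | ew
    · rw [e1 u hu', e1 w hw'] at e; exact h2 u hu' w hw' e
    · rw [e1 u hu', iteM_pos ew] at e
      exact (hy' (e ▸ h1 u hu')).elim
    · rw [e1 w hw', iteM_pos eu] at e
      exact (hy' (e ▸ h1 w hw')).elim
    · exact eu.trans ew.symm

theorem CLe.of_insM {x x' y y' : M} (hy : y ∉ x) (h : CLe (EA.insM x y) (EA.insM x' y')) :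
    CLe x x' := by
  obtain ⟨F, hF, h1, h2⟩ := h.exists_fun
  have := fun n => DF.app (n := n) F
  have hy1 : y ∈ EA.insM x y := mem_insM.2 (.inr rfl)
  have hx1 : ∀ u ∈ x, u ∈ EA.insM x y := fun u hu => mem_insM.2 (.inl hu)
  have hne : ∀ u ∈ x, F u ≠ F y := fun u hu e => hy (h2 u (hx1 u hu) y hy1 e ▸ hu)
  -- The element that is sent to `y'` is sent to the image of `y` instead.
  refine .of_fun (fun u => iteM (F u = y') (F y) (F u)) ?_ ?_
  · intro u hu
    by_cases e : F u = y'
    · rw [iteM_pos e]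
      exact (mem_insM.1 (h1 y hy1)).resolve_right fun e' => hne u hu (e.trans e'.symm)
    · rw [iteM_neg e]
      exact (mem_insM.1 (h1 u (hx1 u hu))).resolve_right e
  · intro u hu w hw e
    by_cases eu : F u = y' <;> by_cases ew : F w = y'
    · exact h2 u (hx1 u hu) w (hx1 w hw) (eu.trans ew.symm)
    · rw [iteM_pos eu, iteM_neg ew] at e; exact (hne w hw e.symm).elim
    · rw [iteM_neg eu, iteM_pos ew] at e; exact (hne u hu e).elim
    · rw [iteM_neg eu, iteM_neg ew] at e; exact h2 u (hx1 u hu) w (hx1 w hw) e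

/-- Induction on sets, for definable properties. If the induction steps do not lead to `a`, then
adding an element is an injective operation, which is not onto, on the equivalence classes under
cardinal equivalence of those subsets of `a` that have the property. -/
theorem set_ind (P : M → Prop) [DP1 P] (h0 : P ∅) (hs : ∀ x y, y ∉ x → P x → P (insM x y))
    (a : M) : P a := by
  have := fun n => DP.app (n := n) P
  by_contra ha
  let cl : M → M := fun x => sepM (powM a) fun u => CEq u x
  let C := imgM (sepM (powM a) P) cl
  have hC : ∀ p, p ∈ C ↔ ∃ x, x ⊆ a ∧ P x ∧ p = cl x := fun p => by
    simp only [C, cl, mem_imgM, mem_sepM, mem_powM, and_assoc]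
  have hcl : ∀ x u, u ∈ cl x ↔ u ⊆ a ∧ CEq u x := fun x u => by
    simp only [cl, mem_sepM, mem_powM]
  have hcle : ∀ x x', CEq x x' → cl x = cl x' := fun x x' h => ext fun u => by
    rw [hcl, hcl]; exact and_congr_right fun _ => ⟨fun h' => h'.trans h, fun h' => h'.trans h.symm⟩
  have hcli : ∀ x x', x ⊆ a → cl x = cl x' → CEq x x' := fun x x' hx h =>
    ((hcl x' x).1 (h ▸ (hcl x x).2 ⟨hx, .refl x⟩)).2
  have hnext : ∀ x, x ⊆ a → P x → ∃ y ∈ a, y ∉ x := by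
    intro x hx hP
    by_contra! hn
    exact ha (sub_antisymm hx hn ▸ hP)
  have hins : ∀ x y, x ⊆ a → y ∈ a → insM x y ⊆ a := fun x y hx hy z hz =>
    (mem_insM.1 hz).elim (hx z) (fun e => e ▸ hy)
  let R : M → M → Prop := fun p q => ∃ x, x ∈ p ∧ ∃ y, y ∈ a ∧ y ∉ x ∧ insM x y ∈ q
  have key : ∀ q ∈ C, ∃ p ∈ C, R p q := by
    refine surj_of_rel (a := C) R ?_ ?_ ?_
    · intro p hp
      obtain ⟨x, hx, hP, rfl⟩ := (hC p).1 hp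
      obtain ⟨y, hy, hyx⟩ := hnext x hx hP
      exact ⟨cl (insM x y), (hC _).2 ⟨_, hins x y hx hy, hs x y hyx hP, rfl⟩, x,
        (hcl _ _).2 ⟨hx, .refl x⟩, y, hy, hyx, (hcl _ _).2 ⟨hins x y hx hy, .refl _⟩⟩
    · rintro p hp q hq q' hq' ⟨x, hx, y, hy, hyx, hxy⟩ ⟨x', hx', y', hy', hyx', hxy'⟩
      obtain ⟨w, hw, hP, rfl⟩ := (hC p).1 hp
      obtain ⟨u, hu, _, rfl⟩ := (hC q).1 hq
      obtain ⟨u', hu', _, rfl⟩ := (hC q').1 hq'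
      have h1 : CEq x x' := ((hcl _ _).1 hx).2.trans ((hcl _ _).1 hx').2.symm
      have h2 : CEq (insM x y) (insM x' y') :=
        (CLe.insM hyx hyx' h1.cLe).antisymm (CLe.insM hyx' hyx h1.symm.cLe)
      exact hcle _ _ ((((hcl _ _).1 hxy).2.symm.trans h2).trans ((hcl _ _).1 hxy').2)
    · rintro p hp p' hp' q hq ⟨x, hx, y, hy, hyx, hxy⟩ ⟨x', hx', y', hy', hyx', hxy'⟩
      obtain ⟨w, hw, hP, rfl⟩ := (hC p).1 hp
      obtain ⟨w', hw', hP', rfl⟩ := (hC p').1 hp'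
      obtain ⟨u, hu, _, rfl⟩ := (hC q).1 hq
      have h1 : CEq (insM x y) (insM x' y') := ((hcl _ _).1 hxy).2.trans ((hcl _ _).1 hxy').2.symm
      have h2 : CEq x x' := (CLe.of_insM hyx h1.cLe).antisymm (CLe.of_insM hyx' h1.symm.cLe)
      exact hcle _ _ ((((hcl _ _).1 hx).2.symm.trans h2).trans ((hcl _ _).1 hx').2)
  obtain ⟨p, hp, x, hx, y, hy, hyx, hxy⟩ := key (cl ∅)
    ((hC _).2 ⟨∅, fun x hx => (not_mem_empty x hx).elim, h0, rfl⟩)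
  obtain ⟨F, _, h1, _⟩ := ((hcl _ _).1 hxy).2.cLe.exists_fun
  exact not_mem_empty _ (h1 y (mem_insM.2 (.inr rfl)))

end Functions

/-! ### Cardinal numbers of a model -/

section Cardinals

variable {M : Type} [EAModel M] {n : ℕ}

instance cardSetoid (M : Type) [EAModel M] : Setoid M := ⟨CEq, .refl, .symm, .trans⟩

/-- The cardinal numbers of a model. -/
def Cd (M : Type) [EAModel M] : Type := Quotient (cardSetoid M)

/-- The cardinal number of a set. -/
def cd (a : M) : Cd M := Quotient.mk _ a

theorem cd_eq {a b : M} : cd a = cd b ↔ CEq a b := Quotient.eq (r := cardSetoid M)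

theorem cd_surj (c : Cd M) : ∃ a, cd a = c := Quotient.exists_rep c

instance : LE (Cd M) := ⟨Quotient.lift₂ CLe fun _ _ _ _ h h' => propext
  ⟨fun k => (CEq.symm h).cLe.trans (k.trans (CEq.cLe h')),
    fun k => (CEq.cLe h).trans (k.trans (CEq.symm h').cLe)⟩⟩

theorem cd_le {a b : M} : cd a ≤ cd b ↔ CLe a b := Iff.rfl

/-- The function `c` from valuations to cardinal numbers is given by a definable function. -/
class DC {n : ℕ} (c : (Fin n → M) → Cd M) : Prop where
  out : ∃ f : (Fin n → M) → M, DF f ∧ ∀ v, c v = cd (f v)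

instance (f : (Fin n → M) → M) [DF f] : DC fun v => cd (f v) := ⟨f, inferInstance, fun _ => rfl⟩

instance (c : Cd M) : DC fun _ : Fin n → M => c :=
  (cd_surj c).elim fun a h => ⟨fun _ => a, inferInstance, fun _ => h.symm⟩

instance (priority := low) DC.rename {m : ℕ} (c : (Fin m → M) → Cd M) [h : DC c]
    (ρ : Fin m → Fin n) : DC fun v : Fin n → M => c fun i => v (ρ i) := by
  obtain ⟨f, hf, h⟩ := h.out
  exact ⟨fun v => f fun i => v (ρ i), inferInstance, fun v => h _⟩

instance (c d : (Fin n → M) → Cd M) [hc : DC c] [hd : DC d] : DP fun v => c v = d v := by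
  obtain ⟨f, hf, hc⟩ := hc.out
  obtain ⟨g, hg, hd⟩ := hd.out
  simp only [hc, hd, cd_eq]; infer_instance

instance (c d : (Fin n → M) → Cd M) [hc : DC c] [hd : DC d] : DP fun v => c v ≤ d v := by
  obtain ⟨f, hf, hc⟩ := hc.out
  obtain ⟨g, hg, hd⟩ := hd.out
  simp only [hc, hd, cd_le]; infer_instance

/-- A disjoint sum of two sets. -/
noncomputable def sumM (a b : M) : M := cupM (prodM (singM ∅) a) (prodM (singM (singM ∅)) b)

instance (f g : (Fin n → M) → M) [DF f] [DF g] : DF fun v => sumM (f v) (g v) := by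
  unfold sumM; infer_instance

theorem mem_sumM {a b u : M} : u ∈ sumM a b ↔
    (∃ x ∈ a, u = opairM ∅ x) ∨ ∃ y ∈ b, u = opairM (singM ∅) y := by
  simp [sumM]

theorem singM_ne_empty (a : M) : singM a ≠ ∅ := fun h =>
  not_mem_empty a (h ▸ mem_singM.2 rfl)

theorem cEq_cupM {a b : M} (h : ∀ x ∈ a, x ∉ b) : CEq (cupM a b) (sumM a b) := by
  have e1 : ∀ u ∈ a, iteM (u ∈ a) (opairM ∅ u) (opairM (singM ∅) u) = opairM ∅ u :=
    fun u hu => iteM_pos hu _ _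
  have e2 : ∀ u ∈ b, iteM (u ∈ a) (opairM ∅ u) (opairM (singM ∅) u) = opairM (singM ∅) u :=
    fun u hu => iteM_neg (fun hu' => h u hu' hu) _ _
  refine .of_fun (fun u => iteM (u ∈ a) (opairM ∅ u) (opairM (singM ∅) u)) ?_ ?_ ?_
  · intro u hu
    rcases mem_cupM.1 hu with hu | hu
    · exact mem_sumM.2 (.inl ⟨u, hu, e1 u hu⟩)
    · exact mem_sumM.2 (.inr ⟨u, hu, e2 u hu⟩)
  · intro u hu w hw e
    rcases mem_cupM.1 hu with hu | hu <;> rcases mem_cupM.1 hw with hw | hw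
    · rw [e1 u hu, e1 w hw] at e; exact (opairM_inj.1 e).2
    · rw [e1 u hu, e2 w hw] at e; exact (singM_ne_empty _ (opairM_inj.1 e).1.symm).elim
    · rw [e2 u hu, e1 w hw] at e; exact (singM_ne_empty _ (opairM_inj.1 e).1).elim
    · rw [e2 u hu, e2 w hw] at e; exact (opairM_inj.1 e).2
  · intro y hy
    rcases mem_sumM.1 hy with ⟨x, hx, rfl⟩ | ⟨x, hx, rfl⟩
    · exact ⟨x, mem_cupM.2 (.inl hx), e1 x hx⟩
    · exact ⟨x, mem_cupM.2 (.inr hx), e2 x hx⟩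

theorem CLe.sumM {a b a' b' : M} (h : CLe a a') (h' : CLe b b') :
    CLe (sumM a b) (sumM a' b') := by
  obtain ⟨F, hF, h1, h2⟩ := h.exists_fun
  obtain ⟨G, hG, k1, k2⟩ := h'.exists_fun
  have := fun n => DF.app (n := n) F
  have := fun n => DF.app (n := n) G
  have e1 : ∀ u : M, iteM (fstM (opairM ∅ u) = ∅) (opairM ∅ (F (sndM (opairM ∅ u))))
      (opairM (singM ∅) (G (sndM (opairM ∅ u)))) = opairM ∅ (F u) := fun u => by
    rw [iteM_pos (by simp), sndM_opairM]
  have e2 : ∀ u : M, iteM (fstM (opairM (singM ∅) u) = ∅)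
      (opairM ∅ (F (sndM (opairM (singM ∅) u))))
      (opairM (singM ∅) (G (sndM (opairM (singM ∅) u)))) = opairM (singM ∅) (G u) := fun u => by
    rw [iteM_neg (by simp [singM_ne_empty]), sndM_opairM]
  refine .of_fun (fun p => iteM (fstM p = ∅) (opairM ∅ (F (sndM p)))
    (opairM (singM ∅) (G (sndM p)))) ?_ ?_
  · intro p hp
    rcases mem_sumM.1 hp with ⟨x, hx, rfl⟩ | ⟨x, hx, rfl⟩
    · rw [e1]; exact mem_sumM.2 (.inl ⟨_, h1 x hx, rfl⟩)
    · rw [e2]; exact mem_sumM.2 (.inr ⟨_, k1 x hx, rfl⟩)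
  · intro p hp q hq e
    rcases mem_sumM.1 hp with ⟨x, hx, rfl⟩ | ⟨x, hx, rfl⟩ <;>
      rcases mem_sumM.1 hq with ⟨y, hy, rfl⟩ | ⟨y, hy, rfl⟩
    · rw [e1, e1] at e; rw [h2 x hx y hy (opairM_inj.1 e).2]
    · rw [e1, e2] at e; exact (singM_ne_empty _ (opairM_inj.1 e).1.symm).elim
    · rw [e2, e1] at e; exact (singM_ne_empty _ (opairM_inj.1 e).1).elim
    · rw [e2, e2] at e; rw [k2 x hx y hy (opairM_inj.1 e).2]

theorem CLe.prodM {a b a' b' : M} (h : CLe a a') (h' : CLe b b') :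
    CLe (prodM a b) (prodM a' b') := by
  obtain ⟨F, hF, h1, h2⟩ := h.exists_fun
  obtain ⟨G, hG, k1, k2⟩ := h'.exists_fun
  have := fun n => DF.app (n := n) F
  have := fun n => DF.app (n := n) G
  refine .of_fun (fun p => opairM (F (fstM p)) (G (sndM p))) ?_ ?_
  · intro p hp
    obtain ⟨x, hx, y, hy, rfl⟩ := mem_prodM.1 hp
    simp only [fstM_opairM, sndM_opairM]
    exact opairM_mem_prodM.2 ⟨h1 x hx, k1 y hy⟩
  · intro p hp q hq e
    obtain ⟨x, hx, y, hy, rfl⟩ := mem_prodM.1 hp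
    obtain ⟨x', hx', y', hy', rfl⟩ := mem_prodM.1 hq
    simp only [fstM_opairM, sndM_opairM, opairM_inj] at e
    rw [h2 x hx x' hx' e.1, k2 y hy y' hy' e.2]

/-- The local function `x ↦ F x` on `a`. -/
noncomputable def lamM (a : M) (F : M → M) : M := imgM a fun x => opairM x (F x)

theorem mem_lamM {a p : M} {F : M → M} [DF1 F] : p ∈ lamM a F ↔ ∃ x ∈ a, p = opairM x (F x) := by
  have := fun n => DF.app (n := n) F
  simp [lamM]

theorem lamM_isFun {a b : M} {F : M → M} [DF1 F] (h : ∀ x ∈ a, F x ∈ b) :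
    IsFun (lamM a F) a b := by
  refine ⟨fun p hp => ?_, fun x hx => ⟨F x, h x hx, mem_lamM.2 ⟨x, hx, rfl⟩, fun z _ hz => ?_⟩⟩
  · obtain ⟨x, hx, rfl⟩ := mem_lamM.1 hp
    exact opairM_mem_prodM.2 ⟨hx, h x hx⟩
  · obtain ⟨x', _, e⟩ := mem_lamM.1 hz
    rw [opairM_inj] at e
    rw [e.2, e.1]

theorem valM_lamM {a x : M} {F : M → M} [DF1 F] (hx : x ∈ a) : valM (lamM a F) x = F x :=
  (lamM_isFun (b := imgM a F) fun x hx => mem_imgM.2 ⟨x, hx, rfl⟩).val_eq (mem_lamM.2 ⟨x, hx, rfl⟩)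

instance (s : (Fin n → M) → M) (F : (Fin n → M) → M → M) [DF s]
    [DF fun w : Fin (n + 1) → M => F (fun i => w i.succ) (w 0)] :
    DF fun v => lamM (s v) (F v) := by
  unfold lamM; infer_instance

theorem CEq.expM {a b a' b' : M} (h : CEq a a') (h' : CEq b b') :
    CEq (expM a b) (expM a' b') := by
  have key : ∀ {a b a' b' : M}, CEq a a' → CEq b b' → CLe (EA.expM a b) (EA.expM a' b') := by
    intro a b a' b' h h'
    obtain ⟨F, hF, h1, h2, _⟩ := h.exists_fun
    obtain ⟨G, hG, k1, k2, k3⟩ := h'.symm.exists_fun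
    have := fun n => DF.app (n := n) F
    have := fun n => DF.app (n := n) G
    refine .of_fun (fun f => lamM b' fun y => F (valM f (G y))) ?_ ?_
    · intro f hf
      have hf := mem_expM.1 hf
      exact mem_expM.2 (lamM_isFun fun y hy => h1 _ (hf.val_spec (k1 y hy)).1)
    · intro f hf g hg e
      have hf := mem_expM.1 hf
      have hg := mem_expM.1 hg
      refine hf.ext hg fun x hx => ?_
      obtain ⟨y, hy, rfl⟩ := k3 x hx
      have e' := congrArg (valM · y) e
      simp only [valM_lamM hy] at e'
      exact h2 _ (hf.val_spec (k1 y hy)).1 _ (hg.val_spec (k1 y hy)).1 e'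
  exact (key h h').antisymm (key h.symm h'.symm)

namespace Cd

instance : Zero (Cd M) := ⟨cd ∅⟩

instance : One (Cd M) := ⟨cd (singM ∅)⟩

noncomputable instance : Add (Cd M) := ⟨Quotient.map₂ sumM fun _ _ h _ _ h' =>
  (CLe.sumM (CEq.cLe h) (CEq.cLe h')).antisymm (CLe.sumM (CEq.symm h).cLe (CEq.symm h').cLe)⟩

noncomputable instance : Mul (Cd M) := ⟨Quotient.map₂ prodM fun _ _ h _ _ h' =>
  (CLe.prodM (CEq.cLe h) (CEq.cLe h')).antisymm (CLe.prodM (CEq.symm h).cLe (CEq.symm h').cLe)⟩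

noncomputable instance : Pow (Cd M) (Cd M) := ⟨Quotient.map₂ expM fun _ _ h _ _ h' => CEq.expM h h'⟩

theorem cd_empty : cd (∅ : M) = 0 := rfl
theorem cd_sumM (a b : M) : cd (sumM a b) = cd a + cd b := rfl
theorem cd_prodM (a b : M) : cd (prodM a b) = cd a * cd b := rfl
theorem cd_expM (a b : M) : cd (expM a b) = cd a ^ cd b := rfl

theorem cd_cupM {a b : M} (h : ∀ x ∈ a, x ∉ b) : cd (cupM a b) = cd a + cd b :=
  cd_eq.2 (cEq_cupM h)

theorem cd_singM (a : M) : cd (singM a) = 1 :=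
  cd_eq.2 (.of_fun (fun _ => ∅) (fun _ _ => mem_singM.2 rfl)
    (fun _ hx _ hy _ => (mem_singM.1 hx).trans (mem_singM.1 hy).symm)
    fun _ hy => ⟨a, mem_singM.2 rfl, (mem_singM.1 hy).symm⟩)

theorem cd_insM {a y : M} (h : y ∉ a) : cd (insM a y) = cd a + 1 := by
  rw [insM, cd_cupM (fun x (hx : x ∈ a) (hx' : x ∈ singM y) => h (mem_singM.1 hx' ▸ hx)),
    cd_singM]

instance (c d : (Fin n → M) → Cd M) [hc : DC c] [hd : DC d] : DC fun v => c v + d v := by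
  obtain ⟨f, hf, hc⟩ := hc.out
  obtain ⟨g, hg, hd⟩ := hd.out
  simp only [hc, hd, ← cd_sumM]; infer_instance

instance (c d : (Fin n → M) → Cd M) [hc : DC c] [hd : DC d] : DC fun v => c v * d v := by
  obtain ⟨f, hf, hc⟩ := hc.out
  obtain ⟨g, hg, hd⟩ := hd.out
  simp only [hc, hd, ← cd_prodM]; infer_instance

instance (c d : (Fin n → M) → Cd M) [hc : DC c] [hd : DC d] : DC fun v => c v ^ d v := by
  obtain ⟨f, hf, hc⟩ := hc.out
  obtain ⟨g, hg, hd⟩ := hd.out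
  simp only [hc, hd, ← cd_expM]; infer_instance

/-- Induction on cardinal numbers, for definable properties. -/
theorem ind (P : Cd M → Prop) [DP fun v : Fin 1 → M => P (cd (v 0))] (h0 : P 0)
    (hs : ∀ c, P c → P (c + 1)) (c : Cd M) : P c := by
  obtain ⟨a, rfl⟩ := cd_surj c
  exact set_ind (fun a => P (cd a)) h0 (fun x y hy hP => cd_insM hy ▸ hs _ hP) a

theorem cd_eq_zero {a : M} : cd a = 0 ↔ a = ∅ := by
  refine ⟨fun h => ext fun x => ⟨fun hx => ?_, fun hx => (not_mem_empty x hx).elim⟩,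
    fun h => h ▸ rfl⟩
  obtain ⟨F, _, h1, _⟩ := (cd_eq.1 (h.trans cd_empty.symm)).exists_fun
  exact (not_mem_empty _ (h1 x hx)).elim

theorem exists_insM (c : Cd M) : ∃ a y : M, cd a = c ∧ y ∉ a ∧ cd (insM a y) = c + 1 := by
  obtain ⟨a, rfl⟩ := cd_surj c
  have h : ∀ x ∈ prodM (singM ∅) a, x ∉ singM (opairM (singM ∅) (∅ : M)) := by
    intro x hx hx'
    obtain ⟨y, hy, z, hz, rfl⟩ := mem_prodM.1 hx
    rw [mem_singM, opairM_inj, mem_singM.1 hy] at hx'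
    exact singM_ne_empty _ hx'.1.symm
  have h1 : cd (prodM (singM ∅) a) = cd a := by
    refine cd_eq.2 (.of_fun sndM ?_ ?_ ?_)
    · intro p hp
      obtain ⟨y, hy, z, hz, rfl⟩ := mem_prodM.1 hp
      simpa using hz
    · intro p hp q hq e
      obtain ⟨y, hy, z, hz, rfl⟩ := mem_prodM.1 hp
      obtain ⟨y', hy', z', hz', rfl⟩ := mem_prodM.1 hq
      simp only [sndM_opairM] at e
      rw [e, mem_singM.1 hy, mem_singM.1 hy']
    · exact fun y hy => ⟨opairM ∅ y, opairM_mem_prodM.2 ⟨mem_singM.2 rfl, hy⟩, by simp⟩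
  have h2 : opairM (singM ∅) (∅ : M) ∉ prodM (singM ∅) a := fun h' => h _ h' (mem_singM.2 rfl)
  exact ⟨_, _, h1, h2, by rw [cd_insM h2, h1]⟩

theorem succ_ne_zero (c : Cd M) : c + 1 ≠ 0 := by
  obtain ⟨a, y, rfl, h, h'⟩ := exists_insM c
  rw [← h']
  exact fun e => not_mem_empty y (cd_eq_zero.1 e ▸ mem_insM.2 (.inr rfl))

theorem succ_inj {c d : Cd M} (h : c + 1 = d + 1) : c = d := by
  obtain ⟨a, y, rfl, ha, ha'⟩ := exists_insM c
  obtain ⟨b, z, rfl, hb, hb'⟩ := exists_insM d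
  rw [← ha', ← hb', cd_eq] at h
  exact cd_eq.2 ((CLe.of_insM ha h.cLe).antisymm (CLe.of_insM hb h.symm.cLe))

protected theorem add_zero (c : Cd M) : c + 0 = c := by
  obtain ⟨a, rfl⟩ := cd_surj c
  rw [← cd_empty, ← cd_cupM fun x _ => not_mem_empty x]
  congr 1
  exact ext fun x => by simp

protected theorem add_succ (c d : Cd M) : c + (d + 1) = c + d + 1 := by
  obtain ⟨a, rfl⟩ := cd_surj c
  obtain ⟨b, y, rfl, hb, hb'⟩ := exists_insM d
  have h : opairM (singM ∅) y ∉ sumM a b := by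
    intro h
    rcases mem_sumM.1 h with ⟨x, _, e⟩ | ⟨x, hx, e⟩
    · exact singM_ne_empty _ (opairM_inj.1 e).1
    · exact hb ((opairM_inj.1 e).2 ▸ hx)
  rw [← hb', ← cd_sumM, ← cd_sumM, ← cd_insM h]
  congr 1
  refine ext fun p => ?_
  simp only [mem_insM, mem_sumM]
  constructor
  · rintro (h | ⟨x, hx | rfl, rfl⟩)
    · exact .inl (.inl h)
    · exact .inl (.inr ⟨x, hx, rfl⟩)
    · exact .inr rfl
  · rintro ((h | ⟨x, hx, rfl⟩) | rfl)
    · exact .inl h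
    · exact .inr ⟨x, .inl hx, rfl⟩
    · exact .inr ⟨y, .inr rfl, rfl⟩

protected theorem mul_zero (c : Cd M) : c * 0 = 0 := by
  obtain ⟨a, rfl⟩ := cd_surj c
  rw [← cd_empty, ← cd_prodM]
  congr 1
  exact ext fun x => by simp

theorem cd_prodM_singM (a y : M) : cd (prodM a (singM y)) = cd a := by
  refine cd_eq.2 (.of_fun fstM ?_ ?_ ?_)
  · intro p hp
    obtain ⟨x, hx, z, hz, rfl⟩ := mem_prodM.1 hp
    simpa using hx
  · intro p hp q hq e
    obtain ⟨y, hy, z, hz, rfl⟩ := mem_prodM.1 hp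
    obtain ⟨y', hy', z', hz', rfl⟩ := mem_prodM.1 hq
    simp only [fstM_opairM] at e
    rw [e, mem_singM.1 hz, mem_singM.1 hz']
  · exact fun x hx => ⟨opairM x y, opairM_mem_prodM.2 ⟨hx, mem_singM.2 rfl⟩, by simp⟩

protected theorem mul_succ (c d : Cd M) : c * (d + 1) = c * d + c := by
  obtain ⟨a, rfl⟩ := cd_surj c
  obtain ⟨b, y, rfl, hb, hb'⟩ := exists_insM d
  have h : ∀ p ∈ prodM a b, p ∉ prodM a (singM y) := by
    intro p hp hp'
    obtain ⟨x, hx, z, hz, rfl⟩ := mem_prodM.1 hp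
    exact hb (mem_singM.1 (opairM_mem_prodM.1 hp').2 ▸ hz)
  rw [← hb', ← cd_prodM, ← cd_prodM]
  conv_rhs => rw [← cd_prodM_singM a y]
  rw [← cd_cupM h]
  congr 1
  refine ext fun p => ?_
  simp only [mem_cupM, mem_prodM, mem_insM, mem_singM]
  constructor
  · rintro ⟨x, hx, z, hz | rfl, rfl⟩
    · exact .inl ⟨x, hx, z, hz, rfl⟩
    · exact .inr ⟨x, hx, z, rfl, rfl⟩
  · rintro (⟨x, hx, z, hz, rfl⟩ | ⟨x, hx, z, rfl, rfl⟩)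
    · exact ⟨x, hx, z, .inl hz, rfl⟩
    · exact ⟨x, hx, z, .inr rfl, rfl⟩

protected theorem pow_zero (c : Cd M) : c ^ (0 : Cd M) = 1 := by
  obtain ⟨a, rfl⟩ := cd_surj c
  rw [← cd_empty, ← cd_expM, ← cd_singM ∅]
  congr 1
  refine ext fun f => ?_
  rw [mem_expM, mem_singM]
  constructor
  · intro h
    exact ext fun p => ⟨fun hp => by simpa using h.1 p hp, fun hp => (not_mem_empty p hp).elim⟩
  · rintro rfl
    exact ⟨fun p hp => (not_mem_empty p hp).elim, fun x hx => (not_mem_empty x hx).elim⟩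

protected theorem pow_succ (c d : Cd M) : c ^ (d + 1) = c ^ d * c := by
  obtain ⟨a, rfl⟩ := cd_surj c
  obtain ⟨b, y, rfl, hb, hb'⟩ := exists_insM d
  rw [← hb', ← cd_expM, ← cd_expM, ← cd_prodM, cd_eq]
  have hy : y ∈ insM b y := mem_insM.2 (.inr rfl)
  have hsub : ∀ x ∈ b, x ∈ insM b y := fun x hx => mem_insM.2 (.inl hx)
  refine .of_fun (fun f => opairM (lamM b fun x => valM f x) (valM f y)) ?_ ?_ ?_
  · intro f hf
    have hf := mem_expM.1 hf
    exact opairM_mem_prodM.2 ⟨mem_expM.2 (lamM_isFun fun x hx => (hf.val_spec (hsub x hx)).1),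
      (hf.val_spec hy).1⟩
  · intro f hf g hg e
    rw [opairM_inj] at e
    refine (mem_expM.1 hf).ext (mem_expM.1 hg) fun x hx => ?_
    rcases mem_insM.1 hx with hx | rfl
    · have := congrArg (valM · x) e.1
      simpa only [valM_lamM hx] using this
    · exact e.2
  · intro p hp
    obtain ⟨g, hg, z, hz, rfl⟩ := mem_prodM.1 hp
    have hg := mem_expM.1 hg
    have h1 : ∀ x ∈ b, iteM (x = y) z (valM g x) = valM g x := fun x hx =>
      iteM_neg (fun e : x = y => hb (e ▸ hx)) _ _
    refine ⟨lamM (insM b y) fun x => iteM (x = y) z (valM g x), mem_expM.2 (lamM_isFun ?_), ?_⟩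
    · intro x hx
      rcases mem_insM.1 hx with hx | rfl
      · rw [h1 x hx]; exact (hg.val_spec hx).1
      · rw [iteM_pos rfl]; exact hz
    · rw [opairM_inj, valM_lamM hy, iteM_pos rfl]
      refine ⟨IsFun.ext (a := b) (b := a) (b' := a) (lamM_isFun fun x hx => ?_) hg fun x hx => ?_,
        rfl⟩
      · rw [valM_lamM (hsub x hx), h1 x hx]; exact (hg.val_spec hx).1
      · rw [valM_lamM hx, valM_lamM (hsub x hx), h1 x hx]

protected theorem zero_add (c : Cd M) : 0 + c = c := by
  refine ind (fun c => 0 + c = c) (Cd.add_zero 0) (fun c h => ?_) c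
  rw [Cd.add_succ, h]

protected theorem succ_add (c d : Cd M) : c + 1 + d = c + d + 1 := by
  refine ind (fun d => c + 1 + d = c + d + 1) ?_ (fun d h => ?_) d
  · rw [Cd.add_zero, Cd.add_zero]
  · rw [Cd.add_succ, Cd.add_succ, h]

protected theorem add_comm (c d : Cd M) : c + d = d + c := by
  refine ind (fun d => c + d = d + c) ?_ (fun d h => ?_) d
  · rw [Cd.add_zero, Cd.zero_add]
  · rw [Cd.add_succ, Cd.succ_add, h]

protected theorem add_assoc (b c d : Cd M) : b + c + d = b + (c + d) := by
  refine ind (fun d => b + c + d = b + (c + d)) ?_ (fun d h => ?_) d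
  · rw [Cd.add_zero, Cd.add_zero]
  · rw [Cd.add_succ, Cd.add_succ, Cd.add_succ, h]

noncomputable instance : AddCommMonoid (Cd M) where
  add_assoc := Cd.add_assoc
  zero_add := Cd.zero_add
  add_zero := Cd.add_zero
  add_comm := Cd.add_comm
  nsmul := nsmulRec

protected theorem mul_add (b c d : Cd M) : b * (c + d) = b * c + b * d := by
  refine ind (fun d => b * (c + d) = b * c + b * d) ?_ (fun d h => ?_) d
  · rw [Cd.mul_zero, add_zero, add_zero]
  · rw [Cd.add_succ, Cd.mul_succ, Cd.mul_succ, h, add_assoc]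

protected theorem zero_mul (c : Cd M) : 0 * c = 0 := by
  refine ind (fun c => 0 * c = 0) (Cd.mul_zero 0) (fun c h => ?_) c
  rw [Cd.mul_succ, h, add_zero]

protected theorem succ_mul (c d : Cd M) : (c + 1) * d = c * d + d := by
  refine ind (fun d => (c + 1) * d = c * d + d) ?_ (fun d h => ?_) d
  · rw [Cd.mul_zero, Cd.mul_zero, add_zero]
  · rw [Cd.mul_succ, Cd.mul_succ, h]; abel

protected theorem mul_comm (c d : Cd M) : c * d = d * c := by
  refine ind (fun d => c * d = d * c) ?_ (fun d h => ?_) d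
  · rw [Cd.mul_zero, Cd.zero_mul]
  · rw [Cd.mul_succ, Cd.succ_mul, h]

protected theorem mul_assoc (b c d : Cd M) : b * c * d = b * (c * d) := by
  refine ind (fun d => b * c * d = b * (c * d)) ?_ (fun d h => ?_) d
  · simp only [Cd.mul_zero]
  · rw [Cd.mul_succ, Cd.mul_succ, Cd.mul_add, h]

protected theorem mul_one (c : Cd M) : c * 1 = c := by
  have := Cd.mul_succ c 0
  rwa [zero_add, Cd.mul_zero, zero_add] at this

noncomputable instance : CommSemiring (Cd M) where
  mul_assoc := Cd.mul_assoc
  one_mul c := (Cd.mul_comm _ _).trans (Cd.mul_one c)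
  mul_one := Cd.mul_one
  zero_mul := Cd.zero_mul
  mul_zero := Cd.mul_zero
  left_distrib := Cd.mul_add
  right_distrib a b c := by simp only [Cd.mul_comm _ c, Cd.mul_add]
  mul_comm := Cd.mul_comm

theorem le_iff_exists_add' {c d : Cd M} : c ≤ d ↔ ∃ e, d = c + e := by
  obtain ⟨a, rfl⟩ := cd_surj c
  obtain ⟨b, rfl⟩ := cd_surj d
  constructor
  · intro h
    obtain ⟨F, hF, h1, h2⟩ := (cd_le.1 h).exists_fun
    have := fun n => DF.app (n := n) F
    refine ⟨cd (sepM b fun y => ∀ x, x ∈ a → F x ≠ y), ?_⟩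
    have e1 : cd a = cd (imgM a F) := cd_eq.2 (.of_fun F (fun x hx => mem_imgM.2 ⟨x, hx, rfl⟩) h2
      fun y hy => (mem_imgM.1 hy).imp fun x hx => ⟨hx.1, hx.2.symm⟩)
    rw [e1, ← cd_cupM]
    · congr 1
      refine ext fun y => ?_
      simp only [mem_cupM, mem_imgM, mem_sepM]
      constructor
      · intro hy
        by_cases h : ∃ x ∈ a, y = F x
        · exact .inl h
        · exact .inr ⟨hy, fun x hx e => h ⟨x, hx, e.symm⟩⟩
      · rintro (⟨x, hx, rfl⟩ | h)
        · exact h1 x hx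
        · exact h.1
    · intro y hy hy'
      obtain ⟨x, hx, rfl⟩ := mem_imgM.1 hy
      exact (mem_sepM.1 hy').2 x hx rfl
  · rintro ⟨e, he⟩
    obtain ⟨s, rfl⟩ := cd_surj e
    have h1 : CLe a (sumM a s) := .of_fun (fun x => opairM ∅ x)
      (fun x hx => mem_sumM.2 (.inl ⟨x, hx, rfl⟩)) fun x _ y _ e => (opairM_inj.1 e).2
    exact cd_le.2 (h1.trans (cd_eq.1 he).symm.cLe)

theorem eq_zero_or_succ (c : Cd M) : c = 0 ∨ ∃ d, c = d + 1 := by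
  obtain ⟨a, rfl⟩ := cd_surj c
  exact set_ind (fun a => cd a = 0 ∨ ∃ x, x ∈ powM a ∧ cd a = cd x + 1) (.inl rfl)
    (fun x y hy _ => .inr ⟨x, mem_powM.2 fun z hz => mem_insM.2 (.inl hz), cd_insM hy⟩) a
    |>.imp_right fun ⟨x, _, h⟩ => ⟨_, h⟩

protected theorem add_left_cancel {b c d : Cd M} (h : b + c = b + d) : c = d := by
  revert h
  refine ind (fun b => b + c = b + d → c = d) ?_ (fun b ih h => ih (succ_inj ?_)) b
  · rw [zero_add, zero_add]; exact id
  · rwa [Cd.succ_add, Cd.succ_add] at h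

theorem eq_zero_of_add_eq_zero {b c : Cd M} (h : b + c = 0) : c = 0 := by
  rcases eq_zero_or_succ c with h' | ⟨d, rfl⟩
  · exact h'
  · exact (succ_ne_zero _ (Cd.add_succ b d ▸ h)).elim

protected theorem le_total (c d : Cd M) : c ≤ d ∨ d ≤ c := by
  refine ind (fun d => c ≤ d ∨ d ≤ c) ?_ (fun d h => ?_) d
  · exact .inr (le_iff_exists_add'.2 ⟨c, (zero_add c).symm⟩)
  · rcases h with h | h
    · obtain ⟨e, rfl⟩ := le_iff_exists_add'.1 h
      exact .inl (le_iff_exists_add'.2 ⟨e + 1, add_assoc _ _ _⟩)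
    · obtain ⟨e, rfl⟩ := le_iff_exists_add'.1 h
      rcases eq_zero_or_succ e with rfl | ⟨e, rfl⟩
      · exact .inl (le_iff_exists_add'.2 ⟨1, by rw [add_zero]⟩)
      · exact .inr (le_iff_exists_add'.2 ⟨e, by abel⟩)

open Classical in
noncomputable instance : LinearOrder (Cd M) where
  le_refl c := le_iff_exists_add'.2 ⟨0, (add_zero c).symm⟩
  le_trans a b c h h' := by
    obtain ⟨d, rfl⟩ := le_iff_exists_add'.1 h
    obtain ⟨e, rfl⟩ := le_iff_exists_add'.1 h'
    exact le_iff_exists_add'.2 ⟨d + e, add_assoc _ _ _⟩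
  le_antisymm a b h h' := by
    obtain ⟨d, rfl⟩ := le_iff_exists_add'.1 h
    obtain ⟨e, he⟩ := le_iff_exists_add'.1 h'
    have : d + e = 0 := Cd.add_left_cancel (b := a) (by rw [add_zero, ← add_assoc]; exact he.symm)
    rw [add_comm] at this
    rw [eq_zero_of_add_eq_zero this, add_zero]
  le_total := Cd.le_total
  toDecidableLE := inferInstance

instance : IsOrderedCancelAddMonoid (Cd M) where
  add_le_add_left _ _ h _ := by
    obtain ⟨d, rfl⟩ := le_iff_exists_add'.1 h
    exact le_iff_exists_add'.2 ⟨d, by abel⟩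
  le_of_add_le_add_left a b c h := by
    obtain ⟨d, hd⟩ := le_iff_exists_add'.1 h
    exact le_iff_exists_add'.2 ⟨d, Cd.add_left_cancel (by rw [hd, add_assoc])⟩

instance : CanonicallyOrderedAdd (Cd M) where
  exists_add_of_le h := le_iff_exists_add'.1 h
  le_self_add _ b := le_iff_exists_add'.2 ⟨b, rfl⟩
  le_add_self _ b := le_iff_exists_add'.2 ⟨b, add_comm _ _⟩

theorem lt_iff_succ_le {c d : Cd M} : c < d ↔ c + 1 ≤ d := by
  constructor
  · intro h
    obtain ⟨e, rfl⟩ := le_iff_exists_add'.1 h.le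
    rcases eq_zero_or_succ e with rfl | ⟨e, rfl⟩
    · exact (h.ne (add_zero c).symm).elim
    · exact le_iff_exists_add'.2 ⟨e, by abel⟩
  · intro h
    refine lt_of_le_of_ne (le_self_add.trans h) ?_
    rintro rfl
    obtain ⟨e, he⟩ := le_iff_exists_add'.1 h
    refine succ_ne_zero e (Cd.add_left_cancel (b := c) ?_)
    rw [add_zero, add_comm e 1, ← add_assoc]; exact he.symm

theorem lt_succ_iff {c d : Cd M} : c < d + 1 ↔ c ≤ d := by
  rw [lt_iff_succ_le, add_le_add_iff_right]

theorem zero_lt_one' : (0 : Cd M) < 1 := lt_iff_succ_le.2 (by rw [zero_add])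

instance : Nontrivial (Cd M) := ⟨0, 1, zero_lt_one'.ne⟩

instance : IsStrictOrderedRing (Cd M) where
  zero_le_one := zero_lt_one'.le
  mul_lt_mul_of_pos_left a ha b c h := by
    obtain ⟨d, rfl⟩ := le_iff_exists_add'.1 (lt_iff_succ_le.1 h)
    have : a * (b + 1 + d) = a * b + (a + a * d) := by ring
    simp only [this]
    exact lt_add_of_pos_right _ (lt_of_lt_of_le ha le_self_add)
  mul_lt_mul_of_pos_right a ha b c h := by
    obtain ⟨d, rfl⟩ := le_iff_exists_add'.1 (lt_iff_succ_le.1 h)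
    have : (b + 1 + d) * a = b * a + (a + a * d) := by ring
    simp only [this]
    exact lt_add_of_pos_right _ (lt_of_lt_of_le ha le_self_add)

end Cd

end Cardinals

/-! ### Definability and cardinal numbers -/

section CardinalDefinability

variable {M : Type} [EAModel M] {n : ℕ}

theorem cd_le_of_subset {a b : M} (h : a ⊆ b) : cd a ≤ cd b := cd_le.2 (.of_subset h)

theorem eq_of_subset_of_cd_le {a b : M} (h : a ⊆ b) (h' : cd b ≤ cd a) : a = b :=
  CEq.of_subset h (cd_eq.1 (le_antisymm (cd_le_of_subset h) h'))

theorem cd_lt_of_subset {a b : M} (h : a ⊆ b) (h' : a ≠ b) : cd a < cd b :=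
  lt_of_not_ge fun k => h' (eq_of_subset_of_cd_le h k)

theorem cd_imgM {a : M} (F : M → M) [DF1 F] (h : ∀ x ∈ a, ∀ x' ∈ a, F x = F x' → x = x') :
    cd (imgM a F) = cd a :=
  (cd_eq.2 (.of_fun F (fun x hx => mem_imgM.2 ⟨x, hx, rfl⟩) h
    fun _ hy => (mem_imgM.1 hy).imp fun _ hx => ⟨hx.1, hx.2.symm⟩)).symm

theorem exists_subset_cd {b : M} {c : Cd M} (h : c ≤ cd b) : ∃ a, a ⊆ b ∧ cd a = c := by
  obtain ⟨a, rfl⟩ := cd_surj c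
  obtain ⟨F, hF, h1, h2⟩ := (cd_le.1 h).exists_fun
  refine ⟨imgM a F, fun y hy => ?_, cd_imgM F h2⟩
  obtain ⟨x, hx, rfl⟩ := mem_imgM.1 hy
  exact h1 x hx

instance (c d : (Fin n → M) → Cd M) [DC c] [DC d] : DP fun v => c v < d v := by
  simp only [lt_iff_le_not_ge]; infer_instance

theorem DC.app (V : M → Cd M) [h : DC fun v : Fin 1 → M => V (v 0)] (f : (Fin n → M) → M) [DF f] :
    DC fun v => V (f v) := by
  obtain ⟨g, hg, h⟩ := h.out
  have : DF1 fun x => g fun _ => x := by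
    convert hg using 2 with v
    exact congrArg g (funext fun i => by rw [Subsingleton.elim i 0])
  exact ⟨fun v => g fun _ => f v, DF.app (fun x => g fun _ => x) f, fun v => h fun _ => f v⟩

theorem DP.appC (P : Cd M → Prop) [h : DP fun v : Fin 1 → M => P (cd (v 0))]
    (c : (Fin n → M) → Cd M) [hc : DC c] : DP fun v => P (c v) := by
  obtain ⟨f, hf, hc⟩ := hc.out
  simp only [hc]
  exact DP.app (fun x => P (cd x)) f

instance DP.ballC (c : (Fin n → M) → Cd M) (P : (Fin n → M) → Cd M → Prop) [hc : DC c]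
    [DP fun w : Fin (n + 1) → M => P (fun i => w i.succ) (cd (w 0))] :
    DP fun v => ∀ e, e ≤ c v → P v e := by
  obtain ⟨f, hf, hc⟩ := hc.out
  have : DP fun v => ∀ x, x ∈ powM (f v) → P v (cd x) := inferInstance
  convert this using 3 with v
  constructor
  · exact fun h x hx => h _ (hc v ▸ cd_le_of_subset (mem_powM.1 hx))
  · intro h e he
    obtain ⟨a, ha, rfl⟩ := exists_subset_cd (hc v ▸ he)
    exact h a (mem_powM.2 ha)

namespace Cd

variable {b c d e s t : Cd M}

/-- The least number principle. -/
theorem exists_least (P : Cd M → Prop) [DP fun v : Fin 1 → M => P (cd (v 0))] (h : P c) :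
    ∃ d, P d ∧ ∀ e, P e → d ≤ e := by
  have := fun n => DP.appC (n := n) P
  by_contra hn
  have key : ∀ c, ∀ e, e ≤ c → ¬ P e := by
    refine fun c => ind (fun c => ∀ e, e ≤ c → ¬ P e) ?_ ?_ c
    · intro e he hP
      exact hn ⟨e, hP, fun e' _ => he.trans zero_le⟩
    · intro c ih e he hP
      refine hn ⟨e, hP, fun e' hP' => le_of_not_gt fun hlt => ih e' ?_ hP'⟩
      exact lt_succ_iff.1 (lt_of_lt_of_le hlt he)
  exact key c c le_rfl h

theorem succ_le : c + 1 ≤ d ↔ c < d := lt_iff_succ_le.symm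

theorem one_le : 1 ≤ c ↔ c ≠ 0 := by
  rw [← zero_add (1 : Cd M), succ_le, pos_iff_ne_zero]

theorem lt_one : c < 1 ↔ c = 0 := by
  rw [← not_le, one_le, not_not]

theorem exists_eq_succ (h : c ≠ 0) : ∃ d, c = d + 1 := (eq_zero_or_succ c).resolve_left h

theorem pow_add' : c ^ (d + e) = c ^ d * c ^ e := by
  refine ind (fun e => c ^ (d + e) = c ^ d * c ^ e) ?_ (fun e h => ?_) e
  · rw [add_zero, Cd.pow_zero, mul_one]
  · rw [← add_assoc, Cd.pow_succ, Cd.pow_succ, h, mul_assoc]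

theorem one_pow' : (1 : Cd M) ^ e = 1 := by
  refine ind (fun e => (1 : Cd M) ^ e = 1) (Cd.pow_zero _) (fun e h => ?_) e
  rw [Cd.pow_succ, h, one_mul]

theorem pow_mul' : c ^ (d * e) = (c ^ d) ^ e := by
  refine ind (fun e => c ^ (d * e) = (c ^ d) ^ e) ?_ (fun e h => ?_) e
  · rw [mul_zero, Cd.pow_zero, Cd.pow_zero]
  · rw [mul_add, mul_one, pow_add', Cd.pow_succ, h]

theorem pow_one' : c ^ (1 : Cd M) = c := by
  rw [← zero_add (1 : Cd M), Cd.pow_succ, Cd.pow_zero, one_mul]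

theorem pow_two' : c ^ (2 : Cd M) = c * c := by
  rw [← one_add_one_eq_two, Cd.pow_succ, pow_one']

theorem pow_natCast (m : ℕ) : c ^ (m : Cd M) = c ^ m := by
  induction m with
  | zero => rw [Nat.cast_zero, Cd.pow_zero, pow_zero]
  | succ m ih => rw [Nat.cast_succ, Cd.pow_succ, ih, pow_succ]

theorem pow_le_pow_left' (h : c ≤ d) : c ^ e ≤ d ^ e := by
  refine ind (fun e => c ^ e ≤ d ^ e) ?_ (fun e h' => ?_) e
  · simp only [Cd.pow_zero, le_refl]
  · simp only [Cd.pow_succ]; exact mul_le_mul' h' h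

theorem pow_pos' (h : 1 ≤ c) : 1 ≤ c ^ e := by
  simpa only [one_pow'] using pow_le_pow_left' (e := e) h

theorem pow_le_pow_right' (h : 1 ≤ c) (h' : d ≤ e) : c ^ d ≤ c ^ e := by
  obtain ⟨f, rfl⟩ := le_iff_exists_add'.1 h'
  rw [pow_add']
  exact le_mul_of_one_le_right' (pow_pos' h)

theorem one_le_of_two_le (h : 2 ≤ c) : 1 ≤ c := one_le_two.trans h

theorem pow_lt_pow_right' (h : 2 ≤ c) (h' : d < e) : c ^ d < c ^ e := by
  have h1 : 1 ≤ c ^ d := pow_pos' (one_le_of_two_le h)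
  refine lt_of_lt_of_le ?_ (pow_le_pow_right' (one_le_of_two_le h) (succ_le.2 h'))
  rw [Cd.pow_succ]
  calc c ^ d < c ^ d + c ^ d := lt_add_of_pos_right _ (lt_of_lt_of_le zero_lt_one' h1)
    _ = c ^ d * 2 := by ring
    _ ≤ c ^ d * c := mul_le_mul' le_rfl h

theorem pow_lt_pow_iff_right' (h : 2 ≤ c) : c ^ d < c ^ e ↔ d < e :=
  ⟨fun h' => lt_of_not_ge fun k => absurd (pow_le_pow_right' (one_le_of_two_le h) k)
    (not_le_of_gt h'), pow_lt_pow_right' h⟩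

theorem pow_le_pow_iff_right' (h : 2 ≤ c) : c ^ d ≤ c ^ e ↔ d ≤ e := by
  rw [← not_lt, pow_lt_pow_iff_right' h, not_lt]

theorem lt_pow_self' (h : 2 ≤ c) : d < c ^ d := by
  refine ind (fun d => d < c ^ d) ?_ (fun d h' => ?_) d
  · rw [Cd.pow_zero]; exact zero_lt_one'
  · exact lt_of_le_of_lt (succ_le.2 h') (pow_lt_pow_right' h (lt_succ_iff.2 le_rfl))

theorem exists_lg (s c : Cd M) : ∃ x : Cd M, 2 ≤ s → ∀ y : Cd M, x ≤ y ↔ c ≤ s ^ y := by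
  by_cases hs : 2 ≤ s
  · obtain ⟨x, hx, hl⟩ := exists_least (fun x => c ≤ s ^ x) (lt_pow_self' hs (d := c)).le
    refine ⟨x, fun _ y => ⟨fun h => hx.trans (pow_le_pow_right' (one_le_of_two_le hs) h), hl y⟩⟩
  · exact ⟨0, fun h => (hs h).elim⟩

/-- The logarithm of `c` to the base `s`, rounded up. -/
noncomputable def lg (s c : Cd M) : Cd M := (exists_lg s c).choose

theorem lg_le_iff (hs : 2 ≤ s) : lg s c ≤ d ↔ c ≤ s ^ d := (exists_lg s c).choose_spec hs d

theorem lt_lg_iff (hs : 2 ≤ s) : d < lg s c ↔ s ^ d < c := by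
  rw [← not_le, lg_le_iff hs, not_le]

theorem le_pow_lg (hs : 2 ≤ s) : c ≤ s ^ lg s c := (lg_le_iff hs).1 le_rfl

theorem lg_mono (hs : 2 ≤ s) (h : c ≤ d) : lg s c ≤ lg s d :=
  (lg_le_iff hs).2 (h.trans (le_pow_lg hs))

theorem lg_pow (hs : 2 ≤ s) : lg s (s ^ c) = c :=
  le_antisymm ((lg_le_iff hs).2 le_rfl) ((pow_le_pow_iff_right' hs).1 (le_pow_lg hs))

theorem lg_le_self (hs : 2 ≤ s) : lg s c ≤ c := (lg_le_iff hs).2 (lt_pow_self' hs).le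

theorem lg_eq_zero (hs : 2 ≤ s) : lg s c = 0 ↔ c ≤ 1 := by
  rw [← nonpos_iff_eq_zero, lg_le_iff hs, Cd.pow_zero]

theorem lg_lt_self (hs : 2 ≤ s) (h : c ≠ 0) : lg s c < c := by
  obtain ⟨d, rfl⟩ := exists_eq_succ h
  exact lt_succ_iff.2 ((lg_le_iff hs).2 (succ_le.2 (lt_pow_self' hs)))

/-- Uniqueness of quotient and remainder. -/
theorem add_mul_inj {q r q' r' : Cd M} (hr : r < b) (hr' : r' < b) (h : r + q * b = r' + q' * b) :
    r = r' ∧ q = q' := by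
  have key : ∀ {q r q' r' : Cd M}, r' < b → r + q * b = r' + q' * b → q ≤ q' := by
    intro q r q' r' hr' h
    by_contra hlt
    obtain ⟨e, rfl⟩ := le_iff_exists_add'.1 (succ_le.2 (lt_of_not_ge hlt))
    have : r' + q' * b < r + (q' + 1 + e) * b := by
      calc r' + q' * b < b + q' * b := by gcongr
        _ ≤ r + (q' + 1 + e) * b := by
          rw [show r + (q' + 1 + e) * b = b + q' * b + (r + e * b) by ring]
          exact le_self_add
    exact absurd h this.ne'
  have hq : q = q' := le_antisymm (key hr' h) (key hr h.symm)
  subst hq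
  exact ⟨add_right_cancel h, rfl⟩

end Cd

theorem exists_min_cd {D x : M} (V : M → Cd M) [DC fun v : Fin 1 → M => V (v 0)] (hx : x ∈ D) :
    ∃ x ∈ D, ∀ y ∈ D, V x ≤ V y := by
  have := fun n => DC.app (n := n) V
  obtain ⟨c, ⟨x, hx, rfl⟩, hl⟩ := Cd.exists_least (fun c => ∃ x, x ∈ D ∧ V x = c) ⟨x, hx, rfl⟩
  exact ⟨x, hx, fun y hy => hl _ ⟨y, hy, rfl⟩⟩

theorem exists_max_cd {D x : M} (V : M → Cd M) [DC fun v : Fin 1 → M => V (v 0)] (hx : x ∈ D)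
    {m : Cd M} (hm : ∀ x ∈ D, V x ≤ m) : ∃ x ∈ D, ∀ y ∈ D, V y ≤ V x := by
  have := fun n => DC.app (n := n) V
  obtain ⟨c, hc, hl⟩ := Cd.exists_least (fun c => ∀ x, x ∈ D → V x ≤ c) hm
  by_contra hn
  push Not at hn
  rcases Cd.eq_zero_or_succ c with rfl | ⟨d, rfl⟩
  · obtain ⟨y, hy, hxy⟩ := hn x hx
    exact absurd (hc y hy) (not_le_of_gt (lt_of_le_of_lt zero_le hxy))
  · refine absurd (hl d fun x hx => ?_) (not_le_of_gt (Cd.lt_succ_iff.2 le_rfl))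
    obtain ⟨y, hy, hxy⟩ := hn x hx
    exact Cd.lt_succ_iff.1 (lt_of_lt_of_le hxy (hc y hy))

end CardinalDefinability

/-! ### Counting -/

section Counting

variable {M : Type} [EAModel M] {n : ℕ} {D : M} {c : Cd M}

theorem sepM_lt_succ (G : M → Cd M) [DC fun v : Fin 1 → M => G (v 0)]
    (hinj : ∀ x ∈ D, ∀ y ∈ D, G x = G y → x = y) {x : M} (hx : x ∈ D) :
    sepM D (fun y => G y < G x + 1) = insM (sepM D fun y => G y < G x) x := by
  have := fun n => DC.app (n := n) G
  refine ext fun y => ?_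
  simp only [mem_sepM, mem_insM, Cd.lt_succ_iff]
  constructor
  · rintro ⟨hy, h⟩
    rcases h.lt_or_eq with h | h
    · exact .inl ⟨hy, h⟩
    · exact .inr (hinj y hy x hx h)
  · rintro (⟨hy, h⟩ | rfl)
    · exact ⟨hy, h.le⟩
    · exact ⟨hx, le_rfl⟩

theorem sepM_lt_succ' (G : M → Cd M) [DC fun v : Fin 1 → M => G (v 0)]
    (h : ¬ ∃ x, x ∈ D ∧ G x = c) :
    sepM D (fun y => G y < c + 1) = sepM D fun y => G y < c := by
  have := fun n => DC.app (n := n) G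
  refine ext fun y => ?_
  simp only [mem_sepM, Cd.lt_succ_iff]
  exact and_congr_right fun hy => ⟨fun hl => hl.lt_of_ne fun e => h ⟨y, hy, e⟩, le_of_lt⟩

theorem sepM_lt_zero (G : M → Cd M) [DC fun v : Fin 1 → M => G (v 0)] :
    sepM D (fun y => G y < 0) = ∅ := by
  have := fun n => DC.app (n := n) G
  exact ext fun y => by simp

/-- If the function `G` with cardinal values takes every value below `c` exactly once on `D`, then
it takes a value below `c` at exactly `c` places. -/
theorem cd_sepM_lt (G : M → Cd M) [DC fun v : Fin 1 → M => G (v 0)]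
    (hinj : ∀ x ∈ D, ∀ y ∈ D, G x = G y → x = y) (h : ∀ d, d < c → ∃ x, x ∈ D ∧ G x = d) :
    cd (sepM D fun x => G x < c) = c := by
  have := fun n => DC.app (n := n) G
  have key : ∀ d, d ≤ c → cd (sepM D fun x => G x < d) = d := by
    refine fun d => Cd.ind (fun d => d ≤ c → cd (sepM D fun x => G x < d) = d) ?_ ?_ d
    · intro _; rw [sepM_lt_zero]; rfl
    · intro d ih hd
      have hd' := Cd.succ_le.1 hd
      obtain ⟨x, hx, rfl⟩ := h d hd'
      rw [sepM_lt_succ G hinj hx, Cd.cd_insM, ih hd'.le]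
      simp
  exact key c le_rfl

theorem cd_sepM_lt_le (G : M → Cd M) [DC fun v : Fin 1 → M => G (v 0)]
    (hinj : ∀ x ∈ D, ∀ y ∈ D, G x = G y → x = y) (c : Cd M) :
    cd (sepM D fun x => G x < c) ≤ c := by
  have := fun n => DC.app (n := n) G
  refine Cd.ind (fun d => cd (sepM D fun x => G x < d) ≤ d) ?_ ?_ c
  · rw [sepM_lt_zero]; rfl
  · intro d ih
    by_cases h : ∃ x, x ∈ D ∧ G x = d
    · obtain ⟨x, hx, rfl⟩ := h
      rw [sepM_lt_succ G hinj hx, Cd.cd_insM (by simp)]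
      gcongr
    · rw [sepM_lt_succ' G h]
      exact ih.trans le_self_add

/-- The pigeonhole principle. -/
theorem exists_eq_of_inj (G : M → Cd M) [DC fun v : Fin 1 → M => G (v 0)]
    (hinj : ∀ x ∈ D, ∀ y ∈ D, G x = G y → x = y) (h : ∀ x ∈ D, G x < cd D) (hc : c < cd D) :
    ∃ x ∈ D, G x = c := by
  have := fun n => DC.app (n := n) G
  by_contra hn
  have key : ∀ d, c < d → cd (sepM D fun x => G x < d) + 1 ≤ d := by
    refine fun d => Cd.ind (fun d => c < d → cd (sepM D fun x => G x < d) + 1 ≤ d) ?_ ?_ d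
    · exact fun h => (not_lt_zero h).elim
    · intro d ih hd
      rcases (Cd.lt_succ_iff.1 hd).eq_or_lt with rfl | hd'
      · rw [sepM_lt_succ' G hn]
        gcongr
        exact cd_sepM_lt_le G hinj c
      · by_cases h : ∃ x, x ∈ D ∧ G x = d
        · obtain ⟨x, hx, rfl⟩ := h
          rw [sepM_lt_succ G hinj hx, Cd.cd_insM (by simp)]
          gcongr
          exact ih hd'
        · rw [sepM_lt_succ' G h]
          exact (ih hd').trans le_self_add
  have e : sepM D (fun x => G x < cd D) = D := ext fun x => by
    simp only [mem_sepM]; exact ⟨fun h => h.1, fun hx => ⟨hx, h x hx⟩⟩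
  have := key _ hc
  rw [e] at this
  exact absurd this (not_le_of_gt (Cd.lt_succ_iff.2 le_rfl))

end Counting

/-! ### Linear orderings and ranks -/

section Orderings

variable {M : Type} [EAModel M] {n : ℕ} {L K x y z a u : M} {c : Cd M}

/-- The rank of `x` in the linear ordering `L`: the number of terms before `x`. -/
noncomputable def rk (L x : M) : Cd M := cd (belowM L x)

instance (f g : (Fin n → M) → M) [DF f] [DF g] : DC fun v => rk (f v) (g v) := by
  unfold rk; infer_instance

/-- The length of the linear ordering `L`. -/
noncomputable def len (L : M) : Cd M := cd (unionM L)

instance (f : (Fin n → M) → M) [DF f] : DC fun v => len (f v) := by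
  unfold len; infer_instance

theorem mem_belowM : y ∈ belowM L x ↔ ∃ u ∈ L, y ∈ u ∧ x ∉ u := by
  simp only [belowM, mem_sepM, mem_unionM, OrdLt]
  exact ⟨fun h => h.2, fun h => ⟨h.imp fun u hu => ⟨hu.1, hu.2.1⟩, h⟩⟩

theorem not_mem_belowM : x ∉ belowM L x := fun h => by
  obtain ⟨u, _, h, h'⟩ := mem_belowM.1 h
  exact h' h

theorem belowM_sub : belowM L x ⊆ unionM L := fun y h => by
  obtain ⟨u, hu, h, _⟩ := mem_belowM.1 h
  exact mem_unionM.2 ⟨u, hu, h⟩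

theorem rk_lt_len (hx : x ∈ unionM L) : rk L x < len L :=
  cd_lt_of_subset belowM_sub fun h => not_mem_belowM (h ▸ hx : x ∈ belowM L x)

theorem unionM_empty : unionM (∅ : M) = ∅ := ext fun x => by simp

theorem isOrd_empty : IsOrd (∅ : M) := by
  refine ⟨not_mem_empty _, fun h => (h rfl).elim, ?_, ?_⟩ <;> intro x hx <;>
    exact (not_mem_empty x hx).elim

theorem len_empty : len (∅ : M) = 0 := by rw [len, unionM_empty]; rfl

namespace IsOrd

theorem mem_unionM_of_mem (hu : u ∈ L) (hx : x ∈ u) : x ∈ unionM L := mem_unionM.2 ⟨u, hu, hx⟩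

theorem eq_of_cd_eq (hL : IsOrd L) {u w : M} (hu : u ∈ L) (hw : w ∈ L) (h : cd u = cd w) :
    u = w := by
  rcases hL.2.2.2 u hu w hw with k | k
  · exact eq_of_subset_of_cd_le k h.ge
  · exact (eq_of_subset_of_cd_le k h.le).symm

theorem sub_of_cd_le (hL : IsOrd L) {u w : M} (hu : u ∈ L) (hw : w ∈ L) (h : cd u ≤ cd w) :
    u ⊆ w := by
  rcases hL.2.2.2 u hu w hw with k | k
  · exact k
  · rw [eq_of_subset_of_cd_le k h]; exact fun _ h => h

/-- The terms up to and including a term form a member of the linear ordering. -/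
theorem insM_belowM_mem (hL : IsOrd L) (hx : x ∈ unionM L) : insM (belowM L x) x ∈ L := by
  obtain ⟨u₀, hu₀, hxu₀⟩ := mem_unionM.1 hx
  -- the least member `w` containing `x`
  obtain ⟨w, hw, hmin⟩ := exists_min_cd (D := sepM L fun u => x ∈ u) (fun u => cd u)
    (mem_sepM.2 ⟨hu₀, hxu₀⟩)
  obtain ⟨hwL, hxw⟩ := mem_sepM.1 hw
  suffices h : w = insM (belowM L x) x from h ▸ hwL
  refine ext fun j => ?_
  rw [mem_insM]
  constructor
  · intro hj
    by_cases hjx : j = x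
    · exact .inr hjx
    refine .inl (mem_belowM.2 ?_)
    by_cases hex : ∃ u, u ∈ sepM L fun u => x ∉ u
    · -- the greatest member `u` not containing `x` is the predecessor of `w`
      obtain ⟨u, hu⟩ := hex
      obtain ⟨u, hu, hmax⟩ := exists_max_cd (m := cd (unionM L)) (fun u => cd u) hu fun u hu =>
        cd_le_of_subset fun y hy => mem_unionM_of_mem (mem_sepM.1 hu).1 hy
      obtain ⟨huL, hxu⟩ := mem_sepM.1 hu
      rcases hL.2.2.1 u huL with h | ⟨z, hz, hzu, hins⟩
      · exact (hxu (h ▸ hx)).elim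
      · by_cases hxz : x ∈ insM u z
        · refine ⟨u, huL, ?_, hxu⟩
          have hle := hmin _ (mem_sepM.2 ⟨hins, hxz⟩)
          have hjz := hL.sub_of_cd_le hwL hins hle j hj
          rcases mem_insM.1 hjz with h | h
          · exact h
          · rcases mem_insM.1 hxz with h' | h'
            · exact (hxu h').elim
            · exact (hjx (h.trans h'.symm)).elim
        · have hle := hmax _ (mem_sepM.2 ⟨hins, hxz⟩)
          rw [Cd.cd_insM hzu] at hle
          exact absurd hle (not_le_of_gt (Cd.lt_succ_iff.2 le_rfl))
    · have hall : ∀ u ∈ L, x ∈ u := fun u hu => by_contra fun h => hex ⟨u, mem_sepM.2 ⟨hu, h⟩⟩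
      obtain ⟨u, hu, y, _, rfl⟩ := hL.2.1 fun h => not_mem_empty _ (h ▸ hwL : w ∈ (∅ : M))
      have h1 := mem_singM.1 (hall _ hu)
      have hle := hL.sub_of_cd_le hwL hu (hmin _ (mem_sepM.2 ⟨hu, hall _ hu⟩))
      exact (hjx ((mem_singM.1 (hle j hj)).trans h1.symm)).elim
  · rintro (h | rfl)
    · obtain ⟨u, hu, hju, hxu⟩ := mem_belowM.1 h
      rcases hL.2.2.2 u hu w hwL with k | k
      · exact k j hju
      · exact (hxu (k x hxw)).elim
    · exact hxw

theorem cd_insM_belowM : cd (insM (belowM L x) x) = rk L x + 1 := Cd.cd_insM not_mem_belowM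

theorem ordLt_iff (hL : IsOrd L) (hx : x ∈ unionM L) (_ : y ∈ unionM L) :
    OrdLt L x y ↔ rk L x < rk L y := by
  have key : ∀ {x y : M}, OrdLt L x y → rk L x < rk L y := by
    rintro x y ⟨u, hu, hxu, hyu⟩
    refine cd_lt_of_subset (fun j hj => ?_) fun h => not_mem_belowM (L := L) (x := x) ?_
    · obtain ⟨w, hw, hjw, hxw⟩ := mem_belowM.1 hj
      refine mem_belowM.2 ⟨u, hu, ?_, hyu⟩
      rcases hL.2.2.2 w hw u hu with k | k
      · exact k j hjw
      · exact (hxw (k x hxu)).elim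
    · rw [h]; exact mem_belowM.2 ⟨u, hu, hxu, hyu⟩
  refine ⟨key, fun h => ⟨_, hL.insM_belowM_mem hx, mem_insM.2 (.inr rfl), fun h' => ?_⟩⟩
  rcases mem_insM.1 h' with h' | rfl
  · obtain ⟨u, hu⟩ := mem_belowM.1 h'
    exact lt_asymm h (key ⟨u, hu⟩)
  · exact lt_irrefl _ h

theorem rk_inj (hL : IsOrd L) (hx : x ∈ unionM L) (hy : y ∈ unionM L) (h : rk L x = rk L y) :
    x = y := by
  have e : insM (belowM L x) x = insM (belowM L y) y :=
    hL.eq_of_cd_eq (hL.insM_belowM_mem hx) (hL.insM_belowM_mem hy)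
      (by rw [cd_insM_belowM, cd_insM_belowM, h])
  have hxy : x ∈ insM (belowM L y) y := e ▸ mem_insM.2 (.inr rfl)
  rcases mem_insM.1 hxy with hxy | hxy
  · obtain ⟨u, hu⟩ := mem_belowM.1 hxy
    exact absurd h ((hL.ordLt_iff hx hy).1 ⟨u, hu⟩).ne
  · exact hxy

theorem exists_rk (hL : IsOrd L) (hc : c < len L) : ∃ x ∈ unionM L, rk L x = c := by
  revert hc
  refine Cd.ind (fun c => c < len L → ∃ x, x ∈ unionM L ∧ rk L x = c) ?_ ?_ c
  · intro h
    have hne : L ≠ ∅ := by rintro rfl; exact (len_empty (M := M) ▸ h).ne rfl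
    obtain ⟨u, hu, y, hy, rfl⟩ := hL.2.1 hne
    have hyL := mem_unionM_of_mem hu hy
    refine ⟨y, hyL, Cd.cd_eq_zero.2 (ext fun j =>
      ⟨fun hj => ?_, fun h => (not_mem_empty j h).elim⟩)⟩
    have hle : cd (singM y) ≤ cd (insM (belowM L y) y) :=
      cd_le_of_subset fun z hz => mem_insM.2 (.inr (mem_singM.1 hz))
    rcases hL.2.2.2 _ (hL.insM_belowM_mem hyL) _ hu with k | k
    · have := mem_singM.1 (k j (mem_insM.2 (.inl hj)))
      exact (not_mem_belowM (this ▸ hj)).elim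
    · obtain ⟨u, hu', hju, hyu⟩ := mem_belowM.1 hj
      rcases hL.2.2.2 u hu' _ hu with k' | k'
      · exact (hyu (mem_singM.1 (k' j hju) ▸ hju)).elim
      · exact (hyu (k' y hy)).elim
  · intro c ih hc
    obtain ⟨x, hx, rfl⟩ := ih (lt_of_le_of_lt le_self_add hc)
    rcases hL.2.2.1 _ (hL.insM_belowM_mem hx) with h | ⟨z, hz, hzu, hins⟩
    · rw [← cd_insM_belowM, h] at hc
      exact (lt_irrefl _ hc).elim
    · refine ⟨z, hz, le_antisymm ?_ ?_⟩
      · have h1 : insM (belowM L z) z ⊆ insM (insM (belowM L x) x) z := by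
          intro j hj
          rcases mem_insM.1 hj with hj | hj
          · obtain ⟨u, hu, hju, hzu'⟩ := mem_belowM.1 hj
            rcases hL.2.2.2 u hu _ hins with k | k
            · exact k j hju
            · exact (hzu' (k z (mem_insM.2 (.inr rfl)))).elim
          · exact mem_insM.2 (.inr hj)
        have := cd_le_of_subset h1
        rwa [cd_insM_belowM, Cd.cd_insM hzu, cd_insM_belowM, add_le_add_iff_right] at this
      · rw [← cd_insM_belowM]
        exact cd_le_of_subset fun j hj => mem_belowM.2 ⟨_, hL.insM_belowM_mem hx, hj, hzu⟩

theorem mem_iff (hL : IsOrd L) : u ∈ L ↔ ∃ x ∈ unionM L, u = insM (belowM L x) x := by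
  constructor
  · intro hu
    have hne : cd u ≠ 0 := fun h => hL.1 (Cd.cd_eq_zero.1 h ▸ hu)
    obtain ⟨c, hc⟩ := Cd.exists_eq_succ hne
    have hlt : c < len L := Cd.succ_le.1 (hc ▸ cd_le_of_subset fun y hy => mem_unionM_of_mem hu hy)
    obtain ⟨x, hx, rfl⟩ := hL.exists_rk hlt
    exact ⟨x, hx, hL.eq_of_cd_eq hu (hL.insM_belowM_mem hx) (by rw [cd_insM_belowM, hc])⟩
  · rintro ⟨x, hx, rfl⟩
    exact hL.insM_belowM_mem hx

/-- A linear ordering has as many initial segments as terms. -/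
theorem cd_eq_len (hL : IsOrd L) : cd L = len L := by
  have e : L = imgM (unionM L) fun x => insM (belowM L x) x := EA.ext fun u => by
    rw [mem_imgM, hL.mem_iff]
  conv_lhs => rw [e]
  refine cd_imgM _ fun x hx y hy h => hL.rk_inj hx hy ?_
  have := congrArg cd h
  rwa [cd_insM_belowM, cd_insM_belowM, add_left_inj] at this

theorem len_eq_zero (hL : IsOrd L) : len L = 0 ↔ L = ∅ := by rw [← hL.cd_eq_len, Cd.cd_eq_zero]

theorem belowM_eq (hL : IsOrd L) (hx : x ∈ unionM L) :
    belowM L x = sepM (unionM L) fun y => rk L y < rk L x := EA.ext fun y => by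
  rw [belowM, mem_sepM, mem_sepM]
  exact and_congr_right fun hy => hL.ordLt_iff hy hx

theorem mem_belowM_iff (hL : IsOrd L) (hx : x ∈ unionM L) :
    y ∈ belowM L x ↔ y ∈ unionM L ∧ rk L y < rk L x := by
  rw [hL.belowM_eq hx, mem_sepM]

theorem cd_sepM_rk_lt (hL : IsOrd L) (hc : c ≤ len L) :
    cd (sepM (unionM L) fun x => rk L x < c) = c :=
  cd_sepM_lt (fun x => rk L x) (fun _ hx _ hy h => hL.rk_inj hx hy h)
    fun _ hd => hL.exists_rk (hd.trans_le hc)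

theorem firstM_eq (hL : IsOrd L) (hx : x ∈ unionM L) (h : rk L x = 0) : firstM L = x :=
  theM_eq hx (fun b hb => by rw [hL.ordLt_iff hb hx, h]; exact not_lt_zero) fun b hb hmin => by
    have := hmin x hx
    rw [hL.ordLt_iff hx hb, h, not_lt, nonpos_iff_eq_zero] at this
    exact hL.rk_inj hb hx (this.trans h.symm)

theorem lastM_eq (hL : IsOrd L) (hx : x ∈ unionM L) (h : rk L x + 1 = len L) : lastM L = x :=
  theM_eq hx (fun b hb => by
    rw [hL.ordLt_iff hx hb, not_lt, ← Cd.lt_succ_iff, h]; exact rk_lt_len hb) fun b hb hmin => by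
    have h1 := hmin x hx
    rw [hL.ordLt_iff hb hx, not_lt] at h1
    have h2 := rk_lt_len hb
    rw [← h, Cd.lt_succ_iff] at h2
    exact hL.rk_inj hb hx (le_antisymm h2 h1)

theorem firstM_spec (hL : IsOrd L) (hne : L ≠ ∅) :
    firstM L ∈ unionM L ∧ rk L (firstM L) = 0 := by
  obtain ⟨x, hx, h⟩ := hL.exists_rk (c := 0) (pos_iff_ne_zero.2 fun h => hne (hL.len_eq_zero.1 h))
  rw [hL.firstM_eq hx h]; exact ⟨hx, h⟩

theorem lastM_spec (hL : IsOrd L) (hne : L ≠ ∅) :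
    lastM L ∈ unionM L ∧ rk L (lastM L) + 1 = len L := by
  obtain ⟨c, hc⟩ := Cd.exists_eq_succ fun h => hne (hL.len_eq_zero.1 h)
  obtain ⟨x, hx, h⟩ := hL.exists_rk (c := c) (hc ▸ Cd.lt_succ_iff.2 le_rfl)
  rw [hL.lastM_eq hx (by rw [h, hc])]; exact ⟨hx, by rw [h, hc]⟩

theorem eq_lastM_iff (hL : IsOrd L) (hx : x ∈ unionM L) : x = lastM L ↔ rk L x + 1 = len L := by
  refine ⟨?_, fun h => (hL.lastM_eq hx h).symm⟩
  intro h
  rw [h]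
  exact (hL.lastM_spec (by rintro rfl; rw [unionM_empty] at hx; exact not_mem_empty x hx)).2

theorem nextM_eq (hL : IsOrd L) (hx : x ∈ unionM L) (hy : y ∈ unionM L)
    (h : rk L y = rk L x + 1) : nextM L x = y := by
  have hlast : x ≠ lastM L := fun e => by
    have := rk_lt_len hy
    rw [h, (hL.eq_lastM_iff hx).1 e] at this
    exact lt_irrefl _ this
  refine theM_eq hy (.inr ⟨?_, fun z hz hxz => ?_⟩) fun b hb hmin => ?_
  · rw [hL.ordLt_iff hx hy, h]; exact Cd.lt_succ_iff.2 le_rfl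
  · rw [hL.ordLt_iff hx hz] at hxz
    rw [hL.ordLt_iff hz hy, h, not_lt]; exact Cd.succ_le.2 hxz
  · rcases hmin with ⟨e, _⟩ | ⟨h1, h2⟩
    · exact (hlast e).elim
    · have h3 := h2 y hy ((hL.ordLt_iff hx hy).2 (h ▸ Cd.lt_succ_iff.2 le_rfl))
      rw [hL.ordLt_iff hy hb, not_lt, h] at h3
      rw [hL.ordLt_iff hx hb] at h1
      exact hL.rk_inj hb hy (h ▸ le_antisymm h3 (Cd.succ_le.2 h1))

theorem nextM_spec (hL : IsOrd L) (hx : x ∈ unionM L) (h : rk L x + 1 ≠ len L) :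
    nextM L x ∈ unionM L ∧ rk L (nextM L x) = rk L x + 1 := by
  obtain ⟨y, hy, hr⟩ := hL.exists_rk ((Cd.succ_le.2 (rk_lt_len hx)).lt_of_ne h)
  rw [hL.nextM_eq hx hy hr]; exact ⟨hy, hr⟩

/-- A linear ordering contained in another one is an initial segment of it. -/
theorem belowM_of_sub (hL : IsOrd L) (hK : IsOrd K) (h : K ⊆ L) (hx : x ∈ unionM K) :
    belowM K x = belowM L x := EA.ext fun j => by
  constructor
  · intro hj
    obtain ⟨u, hu, h'⟩ := mem_belowM.1 hj
    exact mem_belowM.2 ⟨u, h u hu, h'⟩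
  · intro hj
    obtain ⟨u, hu, hju, hxu⟩ := mem_belowM.1 hj
    rcases hL.2.2.2 u hu _ (h _ (hK.insM_belowM_mem hx)) with k | k
    · rcases mem_insM.1 (k j hju) with h' | rfl
      · exact h'
      · exact (hxu hju).elim
    · exact (hxu (k x (mem_insM.2 (.inr rfl)))).elim

theorem rk_of_sub (hL : IsOrd L) (hK : IsOrd K) (h : K ⊆ L) (hx : x ∈ unionM K) :
    rk K x = rk L x := by rw [rk, hL.belowM_of_sub hK h hx, rk]

theorem unionM_sub (h : K ⊆ L) : unionM K ⊆ unionM L := fun x hx => by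
  obtain ⟨u, hu, hxu⟩ := mem_unionM.1 hx
  exact mem_unionM_of_mem (h u hu) hxu

theorem len_le_of_sub (h : K ⊆ L) : len K ≤ len L := cd_le_of_subset (unionM_sub h)

theorem mem_unionM_of_sub (hL : IsOrd L) (hK : IsOrd K) (h : K ⊆ L) :
    x ∈ unionM K ↔ x ∈ unionM L ∧ rk L x < len K := by
  constructor
  · intro hx
    exact ⟨unionM_sub h x hx, hL.rk_of_sub hK h hx ▸ rk_lt_len hx⟩
  · rintro ⟨hx, hr⟩
    obtain ⟨y, hy, hxy⟩ := hK.exists_rk hr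
    rw [hL.rk_of_sub hK h hy] at hxy
    rwa [hL.rk_inj hx (unionM_sub h y hy) hxy.symm]

theorem sub_of_len_le (hL : IsOrd L) {K' : M} (hK : IsOrd K) (hK' : IsOrd K') (h : K ⊆ L)
    (h' : K' ⊆ L) (hlen : len K ≤ len K') : K ⊆ K' := fun u hu => by
  obtain ⟨x, hx, rfl⟩ := hK.mem_iff.1 hu
  have hx' : x ∈ unionM K' := by
    obtain ⟨h1, h2⟩ := (hL.mem_unionM_of_sub hK h).1 hx
    exact (hL.mem_unionM_of_sub hK' h').2 ⟨h1, h2.trans_le hlen⟩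
  rw [hL.belowM_of_sub hK h hx, ← hL.belowM_of_sub hK' h' hx']
  exact hK'.insM_belowM_mem hx'

end IsOrd

/-- The initial segment of `L` of length `c`. -/
noncomputable def segM (L : M) (c : Cd M) : M := sepM L fun u => cd u ≤ c

theorem mem_segM : u ∈ segM L c ↔ u ∈ L ∧ cd u ≤ c := by rw [segM, mem_sepM]

theorem segM_sub : segM L c ⊆ L := fun _ h => (mem_segM.1 h).1

theorem IsOrd.mem_unionM_segM (hL : IsOrd L) :
    x ∈ unionM (segM L c) ↔ x ∈ unionM L ∧ rk L x < c := by
  constructor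
  · intro h
    obtain ⟨u, hu, hx⟩ := mem_unionM.1 h
    obtain ⟨huL, huc⟩ := mem_segM.1 hu
    refine ⟨mem_unionM_of_mem huL hx, Cd.succ_le.1 (le_trans ?_ huc)⟩
    obtain ⟨y, hy, rfl⟩ := hL.mem_iff.1 huL
    rw [cd_insM_belowM, add_le_add_iff_right]
    rcases mem_insM.1 hx with hx | rfl
    · exact ((hL.mem_belowM_iff hy).1 hx).2.le
    · exact le_rfl
  · rintro ⟨hx, hr⟩
    exact mem_unionM_of_mem (mem_segM.2 ⟨hL.insM_belowM_mem hx, by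
      rw [cd_insM_belowM]; exact Cd.succ_le.2 hr⟩) (mem_insM.2 (.inr rfl))

theorem IsOrd.unionM_segM (hL : IsOrd L) :
    unionM (segM L c) = sepM (unionM L) fun x => rk L x < c := EA.ext fun x => by
  rw [hL.mem_unionM_segM, mem_sepM]

theorem IsOrd.len_segM (hL : IsOrd L) (hc : c ≤ len L) : len (segM L c) = c := by
  rw [len, hL.unionM_segM, hL.cd_sepM_rk_lt hc]

theorem IsOrd.segM (hL : IsOrd L) : IsOrd (segM L c) := by
  refine ⟨fun h => hL.1 (mem_segM.1 h).1, fun hne => ?_, fun u hu => ?_,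
    fun u hu w hw => hL.2.2.2 u (mem_segM.1 hu).1 w (mem_segM.1 hw).1⟩
  · have hex : ∃ u, u ∈ EA.segM L c := by
      by_contra h
      push Not at h
      exact hne (EA.ext fun u => ⟨fun hu => (h u hu).elim, fun hu => (not_mem_empty u hu).elim⟩)
    obtain ⟨u, hu⟩ := hex
    obtain ⟨huL, huc⟩ := mem_segM.1 hu
    obtain ⟨w, hw, y, hy, rfl⟩ := hL.2.1 fun h => not_mem_empty u (h ▸ huL)
    refine ⟨_, mem_segM.2 ⟨hw, le_trans ?_ huc⟩, y, hy, rfl⟩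
    rw [Cd.cd_singM, Cd.one_le]
    exact fun h => hL.1 (Cd.cd_eq_zero.1 h ▸ huL)
  · obtain ⟨huL, huc⟩ := mem_segM.1 hu
    by_cases h : cd u = c
    · left
      obtain ⟨x, hx, rfl⟩ := hL.mem_iff.1 huL
      refine EA.ext fun y => ?_
      rw [hL.mem_unionM_segM, mem_insM, hL.mem_belowM_iff hx, ← h, cd_insM_belowM, Cd.lt_succ_iff]
      constructor
      · rintro (h | rfl)
        · exact ⟨h.1, h.2.le⟩
        · exact ⟨hx, le_rfl⟩
      · rintro ⟨hy, hr⟩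
        rcases hr.lt_or_eq with hr | hr
        · exact .inl ⟨hy, hr⟩
        · exact .inr (hL.rk_inj hy hx hr)
    · rcases hL.2.2.1 u huL with h' | ⟨y, hy, hyu, hins⟩
      · left
        refine EA.ext fun y => ⟨fun hy => mem_unionM_of_mem hu hy, fun hy => ?_⟩
        rw [h']; exact IsOrd.unionM_sub segM_sub y hy
      · have hm : insM u y ∈ EA.segM L c := mem_segM.2 ⟨hins, by
          rw [Cd.cd_insM hyu]; exact Cd.succ_le.2 (huc.lt_of_ne h)⟩
        exact .inr ⟨y, mem_unionM_of_mem hm (mem_insM.2 (.inr rfl)), hyu, hm⟩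

theorem IsOrd.sub_segM (hL : IsOrd L) (hK : IsOrd K) (h : K ⊆ L) : K = EA.segM L (len K) := by
  have h1 := hL.len_segM (len_le_of_sub h)
  exact sub_antisymm (hL.sub_of_len_le hK hL.segM h segM_sub h1.ge)
    (hL.sub_of_len_le hL.segM hK segM_sub h h1.le)

section Snoc

theorem mem_snocM : u ∈ snocM L a ↔ u ∈ L ∨ u = insM (unionM L) a := by rw [snocM, mem_insM]

theorem unionM_snocM : unionM (snocM L a) = insM (unionM L) a := EA.ext fun x => by
  simp only [mem_unionM (a := snocM L a), mem_snocM]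
  constructor
  · rintro ⟨u, hu | rfl, hx⟩
    · exact mem_insM.2 (.inl (IsOrd.mem_unionM_of_mem hu hx))
    · exact hx
  · exact fun h => ⟨_, .inr rfl, h⟩

theorem sub_snocM : L ⊆ snocM L a := fun _ h => mem_snocM.2 (.inl h)

theorem IsOrd.snocM (hL : IsOrd L) (ha : a ∉ unionM L) : IsOrd (snocM L a) := by
  have hsub : ∀ u ∈ L, u ⊆ insM (unionM L) a := fun u hu x hx =>
    mem_insM.2 (.inl (mem_unionM_of_mem hu hx))
  refine ⟨fun h => ?_, fun _ => ?_, fun u hu => ?_, fun u hu w hw => ?_⟩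
  · rcases mem_snocM.1 h with h | h
    · exact hL.1 h
    · exact not_mem_empty a (h ▸ mem_insM.2 (.inr rfl))
  · by_cases h : L = ∅
    · subst h
      refine ⟨_, mem_snocM.2 (.inr rfl), a, mem_insM.2 (.inr rfl), EA.ext fun x => ?_⟩
      simp [unionM_empty]
    · obtain ⟨w, hw, y, hy, e⟩ := hL.2.1 h
      exact ⟨w, mem_snocM.2 (.inl hw), y, hy, e⟩
  · rw [unionM_snocM]
    rcases mem_snocM.1 hu with hu | hu
    · refine .inr ?_
      rcases hL.2.2.1 u hu with h | ⟨y, hy, hyu, hins⟩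
      · exact ⟨a, mem_insM.2 (.inr rfl), h ▸ ha, mem_snocM.2 (.inr (by rw [h]))⟩
      · exact ⟨y, mem_insM.2 (.inl hy), hyu, mem_snocM.2 (.inl hins)⟩
    · exact .inl hu
  · rcases mem_snocM.1 hu with hu | rfl <;> rcases mem_snocM.1 hw with hw | rfl
    · exact hL.2.2.2 u hu w hw
    · exact .inl (hsub u hu)
    · exact .inr (hsub w hw)
    · exact .inl fun _ h => h

theorem len_snocM (ha : a ∉ unionM L) : len (snocM L a) = len L + 1 := by
  rw [len, unionM_snocM, Cd.cd_insM ha, len]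

theorem rk_snocM (ha : a ∉ unionM L) : rk (snocM L a) a = len L := by
  rw [rk, len]
  congr 1
  refine EA.ext fun x => ?_
  rw [mem_belowM]
  constructor
  · rintro ⟨u, hu, hxu, hau⟩
    rcases mem_snocM.1 hu with hu | rfl
    · exact IsOrd.mem_unionM_of_mem hu hxu
    · exact (hau (mem_insM.2 (.inr rfl))).elim
  · intro hx
    obtain ⟨u, hu, hxu⟩ := mem_unionM.1 hx
    exact ⟨u, mem_snocM.2 (.inl hu), hxu, fun h => ha (IsOrd.mem_unionM_of_mem hu h)⟩

end Snoc

/-- A definable function `G` with cardinal values that takes each value once, and together with a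
value all smaller ones, is the rank function of a linear ordering of `D`. -/
theorem ordOfM_spec {D : M} (G : M → Cd M) [DC fun v : Fin 1 → M => G (v 0)] {le : M → M → Prop}
    [DP2 le] (hle : ∀ x ∈ D, ∀ y ∈ D, le x y ↔ G x ≤ G y)
    (hinj : ∀ x ∈ D, ∀ y ∈ D, G x = G y → x = y)
    (hdown : ∀ x ∈ D, ∀ c, c < G x → ∃ y, y ∈ D ∧ G y = c) :
    IsOrd (ordOfM D le) ∧ unionM (ordOfM D le) = D ∧ ∀ x ∈ D, rk (ordOfM D le) x = G x := by
  have := fun n => DC.app (n := n) G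
  have := fun n => DP.app2 (n := n) le
  have hmem : ∀ u, u ∈ ordOfM D le ↔ ∃ x ∈ D, u = sepM D fun y => G y < G x + 1 := by
    intro u
    rw [ordOfM, mem_imgM]
    refine exists_congr fun x => and_congr_right fun hx => ?_
    rw [show sepM D (fun y => le y x) = sepM D fun y => G y < G x + 1 from EA.ext fun y => by
      rw [mem_sepM, mem_sepM, Cd.lt_succ_iff]
      exact and_congr_right fun hy => hle y hy x hx]
  have hun : unionM (ordOfM D le) = D := EA.ext fun x => by
    rw [mem_unionM]
    constructor
    · rintro ⟨u, hu, hx⟩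
      obtain ⟨y, _, rfl⟩ := (hmem u).1 hu
      exact (mem_sepM.1 hx).1
    · exact fun hx => ⟨_, (hmem _).2 ⟨x, hx, rfl⟩, mem_sepM.2 ⟨hx, Cd.lt_succ_iff.2 le_rfl⟩⟩
  refine ⟨⟨fun h => ?_, fun hne => ?_, fun u hu => ?_, fun u hu w hw => ?_⟩, hun, fun x hx => ?_⟩
  · obtain ⟨x, hx, e⟩ := (hmem _).1 h
    exact not_mem_empty x (e ▸ mem_sepM.2 ⟨hx, Cd.lt_succ_iff.2 le_rfl⟩)
  · have hex : ∃ u, u ∈ ordOfM D le := by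
      by_contra h
      push Not at h
      exact hne (EA.ext fun u => ⟨fun hu => (h u hu).elim, fun hu => (not_mem_empty u hu).elim⟩)
    obtain ⟨u, hu⟩ := hex
    obtain ⟨x, hx, rfl⟩ := (hmem _).1 hu
    have h0 : ∃ y ∈ D, G y = 0 := by
      by_cases h : G x = 0
      · exact ⟨x, hx, h⟩
      · exact hdown x hx 0 (pos_iff_ne_zero.2 h)
    obtain ⟨y, hy, hy0⟩ := h0
    refine ⟨_, (hmem _).2 ⟨y, hy, rfl⟩, y, mem_sepM.2 ⟨hy, Cd.lt_succ_iff.2 le_rfl⟩, ?_⟩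
    refine EA.ext fun z => ?_
    rw [mem_sepM, mem_singM, hy0, Cd.lt_succ_iff, nonpos_iff_eq_zero, ← hy0]
    exact ⟨fun h => hinj z h.1 y hy h.2, fun h => ⟨h ▸ hy, by rw [h]⟩⟩
  · obtain ⟨x, hx, rfl⟩ := (hmem _).1 hu
    rw [hun]
    by_cases h : ∃ y ∈ D, G y = G x + 1
    · obtain ⟨y, hy, hxy⟩ := h
      refine .inr ⟨y, hy, fun h => ?_, ?_⟩
      · exact absurd (mem_sepM.1 h).2 (by rw [hxy]; exact lt_irrefl _)
      · rw [← hxy, ← sepM_lt_succ G hinj hy]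
        exact (hmem _).2 ⟨y, hy, rfl⟩
    · refine .inl (EA.ext fun z => ?_)
      rw [mem_sepM]
      refine ⟨fun h => h.1, fun hz => ⟨hz, lt_of_not_ge fun hge => h ?_⟩⟩
      rcases hge.eq_or_lt with e | hlt
      · exact ⟨z, hz, e.symm⟩
      · exact hdown z hz _ hlt
  · obtain ⟨x, hx, rfl⟩ := (hmem _).1 hu
    obtain ⟨y, hy, rfl⟩ := (hmem _).1 hw
    rcases le_total (G x) (G y) with h | h
    · refine .inl fun z hz => ?_
      rw [mem_sepM] at hz ⊢
      exact ⟨hz.1, hz.2.trans_le (by gcongr)⟩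
    · refine .inr fun z hz => ?_
      rw [mem_sepM] at hz ⊢
      exact ⟨hz.1, hz.2.trans_le (by gcongr)⟩
  · rw [rk]
    have e : belowM (ordOfM D le) x = sepM D fun y => G y < G x := EA.ext fun y => by
      rw [mem_belowM, mem_sepM]
      constructor
      · rintro ⟨u, hu, hyu, hxu⟩
        obtain ⟨z, hz, rfl⟩ := (hmem _).1 hu
        rw [mem_sepM] at hyu hxu
        refine ⟨hyu.1, hyu.2.trans_le (Cd.succ_le.2 (lt_of_not_ge fun h => hxu ⟨hx, ?_⟩))⟩
        exact Cd.lt_succ_iff.2 h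
      · rintro ⟨hy, h⟩
        refine ⟨_, (hmem _).2 ⟨y, hy, rfl⟩, mem_sepM.2 ⟨hy, Cd.lt_succ_iff.2 le_rfl⟩, fun h' => ?_⟩
        exact absurd (Cd.lt_succ_iff.1 (mem_sepM.1 h').2) (not_le_of_gt h)
    rw [e]
    exact cd_sepM_lt G hinj fun d hd => hdown x hx d hd

end Orderings

/-! ### Local cardinals and logarithms in a model -/

section LocalCardinals

variable {M : Type} [EAModel M] {n : ℕ} {a x y S : M} {c : Cd M}

/-- The class of the proper subsets of `a` that are equivalent to `x`. -/
noncomputable def classM (a x : M) : M := sepM (sepM (powM a) fun x => x ≠ a) fun y => CEq y x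

theorem mem_classM : y ∈ classM a x ↔ (y ⊆ a ∧ y ≠ a) ∧ cd y = cd x := by
  simp only [classM, mem_sepM, mem_powM, cd_eq]

instance (f g : (Fin n → M) → M) [DF f] [DF g] : DF fun v => classM (f v) (g v) := by
  unfold classM; infer_instance

theorem mem_cardClassesM {p : M} : p ∈ cardClassesM a ↔ ∃ x, (x ⊆ a ∧ x ≠ a) ∧ p = classM a x := by
  have h : cardClassesM a = imgM (sepM (powM a) fun x => x ≠ a) fun x => classM a x := rfl
  rw [h, mem_imgM]
  simp only [mem_sepM, mem_powM]

/-- There are as many classes of subsets of size less than `c` as there are numbers less than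
`c`. -/
theorem cd_sepM_cardClassesM (hc : c ≤ cd a) :
    cd (sepM (cardClassesM a) fun p => ∃ w, w ∈ p ∧ cd w < c) = c := by
  revert hc
  refine Cd.ind (fun c => c ≤ cd a →
    cd (sepM (cardClassesM a) fun p => ∃ w, w ∈ p ∧ cd w < c) = c) ?_ ?_ c
  · intro _
    rw [Cd.cd_eq_zero]
    refine ext fun p => ⟨fun h => ?_, fun h => (not_mem_empty p h).elim⟩
    obtain ⟨_, w, _, h⟩ := mem_sepM.1 h
    exact (not_lt_zero h).elim
  · intro c ih hc
    have hlt := Cd.succ_le.1 hc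
    obtain ⟨x, hxa, hx⟩ := exists_subset_cd hlt.le
    have hxne : x ≠ a := fun h => hlt.ne (hx ▸ h ▸ rfl)
    have hself : x ∈ classM a x := mem_classM.2 ⟨⟨hxa, hxne⟩, rfl⟩
    have e : sepM (cardClassesM a) (fun p => ∃ w, w ∈ p ∧ cd w < c + 1) =
        insM (sepM (cardClassesM a) fun p => ∃ w, w ∈ p ∧ cd w < c) (classM a x) := by
      refine ext fun p => ?_
      rw [mem_insM, mem_sepM, mem_sepM]
      constructor
      · rintro ⟨hp, w, hw, hwc⟩
        rcases (Cd.lt_succ_iff.1 hwc).lt_or_eq with h | h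
        · exact .inl ⟨hp, w, hw, h⟩
        · right
          obtain ⟨y, _, rfl⟩ := mem_cardClassesM.1 hp
          refine ext fun z => ?_
          rw [mem_classM, mem_classM, ← (mem_classM.1 hw).2, h, hx]
      · rintro (⟨hp, w, hw, hwc⟩ | rfl)
        · exact ⟨hp, w, hw, hwc.trans_le le_self_add⟩
        · exact ⟨mem_cardClassesM.2 ⟨x, ⟨hxa, hxne⟩, rfl⟩, x, hself, hx ▸ Cd.lt_succ_iff.2 le_rfl⟩
    rw [e, Cd.cd_insM, ih hlt.le]
    intro h
    obtain ⟨_, w, hw, hwc⟩ := mem_sepM.1 h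
    rw [(mem_classM.1 hw).2, hx] at hwc
    exact lt_irrefl _ hwc

/-- The linear ordering of the classes of proper subsets by size. -/
theorem isOrd_cardClassesM (a : M) :
    IsOrd (ordOfM (cardClassesM a) fun p q => ∃ u ∈ p, ∃ w ∈ q, CLe u w) ∧
    len (ordOfM (cardClassesM a) fun p q => ∃ u ∈ p, ∃ w ∈ q, CLe u w) = cd a := by
  let G : M → Cd M := fun p => cd (sepM (cardClassesM a) fun q => ∃ w, w ∈ q ∧
    ∃ u, u ∈ p ∧ cd w < cd u)
  have : DC fun v : Fin 1 → M => G (v 0) := by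
    show DC fun v : Fin 1 → M => cd (sepM (cardClassesM a) fun q => ∃ w, w ∈ q ∧
      ∃ u, u ∈ v 0 ∧ cd w < cd u)
    infer_instance
  have hG : ∀ x, x ⊆ a → x ≠ a → G (classM a x) = cd x := by
    intro x hx hxa
    rw [← cd_sepM_cardClassesM (a := a) (c := cd x) (cd_le_of_subset hx)]
    simp only [G]
    congr 2
    funext q
    refine propext (exists_congr fun w => and_congr_right fun hw => ?_)
    constructor
    · rintro ⟨u, hu, h⟩
      rwa [(mem_classM.1 hu).2] at h
    · exact fun h => ⟨x, mem_classM.2 ⟨⟨hx, hxa⟩, rfl⟩, h⟩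
  have h := ordOfM_spec (D := cardClassesM a) G (le := fun p q => ∃ u ∈ p, ∃ w ∈ q, CLe u w)
    ?_ ?_ ?_
  · refine ⟨h.1, ?_⟩
    rw [len, h.2.1]
    have e : sepM (cardClassesM a) (fun p => ∃ w, w ∈ p ∧ cd w < cd a) = cardClassesM a := by
      refine ext fun p => ?_
      rw [mem_sepM]
      refine ⟨fun h => h.1, fun hp => ⟨hp, ?_⟩⟩
      obtain ⟨x, hx, rfl⟩ := mem_cardClassesM.1 hp
      exact ⟨x, mem_classM.2 ⟨hx, rfl⟩, cd_lt_of_subset hx.1 hx.2⟩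
    conv_lhs => rw [← e]
    exact cd_sepM_cardClassesM le_rfl
  · intro p hp q hq
    obtain ⟨x, hx, rfl⟩ := mem_cardClassesM.1 hp
    obtain ⟨y, hy, rfl⟩ := mem_cardClassesM.1 hq
    rw [hG x hx.1 hx.2, hG y hy.1 hy.2]
    constructor
    · rintro ⟨u, hu, w, hw, h⟩
      rw [← (mem_classM.1 hu).2, ← (mem_classM.1 hw).2]
      exact cd_le.2 h
    · exact fun h => ⟨x, mem_classM.2 ⟨hx, rfl⟩, y, mem_classM.2 ⟨hy, rfl⟩, cd_le.1 h⟩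
  · intro p hp q hq e
    obtain ⟨x, hx, rfl⟩ := mem_cardClassesM.1 hp
    obtain ⟨y, hy, rfl⟩ := mem_cardClassesM.1 hq
    rw [hG x hx.1 hx.2, hG y hy.1 hy.2] at e
    exact ext fun z => by rw [mem_classM, mem_classM, e]
  · intro p hp c hc
    obtain ⟨x, hx, rfl⟩ := mem_cardClassesM.1 hp
    rw [hG x hx.1 hx.2] at hc
    obtain ⟨y, hy, rfl⟩ := exists_subset_cd hc.le
    have hya : y ≠ a := by
      rintro rfl
      exact absurd hc (not_lt_of_ge (cd_le_of_subset hx.1))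
    have hya' : y ⊆ a := fun z hz => hx.1 z (hy z hz)
    exact ⟨classM a y, mem_cardClassesM.2 ⟨y, ⟨hya', hya⟩, rfl⟩, hG y hya' hya⟩

theorem mem_inSegM {L K : M} : K ∈ inSegM L ↔ K ⊆ L ∧ IsOrd K ∧ K ≠ L := by
  simp only [inSegM, mem_sepM, mem_powM]

theorem exists_mem_cardM (hc : c < cd a) : ∃ x ∈ cardM a, cd x = c := by
  obtain ⟨hO, hlen⟩ := isOrd_cardClassesM a
  rw [← hlen] at hc
  refine ⟨segM _ c, mem_inSegM.2 ⟨segM_sub, hO.segM, fun h => ?_⟩, ?_⟩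
  · have := hO.len_segM hc.le
    rw [h] at this
    exact hc.ne this.symm
  · rw [hO.segM.cd_eq_len, hO.len_segM hc.le]

theorem cd_lt_of_mem_cardM (hx : x ∈ cardM a) : cd x < cd a := by
  obtain ⟨hO, hlen⟩ := isOrd_cardClassesM a
  obtain ⟨h1, h2, h3⟩ := mem_inSegM.1 hx
  rw [← hlen, ← hO.cd_eq_len]
  exact cd_lt_of_subset h1 h3

theorem eq_of_mem_cardM (hx : x ∈ cardM a) (hy : y ∈ cardM a) (h : cd x = cd y) : x = y := by
  obtain ⟨hO, _⟩ := isOrd_cardClassesM a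
  obtain ⟨h1, h2, _⟩ := mem_inSegM.1 hx
  obtain ⟨k1, k2, _⟩ := mem_inSegM.1 hy
  rw [h2.cd_eq_len, k2.cd_eq_len] at h
  rw [hO.sub_segM h2 h1, hO.sub_segM k2 k1, h]

theorem theM_empty {P : M → Prop} [DP1 P] : theM (∅ : M) P = ∅ := by
  have := fun n => DP.app (n := n) P
  exact ext fun x => by simp [theM]

theorem cd_logM (hS : 2 ≤ cd S) : cd (logM S a) = Cd.lg (cd S) (cd a) := by
  rcases eq_or_ne (cd a) 0 with h0 | h0
  · have e : sepM (cardM a) (fun x => CLe a (expM S x)) = ∅ := ext fun x => by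
      rw [mem_sepM]
      refine ⟨fun h => ?_, fun h => (not_mem_empty x h).elim⟩
      have := cd_lt_of_mem_cardM h.1
      rw [h0] at this
      exact (not_lt_zero this).elim
    rw [logM, e, minCardM, theM_empty, h0, (Cd.lg_eq_zero hS).2 zero_le]
    rfl
  · obtain ⟨x, hx, hxc⟩ := exists_mem_cardM (Cd.lg_lt_self hS h0)
    have hle : ∀ y, CLe a (expM S y) ↔ Cd.lg (cd S) (cd a) ≤ cd y := fun y => by
      rw [Cd.lg_le_iff hS, ← Cd.cd_expM, cd_le]
    have : logM S a = x := by
      refine theM_eq (mem_sepM.2 ⟨hx, (hle x).2 hxc.ge⟩) (fun y hy => ?_) fun b hb hmin => ?_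
      · rw [← cd_le, hxc]; exact (hle y).1 (mem_sepM.1 hy).2
      · obtain ⟨hb1, hb2⟩ := mem_sepM.1 hb
        refine eq_of_mem_cardM hb1 hx (le_antisymm ?_ ?_)
        · exact cd_le.2 (hmin x (mem_sepM.2 ⟨hx, (hle x).2 hxc.ge⟩))
        · rw [hxc]; exact (hle b).1 hb2
    rw [this, hxc]

end LocalCardinals

/-! ### Numbers of a natural number system -/

section Numbers

variable {M : Type} [EAModel M] {n : ℕ} {z : M} {σ : M → M} {L K x y a : M}

theorem isNum_iff (hL : IsOrd L) : IsNum z σ L ↔ (∀ x ∈ unionM L, rk L x = 0 → x = z) ∧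
    ∀ x ∈ unionM L, ∀ y ∈ unionM L, rk L y = rk L x + 1 → y = σ x := by
  constructor
  · rintro ⟨_, rfl | ⟨hne, hz, hs⟩⟩
    · rw [unionM_empty]
      exact ⟨fun x hx => (not_mem_empty x hx).elim, fun x hx => (not_mem_empty x hx).elim⟩
    · refine ⟨fun x hx h => by rw [← hz, hL.firstM_eq hx h], fun x hx y hy h => ?_⟩
      rw [← hs x hx, hL.nextM_eq hx hy h]
      rw [Ne, hL.eq_lastM_iff hx, ← h]
      exact (rk_lt_len hy).ne
  · rintro ⟨h1, h2⟩
    by_cases hne : L = ∅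
    · exact ⟨hL, .inl hne⟩
    · refine ⟨hL, .inr ⟨hne, h1 _ (hL.firstM_spec hne).1 (hL.firstM_spec hne).2, fun x hx h => ?_⟩⟩
      rw [Ne, hL.eq_lastM_iff hx] at h
      obtain ⟨h3, h4⟩ := hL.nextM_spec hx h
      exact h2 x hx _ h3 h4

namespace IsNum

theorem empty : IsNum z σ (∅ : M) := ⟨isOrd_empty, .inl rfl⟩

theorem of_sub (hL : IsNum z σ L) (hK : IsOrd K) (h : K ⊆ L) : IsNum z σ K := by
  obtain ⟨h1, h2⟩ := (isNum_iff hL.1).1 hL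
  refine (isNum_iff hK).2 ⟨fun x hx hr => ?_, fun x hx y hy hr => ?_⟩
  · exact h1 x (IsOrd.unionM_sub h x hx) (by rw [← hL.1.rk_of_sub hK h hx, hr])
  · exact h2 x (IsOrd.unionM_sub h x hx) y (IsOrd.unionM_sub h y hy)
      (by rw [← hL.1.rk_of_sub hK h hx, ← hL.1.rk_of_sub hK h hy, hr])

theorem eq_of_rk_eq (hL : IsNum z σ L) (hK : IsNum z σ K) (hx : x ∈ unionM L) (hy : y ∈ unionM K)
    (h : rk L x = rk K y) : x = y := by
  obtain ⟨h1, h2⟩ := (isNum_iff hL.1).1 hL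
  obtain ⟨k1, k2⟩ := (isNum_iff hK.1).1 hK
  have key : ∀ c, ∀ x, x ∈ unionM L → ∀ y, y ∈ unionM K → rk L x = c → rk K y = c → x = y := by
    refine fun c => Cd.ind (fun c => ∀ x, x ∈ unionM L → ∀ y, y ∈ unionM K → rk L x = c →
      rk K y = c → x = y) ?_ ?_ c
    · intro x hx y hy hx0 hy0
      rw [h1 x hx hx0, k1 y hy hy0]
    · intro c ih x hx y hy hxc hyc
      have hc : ∀ {L : M} {x : M}, x ∈ unionM L → rk L x = c + 1 → c < len L := fun hx h =>
        lt_of_lt_of_le (h ▸ Cd.lt_succ_iff.2 le_rfl) (rk_lt_len hx).le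
      obtain ⟨x', hx', hxr⟩ := hL.1.exists_rk (hc hx hxc)
      obtain ⟨y', hy', hyr⟩ := hK.1.exists_rk (hc hy hyc)
      rw [h2 x' hx' x hx (by rw [hxc, hxr]), k2 y' hy' y hy (by rw [hyc, hyr]),
        ih x' hx' y' hy' hxr hyr]
  exact key _ x hx y hy rfl h.symm

/-- Of two numbers of a system the shorter one is an initial segment of the other. -/
theorem sub_of_len_le (hL : IsNum z σ L) (hK : IsNum z σ K) (h : len L ≤ len K) : L ⊆ K := by
  have hx : ∀ x ∈ unionM L, x ∈ unionM K ∧ rk K x = rk L x := by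
    intro x hx
    obtain ⟨y, hy, hr⟩ := hK.1.exists_rk ((rk_lt_len hx).trans_le h)
    have e := eq_of_rk_eq hL hK hx hy hr.symm
    subst e
    exact ⟨hy, hr⟩
  intro u hu
  obtain ⟨x, hxL, rfl⟩ := hL.1.mem_iff.1 hu
  suffices belowM L x = belowM K x by
    rw [this]; exact hK.1.insM_belowM_mem (hx x hxL).1
  refine EA.ext fun y => ?_
  rw [hL.1.mem_belowM_iff hxL, hK.1.mem_belowM_iff (hx x hxL).1, (hx x hxL).2]
  constructor
  · rintro ⟨hy, hr⟩
    exact ⟨(hx y hy).1, (hx y hy).2.symm ▸ hr⟩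
  · rintro ⟨hy, hr⟩
    obtain ⟨y', hy', hr'⟩ := hL.1.exists_rk (hr.trans (rk_lt_len hxL))
    have := eq_of_rk_eq hL hK hy' hy hr'
    subst this
    exact ⟨hy', hr'.symm ▸ hr⟩

theorem snocM (hL : IsNum z σ L) (ha : a ∉ unionM L) (h0 : L = ∅ → a = z)
    (hs : L ≠ ∅ → a = σ (lastM L)) : IsNum z σ (snocM L a) := by
  obtain ⟨h1, h2⟩ := (isNum_iff hL.1).1 hL
  have hO := hL.1.snocM ha
  have hrk : ∀ x ∈ unionM L, rk (EA.snocM L a) x = rk L x := fun x hx =>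
    (hO.rk_of_sub hL.1 sub_snocM hx).symm
  have hmem : ∀ x ∈ unionM (EA.snocM L a), x ∈ unionM L ∨ x = a := fun x hx => by
    rwa [unionM_snocM, mem_insM] at hx
  refine (isNum_iff hO).2 ⟨fun x hx hr => ?_, fun x hx y hy hr => ?_⟩
  · rcases hmem x hx with hx | rfl
    · exact h1 x hx (by rw [← hrk x hx, hr])
    · rw [rk_snocM ha, hL.1.len_eq_zero] at hr
      exact h0 hr
  · rcases hmem x hx with hx' | rfl <;> rcases hmem y hy with hy' | rfl
    · exact h2 x hx' y hy' (by rw [← hrk x hx', ← hrk y hy', hr])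
    · rw [rk_snocM ha, hrk x hx'] at hr
      rw [hs (by rintro rfl; rw [unionM_empty] at hx'; exact not_mem_empty x hx'),
        hL.1.lastM_eq hx' hr.symm]
    · rw [rk_snocM ha, hrk y hy'] at hr
      exact absurd (rk_lt_len hy') (not_lt_of_ge (hr ▸ le_self_add))
    · exact absurd hr (Cd.lt_succ_iff.2 le_rfl).ne

end IsNum

end Numbers

/-! ### Numerals -/

section Numerals

variable {M : Type} [EAModel M] {n : ℕ} {S K L f g x y a I : M} {c : Cd M}

/-- The set `S` is a numeration base. -/
structure IsBase (S : M) : Prop where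
  two_le : 2 ≤ cd S
  unique : ∀ x : M, cd x < cd S → ∃ y ∈ S, cd y = cd x ∧ ∀ z ∈ S, cd z = cd x → z = y

namespace IsBase

variable (hS : IsBase S)
include hS

theorem exists_mem (h : c < cd S) : ∃ y ∈ S, cd y = c := by
  obtain ⟨x, rfl⟩ := cd_surj c
  obtain ⟨y, hy, e, _⟩ := hS.unique x h
  exact ⟨y, hy, e⟩

theorem cd_lt (hx : x ∈ S) : cd x < cd S := by
  have key : cd (sepM (sepM S fun y => cd y < cd S) fun y => cd y < cd S) = cd S := by
    refine cd_sepM_lt (fun y => cd y) (fun y hy y' hy' e => ?_) fun d hd => ?_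
    · obtain ⟨w, _, _, hw⟩ := hS.unique y (mem_sepM.1 hy).2
      rw [hw y (mem_sepM.1 hy).1 rfl, hw y' (mem_sepM.1 hy').1 e.symm]
    · obtain ⟨y, hy, e⟩ := hS.exists_mem hd
      exact ⟨y, mem_sepM.2 ⟨hy, e ▸ hd⟩, e⟩
  have e := eq_of_subset_of_cd_le (a := sepM (sepM S fun y => cd y < cd S) fun y => cd y < cd S)
    (fun y hy => (mem_sepM.1 (mem_sepM.1 hy).1).1) key.ge
  rw [← e] at hx
  exact (mem_sepM.1 hx).2

theorem inj (hx : x ∈ S) (hy : y ∈ S) (h : cd x = cd y) : x = y := by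
  obtain ⟨w, _, _, hw⟩ := hS.unique x (hS.cd_lt hx)
  rw [hw x hx rfl, hw y hy h.symm]

theorem pos : 0 < cd S := lt_of_lt_of_le two_pos hS.two_le

theorem one_le : 1 ≤ cd S := Cd.one_le_of_two_le hS.two_le

theorem empty_mem : ∅ ∈ S := by
  obtain ⟨y, hy, e⟩ := hS.exists_mem hS.pos
  rwa [← Cd.cd_eq_zero.1 e]

end IsBase

theorem mem_codeM {p : M} : p ∈ codeM S K f I ↔
    ∃ i ∈ I, p ∈ prodM (singM i) (prodM (valM f i) (expM S (belowM K i))) := by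
  rw [codeM, mem_unionM]
  constructor
  · rintro ⟨y, hy, hp⟩
    obtain ⟨i, hi, rfl⟩ := mem_imgM.1 hy
    exact ⟨i, hi, hp⟩
  · rintro ⟨i, hi, hp⟩
    exact ⟨_, mem_imgM.2 ⟨i, hi, rfl⟩, hp⟩

theorem cd_codeM_insM {i : M} (hi : i ∉ I) :
    cd (codeM S K f (insM I i)) = cd (codeM S K f I) + cd (valM f i) * cd S ^ rk K i := by
  have e : codeM S K f (insM I i) = cupM (codeM S K f I)
      (prodM (singM i) (prodM (valM f i) (expM S (belowM K i)))) := ext fun p => by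
    simp only [mem_cupM, mem_codeM, mem_insM]
    constructor
    · rintro ⟨j, hj | rfl, hp⟩
      · exact .inl ⟨j, hj, hp⟩
      · exact .inr hp
    · rintro (⟨j, hj, hp⟩ | hp)
      · exact ⟨j, .inl hj, hp⟩
      · exact ⟨i, .inr rfl, hp⟩
  rw [e, Cd.cd_cupM, Cd.cd_prodM, Cd.cd_singM, one_mul, Cd.cd_prodM, Cd.cd_expM, rk]
  intro p hp hp'
  obtain ⟨j, hj, hp⟩ := mem_codeM.1 hp
  obtain ⟨u, hu, v, _, rfl⟩ := mem_prodM.1 hp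
  obtain ⟨u', hu', v', _, e⟩ := mem_prodM.1 hp'
  rw [mem_singM] at hu hu'
  rw [opairM_inj, hu, hu'] at e
  exact hi (e.1 ▸ hj)

/-- The number coded by the digits with rank less than `c`. -/
noncomputable def partM (S K f : M) (c : Cd M) : Cd M :=
  cd (codeM S K f (sepM (unionM K) fun i => rk K i < c))

instance (s k g : (Fin n → M) → M) (c : (Fin n → M) → Cd M) [DF s] [DF k] [DF g] [DC c] :
    DC fun v => partM (s v) (k v) (g v) (c v) := by
  unfold partM; infer_instance

theorem partM_zero : partM S K f 0 = 0 := by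
  rw [partM, sepM_lt_zero (fun i => rk K i), Cd.cd_eq_zero]
  refine ext fun p => ⟨fun h => ?_, fun h => (not_mem_empty p h).elim⟩
  obtain ⟨i, hi, _⟩ := mem_codeM.1 h
  exact (not_mem_empty i hi).elim

theorem partM_succ (hK : IsOrd K) (hx : x ∈ unionM K) :
    partM S K f (rk K x + 1) = partM S K f (rk K x) + cd (valM f x) * cd S ^ rk K x := by
  rw [partM, sepM_lt_succ (fun i => rk K i) (fun _ hx _ hy h => hK.rk_inj hx hy h) hx,
    cd_codeM_insM (by simp), partM]

theorem partM_len : partM S K f (len K) = cd (codeM S K f (unionM K)) := by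
  rw [partM]
  congr 2
  refine ext fun x => ?_
  rw [mem_sepM]
  exact ⟨fun h => h.1, fun h => ⟨h, rk_lt_len h⟩⟩

theorem partM_lt (hS : IsBase S) (hK : IsOrd K) (hf : f ∈ expM S (unionM K)) (hc : c ≤ len K) :
    partM S K f c < cd S ^ c := by
  have hf := mem_expM.1 hf
  revert hc
  refine Cd.ind (fun c => c ≤ len K → partM S K f c < cd S ^ c) ?_ ?_ c
  · intro _; rw [partM_zero, Cd.pow_zero]; exact Cd.zero_lt_one'
  · intro c ih hc
    obtain ⟨x, hx, rfl⟩ := hK.exists_rk (Cd.succ_le.1 hc)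
    rw [partM_succ hK hx, Cd.pow_succ]
    have h1 := ih (rk_lt_len hx).le
    have h2 := Cd.succ_le.2 (hS.cd_lt (hf.val_spec hx).1)
    calc _ < cd S ^ rk K x + cd (valM f x) * cd S ^ rk K x := by gcongr
      _ = cd S ^ rk K x * (cd (valM f x) + 1) := by ring
      _ ≤ _ := by gcongr

theorem partM_inj (hS : IsBase S) (hK : IsOrd K) (hf : f ∈ expM S (unionM K))
    (hg : g ∈ expM S (unionM K)) (h : partM S K f (len K) = partM S K g (len K)) : f = g := by
  have hf' := mem_expM.1 hf
  have hg' := mem_expM.1 hg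
  have key : ∀ c, c ≤ len K → partM S K f c = partM S K g c →
      ∀ x, x ∈ unionM K → rk K x < c → valM f x = valM g x := by
    refine fun c => Cd.ind (fun c => c ≤ len K → partM S K f c = partM S K g c →
      ∀ x, x ∈ unionM K → rk K x < c → valM f x = valM g x) ?_ ?_ c
    · exact fun _ _ x _ h => (not_lt_zero h).elim
    · intro c ih hc he x hx hxc
      obtain ⟨y, hy, rfl⟩ := hK.exists_rk (Cd.succ_le.1 hc)
      rw [partM_succ hK hy, partM_succ hK hy] at he
      have hle := (rk_lt_len hy).le
      obtain ⟨h1, h2⟩ := Cd.add_mul_inj (partM_lt hS hK hf hle) (partM_lt hS hK hg hle) he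
      rcases (Cd.lt_succ_iff.1 hxc).lt_or_eq with h | h
      · exact ih hle h1 x hx h
      · rw [hK.rk_inj hx hy h]
        exact hS.inj (hf'.val_spec hy).1 (hg'.val_spec hy).1 h2
  exact hf'.ext hg' fun x hx => key _ le_rfl h x hx (rk_lt_len hx)

theorem exists_partM_eq (hS : IsBase S) (hK : IsOrd K) (hc : c < cd S ^ len K) :
    ∃ f ∈ expM S (unionM K), partM S K f (len K) = c :=
  exists_eq_of_inj (D := expM S (unionM K)) (fun f => partM S K f (len K))
    (fun _ hf _ hg h => partM_inj hS hK hf hg h) (fun _ hf => partM_lt hS hK hf le_rfl) hc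

theorem cd_codedM_mkNumM : cd (codedM S (mkNumM S K f)) = partM S K f (len K) := by
  rw [codedM, partM_len, lenM_mkNumM, digM_mkNumM]

theorem mkNumM_inj {S' K' f' : M} : mkNumM S K f = mkNumM S' K' f' ↔ S = S' ∧ K = K' ∧ f = f' := by
  simp only [mkNumM, opairM_inj]

theorem mem_properM : x ∈ properM S L ↔ ∃ K f, K ⊆ L ∧ IsOrd K ∧ K ≠ ∅ ∧ f ∈ expM S (unionM K) ∧
    (valM f (lastM K) ≠ ∅ ∨ firstM K = lastM K) ∧ x = mkNumM S K f := by
  have hF : ∀ (K : M), DF1 fun f => mkNumM S K f := fun K => inferInstance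
  rw [properM, mem_unionM]
  constructor
  · rintro ⟨y, hy, hx⟩
    obtain ⟨K, hK, rfl⟩ := mem_imgM.1 hy
    rw [mem_imgM] at hx
    obtain ⟨f, hf, rfl⟩ := hx
    simp only [mem_sepM, mem_powM] at hK hf
    exact ⟨K, f, hK.1, hK.2.1, hK.2.2, hf.1, hf.2, rfl⟩
  · rintro ⟨K, f, h1, h2, h3, h4, h5, rfl⟩
    refine ⟨_, mem_imgM.2 ⟨K, ?_, rfl⟩, mem_imgM.2 ⟨f, ?_, rfl⟩⟩
    · exact mem_sepM.2 ⟨mem_powM.2 h1, h2, h3⟩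
    · exact mem_sepM.2 ⟨h4, h5⟩

theorem properM_mono (h : K ⊆ L) : properM S K ⊆ properM S L := by
  intro x hx
  obtain ⟨K', f, h1, h2⟩ := mem_properM.1 hx
  exact mem_properM.2 ⟨K', f, fun u hu => h u (h1 u hu), h2⟩

/-- What it is to be a proper numeral, in terms of its length and of the number coded. -/
theorem properM_bounds (hS : IsBase S) (hx : x ∈ properM S L) :
    IsOrd (lenM x) ∧ lenM x ⊆ L ∧ lenM x ≠ ∅ ∧ x ∈ properM S (lenM x) ∧
    cd (codedM S x) < cd S ^ len (lenM x) ∧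
    ∀ c, len (lenM x) = c + 1 → c ≠ 0 → cd S ^ c ≤ cd (codedM S x) := by
  obtain ⟨K, f, h1, h2, h3, h4, h5, rfl⟩ := mem_properM.1 hx
  rw [lenM_mkNumM, cd_codedM_mkNumM]
  refine ⟨h2, h1, h3, mem_properM.2 ⟨K, f, fun _ h => h, h2, h3, h4, h5, rfl⟩,
    partM_lt hS h2 h4 le_rfl, fun c hc hc0 => ?_⟩
  obtain ⟨hm, hr⟩ := h2.lastM_spec h3
  have hrc : rk K (lastM K) = c := add_right_cancel (hr.trans hc)
  have hne : valM f (lastM K) ≠ ∅ := by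
    refine h5.resolve_right fun e => hc0 ?_
    rw [← hrc, ← e]; exact (h2.firstM_spec h3).2
  rw [← hr, partM_succ h2 hm, hrc]
  have : 1 ≤ cd (valM f (lastM K)) := Cd.one_le.2 fun h => hne (Cd.cd_eq_zero.1 h)
  calc cd S ^ c = 1 * cd S ^ c := (one_mul _).symm
    _ ≤ cd (valM f (lastM K)) * cd S ^ c := by gcongr
    _ ≤ _ := le_add_self

theorem len_le_of_codedM_lt (hS : IsBase S) (hx : x ∈ properM S L) {c : Cd M} (hc : 1 ≤ c)
    (h : cd (codedM S x) < cd S ^ c) : len (lenM x) ≤ c := by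
  obtain ⟨h1, _, h3, _, _, h6⟩ := properM_bounds hS hx
  obtain ⟨d, hd⟩ := Cd.exists_eq_succ fun h => h3 (h1.len_eq_zero.1 h)
  rw [hd, Cd.succ_le]
  by_cases hd0 : d = 0
  · rw [hd0]; exact lt_of_lt_of_le Cd.zero_lt_one' hc
  · exact (Cd.pow_lt_pow_iff_right' hS.two_le).1 (lt_of_le_of_lt (h6 d hd hd0) h)

theorem properM_inj (hS : IsBase S) (hL : IsOrd L) (hx : x ∈ properM S L) (hy : y ∈ properM S L)
    (h : cd (codedM S x) = cd (codedM S y)) : x = y := by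
  have key : ∀ {x y : M}, x ∈ properM S L → y ∈ properM S L →
      cd (codedM S x) = cd (codedM S y) → len (lenM x) ≤ len (lenM y) := by
    intro x y hx hy h
    obtain ⟨k1, _, k3, _, k5, _⟩ := properM_bounds hS hy
    exact len_le_of_codedM_lt hS hx (Cd.one_le.2 fun h => k3 (k1.len_eq_zero.1 h)) (h ▸ k5)
  have hlen := le_antisymm (key hx hy h) (key hy hx h.symm)
  obtain ⟨K, f, h1, h2, _, h4, _, rfl⟩ := mem_properM.1 hx
  obtain ⟨K', f', k1, k2, _, k4, _, rfl⟩ := mem_properM.1 hy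
  simp only [lenM_mkNumM] at hlen
  have e : K = K' := by rw [hL.sub_segM h2 h1, hL.sub_segM k2 k1, hlen]
  subst e
  rw [cd_codedM_mkNumM, cd_codedM_mkNumM] at h
  rw [partM_inj hS h2 h4 k4 h]

theorem exists_properM (hS : IsBase S) (hL : IsOrd L) (hne : L ≠ ∅) (hc : c < cd S ^ len L) :
    ∃ x ∈ properM S L, cd (codedM S x) = c := by
  have hl1 : 1 ≤ len L := Cd.one_le.2 fun h => hne (hL.len_eq_zero.1 h)
  -- the length is the least positive one that suffices for `c`
  obtain ⟨d, hd1, hdL, hcd, hmin⟩ : ∃ d : Cd M, 1 ≤ d ∧ d ≤ len L ∧ c < cd S ^ d ∧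
      ∀ e, d = e + 1 → e ≠ 0 → cd S ^ e ≤ c := by
    refine ⟨max 1 (Cd.lg (cd S) (c + 1)), le_max_left _ _, max_le hl1 ?_, ?_, fun e he he0 => ?_⟩
    · exact (Cd.lg_le_iff hS.two_le).2 (Cd.succ_le.2 hc)
    · exact Cd.succ_le.1 ((Cd.lg_le_iff hS.two_le).1 (le_max_right _ _))
    · have h : e < max 1 (Cd.lg (cd S) (c + 1)) := he ▸ Cd.lt_succ_iff.2 le_rfl
      rcases lt_max_iff.1 h with h | h
      · exact (he0 (Cd.lt_one.1 h)).elim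
      · exact Cd.lt_succ_iff.1 ((Cd.lt_lg_iff hS.two_le).1 h)
  have hlen := hL.len_segM hdL
  have hK := hL.segM (c := d)
  obtain ⟨f, hf, rfl⟩ := exists_partM_eq hS hK (by rw [hlen]; exact hcd)
  have hKne : segM L d ≠ ∅ := fun h => by
    rw [h, len_empty] at hlen
    exact Cd.one_le.1 hd1 hlen.symm
  refine ⟨mkNumM S (segM L d) f, mem_properM.2 ⟨segM L d, f, segM_sub, hK, hKne, hf, ?_, rfl⟩,
    cd_codedM_mkNumM⟩
  obtain ⟨hm, hr⟩ := hK.lastM_spec hKne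
  by_contra hcon
  push Not at hcon
  have h0 : rk (segM L d) (lastM (segM L d)) ≠ 0 := fun h => hcon.2 (hK.firstM_eq hm h)
  have h1 := hmin _ (by rw [hr, hlen]) h0
  rw [← hr, partM_succ hK hm, hcon.1, Cd.cd_empty, zero_mul, add_zero] at h1
  exact absurd (partM_lt hS hK hf (rk_lt_len hm).le) (not_lt_of_ge h1)

/-- In the ordering of the proper numerals the rank is the number coded. -/
theorem numOrdM_spec (hS : IsBase S) (hL : IsOrd L) : IsOrd (numOrdM S L) ∧
    unionM (numOrdM S L) = properM S L ∧
    ∀ x ∈ properM S L, rk (numOrdM S L) x = cd (codedM S x) := by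
  refine ordOfM_spec (fun x => cd (codedM S x)) (fun x _ y _ => cd_le.symm)
    (fun x hx y hy h => properM_inj hS hL hx hy h) fun x hx c hc => ?_
  obtain ⟨h1, h2, h3, _, h5, _⟩ := properM_bounds hS hx
  obtain ⟨y, hy, e⟩ := exists_properM hS h1 h3 (hc.trans h5)
  exact ⟨y, properM_mono h2 y hy, e⟩

theorem codedM_lt (hS : IsBase S) (hx : x ∈ properM S L) :
    cd (codedM S x) < cd S ^ len L := by
  obtain ⟨_, h2, _, _, h5, _⟩ := properM_bounds hS hx
  exact h5.trans_le (Cd.pow_le_pow_right' hS.one_le (IsOrd.len_le_of_sub h2))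

theorem len_numOrdM (hS : IsBase S) (hL : IsOrd L) (hne : L ≠ ∅) :
    len (numOrdM S L) = cd S ^ len L := by
  obtain ⟨h1, h2, h3⟩ := numOrdM_spec hS hL
  refine le_antisymm (le_of_not_gt fun h => ?_) (le_of_not_gt fun h => ?_)
  · obtain ⟨x, hx, hr⟩ := h1.exists_rk h
    rw [h2] at hx
    rw [h3 x hx] at hr
    exact (codedM_lt hS hx).ne hr
  · obtain ⟨x, hx, e⟩ := exists_properM hS hL hne h
    rw [← h3 x hx] at e
    exact (rk_lt_len (h2 ▸ hx)).ne e

end Numerals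

/-! ### One-term orderings and the finite ordinals -/

section Singletons

variable {M : Type} [EAModel M] {n : ℕ} {a b z : M} {σ : M → M}

theorem snocM_empty : snocM ∅ a = singM (singM a) := by
  refine ext fun u => ?_
  rw [mem_snocM, mem_singM, unionM_empty]
  have : insM ∅ a = singM a := ext fun x => by simp
  rw [this]
  simp

theorem not_mem_unionM_empty : a ∉ unionM (∅ : M) := by rw [unionM_empty]; exact not_mem_empty a

theorem isOrd_singM : IsOrd (singM (singM a)) :=
  snocM_empty (a := a) ▸ isOrd_empty.snocM not_mem_unionM_empty

theorem unionM_singM : unionM (singM a) = a := ext fun x => by simp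

theorem len_singM : len (singM (singM a)) = 1 := by
  rw [len, unionM_singM, Cd.cd_singM]

theorem lastM_singM : lastM (singM (singM a)) = a := by
  have := (isOrd_singM (a := a)).lastM_spec (singM_ne_empty _)
  rw [unionM_singM, mem_singM] at this
  exact this.1

theorem firstM_singM : firstM (singM (singM a)) = a := by
  have := (isOrd_singM (a := a)).firstM_spec (singM_ne_empty _)
  rw [unionM_singM, mem_singM] at this
  exact this.1

theorem IsNum.singM : IsNum z σ (singM (singM z)) := by
  rw [← snocM_empty]
  exact IsNum.empty.snocM not_mem_unionM_empty (fun _ => rfl) fun h => (h rfl).elim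

theorem isChain_singM (h : a ∈ b) : IsChain (singM (singM a)) b := by
  refine ⟨isOrd_singM, singM_ne_empty _, by rwa [firstM_singM], fun x hx hne => ?_⟩
  rw [unionM_singM, mem_singM] at hx
  exact (hne (by rw [hx, lastM_singM])).elim

theorem mem_tcM_of_mem (h : a ∈ b) : a ∈ tcM b :=
  mem_tcM.2 ⟨_, isChain_singM h, by rw [unionM_singM, mem_singM]⟩

theorem not_mem_self : a ∉ a := fun h => foundation (mem_tcM_of_mem h) (mem_tcM_of_mem h)

theorem cd_numM (k : ℕ) : cd (numM k : M) = k := by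
  induction k with
  | zero => rw [numM, Nat.cast_zero]; rfl
  | succ k ih => rw [numM, Cd.cd_insM not_mem_self, ih, Nat.cast_succ]

end Singletons

/-! ### Numeral extensions of a natural number system -/

section NumeralExtension

variable {M : Type} [EAModel M] {n : ℕ} {S z x y K X : M} {σ : M → M}

/-- The initial term of a numeral extension. -/
def zeroM (S z : M) : M := mkNumM S (singM (singM z)) (singM (opairM z ∅))

/-- The successor function of a numeral extension. -/
noncomputable def succM (S : M) (σ : M → M) (x : M) : M :=
  nextM (numOrdM S (snocM (lenM x) (σ (lastM (lenM x))))) x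

/-- The pair `z`, `σ` generates a natural number system. -/
def IsNatSys (z : M) (σ : M → M) : Prop := ∀ L, IsNum z σ L → σ (lastM L) ∉ unionM L

theorem zeroM_mem (hS : IsBase S) (hK : singM (singM z) ⊆ K) : zeroM S z ∈ properM S K := by
  refine mem_properM.2 ⟨singM (singM z), _, hK, isOrd_singM, singM_ne_empty _, mem_expM.2 ?_,
    .inr (by rw [firstM_singM, lastM_singM]), rfl⟩
  rw [unionM_singM]
  refine ⟨fun p hp => ?_, fun x hx => ⟨∅, hS.empty_mem, ?_, fun w _ hw => ?_⟩⟩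
  · rw [mem_singM.1 hp]
    exact opairM_mem_prodM.2 ⟨mem_singM.2 rfl, hS.empty_mem⟩
  · rw [mem_singM.1 hx]; exact mem_singM.2 rfl
  · exact (opairM_inj.1 (mem_singM.1 hw)).2

theorem codedM_zeroM (hS : IsBase S) : cd (codedM S (zeroM S z)) = 0 := by
  have hm : z ∈ unionM (singM (singM z)) := by rw [unionM_singM, mem_singM]
  have h := zeroM_mem (z := z) hS fun _ h => h
  obtain ⟨K, f, _, _, _, h4, _, e⟩ := mem_properM.1 h
  obtain ⟨-, e2, e3⟩ := mkNumM_inj.1 e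
  subst e2 e3
  have hr : rk (singM (singM z)) z = 0 := by
    have := rk_lt_len hm
    rwa [len_singM, Cd.lt_one] at this
  have hv : valM (singM (opairM z ∅)) z = ∅ := (mem_expM.1 h4).val_eq (mem_singM.2 rfl)
  rw [zeroM, cd_codedM_mkNumM, len_singM, ← zero_add (1 : Cd M), ← hr, partM_succ isOrd_singM hm,
    hv, hr, partM_zero, Cd.cd_empty, zero_mul, add_zero]

/-- A number of the numeral extension of length `S ^ |K|`. For the empty ordering `K` there are no
numerals, and the ordering with only the initial term serves. -/
noncomputable def backM (S z K : M) : M := iteM (K = ∅) (singM (singM (zeroM S z))) (numOrdM S K)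

/-- The length of the last numeral in `X`, which is a number of the original system of length
`log_S |X|`; orderings with at most one term have logarithm zero. -/
noncomputable def cutM (X : M) : M := iteM (CLe X (numM 1)) ∅ (lenM (lastM X))

variable (hS : IsBase S) (hN : IsNatSys z σ)
include hS hN

/-- The defining property of the successor function at a proper numeral. -/
theorem succM_spec (hx : x ∈ properM S (lenM x)) (hK : IsNum z σ (lenM x)) :
    ∀ y, (y ∈ properM S (snocM (lenM x) (σ (lastM (lenM x)))) ∧
      cd (codedM S y) = cd (codedM S x) + 1) ↔ y = succM S σ x := by
  have hna := hN _ hK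
  have hKne : lenM x ≠ ∅ := (properM_bounds hS hx).2.2.1
  have hK' : IsNum z σ (snocM (lenM x) (σ (lastM (lenM x)))) :=
    hK.snocM hna (fun h => (hKne h).elim) fun _ => rfl
  have hK'ne : snocM (lenM x) (σ (lastM (lenM x))) ≠ ∅ := fun h =>
    not_mem_empty _ (h ▸ mem_snocM.2 (.inr rfl) : insM _ _ ∈ (∅ : M))
  obtain ⟨o1, o2, o3⟩ := numOrdM_spec hS hK'.1
  have hxm : x ∈ properM S (snocM (lenM x) (σ (lastM (lenM x)))) :=
    properM_mono sub_snocM x hx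
  have hlt : rk (numOrdM S (snocM (lenM x) (σ (lastM (lenM x))))) x + 1 ≠
      len (numOrdM S (snocM (lenM x) (σ (lastM (lenM x))))) := by
    rw [o3 x hxm, len_numOrdM hS hK'.1 hK'ne, len_snocM hna]
    refine (lt_of_le_of_lt (Cd.succ_le.2 (codedM_lt hS hx)) ?_).ne
    exact Cd.pow_lt_pow_right' hS.two_le (Cd.lt_succ_iff.2 le_rfl)
  obtain ⟨n1, n2⟩ := o1.nextM_spec (o2 ▸ hxm) hlt
  rw [o2] at n1
  rw [o3 x hxm, o3 _ n1] at n2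
  intro y
  constructor
  · rintro ⟨hy, he⟩
    exact properM_inj hS hK'.1 hy n1 (he.trans n2.symm)
  · rintro rfl
    exact ⟨n1, n2⟩

/-- The terms of a number of a numeral extension are proper numerals whose length is a number of
the original system, and code their own rank. -/
theorem numeral_of_mem [DF1 σ] (hX : IsNum (zeroM S z) (succM S σ) X) (hx : x ∈ unionM X) :
    IsNum z σ (lenM x) ∧ x ∈ properM S (lenM x) ∧ cd (codedM S x) = rk X x := by
  obtain ⟨h0, hs⟩ := (isNum_iff hX.1).1 hX
  have key : ∀ c, ∀ x, x ∈ unionM X → rk X x = c →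
      IsNum z σ (lenM x) ∧ x ∈ properM S (lenM x) ∧ cd (codedM S x) = rk X x := by
    refine fun c => Cd.ind (fun c => ∀ x, x ∈ unionM X → rk X x = c →
      IsNum z σ (lenM x) ∧ x ∈ properM S (lenM x) ∧ cd (codedM S x) = rk X x) ?_ ?_ c
    · intro x hx hr
      rw [hr, h0 x hx hr, codedM_zeroM hS]
      have : lenM (zeroM S z) = singM (singM z) := lenM_mkNumM _ _ _
      rw [this]
      exact ⟨IsNum.singM, zeroM_mem hS fun _ h => h, rfl⟩
    · intro c ih y hy hr
      obtain ⟨x, hx, hxr⟩ := hX.1.exists_rk (c := c)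
        (lt_of_lt_of_le (hr ▸ Cd.lt_succ_iff.2 le_rfl) (rk_lt_len hy).le)
      obtain ⟨i1, i2, i3⟩ := ih x hx hxr
      have hKne : lenM x ≠ ∅ := (properM_bounds hS i2).2.2.1
      obtain ⟨n1, n2⟩ := (succM_spec hS hN i2 i1 y).2 (hs x hx y hy (by rw [hr, hxr]))
      obtain ⟨b1, b2, _, b4, _⟩ := properM_bounds hS n1
      exact ⟨(i1.snocM (hN _ i1) (fun h => (hKne h).elim) fun _ => rfl).of_sub b1 b2, b4,
        by rw [n2, i3, hxr, hr]⟩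
  exact key _ x hx rfl

theorem isNatSys_numeral [DF1 σ] : IsNatSys (zeroM S z) (succM S σ) := by
  intro X hX hmem
  by_cases hne : X = ∅
  · subst hne; exact not_mem_unionM_empty hmem
  obtain ⟨h1, h2⟩ := hX.1.lastM_spec hne
  obtain ⟨i1, i2, i3⟩ := numeral_of_mem hS hN hX h1
  obtain ⟨_, n2⟩ := (succM_spec hS hN i2 i1 _).2 rfl
  rw [(numeral_of_mem hS hN hX hmem).2.2, i3, h2] at n2
  exact (rk_lt_len hmem).ne n2

/-- The ordering of the proper numerals with length contained in a number is a number of the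
numeral extension. -/
theorem isNum_numOrdM (hK : IsNum z σ K) (hne : K ≠ ∅) :
    IsNum (zeroM S z) (succM S σ) (numOrdM S K) := by
  obtain ⟨o1, o2, o3⟩ := numOrdM_spec hS hK.1
  have hlen : 1 ≤ len K := Cd.one_le.2 fun h => hne (hK.1.len_eq_zero.1 h)
  have h0 : singM (singM z) ⊆ K := IsNum.singM.sub_of_len_le hK (by rwa [len_singM])
  refine (isNum_iff o1).2 ⟨fun x hx hr => ?_, fun x hx y hy hr => ?_⟩
  · rw [o2] at hx
    rw [o3 x hx] at hr
    exact properM_inj hS hK.1 hx (zeroM_mem hS h0) (by rw [hr, codedM_zeroM hS])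
  · rw [o2] at hx hy
    rw [o3 x hx, o3 y hy] at hr
    obtain ⟨a1, a2, a3, a4, a5, _⟩ := properM_bounds hS hx
    obtain ⟨b1, b2, _, b4, _⟩ := properM_bounds hS hy
    have hKx : IsNum z σ (lenM x) := hK.of_sub a1 a2
    have hna := hN _ hKx
    refine (succM_spec hS hN a4 hKx y).1 ⟨properM_mono ?_ y b4, hr⟩
    refine (hK.of_sub b1 b2).sub_of_len_le
      (hKx.snocM hna (fun h => (a3 h).elim) fun _ => rfl) ?_
    rw [len_snocM hna]
    refine len_le_of_codedM_lt hS hy le_add_self ?_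
    rw [hr]
    exact lt_of_le_of_lt (Cd.succ_le.2 a5)
      (Cd.pow_lt_pow_right' hS.two_le (Cd.lt_succ_iff.2 le_rfl))

/-- The last numeral of a number of a numeral extension codes the greatest rank, so its length is
the logarithm of the length of the number. -/
theorem lenM_lastM (hX : IsNum (zeroM S z) (succM S σ) X) [DF1 σ] (h : 1 < len X) :
    IsNum z σ (lenM (lastM X)) ∧ len (lenM (lastM X)) = Cd.lg (cd S) (len X) := by
  have hne : X ≠ ∅ := fun e => by
    rw [e, len_empty] at h
    exact not_lt_zero h
  obtain ⟨h1, h2⟩ := hX.1.lastM_spec hne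
  obtain ⟨i1, i2, i3⟩ := numeral_of_mem hS hN hX h1
  obtain ⟨b1, _, b3, _, b5, b6⟩ := properM_bounds hS i2
  refine ⟨i1, le_antisymm ?_ ?_⟩
  · obtain ⟨d, hd⟩ := Cd.exists_eq_succ fun h => b3 (b1.len_eq_zero.1 h)
    rw [hd, Cd.succ_le, Cd.lt_lg_iff hS.two_le]
    by_cases hd0 : d = 0
    · rwa [hd0, Cd.pow_zero]
    · refine lt_of_le_of_lt (b6 d hd hd0) ?_
      rw [i3, ← h2]
      exact Cd.lt_succ_iff.2 le_rfl
  · rw [Cd.lg_le_iff hS.two_le, ← h2, ← i3]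
    exact Cd.succ_le.2 b5

theorem isNum_backM (hK : IsNum z σ K) : IsNum (zeroM S z) (succM S σ) (backM S z K) := by
  by_cases h : K = ∅
  · rw [backM, iteM_pos h]; exact IsNum.singM
  · rw [backM, iteM_neg h]; exact isNum_numOrdM hS hN hK h

omit hN in
theorem len_backM (hK : IsNum z σ K) : len (backM S z K) = cd S ^ len K := by
  by_cases h : K = ∅
  · rw [backM, iteM_pos h, h, len_empty, Cd.pow_zero, len_singM]
  · rw [backM, iteM_neg h, len_numOrdM hS hK.1 h]

theorem isNum_cutM [DF1 σ] (hX : IsNum (zeroM S z) (succM S σ) X) :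
    IsNum z σ (cutM X) ∧ len (cutM X) = Cd.lg (cd S) (len X) := by
  by_cases h : CLe X (numM 1)
  · rw [cutM, iteM_pos h, len_empty]
    refine ⟨.empty, ((Cd.lg_eq_zero hS.two_le).2 ?_).symm⟩
    rw [← cd_le, cd_numM, hX.1.cd_eq_len] at h
    simpa using h
  · rw [cutM, iteM_neg h]
    refine lenM_lastM hS hN hX ?_
    rw [← cd_le, cd_numM, hX.1.cd_eq_len] at h
    simpa using h

end NumeralExtension

/-! ### Closed terms denote sets of standard finite size -/

section HereditarilyFinite

variable {M : Type} [EAModel M] {n : ℕ} {a b c x y : M}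

theorem IsChain.mem_of_rk_zero (h : IsChain c b) (hx : x ∈ unionM c) (h0 : rk c x = 0) : x ∈ b := by
  rw [← h.1.firstM_eq hx h0]; exact h.2.2.1

theorem IsChain.mem_of_rk_succ (h : IsChain c b) (hx : x ∈ unionM c) (hy : y ∈ unionM c)
    (hr : rk c y = rk c x + 1) : y ∈ x := by
  rw [← h.1.nextM_eq hx hy hr]
  refine h.2.2.2 x hx ?_
  rw [Ne, h.1.eq_lastM_iff hx, ← hr]
  exact (rk_lt_len hy).ne

theorem isChain_of_rk (hc : IsOrd c) (hne : c ≠ ∅) (h0 : ∀ x ∈ unionM c, rk c x = 0 → x ∈ b)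
    (hs : ∀ x ∈ unionM c, ∀ y ∈ unionM c, rk c y = rk c x + 1 → y ∈ x) : IsChain c b := by
  refine ⟨hc, hne, h0 _ (hc.firstM_spec hne).1 (hc.firstM_spec hne).2, fun x hx h => ?_⟩
  rw [Ne, hc.eq_lastM_iff hx] at h
  obtain ⟨h1, h2⟩ := hc.nextM_spec hx h
  exact hs x hx _ h1 h2

theorem IsChain.unionM_sub (h : IsChain c b) (hb : b ⊆ a) (ha : ∀ x ∈ a, x ⊆ a) :
    unionM c ⊆ a := by
  have key : ∀ d, ∀ x, x ∈ unionM c → rk c x = d → x ∈ a := by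
    refine fun d => Cd.ind (fun d => ∀ x, x ∈ unionM c → rk c x = d → x ∈ a) ?_ ?_ d
    · exact fun x hx h0 => hb x (h.mem_of_rk_zero hx h0)
    · intro d ih y hy hr
      obtain ⟨x, hx, hxr⟩ := h.1.exists_rk (c := d)
        (lt_of_lt_of_le (hr ▸ Cd.lt_succ_iff.2 le_rfl) (rk_lt_len hy).le)
      exact ha x (ih x hx hxr) y (h.mem_of_rk_succ hx hy (by rw [hr, hxr]))
  exact fun x hx => key _ x hx rfl

theorem cd_pairM_singM : cd (pairM ∅ (singM (∅ : M))) = 2 := by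
  have : pairM ∅ (singM (∅ : M)) = insM (singM ∅) (singM ∅) := ext fun x => by simp
  rw [this, Cd.cd_insM, Cd.cd_singM, one_add_one_eq_two]
  rw [mem_singM]; exact singM_ne_empty _

theorem cd_powM_le (a : M) : cd (powM a) ≤ 2 ^ cd a := by
  rw [← cd_pairM_singM, ← Cd.cd_expM, cd_le]
  have hfun : ∀ x : M, IsFun (lamM a fun u => iteM (u ∈ x) (singM ∅) ∅) a (pairM ∅ (singM ∅)) := by
    refine fun x => lamM_isFun fun u _ => ?_
    by_cases h : u ∈ x
    · rw [iteM_pos h]; simp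
    · rw [iteM_neg h]; simp
  refine .of_fun (fun x => lamM a fun u => iteM (u ∈ x) (singM ∅) ∅)
    (fun x _ => mem_expM.2 (hfun x)) fun x hx y hy e => ?_
  rw [mem_powM] at hx hy
  have key : ∀ u ∈ a, (u ∈ x ↔ u ∈ y) := by
    intro u hu
    have e' := congrArg (valM · u) e
    simp only [valM_lamM hu] at e'
    by_cases h : u ∈ x <;> by_cases h' : u ∈ y
    · exact ⟨fun _ => h', fun _ => h⟩
    · rw [iteM_pos h, iteM_neg h'] at e'; exact (singM_ne_empty _ e').elim
    · rw [iteM_neg h, iteM_pos h'] at e'; exact (singM_ne_empty _ e'.symm).elim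
    · exact ⟨fun k => (h k).elim, fun k => (h' k).elim⟩
  exact ext fun u => ⟨fun h => (key u (hx u h)).1 h, fun h => (key u (hy u h)).2 h⟩

/-- The `i`-th level of the cumulative hierarchy. -/
def levelM (M : Type) [EAModel M] : ℕ → M
  | 0 => ∅
  | i + 1 => powM (levelM M i)

theorem levelM_sub_succ (i : ℕ) : levelM M i ⊆ levelM M (i + 1) := by
  induction i with
  | zero => exact fun x hx => (not_mem_empty x hx).elim
  | succ i ih => exact fun x hx => mem_powM.2 fun y hy => ih y (mem_powM.1 hx y hy)

theorem levelM_mono {i j : ℕ} (h : i ≤ j) : levelM M i ⊆ levelM M j := by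
  induction j, h using Nat.le_induction with
  | base => exact fun _ h => h
  | succ j _ ih => exact fun x hx => levelM_sub_succ j x (ih x hx)

theorem levelM_trans {i : ℕ} (hx : x ∈ levelM M i) : x ⊆ levelM M i := by
  cases i with
  | zero => exact (not_mem_empty x hx).elim
  | succ i => exact fun y hy => levelM_sub_succ i y (mem_powM.1 hx y hy)

theorem mem_levelM_succ {i : ℕ} : x ∈ levelM M (i + 1) ↔ x ⊆ levelM M i := mem_powM

/-- The value of a term at arguments in a fixed level lies in a fixed level. -/
theorem exists_level : {n : ℕ} → (t : Tm n) → (i : ℕ) → ∃ j, ∀ (M : Type) [EAModel M]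
    (v : Fin n → M), (∀ k, v k ∈ levelM M i) → ev t v ∈ levelM M j
  | _, .var k, i => ⟨i, fun M _ v h => by rw [ev_var]; exact h k⟩
  | _, .empty, _ => ⟨1, fun M _ v _ => by
      rw [ev_empty]; exact mem_levelM_succ.2 fun x hx => (not_mem_empty x hx).elim⟩
  | _, .pair s t, i => by
      obtain ⟨j, hj⟩ := exists_level s i
      obtain ⟨k, hk⟩ := exists_level t i
      refine ⟨max j k + 1, fun M _ v h => ?_⟩
      rw [ev_pair]
      refine mem_levelM_succ.2 fun x hx => ?_
      rcases mem_pairM.1 hx with rfl | rfl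
      · exact levelM_mono (le_max_left _ _) _ (hj M v h)
      · exact levelM_mono (le_max_right _ _) _ (hk M v h)
  | _, .pow s, i => by
      obtain ⟨j, hj⟩ := exists_level s i
      refine ⟨j + 2, fun M _ v h => ?_⟩
      rw [ev_pow]
      refine mem_levelM_succ.2 fun x hx => mem_levelM_succ.2 fun y hy => ?_
      exact levelM_trans (hj M v h) y (mem_powM.1 hx y hy)
  | _, .union s, i => by
      obtain ⟨j, hj⟩ := exists_level s i
      refine ⟨j + 1, fun M _ v h => ?_⟩
      rw [ev_union]
      refine mem_levelM_succ.2 fun x hx => ?_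
      obtain ⟨y, hy, hx⟩ := mem_unionM.1 hx
      exact levelM_trans (levelM_trans (hj M v h) y hy) x hx
  | _, .fan s, i => by
      obtain ⟨j, hj⟩ := exists_level s i
      refine ⟨j + 3, fun M _ v h => ?_⟩
      rw [ev_fan]
      refine mem_levelM_succ.2 fun c hc => mem_levelM_succ.2 fun u hu =>
        mem_levelM_succ.2 fun x hx => ?_
      exact (mem_fanM.1 hc).unionM_sub (levelM_trans (hj M v h)) (fun _ => levelM_trans) x
        (IsOrd.mem_unionM_of_mem hu hx)
  | _, .sep s A, i => by
      obtain ⟨j, hj⟩ := exists_level s i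
      refine ⟨j + 1, fun M _ v h => ?_⟩
      exact mem_levelM_succ.2 fun x hx => levelM_trans (hj M v h) x ((mem_ev_sep _ _ _ _).1 hx).1
  | _, .repl t s, i => by
      obtain ⟨j, hj⟩ := exists_level s i
      obtain ⟨k, hk⟩ := exists_level t (max i j)
      refine ⟨k + 1, fun M _ v h => ?_⟩
      refine mem_levelM_succ.2 fun x hx => ?_
      obtain ⟨y, hy, rfl⟩ := (mem_ev_repl _ _ _ _).1 hx
      refine hk M _ fun l => ?_
      refine Fin.cases ?_ (fun l => ?_) l
      · exact levelM_mono (le_max_right _ _) _ (levelM_trans (hj M v h) y hy)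
      · exact levelM_mono (le_max_left _ _) _ (h l)

theorem exists_cd_levelM_le (i : ℕ) : ∃ m : ℕ, ∀ (M : Type) [EAModel M], cd (levelM M i) ≤ m := by
  induction i with
  | zero => exact ⟨0, fun M _ => le_of_eq (by rw [levelM, Cd.cd_empty, Nat.cast_zero])⟩
  | succ i ih =>
    obtain ⟨m, hm⟩ := ih
    refine ⟨2 ^ m, fun M _ => (cd_powM_le _).trans ?_⟩
    rw [Nat.cast_pow, ← Cd.pow_natCast, Nat.cast_ofNat]
    exact Cd.pow_le_pow_right' one_le_two (hm M)

/-- A closed term has a standard number of members, the same bound being good for all models. -/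
theorem exists_cd_closed_le (t : Tm 0) :
    ∃ m : ℕ, ∀ (M : Type) [EAModel M], cd (ev t (Fin.elim0 : Fin 0 → M)) ≤ m := by
  obtain ⟨j, hj⟩ := exists_level t 0
  obtain ⟨m, hm⟩ := exists_cd_levelM_le j
  exact ⟨m, fun M _ => (cd_le_of_subset (levelM_trans (hj M _ fun k => k.elim0))).trans (hm M)⟩

end HereditarilyFinite

/-! ### Global functions and systems, interpreted in models -/

section Semantics

variable {M : Type} [EAModel M] {n : ℕ}

/-- The function on a model given by a unary global function. -/
def fn (φ : Tm 1) (x : M) : M := ev φ fun _ => x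

instance (φ : Tm 1) (f : (Fin n → M) → M) [DF f] : DF fun v => fn φ (f v) := DF.ev1 φ f

/-- The value of a closed term. -/
def cv (M : Type) [EAModel M] (S : Tm 0) : M := ev S (Fin.elim0 : Fin 0 → M)

theorem fn_ap (φ ψ : Tm 1) (x : M) : fn (ap φ ψ) x = fn φ (fn ψ x) := ev_ap _ _ _

/-- The function on cardinal numbers given by an arithmetical global function; for other global
functions its value depends on the choice of a set of the given cardinal number. -/
noncomputable def cf (φ : Tm 1) (c : Cd M) : Cd M := cd (fn φ (cd_surj c).choose)

theorem arithmetical_iff {φ : Tm 1} : Arithmetical φ ↔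
    ∀ (M : Type) [EAModel M] (x y : M), cd x = cd y → cd (fn φ x) = cd (fn φ y) := by
  rw [Arithmetical, proves_iff]
  simp only [forallE, sat_all, sat_imp, sat_cardEq, ev_ap, ev_wk, ev_var, cd_eq, fn]
  rfl

theorem Arithmetical.cd_fn {φ : Tm 1} (h : Arithmetical φ) (x : M) : cd (fn φ x) = cf φ (cd x) :=
  arithmetical_iff.1 h M _ _ (cd_surj (cd x)).choose_spec.symm

/-- A global function is arithmetical if in each model the cardinal number of its value is a
function of that of the argument. -/
theorem arithmetical_of {φ : Tm 1} (F : ∀ (M : Type) [EAModel M], Cd M → Cd M)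
    (h : ∀ (M : Type) [EAModel M] (x : M), cd (fn φ x) = F M (cd x)) :
    Arithmetical φ ∧ ∀ (M : Type) [EAModel M] (c : Cd M), cf φ c = F M c := by
  have hA : Arithmetical φ := arithmetical_iff.2 fun M _ x y e => by rw [h, h, e]
  refine ⟨hA, fun M _ c => ?_⟩
  obtain ⟨x, rfl⟩ := cd_surj c
  rw [← hA.cd_fn, h]

theorem Arithmetical.increasing_iff {φ : Tm 1} (hφ : Arithmetical φ) : Increasing φ ↔
    ∀ (M : Type) [EAModel M] (c d : Cd M), c ≤ d → cf φ c ≤ cf φ d := by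
  rw [Increasing, proves_iff]
  simp only [forallE, sat_all, sat_imp, sat_cardLe, ev_ap, ev_wk, ev_var]
  constructor
  · intro h M _ c d hcd
    obtain ⟨x, rfl⟩ := cd_surj c
    obtain ⟨y, rfl⟩ := cd_surj d
    rw [← hφ.cd_fn, ← hφ.cd_fn]
    exact h M x y hcd
  · intro h M _ x y hxy
    have := h M _ _ (cd_le.2 hxy)
    rw [← hφ.cd_fn, ← hφ.cd_fn] at this
    exact this

theorem Arithmetical.represents_iff {φ η : Tm 1} (hφ : Arithmetical φ) {N N' : IterSystem} :
    Represents η φ N N' ↔ ∀ (M : Type) [EAModel M] (x : M), IsNum (N.z M) N.σ x →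
      IsNum (N'.z M) N'.σ (fn η x) ∧ len (fn η x) = cf φ (len x) := by
  rw [Represents, proves_iff]
  simp only [forallE, sat_all, sat_imp, sat_and, sat_isNumber, sat_cardEq, ev_ap, ev_var]
  refine forall_congr' fun M => forall_congr' fun _ => forall_congr' fun x =>
    forall_congr' fun hx => and_congr_right fun hη => ?_
  change CEq (fn φ x) (fn η x) ↔ _
  have hη : IsNum (N'.z M) N'.σ (fn η x) := hη
  rw [← cd_eq, hφ.cd_fn, hη.1.cd_eq_len]
  have hx : IsNum (N.z M) N.σ x := hx
  rw [hx.1.cd_eq_len, eq_comm]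

theorem Arithmetical.dominatedOn_iff {φ ψ : Tm 1} (hφ : Arithmetical φ) (hψ : Arithmetical ψ)
    {N : IterSystem} : DominatedOn N ψ φ ↔ ∃ m : ℕ, ∀ (M : Type) [EAModel M] (x : M),
      IsNum (N.z M) N.σ x → (m : Cd M) ≤ len x → cf ψ (len x) < cf φ (len x) := by
  refine exists_congr fun m => ?_
  rw [proves_iff]
  simp only [forallE, sat_all, sat_imp, sat_and, sat_isNumber, sat_cardLe, sat_cardLt, ev_ap,
    ev_var, ev_numeral, and_imp]
  refine forall_congr' fun M => forall_congr' fun _ => forall_congr' fun x =>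
    forall_congr' fun hx => ?_
  have hx : IsNum (N.z M) N.σ x := hx
  rw [← hx.1.cd_eq_len, ← hφ.cd_fn, ← hψ.cd_fn, ← cd_numM, cd_le, lt_iff_le_and_ne, cd_le, Ne,
    cd_eq]
  rfl

theorem fn_var (x : M) : fn (.var 0) x = x := ev_var _ _

theorem cf_var : Arithmetical (.var 0) ∧ ∀ (M : Type) [EAModel M] (c : Cd M), cf (.var 0) c = c :=
  arithmetical_of (fun _ _ c => c) fun M _ x => by rw [fn_var]

theorem Arithmetical.ap {φ ψ : Tm 1} (hφ : Arithmetical φ) (hψ : Arithmetical ψ) :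
    Arithmetical (ap φ ψ) ∧
      ∀ (M : Type) [EAModel M] (c : Cd M), cf (EA.ap φ ψ) c = cf φ (cf ψ c) :=
  arithmetical_of (fun _ _ c => cf φ (cf ψ c)) fun M _ x => by rw [fn_ap, hφ.cd_fn, hψ.cd_fn]

theorem Arithmetical.iterate {φ : Tm 1} (hφ : Arithmetical φ) (k : ℕ) :
    Arithmetical (iterate φ k) ∧
      ∀ (M : Type) [EAModel M] (c : Cd M), cf (EA.iterate φ k) c = (cf φ)^[k] c := by
  induction k with
  | zero => exact cf_var
  | succ k ih =>
    obtain ⟨h1, h2⟩ := hφ.ap ih.1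
    refine ⟨h1, fun M _ c => ?_⟩
    rw [Function.iterate_succ_apply', ← ih.2]
    exact h2 M c

theorem isNatSystem_iff {N : IterSystem} : N.IsNatSystem ↔
    ∀ (M : Type) [EAModel M], IsNatSys (N.z M) N.σ := by
  rw [IterSystem.IsNatSystem, proves_iff]
  simp only [forallE, sat_all, sat_imp, sat_isNumber, sat_neg, sat_mem, ev_ap, ev_var, ev_last,
    ev_field]
  rfl

theorem isNumerationBase_iff {S : Tm 0} : IsNumerationBase S ↔
    ∀ (M : Type) [EAModel M], IsBase (cv M S) := by
  rw [IsNumerationBase, proves_iff]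
  simp only [forallE, sat_all, sat_imp, sat_and, sat_cardLt, sat_cardLe, sat_cardEq, sat_bex,
    sat_ball, sat_eq, ev_var, ev_wk, ev_numeral, cons_zero]
  refine forall_congr' fun M => forall_congr' fun _ => ?_
  have h2 : CLe (numM 2) (ev S (Fin.elim0 : Fin 0 → M)) ↔ 2 ≤ cd (cv M S) := by
    rw [← cd_le, cd_numM, Nat.cast_ofNat]; rfl
  have h3 : (∀ x : M, CLe x (cv M S) ∧ ¬ CEq x (cv M S) →
      ∃ y ∈ cv M S, CEq y x ∧ ∀ z ∈ cv M S, CEq z x → z = y) ↔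
      ∀ x : M, cd x < cd (cv M S) → ∃ y ∈ cv M S, cd y = cd x ∧
        ∀ z ∈ cv M S, cd z = cd x → z = y := by
    simp only [cd_eq, lt_iff_le_and_ne, cd_le, Ne]
  constructor
  · exact fun h => ⟨h2.1 h.1, h3.1 h.2⟩
  · exact fun h => ⟨h2.2 h.two_le, h3.2 h.unique⟩

theorem numeralExt_z (S : Tm 0) (N : IterSystem) :
    (numeralExt S N).z M = zeroM (cv M S) (N.z M) := z_numeralExt S N

theorem numeralExt_σ (S : Tm 0) (N : IterSystem) :
    (numeralExt S N).σ = succM (cv M S) (N.σ : M → M) := funext fun x => σ_numeralExt S N x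

/-- The term with value `s` if `A` holds, and `t` otherwise. -/
def ite (A : Fm0 n) (s t : Tm n) : Tm n := cup (.sep s A.wk) (.sep t (∼ₑA).wk)

@[simp] theorem ev_ite (A : Fm0 n) (s t : Tm n) (v : Fin n → M) :
    ev (ite A s t) v = iteM (sat A v) (ev s v) (ev t v) := by
  rw [ite, ev_cup, ev_sep, ev_sep, iteM]
  congr 2
  · funext a; exact propext (sat_rename' _ _ _)
  · funext a; exact propext ((sat_rename' _ _ _).trans (sat_neg _ _))

end Semantics

/-! ### Maximally powerful functions in a numeral extension -/

section Step

variable {M : Type} [EAModel M] {n : ℕ} {N : IterSystem} {S : Tm 0} {φ ψ η : Tm 1}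

/-- The function `S ^ φ(log_S a)`. -/
def step (S : Tm 0) (φ : Tm 1) : Tm 1 := exp (const S) (ap φ (log (const S) (.var 0)))

theorem Arithmetical.step (hS : IsNumerationBase S) (hφ : Arithmetical φ) :
    Arithmetical (step S φ) ∧ ∀ (M : Type) [EAModel M] (c : Cd M),
      cf (EA.step S φ) c = cd (cv M S) ^ cf φ (Cd.lg (cd (cv M S)) c) :=
  arithmetical_of (fun M _ c => cd (cv M S) ^ cf φ (Cd.lg (cd (cv M S)) c)) fun M _ x => by
    have h : fn (EA.step S φ) x = expM (cv M S) (fn φ (logM (cv M S) x)) := by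
      simp only [fn, EA.step, ev_exp, ev_const, ev_ap, ev_log, ev_var]; rfl
    rw [h, Cd.cd_expM, hφ.cd_fn, cd_logM ((isNumerationBase_iff.1 hS M).two_le)]

theorem isNatSystem_numeralExt (hN : N.IsNatSystem) (hS : IsNumerationBase S) :
    (numeralExt S N).IsNatSystem := by
  refine isNatSystem_iff.2 fun M _ => ?_
  rw [numeralExt_z, numeralExt_σ]
  exact isNatSys_numeral (isNumerationBase_iff.1 hS M) (isNatSystem_iff.1 hN M)

/-- The term with value `backM`: a number of `N[S]` of length `S ^ |K|` for a number `K` of `N`. -/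
def back (S : Tm 0) (N : IterSystem) : Tm 1 :=
  ite (.var 0 =ₑ .empty) (const (sing (sing (numeralExt S N).zero)))
    (numOrd (const S) (.var 0))

/-- The term with value `cutM`: a number of `N` of length `log_S |X|` for a number `X` of `N[S]`. -/
def cut : Tm 1 := ite (.var 0 ≤c numeral 1) .empty (lengthOf (last (.var 0)))

theorem fn_back (S : Tm 0) (N : IterSystem) (K : M) :
    fn (back S N) K = backM (cv M S) (N.z M) K := by
  have h : ev (numeralExt S N).zero (Fin.elim0 : Fin 0 → M) = zeroM (cv M S) (N.z M) :=
    numeralExt_z S N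
  simp only [fn, back, ev_ite, sat_eq, ev_var, ev_empty, ev_const, ev_sing, ev_numOrd, backM, h]
  rfl

theorem fn_cut (X : M) : fn cut X = cutM X := by
  simp only [fn, cut, ev_ite, sat_cardLe, ev_var, ev_empty, ev_numeral, ev_lengthOf, ev_last, cutM]

theorem fn_back_spec (hN : N.IsNatSystem) (hS : IsNumerationBase S) {K : M}
    (hK : IsNum (N.z M) N.σ K) :
    IsNum ((numeralExt S N).z M) (numeralExt S N).σ (fn (back S N) K) ∧
      len (fn (back S N) K) = cd (cv M S) ^ len K := by
  have hS' := isNumerationBase_iff.1 hS M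
  have hN' := isNatSystem_iff.1 hN M
  rw [fn_back, numeralExt_z, numeralExt_σ]
  exact ⟨isNum_backM hS' hN' hK, len_backM hS' hK⟩

theorem fn_cut_spec (hN : N.IsNatSystem) (hS : IsNumerationBase S) {X : M}
    (hX : IsNum ((numeralExt S N).z M) (numeralExt S N).σ X) :
    IsNum (N.z M) N.σ (fn cut X) ∧ len (fn cut X) = Cd.lg (cd (cv M S)) (len X) := by
  rw [numeralExt_z, numeralExt_σ] at hX
  rw [fn_cut]
  exact isNum_cutM (isNumerationBase_iff.1 hS M) (isNatSystem_iff.1 hN M) hX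

theorem closedUnder_step (hN : N.IsNatSystem) (hS : IsNumerationBase S) (hφ : Arithmetical φ)
    (h : ClosedUnder N φ) : ClosedUnder (numeralExt S N) (step S φ) := by
  obtain ⟨η, hη⟩ := h
  obtain ⟨h1, h2⟩ := hφ.step hS
  rw [hφ.represents_iff] at hη
  refine ⟨ap (back S N) (ap η cut), h1.represents_iff.2 fun M _ X hX => ?_⟩
  obtain ⟨c1, c2⟩ := fn_cut_spec hN hS hX
  obtain ⟨e1, e2⟩ := hη M _ c1
  obtain ⟨b1, b2⟩ := fn_back_spec hN hS e1
  rw [fn_ap, fn_ap]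
  exact ⟨b1, by rw [b2, e2, c2, h2]⟩

/-- The largest logarithm of a value of `ψ` at an argument of size at most `S ^ a`, which is the
number of cardinalities smaller than one of these logarithms. -/
def logBound (S : Tm 0) (ψ : Tm 1) : Tm 1 :=
  let W : Tm 1 := image (.pow (exp (const S) (.var 0))) fun z => log (const S) (ap ψ z)
  comp (card (.union W)) fun x => bex W.wk fun w => x.wk <c w

theorem fn_logBound (S : Tm 0) (ψ : Tm 1) (a : M) :
    fn (logBound S ψ) a =
      sepM (cardM (unionM (imgM (powM (expM (cv M S) a)) fun z => logM (cv M S) (fn ψ z))))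
        fun x => ∃ w ∈ imgM (powM (expM (cv M S) a)) (fun z => logM (cv M S) (fn ψ z)),
          cd x < cd w := by
  have hw : ev (image (.pow (exp (const S) (.var 0))) fun z => log (const S) (ap ψ z) : Tm 1)
      (fun _ => a) = imgM (powM (expM (cv M S) a)) fun z => logM (cv M S) (fn ψ z) := by
    simp only [ev_image, ev_pow, ev_exp, ev_const, ev_var, ev_log, ev_ap]; rfl
  simp only [fn, logBound, ev_comp, ev_card, ev_union, sat_bex, ev_wk, hw, sat_cardLt,
    ev_var, cons_zero, lt_iff_le_and_ne, cd_le, Ne, cd_eq]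

/-- The value of `logBound` has as many members as the maximum `m` of the logarithms. -/
theorem cd_fn_logBound (hS : IsNumerationBase S) (hψ : Arithmetical ψ) (a : M) {m : Cd M}
    (h1 : ∀ c : Cd M, c ≤ cd (cv M S) ^ cd a → Cd.lg (cd (cv M S)) (cf ψ c) ≤ m)
    (h2 : ∃ c : Cd M, c ≤ cd (cv M S) ^ cd a ∧ Cd.lg (cd (cv M S)) (cf ψ c) = m) :
    cd (fn (logBound S ψ) a) = m := by
  have hS2 := (isNumerationBase_iff.1 hS M).two_le
  rw [fn_logBound]
  generalize hW : imgM (powM (expM (cv M S) a)) (fun z => logM (cv M S) (fn ψ z)) = W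
  have hmem : ∀ w, w ∈ W ↔ ∃ z, z ⊆ expM (cv M S) a ∧ w = logM (cv M S) (fn ψ z) := fun w => by
    rw [← hW, mem_imgM]; simp only [mem_powM]
  have hcd : ∀ z, cd (logM (cv M S) (fn ψ z)) = Cd.lg (cd (cv M S)) (cf ψ (cd z)) := fun z => by
    rw [cd_logM hS2, hψ.cd_fn]
  have hle : ∀ w ∈ W, cd w ≤ m := by
    intro w hw
    obtain ⟨z, hz, rfl⟩ := (hmem w).1 hw
    rw [hcd]
    exact h1 _ (by rw [← Cd.cd_expM]; exact cd_le_of_subset hz)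
  obtain ⟨w, hw, hwm⟩ : ∃ w ∈ W, cd w = m := by
    obtain ⟨c, hc, hcm⟩ := h2
    rw [← Cd.cd_expM] at hc
    obtain ⟨z, hz, rfl⟩ := exists_subset_cd hc
    exact ⟨_, (hmem _).2 ⟨z, hz, rfl⟩, by rw [hcd, hcm]⟩
  have e : sepM (cardM (unionM W)) (fun x => ∃ w ∈ W, cd x < cd w) =
      sepM (cardM (unionM W)) fun x => cd x < m := ext fun x => by
    rw [mem_sepM, mem_sepM]
    refine and_congr_right fun _ => ⟨?_, fun h => ⟨w, hw, hwm ▸ h⟩⟩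
    rintro ⟨w', hw', h⟩
    exact h.trans_le (hle w' hw')
  rw [e]
  refine cd_sepM_lt (fun x => cd x) (fun x hx y hy h => eq_of_mem_cardM hx hy h) fun d hd => ?_
  refine exists_mem_cardM (hd.trans_le ?_)
  rw [← hwm]
  exact cd_le_of_subset fun x hx => mem_unionM.2 ⟨w, hw, hx⟩

/-- Arguments of size at most `S ^ d` may be taken among the subsets of one set, so that the maximum
of the logarithms exists. -/
theorem exists_logBound (hS : IsNumerationBase S) (hψ : Arithmetical ψ) (d : Cd M) : ∃ m : Cd M,
    (∀ c : Cd M, c ≤ cd (cv M S) ^ d → Cd.lg (cd (cv M S)) (cf ψ c) ≤ m) ∧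
    ∃ c : Cd M, c ≤ cd (cv M S) ^ d ∧ Cd.lg (cd (cv M S)) (cf ψ c) = m := by
  have hS2 := (isNumerationBase_iff.1 hS M).two_le
  obtain ⟨a, rfl⟩ := cd_surj d
  have hle : ∀ z ∈ powM (expM (cv M S) a), cd (logM (cv M S) (fn ψ z)) ≤
      cd (unionM (imgM (powM (expM (cv M S) a)) fun z => logM (cv M S) (fn ψ z))) := fun z hz =>
    cd_le_of_subset fun x hx => mem_unionM.2 ⟨_, mem_imgM.2 ⟨z, hz, rfl⟩, hx⟩
  obtain ⟨z, hz, hmax⟩ := exists_max_cd (D := powM (expM (cv M S) a)) (x := ∅)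
    (fun z => cd (logM (cv M S) (fn ψ z)))
    (mem_powM.2 fun x hx => (not_mem_empty x hx).elim) hle
  have hcd : ∀ z, cd (logM (cv M S) (fn ψ z)) = Cd.lg (cd (cv M S)) (cf ψ (cd z)) := fun z => by
    rw [cd_logM hS2, hψ.cd_fn]
  refine ⟨_, fun c hc => ?_, cd z, ?_, rfl⟩
  · rw [← Cd.cd_expM] at hc
    obtain ⟨w, hw, rfl⟩ := exists_subset_cd hc
    rw [← hcd, ← hcd]
    exact hmax w (mem_powM.2 hw)
  · rw [← Cd.cd_expM]; exact cd_le_of_subset (mem_powM.1 hz)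

theorem Arithmetical.logBound (hS : IsNumerationBase S) (hψ : Arithmetical ψ) :
    Arithmetical (logBound S ψ) := by
  refine arithmetical_iff.2 fun M _ x y e => ?_
  obtain ⟨m, h1, h2⟩ := exists_logBound (M := M) hS hψ (cd x)
  rw [cd_fn_logBound hS hψ x h1 h2, cd_fn_logBound hS hψ y (e ▸ h1) (e ▸ h2)]

theorem lg_cf_le_logBound (hS : IsNumerationBase S) (hψ : Arithmetical ψ) {c d : Cd M}
    (h : c ≤ cd (cv M S) ^ d) : Cd.lg (cd (cv M S)) (cf ψ c) ≤ cf (logBound S ψ) d := by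
  obtain ⟨m, h1, h2⟩ := exists_logBound (M := M) hS hψ d
  obtain ⟨a, rfl⟩ := cd_surj d
  rw [← (hψ.logBound hS).cd_fn, cd_fn_logBound hS hψ a h1 h2]
  exact h1 c h

/-- The initial segments of `back K` have all the lengths up to `S ^ |K|`; `cut ∘ η` maps them to
numbers of `N` that have the logarithms of the values of `ψ` as lengths. -/
theorem closedUnder_logBound (hN : N.IsNatSystem) (hS : IsNumerationBase S) (hψ : Arithmetical ψ)
    (h : ClosedUnder (numeralExt S N) ψ) : ClosedUnder N (logBound S ψ) := by
  obtain ⟨η, hη⟩ := h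
  rw [hψ.represents_iff] at hη
  -- the union of the representatives of the logarithms, the longest of which contains the others
  refine ⟨.union (image (comp (.pow (back S N)) fun z => isOrd z) fun z => ap cut (ap η z)),
    (hψ.logBound hS).represents_iff.2 fun M _ K hK => ?_⟩
  have hfn : fn (.union (image (comp (.pow (back S N)) fun z => isOrd z)
      fun z => ap cut (ap η z))) K =
      unionM (imgM (sepM (powM (fn (back S N) K)) fun z => IsOrd z) fun z => fn cut (fn η z)) := by
    simp only [fn, ev_union, ev_image, ev_comp, ev_pow, sat_isOrd, ev_var, cons_zero, ev_ap]
  rw [hfn]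
  obtain ⟨b1, b2⟩ := fn_back_spec hN hS hK
  obtain ⟨m, h1, c₀, hc₀, hm⟩ := exists_logBound (M := M) hS hψ (len K)
  have hcf : cf (logBound S ψ) (len K) = m := by
    rw [← hK.1.cd_eq_len, ← (hψ.logBound hS).cd_fn]
    rw [← hK.1.cd_eq_len] at h1 hc₀
    exact cd_fn_logBound hS hψ K h1 ⟨c₀, hc₀, hm⟩
  have hval : ∀ z, z ⊆ fn (back S N) K → IsOrd z → IsNum (N.z M) N.σ (fn cut (fn η z)) ∧
      len (fn cut (fn η z)) = Cd.lg (cd (cv M S)) (cf ψ (len z)) ∧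
      len z ≤ cd (cv M S) ^ len K := by
    intro z hz hzo
    obtain ⟨e1, e2⟩ := hη M z (b1.of_sub hzo hz)
    obtain ⟨c1, c2⟩ := fn_cut_spec hN hS e1
    exact ⟨c1, by rw [c2, e2], b2 ▸ IsOrd.len_le_of_sub hz⟩
  obtain ⟨z₀, hz₀, hz₀o, hz₀c⟩ : ∃ z, z ⊆ fn (back S N) K ∧ IsOrd z ∧ len z = c₀ :=
    ⟨segM _ c₀, segM_sub, b1.1.segM, b1.1.len_segM (b2.symm ▸ hc₀)⟩
  obtain ⟨k1, k2, _⟩ := hval z₀ hz₀ hz₀o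
  rw [hz₀c, hm] at k2
  have e : unionM (imgM (sepM (powM (fn (back S N) K)) fun z => IsOrd z)
      fun z => fn cut (fn η z)) = fn cut (fn η z₀) := by
    refine ext fun u => ?_
    rw [mem_unionM]
    constructor
    · rintro ⟨w, hw, hu⟩
      obtain ⟨z, hz, rfl⟩ := mem_imgM.1 hw
      rw [mem_sepM, mem_powM] at hz
      obtain ⟨l1, l2, l3⟩ := hval z hz.1 hz.2
      exact l1.sub_of_len_le k1 (by rw [k2, l2]; exact h1 _ l3) u hu
    · exact fun hu => ⟨_, mem_imgM.2 ⟨z₀, mem_sepM.2 ⟨mem_powM.2 hz₀, hz₀o⟩, rfl⟩, hu⟩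
  rw [e, hcf]
  exact ⟨k1, k2⟩

theorem closedUnder_var : ClosedUnder N (.var 0) :=
  ⟨.var 0, cf_var.1.represents_iff.2 fun M _ x hx => by rw [fn_var, cf_var.2]; exact ⟨hx, rfl⟩⟩

/-- In a system in which `φ` is maximally powerful each closed function is dominated by a proper
iterate of `φ`. -/
theorem MaximallyPowerful.exists_iterate_succ (h : MaximallyPowerful φ N) (hψ : Arithmetical ψ)
    (hc : ClosedUnder N ψ) : ∃ k m : ℕ, ∀ (M : Type) [EAModel M] (x : M),
      IsNum (N.z M) N.σ x → (m : Cd M) ≤ len x → cf ψ (len x) < (cf φ)^[k + 1] (len x) := by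
  have hit := h.arithmetical.iterate
  have hdom : ∀ {ψ : Tm 1}, Arithmetical ψ → ClosedUnder N ψ → ∃ k m : ℕ, ∀ (M : Type)
      [EAModel M] (x : M), IsNum (N.z M) N.σ x → (m : Cd M) ≤ len x →
        cf ψ (len x) < (cf φ)^[k] (len x) := by
    intro ψ hψ hc
    obtain ⟨k, hk⟩ := h.dominates ψ hψ hc
    obtain ⟨m, hm⟩ := ((hit k).1.dominatedOn_iff hψ).1 hk
    exact ⟨k, m, fun M _ x hx hx' => (hit k).2 M _ ▸ hm M x hx hx'⟩
  obtain ⟨k, m, hk⟩ := hdom hψ hc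
  cases k with
  | succ k => exact ⟨k, m, hk⟩
  | zero =>
    -- a function below the identity is dominated together with the identity
    obtain ⟨j, m', hj⟩ := hdom cf_var.1 closedUnder_var
    cases j with
    | zero =>
      refine ⟨0, m', fun M _ x hx hx' => ?_⟩
      have := hj M x hx hx'
      rw [cf_var.2] at this
      exact (lt_irrefl _ this).elim
    | succ j =>
      refine ⟨j, max m m', fun M _ x hx hx' => (hk M x hx ?_).trans ?_⟩
      · exact le_trans (by exact_mod_cast le_max_left m m') hx'
      · have := hj M x hx (le_trans (by exact_mod_cast le_max_right m m') hx')
        rwa [cf_var.2] at this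

/-- Only proper iterates have this form: `S ^ log_S c` may exceed `c`. -/
theorem cf_step_iterate (hS : IsNumerationBase S) (hφ : Arithmetical φ) (k : ℕ) (c : Cd M) :
    (cf (step S φ))^[k + 1] c =
      cd (cv M S) ^ (cf φ)^[k + 1] (Cd.lg (cd (cv M S)) c) := by
  have hS2 := (isNumerationBase_iff.1 hS M).two_le
  induction k with
  | zero => exact (hφ.step hS).2 M c
  | succ k ih =>
    rw [Function.iterate_succ_apply', ih, (hφ.step hS).2, Cd.lg_pow hS2,
      ← Function.iterate_succ_apply' (cf φ) (k + 1)]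

/-- If `logBound S ψ` is dominated by an iterate of `φ` in `N`, then `ψ` is dominated by the same
iterate of `step S φ` in `N[S]`, since `ψ c ≤ S ^ log_S (ψ c)` and `log_S (ψ c)` is at most the value
of `logBound S ψ` at `log_S c`. -/
theorem MaximallyPowerful.step (h : MaximallyPowerful φ N) (hS : IsNumerationBase S) :
    MaximallyPowerful (step S φ) (numeralExt S N) := by
  obtain ⟨hA, hcf⟩ := h.arithmetical.step hS
  refine ⟨isNatSystem_numeralExt h.isNatSystem hS, hA, hA.increasing_iff.2 fun M _ c d hcd => ?_,
    closedUnder_step h.isNatSystem hS h.arithmetical h.closed, fun ψ hψ hc => ?_⟩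
  · have hb := isNumerationBase_iff.1 hS M
    rw [hcf, hcf]
    exact Cd.pow_le_pow_right' hb.one_le
      (h.arithmetical.increasing_iff.1 h.increasing M _ _ (Cd.lg_mono hb.two_le hcd))
  · obtain ⟨k, m, hk⟩ := h.exists_iterate_succ (hψ.logBound hS)
      (closedUnder_logBound h.isNatSystem hS hψ hc)
    obtain ⟨t, ht⟩ := exists_cd_closed_le S
    obtain ⟨hI, hIc⟩ := hA.iterate (k + 1)
    -- `log_S c` is at least `m` from `S ^ m` on, and `S` has at most `t` members in each model
    refine ⟨k + 1, (hI.dominatedOn_iff hψ).2 ⟨t ^ m, fun M _ X hX hm => ?_⟩⟩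
    have hb := isNumerationBase_iff.1 hS M
    obtain ⟨c1, c2⟩ := fn_cut_spec h.isNatSystem hS hX
    have hlg : (m : Cd M) ≤ Cd.lg (cd (cv M S)) (len X) := by
      rw [← Cd.lg_pow hb.two_le (c := (m : Cd M))]
      refine Cd.lg_mono hb.two_le (le_trans ?_ hm)
      rw [Cd.pow_natCast, Nat.cast_pow]
      exact pow_le_pow_left' (ht M) m
    have hlt := hk M _ c1 (by rw [c2]; exact hlg)
    rw [c2] at hlt
    rw [hIc, cf_step_iterate hS h.arithmetical]
    refine lt_of_le_of_lt (Cd.le_pow_lg hb.two_le) (Cd.pow_lt_pow_right' hb.two_le ?_)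
    exact lt_of_le_of_lt (lg_cf_le_logBound hS hψ (Cd.le_pow_lg hb.two_le)) hlt

theorem maximallyPowerful_hier (h : MaximallyPowerful φ N) (hS : IsNumerationBase S) (n : ℕ) :
    MaximallyPowerful (hier S φ n) (iterExt S N n) := by
  induction n with
  | zero => exact h
  | succ n ih => exact ih.step hS

end Step

/-! ### The rank of a set -/

section Rank

variable {M : Type} [EAModel M] {n : ℕ} {a b d x y z : M} {c : Cd M}

/-- A set with as many members as the longest epsilon chain for `a` has terms. -/
noncomputable def rankM (a : M) : M :=
  sepM (cardM (tcM a)) fun x => ∃ d ∈ fanM a, cd x < len d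

instance (f : (Fin n → M) → M) [DF f] : DF fun v => tcM (f v) := by
  unfold tcM; infer_instance

instance (f : (Fin n → M) → M) [DF f] : DF fun v => rankM (f v) := by
  unfold rankM; infer_instance

/-- The greatest length of an epsilon chain for `a`. -/
noncomputable def Rk (a : M) : Cd M := cd (rankM a)

instance (f : (Fin n → M) → M) [DF f] : DC fun v => Rk (f v) := by
  unfold Rk; infer_instance

theorem len_le_cd_tcM (h : IsChain d a) : len d ≤ cd (tcM a) :=
  cd_le_of_subset fun _ hx => mem_tcM.2 ⟨d, h, hx⟩

theorem Rk_spec (a : M) : (∀ d, IsChain d a → len d ≤ Rk a) ∧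
    (Rk a = 0 ∨ ∃ d, IsChain d a ∧ len d = Rk a) := by
  by_cases hex : ∃ d, IsChain d a
  · obtain ⟨d, hd⟩ := hex
    obtain ⟨d, hd, hmax⟩ := exists_max_cd (D := fanM a) (fun d => len d) (mem_fanM.2 hd)
      fun d hd => len_le_cd_tcM (mem_fanM.1 hd)
    have e : rankM a = sepM (cardM (tcM a)) fun x => cd x < len d := ext fun x => by
      rw [rankM, mem_sepM, mem_sepM]
      refine and_congr_right fun _ => ⟨?_, fun h => ⟨d, hd, h⟩⟩
      rintro ⟨d', hd', h⟩
      exact h.trans_le (hmax d' hd')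
    have hR : Rk a = len d := by
      rw [Rk, e]
      refine cd_sepM_lt (fun x => cd x) (fun x hx y hy h => eq_of_mem_cardM hx hy h) fun c hc => ?_
      exact exists_mem_cardM (hc.trans_le (len_le_cd_tcM (mem_fanM.1 hd)))
    rw [hR]
    exact ⟨fun d' hd' => hmax d' (mem_fanM.2 hd'), .inr ⟨d, mem_fanM.1 hd, rfl⟩⟩
  · refine ⟨fun d hd => (hex ⟨d, hd⟩).elim, .inl (Cd.cd_eq_zero.2 (ext fun x => ?_))⟩
    rw [rankM, mem_sepM]
    refine ⟨?_, fun h => (not_mem_empty x h).elim⟩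
    rintro ⟨_, d, hd, _⟩
    exact (hex ⟨d, mem_fanM.1 hd⟩).elim

/-- A set can be put in front of an epsilon chain for it. -/
theorem IsChain.exists_cons (h : IsChain d x) (hx : x ∈ a) :
    ∃ e, IsChain e a ∧ len e = len d + 1 := by
  have hxd : x ∉ unionM d := fun h' =>
    have := mem_tcM.2 ⟨d, h, h'⟩
    foundation this this
  let G : M → Cd M := fun y => cd (iteM (y = x) ∅ (insM (belowM d y) y))
  have : DC fun v : Fin 1 → M => G (v 0) := by
    show DC fun v : Fin 1 → M => cd (iteM (v 0 = x) ∅ (insM (belowM d (v 0)) (v 0)))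
    infer_instance
  have := fun n => DC.app (n := n) G
  have hG0 : G x = 0 := by simp only [G, iteM_pos]; rfl
  have hG1 : ∀ y ∈ unionM d, G y = rk d y + 1 := fun y hy => by
    simp only [G]
    rw [iteM_neg (by rintro rfl; exact hxd hy), IsOrd.cd_insM_belowM]
  have hs : ∀ c : Cd M, c + 1 ≠ 0 := Cd.succ_ne_zero
  have hinj : ∀ y ∈ insM (unionM d) x, ∀ z ∈ insM (unionM d) x, G y = G z → y = z := by
    intro y hy z hz e
    rcases mem_insM.1 hy with hy' | rfl <;> rcases mem_insM.1 hz with hz' | hz'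
    · rw [hG1 y hy', hG1 z hz', add_left_inj] at e
      exact h.1.rk_inj hy' hz' e
    · rw [hG1 y hy', hz', hG0] at e; exact (hs _ e).elim
    · rw [hG1 z hz', hG0] at e; exact (hs _ e.symm).elim
    · exact hz'.symm
  have hdown : ∀ y ∈ insM (unionM d) x, ∀ c, c < G y → ∃ z, z ∈ insM (unionM d) x ∧ G z = c := by
    intro y hy c hc
    rcases Cd.eq_zero_or_succ c with rfl | ⟨c, rfl⟩
    · exact ⟨x, mem_insM.2 (.inr rfl), hG0⟩
    · rcases mem_insM.1 hy with hy | rfl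
      · rw [hG1 y hy, add_lt_add_iff_right] at hc
        obtain ⟨z, hz, rfl⟩ := h.1.exists_rk (hc.trans (rk_lt_len hy))
        exact ⟨z, mem_insM.2 (.inl hz), hG1 z hz⟩
      · rw [hG0] at hc; exact (not_lt_zero hc).elim
  obtain ⟨o1, o2, o3⟩ := ordOfM_spec (D := insM (unionM d) x) G (le := fun y z => G y ≤ G z)
    (fun _ _ _ _ => Iff.rfl) hinj hdown
  refine ⟨_, isChain_of_rk o1 (fun h => ?_) (fun y hy hr => ?_) fun y hy z hz hr => ?_,
    by rw [len, o2, Cd.cd_insM hxd, len]⟩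
  · rw [h, unionM_empty] at o2
    exact not_mem_empty x (o2 ▸ mem_insM.2 (.inr rfl))
  · rw [o2] at hy
    rw [o3 y hy] at hr
    rcases mem_insM.1 hy with hy' | rfl
    · rw [hG1 y hy'] at hr; exact (hs _ hr).elim
    · exact hx
  · rw [o2] at hy hz
    rw [o3 y hy, o3 z hz] at hr
    rcases mem_insM.1 hz with hz' | hz'
    · rw [hG1 z hz', add_left_inj] at hr
      rcases mem_insM.1 hy with hy' | rfl
      · rw [hG1 y hy'] at hr
        exact h.mem_of_rk_succ hy' hz' hr
      · rw [hG0] at hr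
        exact h.mem_of_rk_zero hz' hr
    · rw [hz', hG0] at hr; exact (hs _ hr.symm).elim

/-- The first term of an epsilon chain can be dropped. -/
theorem IsChain.exists_tail (h : IsChain d a) (hlen : len d = c + 1) (hc : c ≠ 0) :
    ∃ e, IsChain e (firstM d) ∧ len e = c := by
  obtain ⟨f1, f2⟩ := h.1.firstM_spec h.2.1
  let D : M := sepM (unionM d) fun y => y ≠ firstM d
  have hD : ∀ y, y ∈ D ↔ y ∈ unionM d ∧ y ≠ firstM d := fun y => by simp only [D, mem_sepM]
  let G : M → Cd M := fun y => cd (sepM (belowM d y) fun z => z ≠ firstM d)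
  have : DC fun v : Fin 1 → M => G (v 0) := by
    show DC fun v : Fin 1 → M => cd (sepM (belowM d (v 0)) fun z => z ≠ firstM d)
    infer_instance
  have := fun n => DC.app (n := n) G
  have hins : ∀ s : M, firstM d ∈ s → insM (sepM s fun z => z ≠ firstM d) (firstM d) = s :=
    fun s hs => ext fun z => by
      rw [mem_insM, mem_sepM]
      constructor
      · rintro (h | rfl)
        · exact h.1
        · exact hs
      · intro hz
        by_cases hz' : z = firstM d
        · exact .inr hz'
        · exact .inl ⟨hz, hz'⟩
  have hcd : ∀ s : M, firstM d ∈ s → cd (sepM s fun z => z ≠ firstM d) + 1 = cd s := fun s hs => by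
    rw [← Cd.cd_insM (a := sepM s fun z => z ≠ firstM d) (y := firstM d) (by simp), hins s hs]
  have hG : ∀ y ∈ D, G y + 1 = rk d y := fun y hy => by
    rw [hD] at hy
    refine hcd _ ((h.1.mem_belowM_iff hy.1).2 ⟨f1, ?_⟩)
    rw [f2, pos_iff_ne_zero]
    exact fun h0 => hy.2 (h.1.rk_inj hy.1 f1 (h0.trans f2.symm))
  have hDc : cd D = c := by
    have := hcd (unionM d) f1
    exact Cd.succ_inj (this.trans hlen)
  have hinj : ∀ y ∈ D, ∀ z ∈ D, G y = G z → y = z := fun y hy z hz e =>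
    h.1.rk_inj ((hD y).1 hy).1 ((hD z).1 hz).1 (by rw [← hG y hy, ← hG z hz, e])
  have hdown : ∀ y ∈ D, ∀ c, c < G y → ∃ z, z ∈ D ∧ G z = c := by
    intro y hy c hc
    have hlt : c + 1 < len d := by
      refine lt_trans ?_ (rk_lt_len ((hD y).1 hy).1)
      rw [← hG y hy]; gcongr
    obtain ⟨z, hz, hr⟩ := h.1.exists_rk hlt
    have hzD : z ∈ D := (hD z).2 ⟨hz, by
      rintro rfl
      exact Cd.succ_ne_zero c (hr.symm.trans f2)⟩
    exact ⟨z, hzD, Cd.succ_inj ((hG z hzD).trans hr)⟩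
  obtain ⟨o1, o2, o3⟩ := ordOfM_spec (D := D) G (le := fun y z => G y ≤ G z)
    (fun _ _ _ _ => Iff.rfl) hinj hdown
  refine ⟨_, isChain_of_rk o1 (fun h => ?_) (fun y hy hr => ?_) fun y hy z hz hr => ?_,
    by rw [len, o2, hDc]⟩
  · rw [h, unionM_empty] at o2
    exact hc (by rw [← hDc, ← o2]; rfl)
  · rw [o2] at hy
    rw [o3 y hy] at hr
    refine h.mem_of_rk_succ f1 ((hD y).1 hy).1 ?_
    rw [← hG y hy, hr, f2]
  · rw [o2] at hy hz
    rw [o3 y hy, o3 z hz] at hr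
    refine h.mem_of_rk_succ ((hD y).1 hy).1 ((hD z).1 hz).1 ?_
    rw [← hG y hy, ← hG z hz, hr]

theorem Rk_lt_of_mem (h : x ∈ a) : Rk x < Rk a := by
  rcases (Rk_spec x).2 with h0 | ⟨d, hd, hr⟩
  · have := (Rk_spec a).1 _ (isChain_singM h)
    rw [len_singM] at this
    rw [h0]
    exact lt_of_lt_of_le Cd.zero_lt_one' this
  · obtain ⟨e, he, hl⟩ := hd.exists_cons h
    rw [← hr, ← Cd.succ_le, ← hl]
    exact (Rk_spec a).1 e he

theorem Rk_le (h : ∀ x ∈ a, Rk x < c) : Rk a ≤ c := by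
  rcases (Rk_spec a).2 with h0 | ⟨d, hd, hr⟩
  · rw [h0]; exact zero_le
  · have hf := h _ hd.2.2.1
    rw [← hr]
    obtain ⟨e, he⟩ := Cd.exists_eq_succ fun h => hd.2.1 (hd.1.len_eq_zero.1 h)
    rw [he, Cd.succ_le]
    refine lt_of_le_of_lt ?_ hf
    by_cases he0 : e = 0
    · rw [he0]; exact zero_le
    · obtain ⟨d', hd', hl⟩ := hd.exists_tail he he0
      rw [← hl]
      exact (Rk_spec _).1 d' hd'

theorem Rk_mono (h : a ⊆ b) : Rk a ≤ Rk b := Rk_le fun x hx => Rk_lt_of_mem (h x hx)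

theorem Rk_empty : Rk (∅ : M) = 0 :=
  nonpos_iff_eq_zero.1 (Rk_le fun x hx => (not_mem_empty x hx).elim)

theorem IsChain.Rk_lt (h : IsChain d a) (hx : x ∈ unionM d) : Rk x < Rk a := by
  have key : ∀ e, ∀ x, x ∈ unionM d → rk d x = e → Rk x < Rk a := by
    refine fun e => Cd.ind (fun e => ∀ x, x ∈ unionM d → rk d x = e → Rk x < Rk a) ?_ ?_ e
    · exact fun x hx h0 => Rk_lt_of_mem (h.mem_of_rk_zero hx h0)
    · intro e ih y hy hr
      obtain ⟨x, hx, hxr⟩ := h.1.exists_rk (c := e)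
        (lt_of_lt_of_le (hr ▸ Cd.lt_succ_iff.2 le_rfl) (rk_lt_len hy).le)
      exact (Rk_lt_of_mem (h.mem_of_rk_succ hx hy (by rw [hr, hxr]))).trans (ih x hx hxr)
  exact key _ x hx rfl

/-- A term raises the rank by at most a standard number. -/
theorem exists_Rk_le : {n : ℕ} → (t : Tm n) → ∃ k : ℕ, ∀ (M : Type) [EAModel M] (v : Fin n → M)
    (c : Cd M), (∀ i, Rk (v i) ≤ c) → Rk (ev t v) ≤ c + k
  | _, .var i => ⟨0, fun M _ v c h => by rw [ev_var, Nat.cast_zero, add_zero]; exact h i⟩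
  | _, .empty => ⟨0, fun M _ v c _ => by rw [ev_empty, Rk_empty]; exact zero_le⟩
  | _, .pair s t => by
      obtain ⟨j, hj⟩ := exists_Rk_le s
      obtain ⟨k, hk⟩ := exists_Rk_le t
      refine ⟨j + k + 1, fun M _ v c h => ?_⟩
      rw [ev_pair]
      have h1 := hj M v c h
      have h2 := hk M v c h
      push_cast
      refine Rk_le fun x hx => ?_
      rw [← add_assoc, Cd.lt_succ_iff]
      rcases mem_pairM.1 hx with rfl | rfl
      · exact h1.trans (by rw [← add_assoc]; exact le_self_add)
      · exact h2.trans (by rw [add_comm (j : Cd M), ← add_assoc]; exact le_self_add)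
  | _, .pow s => by
      obtain ⟨j, hj⟩ := exists_Rk_le s
      refine ⟨j + 1, fun M _ v c h => ?_⟩
      rw [ev_pow]
      push_cast
      refine Rk_le fun x hx => ?_
      rw [← add_assoc, Cd.lt_succ_iff]
      exact (Rk_mono (mem_powM.1 hx)).trans (hj M v c h)
  | _, .union s => by
      obtain ⟨j, hj⟩ := exists_Rk_le s
      refine ⟨j, fun M _ v c h => ?_⟩
      rw [ev_union]
      refine Rk_le fun x hx => ?_
      obtain ⟨y, hy, hx⟩ := mem_unionM.1 hx
      exact ((Rk_lt_of_mem hx).trans (Rk_lt_of_mem hy)).trans_le (hj M v c h)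
  | _, .fan s => by
      obtain ⟨j, hj⟩ := exists_Rk_le s
      refine ⟨j + 2, fun M _ v c h => ?_⟩
      rw [ev_fan]
      have h1 := hj M v c h
      push_cast
      rw [← one_add_one_eq_two, ← add_assoc, ← add_assoc]
      refine Rk_le fun d hd => Cd.lt_succ_iff.2 (Rk_le fun u hu => Cd.lt_succ_iff.2
        (Rk_le fun x hx => ?_))
      exact ((mem_fanM.1 hd).Rk_lt (IsOrd.mem_unionM_of_mem hu hx)).trans_le h1
  | _, .sep s A => by
      obtain ⟨j, hj⟩ := exists_Rk_le s
      refine ⟨j, fun M _ v c h => ?_⟩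
      exact (Rk_mono fun x hx => ((mem_ev_sep _ _ _ _).1 hx).1).trans (hj M v c h)
  | _, .repl t s => by
      obtain ⟨j, hj⟩ := exists_Rk_le s
      obtain ⟨k, hk⟩ := exists_Rk_le t
      refine ⟨j + k + 1, fun M _ v c h => ?_⟩
      push_cast
      refine Rk_le fun x hx => ?_
      obtain ⟨y, hy, rfl⟩ := (mem_ev_repl _ _ _ _).1 hx
      rw [← add_assoc, ← add_assoc, Cd.lt_succ_iff]
      refine hk M _ _ fun l => ?_
      refine Fin.cases ?_ (fun l => ?_) l
      · exact (Rk_lt_of_mem hy).le.trans (hj M v c h)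
      · exact (h l).trans le_self_add

end Rank

/-! ### The systems of unit growth -/

section BaseSystems

variable {M : Type} [EAModel M] {n : ℕ} {N : IterSystem} {L x y : M}

/-- The initial term of `N` is the empty set, and the successor function raises ranks by one: at
least by one because a set belongs to its successor. -/
structure IsRanked (N : IterSystem) : Prop where
  zero : ∀ (M : Type) [EAModel M], N.z M = ∅
  mem : ∀ (M : Type) [EAModel M] (x : M), x ∈ N.σ x
  rank_le : ∀ (M : Type) [EAModel M] (x : M), Rk (N.σ x) ≤ Rk x + 1

theorem z_of_zero (h : N.zero = .empty) : N.z M = ∅ := by rw [IterSystem.z, h, ev_empty]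

theorem isRanked_CH : IsRanked CH := by
  have hσ : ∀ (M : Type) [EAModel M] (x : M), CH.σ x = powM x := fun M _ x => by
    rw [IterSystem.σ, CH, ev_pow, ev_var]
  refine ⟨fun M _ => z_of_zero rfl, fun M _ x => ?_, fun M _ x => ?_⟩
  · rw [hσ]; exact mem_powM.2 fun _ h => h
  · rw [hσ]; exact Rk_le fun y hy => Cd.lt_succ_iff.2 (Rk_mono (mem_powM.1 hy))

theorem isRanked_VN : IsRanked VN := by
  have hσ : ∀ (M : Type) [EAModel M] (x : M), VN.σ x = insM x x := fun M _ x => by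
    rw [IterSystem.σ, VN, ev_succSet, ev_var]
  refine ⟨fun M _ => z_of_zero rfl, fun M _ x => ?_, fun M _ x => ?_⟩
  · rw [hσ]; exact mem_insM.2 (.inr rfl)
  · rw [hσ]
    refine Rk_le fun y hy => Cd.lt_succ_iff.2 ?_
    rcases mem_insM.1 hy with hy | rfl
    · exact (Rk_lt_of_mem hy).le
    · exact le_rfl

theorem isRanked_Zer : IsRanked Zer := by
  have hσ : ∀ (M : Type) [EAModel M] (x : M), Zer.σ x = singM x := fun M _ x => by
    rw [IterSystem.σ, Zer, ev_sing, ev_var]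
  refine ⟨fun M _ => z_of_zero rfl, fun M _ x => ?_, fun M _ x => ?_⟩
  · rw [hσ]; exact mem_singM.2 rfl
  · rw [hσ]
    exact Rk_le fun y hy => Cd.lt_succ_iff.2 (by rw [mem_singM.1 hy])

theorem IsRanked.Rk_eq (hN : IsRanked N) (hL : IsNum (N.z M) N.σ L) (hx : x ∈ unionM L) :
    Rk x = rk L x := by
  obtain ⟨h0, hs⟩ := (isNum_iff hL.1).1 hL
  have key : ∀ c, ∀ x, x ∈ unionM L → rk L x = c → Rk x = c := by
    refine fun c => Cd.ind (fun c => ∀ x, x ∈ unionM L → rk L x = c → Rk x = c) ?_ ?_ c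
    · intro x hx hr
      rw [h0 x hx hr, hN.zero, Rk_empty]
    · intro c ih y hy hr
      obtain ⟨x, hx, hxr⟩ := hL.1.exists_rk (c := c)
        (lt_of_lt_of_le (hr ▸ Cd.lt_succ_iff.2 le_rfl) (rk_lt_len hy).le)
      rw [hs x hx y hy (by rw [hr, hxr])]
      refine le_antisymm ?_ ?_
      · exact ih x hx hxr ▸ hN.rank_le M x
      · have := Rk_lt_of_mem (hN.mem M x)
        rw [ih x hx hxr] at this
        exact Cd.succ_le.2 this
  exact key _ x hx rfl

theorem IsRanked.isNatSystem (hN : IsRanked N) : N.IsNatSystem := by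
  refine isNatSystem_iff.2 fun M _ L hL hmem => ?_
  by_cases hne : L = ∅
  · subst hne; exact not_mem_unionM_empty hmem
  obtain ⟨h1, h2⟩ := hL.1.lastM_spec hne
  have h3 := Rk_lt_of_mem (hN.mem M (lastM L))
  rw [hN.Rk_eq hL h1, hN.Rk_eq hL hmem] at h3
  have h4 := Cd.succ_le.2 h3
  rw [h2] at h4
  exact absurd (rk_lt_len hmem) (not_lt_of_ge h4)

theorem IsRanked.Rk_le (hN : IsRanked N) (hL : IsNum (N.z M) N.σ L) : Rk L ≤ len L + 1 :=
  EA.Rk_le fun u hu => Cd.lt_succ_iff.2 (EA.Rk_le fun x hx => by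
    have hx := IsOrd.mem_unionM_of_mem hu hx
    rw [hN.Rk_eq hL hx]
    exact rk_lt_len hx)

theorem IsRanked.len_le_Rk (hN : IsRanked N) (hL : IsNum (N.z M) N.σ L) : len L ≤ Rk L := by
  by_cases hne : L = ∅
  · rw [hne, len_empty]; exact zero_le
  obtain ⟨h1, h2⟩ := hL.1.lastM_spec hne
  rw [← h2, ← hN.Rk_eq hL h1, Cd.succ_le]
  obtain ⟨u, hu, hx⟩ := mem_unionM.1 h1
  exact (Rk_lt_of_mem hx).trans (Rk_lt_of_mem hu)

/-- The function `λ x, x + 1`. -/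
abbrev succFn : Tm 1 := succSet (.var 0)

theorem cf_succFn : Arithmetical succFn ∧
    ∀ (M : Type) [EAModel M] (c : Cd M), cf succFn c = c + 1 :=
  arithmetical_of (fun _ _ c => c + 1) fun M _ x => by
    rw [fn, ev_succSet, ev_var, Cd.cd_insM not_mem_self]

theorem cf_succFn_iterate (k : ℕ) (c : Cd M) : (cf succFn)^[k] c = c + k := by
  induction k with
  | zero => rw [Function.iterate_zero_apply, Nat.cast_zero, add_zero]
  | succ k ih => rw [Function.iterate_succ_apply', ih, cf_succFn.2, Nat.cast_succ, add_assoc]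

theorem closedUnder_succFn (hN : N.IsNatSystem) : ClosedUnder N succFn := by
  refine ⟨snoc (.var 0) (ite (.var 0 =ₑ .empty) (const N.zero) (ap N.succ (last (.var 0)))),
    cf_succFn.1.represents_iff.2 fun M _ L hL => ?_⟩
  have h : fn (snoc (.var 0) (ite (.var 0 =ₑ .empty) (const N.zero) (ap N.succ (last (.var 0))))) L
      = snocM L (iteM (L = ∅) (N.z M) (N.σ (lastM L))) := by
    simp only [fn, ev_snoc, ev_ite, ev_var, sat_eq, ev_empty, ev_const, ev_ap, ev_last]; rfl
  rw [h, cf_succFn.2]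
  have ha : iteM (L = ∅) (N.z M) (N.σ (lastM L)) ∉ unionM L := by
    by_cases hL0 : L = ∅
    · rw [hL0]; exact not_mem_unionM_empty
    · rw [iteM_neg hL0]; exact isNatSystem_iff.1 hN M L hL
  exact ⟨hL.snocM ha (fun h => iteM_pos h _ _) fun h => iteM_neg h _ _, len_snocM ha⟩

/-- If `η` represents `ψ`, then `ψ |L| = |η(L)|` is at most the rank of `η(L)`, which exceeds that of
`L`, and so `|L|`, by a standard number at most. -/
theorem IsRanked.maximallyPowerful_succFn (hN : IsRanked N) : MaximallyPowerful succFn N := by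
  obtain ⟨hA, hcf⟩ := cf_succFn
  refine ⟨hN.isNatSystem, hA, hA.increasing_iff.2 fun M _ c d h => ?_,
    closedUnder_succFn hN.isNatSystem, fun ψ hψ ⟨η, hη⟩ => ?_⟩
  · rw [hcf, hcf]; gcongr
  · obtain ⟨k, hk⟩ := exists_Rk_le η
    obtain ⟨hI, hIc⟩ := hA.iterate (k + 2)
    refine ⟨k + 2, (hI.dominatedOn_iff hψ).2 ⟨0, fun M _ L hL _ => ?_⟩⟩
    obtain ⟨h1, h2⟩ := hψ.represents_iff.1 hη M L hL
    rw [hIc, cf_succFn_iterate, ← h2]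
    have h3 := hk M (fun _ => L) (len L + 1) fun _ => hN.Rk_le hL
    refine lt_of_le_of_lt ((hN.len_le_Rk h1).trans h3) ?_
    push_cast
    have : len L + ((k : Cd M) + 2) = len L + 1 + k + 1 := by ring
    rw [this]
    exact Cd.lt_succ_iff.2 le_rfl

end BaseSystems

/-! ### Comparison of maximally powerful functions -/

section Transfer

variable {M : Type} [EAModel M] {N : IterSystem} {S : Tm 0} {φ φ' : Tm 1}

/-- The initial segment of the required length of the number representing the larger function
represents the smaller one. -/
theorem closedUnder_of_le (hφ : Arithmetical φ) (hφ' : Arithmetical φ')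
    (hle : ∀ (M : Type) [EAModel M] (c : Cd M), cf φ' c ≤ cf φ c) (h : ClosedUnder N φ) :
    ClosedUnder N φ' := by
  obtain ⟨η, hη⟩ := h
  rw [hφ.represents_iff] at hη
  refine ⟨the (.pow η) fun K => isOrd K ∧ₑ (K ≃c φ'.wk), hφ'.represents_iff.2 fun M _ x hx => ?_⟩
  obtain ⟨h1, h2⟩ := hη M x hx
  have hc : cf φ' (len x) ≤ len (fn η x) := h2.symm ▸ hle M _
  have hcd : cd (fn φ' x) = cf φ' (len x) := by rw [hφ'.cd_fn, hx.1.cd_eq_len]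
  have hK := h1.1.segM (c := cf φ' (len x))
  have e : fn (the (.pow η) fun K => isOrd K ∧ₑ (K ≃c φ'.wk)) x =
      segM (fn η x) (cf φ' (len x)) := by
    have h3 : fn (the (.pow η) fun K => isOrd K ∧ₑ (K ≃c φ'.wk)) x =
        theM (powM (fn η x)) fun K => IsOrd K ∧ CEq K (fn φ' x) := by
      simp only [fn, ev_the, ev_pow, sat_and, sat_isOrd, sat_cardEq, ev_var, ev_wk, cons_zero]
    rw [h3]
    refine theM_eq (mem_powM.2 segM_sub) ⟨hK, ?_⟩ fun K hK' ⟨hKo, hKc⟩ => ?_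
    · rw [← cd_eq, hcd, hK.cd_eq_len, h1.1.len_segM hc]
    · rw [← cd_eq, hcd, hKo.cd_eq_len] at hKc
      rw [← hKc, ← h1.1.sub_segM hKo (mem_powM.1 hK')]
  rw [e]
  exact ⟨h1.of_sub hK segM_sub, h1.1.len_segM hc⟩

/-- A function below a maximally powerful one, an iterate of which is eventually above it, is
maximally powerful. -/
theorem MaximallyPowerful.of_le_of_le_iterate (h : MaximallyPowerful φ N) (hφ' : Arithmetical φ')
    (hinc : ∀ (M : Type) [EAModel M] (c d : Cd M), c ≤ d → cf φ' c ≤ cf φ' d)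
    (hle : ∀ (M : Type) [EAModel M] (c : Cd M), cf φ' c ≤ cf φ c) (j m : ℕ)
    (hge : ∀ (M : Type) [EAModel M] (c : Cd M), (m : Cd M) ≤ c →
      c ≤ cf φ' c ∧ cf φ c ≤ (cf φ')^[j] c) : MaximallyPowerful φ' N := by
  refine ⟨h.isNatSystem, hφ', hφ'.increasing_iff.2 hinc,
    closedUnder_of_le h.arithmetical hφ' hle h.closed, fun ψ hψ hc => ?_⟩
  obtain ⟨k, hk⟩ := h.dominates ψ hψ hc
  obtain ⟨hI, hIc⟩ := h.arithmetical.iterate k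
  obtain ⟨m', hm'⟩ := (hI.dominatedOn_iff hψ).1 hk
  obtain ⟨hJ, hJc⟩ := hφ'.iterate (j * k)
  refine ⟨j * k, (hJ.dominatedOn_iff hψ).2 ⟨max m m', fun M _ x hx hlen => ?_⟩⟩
  have h1 : (m : Cd M) ≤ len x := le_trans (by exact_mod_cast le_max_left m m') hlen
  have h2 : (m' : Cd M) ≤ len x := le_trans (by exact_mod_cast le_max_right m m') hlen
  refine (hm' M x hx h2).trans_le ?_
  rw [hIc, hJc]
  have hstay : ∀ i, (m : Cd M) ≤ (cf φ')^[i] (len x) := by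
    intro i
    induction i with
    | zero => exact h1
    | succ i ih =>
      rw [Function.iterate_succ_apply']
      exact ih.trans (hge M _ ih).1
  clear hIc hI hJ hJc hm' hk
  induction k with
  | zero => exact le_rfl
  | succ k ih =>
    rw [Function.iterate_succ_apply', Nat.mul_succ, add_comm, Function.iterate_add_apply]
    exact (h.arithmetical.increasing_iff.1 h.increasing M _ _ ih).trans (hge M _ (hstay _)).2

end Transfer

/-! ### Doubling, squaring, and the function `ω₁` -/

section Growth

variable {M : Type} [EAModel M] {N : IterSystem} {S : Tm 0}

namespace Cd

variable {b c d e s t : Cd M}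

theorem pow_lg_le (hs : 2 ≤ s) (hc : 1 ≤ c) : s ^ lg s c ≤ c * s := by
  rcases eq_zero_or_succ (lg s c) with h | ⟨e, h⟩
  · rw [h, Cd.pow_zero]
    exact one_le_mul hc (one_le_of_two_le hs)
  · rw [h, Cd.pow_succ]
    gcongr
    exact ((lt_lg_iff hs).1 (h ▸ lt_succ_iff.2 le_rfl)).le

/-- The function `s ^ (log_s c + 1)`, which lies between `s * c` and `s ^ 2 * c` for
positive `c`. -/
noncomputable def blow (s c : Cd M) : Cd M := s ^ (lg s c + 1)

theorem mul_le_blow (hs : 2 ≤ s) : s * c ≤ blow s c := by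
  rw [blow, Cd.pow_succ, mul_comm]
  gcongr
  exact le_pow_lg hs

theorem blow_le (hs : 2 ≤ s) (hc : 1 ≤ c) : blow s c ≤ c * (s * s) := by
  rw [blow, Cd.pow_succ, ← mul_assoc]
  gcongr
  exact pow_lg_le hs hc

theorem pow_le_pow_blow (hs : 2 ≤ s) : c ^ s ≤ s ^ blow s (lg s c) := by
  calc c ^ s ≤ (s ^ lg s c) ^ s := pow_le_pow_left' (le_pow_lg hs)
    _ = s ^ (s * lg s c) := by rw [← pow_mul', mul_comm]
    _ ≤ _ := pow_le_pow_right' (one_le_of_two_le hs) (mul_le_blow hs)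

theorem pow_blow_le (hs : 2 ≤ s) (hc : 2 ≤ c) (hsc : s ≤ c) :
    s ^ blow s (lg s c) ≤ c ^ (2 * (s * s)) := by
  have h1 : 1 ≤ lg s c := one_le.2 fun h =>
    absurd ((lg_eq_zero hs).1 h) (not_le_of_gt (lt_of_lt_of_le one_lt_two hc))
  calc s ^ blow s (lg s c) ≤ s ^ (lg s c * (s * s)) :=
        pow_le_pow_right' (one_le_of_two_le hs) (blow_le hs h1)
    _ = (s ^ lg s c) ^ (s * s) := pow_mul'
    _ ≤ (c * s) ^ (s * s) := pow_le_pow_left' (pow_lg_le hs (one_le_of_two_le hc))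
    _ ≤ (c * c) ^ (s * s) := pow_le_pow_left' (by gcongr)
    _ = _ := by rw [pow_mul' (c := c) (d := 2), pow_two']

theorem lg_two_le (u : Cd M) : lg 2 (u + 2) ≤ 2 ^ u := by
  rw [lg_le_iff le_rfl]
  have h1 : u + 1 ≤ 2 ^ u := succ_le.2 (lt_pow_self' le_rfl)
  calc u + 2 = u + 1 + 1 := by ring
    _ ≤ 2 ^ (u + 1) := succ_le.2 (lt_pow_self' le_rfl)
    _ ≤ 2 ^ (2 : Cd M) ^ u := pow_le_pow_right' one_le_two h1

theorem lg_two_le_mul (hs : 2 ≤ s) : lg 2 c ≤ lg s c * lg 2 s := by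
  rw [lg_le_iff le_rfl, mul_comm, pow_mul']
  exact (le_pow_lg hs).trans (pow_le_pow_left' (le_pow_lg le_rfl))

/-- `ω₁ c ≤ s ^ s ^ s ^ (log_s log_s log_s c + 1)` -/
theorem pow_lg_le_pow_pow_blow (hs : 2 ≤ s) :
    c ^ lg 2 c ≤ s ^ s ^ blow s (lg s (lg s c)) := by
  have h1 := one_le_of_two_le hs
  set a := lg s c with ha
  have h2 : a * (a * lg 2 s) ≤ s ^ blow s (lg s a) := by
    rcases le_or_gt 2 a with h | h
    · obtain ⟨u, rfl⟩ := le_iff_exists_add'.1 hs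
      calc a * (a * lg 2 (2 + u)) ≤ a * (a * a ^ u) := by
            gcongr
            rw [add_comm]
            exact (lg_two_le u).trans (pow_le_pow_left' h)
        _ = a ^ (2 + u) := by rw [pow_add', pow_two', mul_assoc]
        _ ≤ _ := pow_le_pow_blow hs
    · have ha1 : a ≤ 1 := by
        rw [← lt_succ_iff, one_add_one_eq_two]; exact h
      calc a * (a * lg 2 s) ≤ 1 * (1 * lg 2 s) := by gcongr
        _ = lg 2 s := by ring
        _ ≤ s := lg_le_self le_rfl
        _ = s ^ (1 : Cd M) := pow_one'.symm
        _ ≤ _ := pow_le_pow_right' h1 (pow_pos' h1)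
  calc c ^ lg 2 c ≤ (s ^ a) ^ lg 2 c := pow_le_pow_left' (le_pow_lg hs)
    _ = s ^ (a * lg 2 c) := pow_mul'.symm
    _ ≤ _ := pow_le_pow_right' h1 (le_trans (by gcongr; exact lg_two_le_mul hs) h2)

theorem pow_lg_mono (h : c ≤ d) : c ^ lg 2 c ≤ d ^ lg 2 d := by
  rcases eq_or_ne d 0 with rfl | hd
  · rw [nonpos_iff_eq_zero.1 h]
  · exact (pow_le_pow_left' h).trans (pow_le_pow_right' (one_le.2 hd) (lg_mono le_rfl h))

theorem le_pow_lg_self (h : 2 ≤ c) : c ≤ c ^ lg 2 c := by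
  have h1 : 1 ≤ lg 2 c := one_le.2 fun h' =>
    absurd ((lg_eq_zero le_rfl).1 h') (not_le_of_gt (lt_of_lt_of_le one_lt_two h))
  calc c = c ^ (1 : Cd M) := pow_one'.symm
    _ ≤ _ := pow_le_pow_right' (one_le_of_two_le h) h1

/-- In terms of logarithms, `ω₁` squares. -/
theorem two_pow_le_iterate {F : Cd M → Cd M} (hF : ∀ c, F c = c ^ lg 2 c) (h : 2 ^ e ≤ c) (j : ℕ) :
    2 ^ e ^ (2 ^ j : ℕ) ≤ F^[j] c := by
  induction j with
  | zero => rw [Nat.pow_zero, _root_.pow_one]; exact h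
  | succ j ih =>
    rw [Function.iterate_succ_apply', hF]
    have h1 : e ^ 2 ^ j ≤ lg 2 (F^[j] c) := by
      have := lg_mono le_rfl ih
      rwa [lg_pow le_rfl] at this
    calc (2 : Cd M) ^ e ^ 2 ^ (j + 1) = (2 ^ e ^ 2 ^ j) ^ e ^ 2 ^ j := by
          rw [← pow_mul', ← pow_two, ← pow_mul, ← Nat.pow_succ]
      _ ≤ (F^[j] c) ^ e ^ 2 ^ j := pow_le_pow_left' ih
      _ ≤ _ := pow_le_pow_right' ((pow_pos' one_le_two).trans ih) h1

end Cd

theorem cf_double : Arithmetical double ∧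
    ∀ (M : Type) [EAModel M] (c : Cd M), cf double c = 2 * c :=
  arithmetical_of (fun _ _ c => 2 * c) fun M _ x => by
    rw [fn, double, ev_prod, ev_numeral, ev_var, Cd.cd_prodM, cd_numM, Nat.cast_ofNat]

theorem cf_square : Arithmetical square ∧
    ∀ (M : Type) [EAModel M] (c : Cd M), cf square c = c ^ (2 : Cd M) :=
  arithmetical_of (fun _ _ c => c ^ (2 : Cd _)) fun M _ x => by
    rw [fn, square, ev_exp, ev_numeral, ev_var, Cd.cd_expM, cd_numM, Nat.cast_ofNat]

theorem cf_omega1 : Arithmetical omega1 ∧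
    ∀ (M : Type) [EAModel M] (c : Cd M), cf omega1 c = c ^ Cd.lg 2 c :=
  arithmetical_of (fun _ _ c => c ^ Cd.lg 2 c) fun M _ x => by
    have h2 : cd (numM 2 : M) = 2 := by rw [cd_numM, Nat.cast_ofNat]
    rw [fn, omega1, ev_exp, ev_log, ev_numeral, ev_var, Cd.cd_expM, cd_logM h2.ge, h2]

theorem cf_double_iterate (j : ℕ) (c : Cd M) : (cf double)^[j] c = 2 ^ j * c := by
  induction j with
  | zero => rw [Function.iterate_zero_apply, pow_zero, one_mul]
  | succ j ih => rw [Function.iterate_succ_apply', ih, cf_double.2, pow_succ]; ring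

theorem cf_square_iterate (j : ℕ) (c : Cd M) : (cf square)^[j] c = c ^ (2 ^ j : ℕ) := by
  induction j with
  | zero => rw [Function.iterate_zero_apply, pow_zero, pow_one]
  | succ j ih => rw [Function.iterate_succ_apply', ih, cf_square.2, Cd.pow_two', pow_succ, pow_mul,
      pow_two]

theorem cf_hier_succFn (hS : IsNumerationBase S) (n : ℕ) : Arithmetical (hier S succFn n) ∧
    ∀ (M : Type) [EAModel M] (c : Cd M), cf (hier S succFn (n + 1)) c =
      cd (cv M S) ^ cf (hier S succFn n) (Cd.lg (cd (cv M S)) c) := by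
  have hA : Arithmetical (hier S succFn n) := by
    induction n with
    | zero => exact cf_succFn.1
    | succ n ih => exact (ih.step hS).1
  exact ⟨hA, (hA.step hS).2⟩

theorem cf_hier_one (hS : IsNumerationBase S) (c : Cd M) :
    cf (hier S succFn 1) c = Cd.blow (cd (cv M S)) c := by
  rw [(cf_hier_succFn hS 0).2, hier, cf_succFn.2, Cd.blow]

theorem cf_hier_two (hS : IsNumerationBase S) (c : Cd M) :
    cf (hier S succFn 2) c =
      cd (cv M S) ^ Cd.blow (cd (cv M S)) (Cd.lg (cd (cv M S)) c) := by
  rw [(cf_hier_succFn hS 1).2, cf_hier_one hS]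

theorem cf_hier_three (hS : IsNumerationBase S) (c : Cd M) :
    cf (hier S succFn 3) c = cd (cv M S) ^ cd (cv M S) ^
      Cd.blow (cd (cv M S)) (Cd.lg (cd (cv M S)) (Cd.lg (cd (cv M S)) c)) := by
  rw [(cf_hier_succFn hS 2).2, cf_hier_two hS]

theorem natCast_le_two_pow (M : Type) [EAModel M] {i j : ℕ} (h : i ≤ j) :
    (i : Cd M) ≤ 2 ^ j := by
  have : i ≤ 2 ^ j := h.trans (Nat.lt_two_pow_self).le
  calc (i : Cd M) ≤ ((2 ^ j : ℕ) : Cd M) := Nat.cast_le.2 this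
    _ = 2 ^ j := by push_cast; rfl

variable (hN : IsRanked N) (hS : IsNumerationBase S)
include hN hS

theorem maximallyPowerful_double : MaximallyPowerful double (iterExt S N 1) := by
  obtain ⟨t, ht⟩ := exists_cd_closed_le S
  refine (maximallyPowerful_hier hN.maximallyPowerful_succFn hS 1).of_le_of_le_iterate cf_double.1
    (fun M _ c d h => ?_) (fun M _ c => ?_) (t * t) 1 fun M _ c hc => ?_
  · rw [cf_double.2, cf_double.2]; gcongr
  · have hb := isNumerationBase_iff.1 hS M
    rw [cf_double.2, cf_hier_one hS]
    exact le_trans (mul_le_mul' hb.two_le le_rfl) (Cd.mul_le_blow hb.two_le)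
  · have hb := isNumerationBase_iff.1 hS M
    rw [Nat.cast_one] at hc
    rw [cf_double.2, cf_hier_one hS, cf_double_iterate]
    refine ⟨le_mul_of_one_le_left' one_le_two, (Cd.blow_le hb.two_le hc).trans ?_⟩
    rw [mul_comm]
    refine mul_le_mul' ((mul_le_mul' (ht M) (ht M)).trans ?_) le_rfl
    rw [← Nat.cast_mul]
    exact natCast_le_two_pow M le_rfl

theorem maximallyPowerful_square : MaximallyPowerful square (iterExt S N 2) := by
  obtain ⟨t, ht⟩ := exists_cd_closed_le S
  refine (maximallyPowerful_hier hN.maximallyPowerful_succFn hS 2).of_le_of_le_iterate cf_square.1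
    (fun M _ c d h => ?_) (fun M _ c => ?_) (2 * (t * t)) (t + 2) fun M _ c hc => ?_
  · rw [cf_square.2, cf_square.2]; exact Cd.pow_le_pow_left' h
  · have hb := isNumerationBase_iff.1 hS M
    rw [cf_square.2, cf_hier_two hS]
    refine le_trans ?_ (Cd.pow_le_pow_blow hb.two_le)
    rcases eq_or_ne c 0 with rfl | h0
    · rw [Cd.pow_two', mul_zero]; exact zero_le
    · exact Cd.pow_le_pow_right' (Cd.one_le.2 h0) hb.two_le
  · have hb := isNumerationBase_iff.1 hS M
    push_cast at hc
    have h2 : 2 ≤ c := le_add_self.trans hc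
    have h1 := Cd.one_le_of_two_le h2
    rw [cf_square.2, cf_hier_two hS, cf_square_iterate, Cd.pow_two']
    refine ⟨le_mul_of_one_le_left' h1, (Cd.pow_blow_le hb.two_le h2
      ((ht M).trans (le_self_add.trans hc))).trans ?_⟩
    rw [← Cd.pow_natCast]
    refine Cd.pow_le_pow_right' h1 (le_trans (b := ((2 * (t * t) : ℕ) : Cd M)) ?_ ?_)
    · push_cast
      exact mul_le_mul' le_rfl (mul_le_mul' (ht M) (ht M))
    · exact Nat.cast_le.2 Nat.lt_two_pow_self.le

/-- Up to the base, `ω₁` squares the logarithm of `c`, and the function of the numeral extension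
raises it to a power that is bounded by a standard number. -/
theorem maximallyPowerful_omega1 : MaximallyPowerful omega1 (iterExt S N 3) := by
  obtain ⟨t, ht⟩ := exists_cd_closed_le S
  refine (maximallyPowerful_hier hN.maximallyPowerful_succFn hS 3).of_le_of_le_iterate cf_omega1.1
    (fun M _ c d h => ?_) (fun M _ c => ?_) (2 * (2 * (t * t) + 1)) (t ^ (t + 2) + 2 ^ 3)
    fun M _ c hc => ?_
  · rw [cf_omega1.2, cf_omega1.2]; exact Cd.pow_lg_mono h
  · rw [cf_omega1.2, cf_hier_three hS]
    exact Cd.pow_lg_le_pow_pow_blow (isNumerationBase_iff.1 hS M).two_le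
  · have hb := isNumerationBase_iff.1 hS M
    have hst : cd (cv M S) ≤ (t : Cd M) := ht M
    have hc8 : (2 : Cd M) ^ (3 : Cd M) ≤ c := by
      refine le_trans ?_ hc
      rw [show (3 : Cd M) = ((3 : ℕ) : Cd M) by norm_cast, Cd.pow_natCast]
      rw [Nat.cast_add, Nat.cast_pow 2, Nat.cast_ofNat]
      exact le_add_self
    have hct : cd (cv M S) ^ ((t + 2 : ℕ) : Cd M) ≤ c := by
      refine le_trans ?_ hc
      rw [Cd.pow_natCast]
      rw [Nat.cast_add, Nat.cast_pow t]
      refine le_trans (b := (t : Cd M) ^ (t + 2)) ?_ le_self_add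
      exact pow_le_pow_left' hst _
    have hc2 : 2 ≤ c := by
      refine le_trans ?_ hc8
      conv_lhs => rw [← Cd.pow_one' (c := (2 : Cd M))]
      exact Cd.pow_le_pow_right' one_le_two (by norm_num)
    rw [cf_omega1.2, cf_hier_three hS]
    refine ⟨Cd.le_pow_lg_self hc2, ?_⟩
    generalize hs : cd (cv M S) = s at *
    have hs2 : 2 ≤ s := hs ▸ hb.two_le
    set a := Cd.lg s c with ha
    have hat : ((t + 2 : ℕ) : Cd M) ≤ a := by
      rw [ha, ← Cd.lg_pow hs2 (c := ((t + 2 : ℕ) : Cd M))]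
      exact Cd.lg_mono hs2 hct
    push_cast at hat
    have ha2 : 2 ≤ a := le_add_self.trans hat
    have ha1 := Cd.one_le_of_two_le ha2
    have hta : (t : Cd M) ≤ a := le_self_add.trans hat
    -- `e + 1` is the binary logarithm of `c`
    obtain ⟨e, he⟩ := Cd.exists_eq_succ (c := Cd.lg 2 c) fun h =>
      absurd ((Cd.lg_eq_zero le_rfl).1 h) (not_le_of_gt (lt_of_lt_of_le one_lt_two hc2))
    have hec : 2 ^ e ≤ c := ((Cd.lt_lg_iff le_rfl).1 (he ▸ Cd.lt_succ_iff.2 le_rfl)).le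
    have he2 : 2 ≤ e := by
      have := Cd.lg_mono le_rfl hc8
      rw [Cd.lg_pow le_rfl, he, ← two_add_one_eq_three, add_le_add_iff_right] at this
      exact this
    have hae : a ≤ e * e := by
      refine le_trans ?_ (b := e + 1) ?_
      · rw [← he, ha, Cd.lg_le_iff hs2]
        exact (Cd.le_pow_lg le_rfl).trans (Cd.pow_le_pow_left' hs2)
      · calc e + 1 ≤ e + e := by gcongr; exact Cd.one_le_of_two_le he2
          _ = 2 * e := (two_mul e).symm
          _ ≤ e * e := by gcongr
    have hs2t : s ≤ 2 ^ (t : Cd M) := hst.trans (Cd.lt_pow_self' le_rfl).le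
    calc s ^ s ^ Cd.blow s (Cd.lg s a) ≤ s ^ a ^ (2 * (s * s)) :=
          Cd.pow_le_pow_right' (Cd.one_le_of_two_le hs2)
            (Cd.pow_blow_le hs2 ha2 (hst.trans hta))
      _ ≤ s ^ a ^ ((2 * (t * t) : ℕ) : Cd M) := by
          refine Cd.pow_le_pow_right' (Cd.one_le_of_two_le hs2) (Cd.pow_le_pow_right' ha1 ?_)
          push_cast
          exact mul_le_mul' le_rfl (mul_le_mul' hst hst)
      _ ≤ (2 ^ (t : Cd M)) ^ a ^ ((2 * (t * t) : ℕ) : Cd M) := Cd.pow_le_pow_left' hs2t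
      _ = 2 ^ ((t : Cd M) * a ^ (2 * (t * t))) := by rw [← Cd.pow_mul', Cd.pow_natCast]
      _ ≤ 2 ^ (a ^ (2 * (t * t) + 1)) := by
          refine Cd.pow_le_pow_right' one_le_two ?_
          rw [pow_succ, mul_comm]
          gcongr
      _ ≤ 2 ^ ((e * e) ^ (2 * (t * t) + 1)) :=
          Cd.pow_le_pow_right' one_le_two (pow_le_pow_left' hae _)
      _ = 2 ^ (e ^ (2 * (2 * (t * t) + 1))) := by rw [← pow_two, ← pow_mul]
      _ ≤ 2 ^ e ^ (2 ^ (2 * (2 * (t * t) + 1)) : ℕ) := by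
          refine Cd.pow_le_pow_right' one_le_two ?_
          exact pow_le_pow_right' (Cd.one_le_of_two_le he2) Nat.lt_two_pow_self.le
      _ ≤ _ := Cd.two_pow_le_iterate (cf_omega1.2 M) hec _

end Growth

end EA

theorem mainTheorem5 :
    (∀ (N : EA.IterSystem) (S : EA.Tm 0) (φ : EA.Tm 1),
      N.IsNatSystem → EA.IsNumerationBase S → EA.MaximallyPowerful φ N →
        ∀ n : ℕ, EA.MaximallyPowerful (EA.hier S φ n) (EA.iterExt S N n)) ∧
    (∀ N : EA.IterSystem, N = EA.CH ∨ N = EA.VN ∨ N = EA.Zer →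
      ∀ S : EA.Tm 0, EA.IsNumerationBase S →
        EA.MaximallyPowerful EA.double (EA.iterExt S N 1) ∧
        EA.MaximallyPowerful EA.square (EA.iterExt S N 2) ∧
        EA.MaximallyPowerful EA.omega1 (EA.iterExt S N 3)) := by
  refine ⟨fun N S φ _ hS hφ n => EA.maximallyPowerful_hier hφ hS n, fun N hN S hS => ?_⟩
  have hN : EA.IsRanked N := by
    rcases hN with rfl | rfl | rfl
    exacts [EA.isRanked_CH, EA.isRanked_VN, EA.isRanked_Zer]
  exact ⟨EA.maximallyPowerful_double hN hS, EA.maximallyPowerful_square hN hS,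
    EA.maximallyPowerful_omega1 hN hS⟩
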